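/- **Setting.** Let $D\ge 2$ and work on flat $\mathbb R^D$. A *Euclidean-invariant Hadamard parametrix* is a function $H(x_1,x_2;m^2)$, $m^2\in\mathbb R$, $x_1\neq x_2$, such that: it is invariant under all isometries of $\mathbb R^D$; it is jointly smooth in $(m^2,x_1,x_2)$ for $x_1\ne x_2$ and locally integrable in $x_1$; $(-\partial^2+m^2)H=\delta+h$ as distributions, with $h$ smooth in $(m^2,x_1,x_2)$ and symmetric; and $H(x_1/\lambda,x_2/\lambda;\lambda^2m^2)=\lambda^{D-2}\big(H(x_1,x_2;m^2)+V(x_1,x_2;m^2)\log\lambda^2\big)$ for all $\lambda>0$, with a smooth $V$. For monomials $A_v=\partial_{\alpha_{(v,1)}}\phi\cdots\partial_{\alpha_{(v,k_v)}}\phi$ and $B=\partial_{\beta_1}\phi\cdots\partial_{\beta_m}\phi$ the Hadamard normal-ordered OPE coefficient $(C_H)^B_{A_1\cdots A_n}(x_1,\dots,x_n;z)$ is $\frac1{m!}$ times the sum over all perfect matchings of the labels $(0,1),\dots,(0,m),(1,1),\dots,(n,k_n)$ of the product over the pairs $\{(v,i),(w,j)\}$, $v\le w$, of $\partial_{\alpha_{(v,i)}}^{x_v}\partial_{\alpha_{(w,j)}}^{x_w}H(x_v,x_w)$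 if $0\ne v\neq w$, of $\partial^{x_w}_{\alpha_{(w,j)}}(x_w-z)^{\beta_i}/\beta_i!$ if $v=0\ne w$, and of $0$ if $v=w$. Let $\zeta\in C^\infty(\mathbb R)$ with $\zeta(s)=1$ for $|s|\le1$ and $\zeta(s)=0$ for $|s|\ge2$, $\chi(y,z;L)=\zeta(L^{-2}|y-z|^2)$, and for integers $\delta\ge0$, $N>2$ let $$\mathfrak L[L]=\prod_{k=1}^N\Big(1-\tfrac1k L\log L\,\tfrac{\partial}{\partial L}\Big)\ \prod_{\Delta=1}^{D-4+\delta}\Big(1+\tfrac1\Delta L\tfrac{\partial}{\partial L}\Big)^N .$$ For $C=\partial_{\gamma_1}\phi\,\partial_{\gamma_2}\phi$ put $$b^H_C(L)=b^0_C-\tfrac12\int_0^L dL'\int d^Dy\,\tfrac{\partial}{\partial L'}\big(\mathfrak L[L']\chi(y,z;L')\big)(C_H)^I_{\phi^2C}(y,z;z),$$ and $b_C^H=0$ for all other $C$. A family $b^0=(b^0_{\gamma_1\gamma_2}(m^2))_{|\gamma_1|+|\gamma_2|\le\delta}$ is *admissible* if it consists of $O(D)$-invariant tensors that are symmetric under $\gamma_1\leftrightarrow\gamma_2$,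 smooth in $m^2$, and exactly homogeneous with factor $\lambda^{D-4}$ under $(\delta_{\mu\nu},m^2)\to(\lambda^{-2}\delta_{\mu\nu},\lambda^2m^2)$, i.e. $b^0_{\gamma_1\gamma_2}(\lambda^2m^2)=\lambda^{D-4+|\gamma_1|+|\gamma_2|}b^0_{\gamma_1\gamma_2}(m^2)$. For a merger tree $\mathcal T$ on $n$ points (a laminar family of non-empty subsets of $\{1,\dots,n\}$ containing the whole set, which is the root, and all singletons) and an integer $\delta'\ge 0$, $F\sim_{\mathcal T,\delta'}G$ at $z$ means $\varepsilon^{-\delta'}(F-G)(x(\varepsilon))\to0$ as $\varepsilon\to0^+$, where $x_i(\varepsilon)=z+\sum_{S\ni i,\,S\ne\text{root}}\varepsilon^{\mathrm{depth}(S)}v_S$, locally uniformly in those $(v_S)$ for which different children of a common node have different $v$'s. $\sim_\delta$ refers to the trivial tree (only the root and the singletons). Consider, for $L>0$, $$\frac{\partial}{\partial m^2}(C_H)^I_{\phi\cdots\phi}(x_1,\dots,x_n;z)\ \sim_{\mathcal T,\delta'}\ -\frac12\int d^Dy\,\mathfrak L[L]\chi(y,z;L)\,(C_H)^I_{\phi^2\phi\cdots\phi}(y,x_1,\dots,x_n;z)-\sum_{C:\,|\gamma_1|+|\gamma_2|\le\delta}b^H_C(L)\,(C_H)^C_{\phi\cdots\phi}(x_1,\dots,x_n;z).\tag{$*$}$$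 The *two-point flow relation at degree $\delta$* is $(*)$ for $n=2$ with $\sim_\delta$, for all $m^2,z$ and $L>0$ (with $b^0$ independent of $L$). **Theorem.** (0) For every $H$, $\zeta$, $\delta$, $N>2$, $m^2$, $z$, $L>0$ all quantities in $(*)$ are well defined: the $y$-integrals converge absolutely (for pairwise distinct $x_i$), the $m^2$-derivative exists, and the integrand of $\int_0^LdL'$ is integrable for $|\gamma_1|+|\gamma_2|\le\delta$. (1) For any $n$, merger tree $\mathcal T$ and $\delta'$ there is $\delta_0$ such that for all $\delta\ge\delta_0$, $N>2$, $\zeta$, and every Euclidean-invariant Hadamard parametrix $H$ and $b^0$ that satisfy the two-point flow relation at degree $\delta$, the flow relation $(*)$ for $n$ factors of $\phi$ holds in the sense of $\sim_{\mathcal T,\delta'}$, for all $m^2$, $z$ and $L>0$, with the same $b^0$. (2) For fixed $\zeta$, $\delta$, $N>2$, every Euclidean-invariant Hadamard parametrix $H$ satisfies the two-point flow relation at degree $\delta$ for exactly one admissible $b^0=b^0[H]$. (3) The ambiguities are in one-to-one correspondence with the choices of parametrix, in the following sense. Say that $H$ corresponds to $f$, where $f(x_1,x_2;m^2)$ is smooth,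 Euclidean-invariant and exactly homogeneous, $f(x_1/\lambda,x_2/\lambda;\lambda^2m^2)=\lambda^{D-4}f(x_1,x_2;m^2)$, if $b^0[H]_{\gamma\,\emptyset}(m^2)=\partial_\gamma^{x}f(x,z;m^2)|_{x=z}$ for all $|\gamma|\le\delta$ and all $z$. Then every $H$ corresponds to some $f$, and every $f$ corresponds to some $H$. If $H,H'$ correspond to $f,f'$, then $H\sim_\delta H'$ (for all $m^2,z$) implies $f\sim_\delta f'$, and, if $D\ge3$, $f\sim_\delta f'$ implies $H\sim_\delta H'$. -/

import Mathlib

open MeasureTheory Filter Topology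
open scoped ContDiff

noncomputable section

/-- Flat Euclidean space of dimension `D`. -/
abbrev Euc (D : ℕ) := EuclideanSpace ℝ (Fin D)

/-! ### Multi-indices and partial derivatives -/

/-- Multi-indices, in components with respect to the standard inertial coordinates. -/
abbrev MultiIdx (D : ℕ) := Fin D → ℕ

/-- The order `|γ|`. -/
def MultiIdx.order {D : ℕ} (γ : MultiIdx D) : ℕ := ∑ i, γ i

/-- The partial derivative `∂_i f`. -/
def partialD {D : ℕ} (i : Fin D) (f : Euc D → ℝ) : Euc D → ℝ :=
  fun x => fderiv ℝ f x (EuclideanSpace.single i 1)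

/-- The iterated partial derivative `∂^γ f`. -/
def multiD {D : ℕ} (γ : MultiIdx D) (f : Euc D → ℝ) : Euc D → ℝ :=
  (List.finRange D).foldr (fun i g => (partialD i)^[γ i] g) f

/-- The Taylor factor `S^β(x;z) = (x - z)^β / β!`. -/
def taylorFactor {D : ℕ} (β : MultiIdx D) (x z : Euc D) : ℝ :=
  ∏ i, (x i - z i) ^ β i / (Nat.factorial (β i) : ℝ)

/-- The (finite) set of pairs of multi-indices with `|γ₁| + |γ₂| ≤ δ`. -/
def pairsUpTo (D δ : ℕ) : Finset (MultiIdx D × MultiIdx D) :=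
  (Fintype.piFinset (fun _ : Fin D => Finset.range (δ + 1)) ×ˢ
    Fintype.piFinset (fun _ : Fin D => Finset.range (δ + 1))).filter
      (fun γ => γ.1.order + γ.2.order ≤ δ)

/-! ### Euclidean-invariant Hadamard parametrices

A two-point function depending on the squared mass `m² = μ` (of either sign) is a map
`ℝ → Euc D → Euc D → ℝ`, the first argument being `μ`. -/

/-- `H` is a Euclidean-invariant Hadamard parametrix for `K = -∂² + m²` which is smooth in `m²`
(for all `m²`, including `0`) and scales almost homogeneously.  Its values on the diagonal
are irrelevant. -/
structure IsHadamardParametrix {D : ℕ} (H : ℝ → Euc D → Euc D → ℝ) : Prop where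
  /-- invariance under all isometries of Euclidean space (in particular, `H` is symmetric) -/
  invariant : ∀ (μ : ℝ) (g : Euc D ≃ᵢ Euc D) (x y : Euc D), H μ (g x) (g y) = H μ x y
  /-- joint smoothness in `(m², x₁, x₂)` away from the diagonal -/
  smooth : ContDiffOn ℝ ∞ (fun p : ℝ × Euc D × Euc D => H p.1 p.2.1 p.2.2)
    {p | p.2.1 ≠ p.2.2}
  locallyIntegrable : ∀ (μ : ℝ) (y : Euc D), LocallyIntegrable (fun x => H μ x y)
  /-- `(-∂² + m²) H = δ + h` as distributions, with `h` smooth in all variables and symmetric -/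
  parametrix : ∃ h : ℝ → Euc D → Euc D → ℝ,
    ContDiff ℝ ∞ (fun p : ℝ × Euc D × Euc D => h p.1 p.2.1 p.2.2) ∧
    (∀ μ x y, h μ x y = h μ y x) ∧
    ∀ (μ : ℝ) (y : Euc D) (f : Euc D → ℝ), ContDiff ℝ ∞ f → HasCompactSupport f →
      ∫ x, H μ x y * (-(Laplacian.laplacian f x) + μ * f x) = f y + ∫ x, h μ x y * f x
  /-- almost homogeneous scaling under `(δ_{ab}, m²) → (l⁻² δ_{ab}, l² m²)`: rescaling the flat
  metric amounts to rescaling the points by `l⁻¹` -/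
  scaling : ∃ V : ℝ → Euc D → Euc D → ℝ,
    ContDiff ℝ ∞ (fun p : ℝ × Euc D × Euc D => V p.1 p.2.1 p.2.2) ∧
    ∀ (l : ℝ), 0 < l → ∀ (μ : ℝ) (x y : Euc D), x ≠ y →
      H (l ^ 2 * μ) (l⁻¹ • x) (l⁻¹ • y) =
        l ^ (D - 2) * (H μ x y + V μ x y * Real.log (l ^ 2))

/-- Smooth Euclidean-invariant functions of `(m², x₁, x₂)` which scale exactly homogeneously, with
factor `l^(D-4)`, under `(δ_{ab}, m²) → (l⁻² δ_{ab}, l² m²)`. -/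
structure IsHomogeneousInvariant {D : ℕ} (f : ℝ → Euc D → Euc D → ℝ) : Prop where
  invariant : ∀ (μ : ℝ) (g : Euc D ≃ᵢ Euc D) (x y : Euc D), f μ (g x) (g y) = f μ x y
  smooth : ContDiff ℝ ∞ (fun p : ℝ × Euc D × Euc D => f p.1 p.2.1 p.2.2)
  scaling : ∀ (l : ℝ), 0 < l → ∀ (μ : ℝ) (x y : Euc D),
    f (l ^ 2 * μ) (l⁻¹ • x) (l⁻¹ • y) = l ^ ((D : ℤ) - 4) * f μ x y

/-! ### Hadamard normal-ordered OPE coefficients -/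

/-- The monomial `∂_{γ₁}φ ⋯ ∂_{γ_p}φ` is represented by the list `[γ₁, …, γ_p]`;
in particular `[]` is the identity `I`. -/
abbrev Monomial (D : ℕ) := List (MultiIdx D)

/-- The field `φ`. -/
def phi (D : ℕ) : Monomial D := [0]

/-- The field `φ²`. -/
def phiSq (D : ℕ) : Monomial D := [0, 0]

/-- The hafnian: the sum over all perfect matchings (encoded as fixed-point-free involutions) of
the product of the matrix elements over the pairs `p < q` of the matching. -/
def hafnian {ι : Type*} [Fintype ι] [LinearOrder ι] (N : ι → ι → ℝ) : ℝ :=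
  ∑ σ ∈ Finset.univ.filter (fun σ : Equiv.Perm ι => ∀ p, σ p ≠ p ∧ σ (σ p) = p),
    ∏ p ∈ Finset.univ.filter (fun p => p < σ p), N p (σ p)

/-- The labels `(v, i)`, ordered lexicographically: `v = 0` labels the factors of `B`, and
`v = 1, …, n` label the factors of `A₁, …, A_n`. -/
abbrev OpeLabel {D n : ℕ} (A : Fin n → Monomial D) (B : Monomial D) :=
  Σₗ v : Fin (n + 1), Fin ((Fin.cons B A : Fin (n + 1) → Monomial D) v).length

/-- The multi-index carried by a label. -/
def OpeLabel.idx {D n : ℕ} {A : Fin n → Monomial D} {B : Monomial D} (p : OpeLabel A B) :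
    MultiIdx D :=
  ((Fin.cons B A : Fin (n + 1) → Monomial D) (ofLex p).1).get (ofLex p).2

/-- The matrix `𝒩`: derivatives of `H(x_v, x_w)` for `v ≠ w` both nonzero, derivatives of
`S^β(x_w; z)` for `v = 0 ≠ w`, and `0` otherwise. -/
def opeMatrix {D n : ℕ} (H : Euc D → Euc D → ℝ) (A : Fin n → Monomial D) (B : Monomial D)
    (x : Fin n → Euc D) (z : Euc D) (p q : OpeLabel A B) : ℝ :=
  let X : Fin (n + 1) → Euc D := Fin.cons z x
  let v := (ofLex p).1
  let w := (ofLex q).1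
  if v = w ∨ w = 0 then 0
  else if v = 0 then multiD q.idx (fun a => taylorFactor p.idx a z) (X w)
  else multiD p.idx (fun a => multiD q.idx (fun b => H a b) (X w)) (X v)

/-- The Hadamard normal-ordered OPE coefficient `(C_H)_{A₁⋯A_n}^B(x₁,…,x_n;z)`. -/
def opeCoeff {D n : ℕ} (H : Euc D → Euc D → ℝ) (A : Fin n → Monomial D) (B : Monomial D)
    (x : Fin n → Euc D) (z : Euc D) : ℝ :=
  (1 / (Nat.factorial B.length : ℝ)) * hafnian (opeMatrix H A B x z)

/-- `(C_H)_{φ⋯φ}^B(x₁,…,x_n;z)` with `n` factors of `φ`. -/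
def coeffPhi {D n : ℕ} (H : Euc D → Euc D → ℝ) (B : Monomial D) (x : Fin n → Euc D)
    (z : Euc D) : ℝ :=
  opeCoeff H (fun _ : Fin n => phi D) B x z

/-- `(C_H)_{φ²φ⋯φ}^I(y,x₁,…,x_n;z)` with `n` factors of `φ`. -/
def coeffPhiSqPhi {D n : ℕ} (H : Euc D → Euc D → ℝ) (y : Euc D) (x : Fin n → Euc D)
    (z : Euc D) : ℝ :=
  opeCoeff H (Fin.cons (phiSq D) (fun _ : Fin n => phi D) : Fin (n + 1) → Monomial D) []
    (Fin.cons y x : Fin (n + 1) → Euc D) z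

/-- `(C_H)_{φ²C}^I(y,z;z)`. -/
def coeffPhiSqC {D : ℕ} (H : Euc D → Euc D → ℝ) (C : Monomial D) (y z : Euc D) : ℝ :=
  opeCoeff H ![phiSq D, C] [] ![y, z] z

/-! ### The cut-off and the operator `𝔏[L]` -/

/-- Admissible cut-off profiles `ζ`. -/
structure IsCutoff (ζ : ℝ → ℝ) : Prop where
  smooth : ContDiff ℝ ∞ ζ
  eq_one : ∀ s, |s| ≤ 1 → ζ s = 1
  eq_zero : ∀ s, 2 ≤ |s| → ζ s = 0

/-- The cut-off function `χ(y,z;L) = ζ(L⁻² σ(y,z))`, where `σ` is the squared distance. -/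
def chi {D : ℕ} (ζ : ℝ → ℝ) (y z : Euc D) (L : ℝ) : ℝ := ζ ((L ^ 2)⁻¹ * dist y z ^ 2)

/-- `1 + Δ⁻¹ L ∂/∂L`. -/
def opL (Δ : ℕ) (u : ℝ → ℝ) : ℝ → ℝ := fun L => u L + (Δ : ℝ)⁻¹ * L * deriv u L

/-- `1 - k⁻¹ L log L ∂/∂L`. -/
def opLog (k : ℕ) (u : ℝ → ℝ) : ℝ → ℝ :=
  fun L => u L - (k : ℝ)⁻¹ * L * Real.log L * deriv u L

/-- The composition `F 1 ∘ F 2 ∘ ⋯ ∘ F n`. -/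
def opProd (F : ℕ → (ℝ → ℝ) → (ℝ → ℝ)) : ℕ → (ℝ → ℝ) → (ℝ → ℝ)
  | 0 => id
  | n + 1 => opProd F n ∘ F (n + 1)

/-- `𝔏[L] = 𝓛₀ᴺ ∏_{Δ=1}^{D-4+δ} 𝓛_Δᴺ`, where `𝓛₀ᴺ = ∏_{k=1}^N (1 - k⁻¹ L log L ∂_L)` and
`𝓛_Δᴺ = (1 + Δ⁻¹ L ∂_L)ᴺ`; it acts on functions of `L > 0`.
The second product is empty if `D - 4 + δ < 1`. -/
def frakL (D δ N : ℕ) : (ℝ → ℝ) → (ℝ → ℝ) :=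
  opProd opLog N ∘ opProd (fun Δ => (opL Δ)^[N]) (D + δ - 4)

/-! ### Counterterms and the flow relation -/

/-- Families of tensors `b⁰_C(m²)` with `C = ∂_{γ₁}φ ∂_{γ₂}φ`. For all other `C` the counterterm
`b_C` vanishes: `b⁰_C = 0`, and `(C_H)_{φ²C}^I = 0`, unless `C` has two factors of `φ`. -/
abbrev Counterterm (D : ℕ) := MultiIdx D → MultiIdx D → ℝ → ℝ

/-- The constraints on `b⁰`: it is symmetric, is an invariant tensor under the full orthogonal
group (stated for its generating polynomial), depends smoothly on `m²`, and scales exactly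
homogeneously with factor `l^(D-4)` under `(δ_{ab}, m²) → (l⁻² δ_{ab}, l² m²)`; the covariant
indices contribute `l^(|γ₁|+|γ₂|)` to the scaling of the components with the metric held fixed.
The components of order exceeding `δ`, which never occur, are set to zero. -/
structure IsAdmissible {D : ℕ} (δ : ℕ) (b : Counterterm D) : Prop where
  symm : ∀ γ₁ γ₂ μ, b γ₁ γ₂ μ = b γ₂ γ₁ μ
  invariant : ∀ (μ : ℝ) (g : Euc D ≃ₗᵢ[ℝ] Euc D) (u v : Euc D),
    ∑ γ ∈ pairsUpTo D δ, b γ.1 γ.2 μ * taylorFactor γ.1 (g u) 0 * taylorFactor γ.2 (g v) 0 =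
      ∑ γ ∈ pairsUpTo D δ, b γ.1 γ.2 μ * taylorFactor γ.1 u 0 * taylorFactor γ.2 v 0
  smooth : ∀ γ₁ γ₂, ContDiff ℝ ∞ (b γ₁ γ₂)
  scaling : ∀ γ₁ γ₂ (l : ℝ), 0 < l → ∀ μ : ℝ,
    b γ₁ γ₂ (l ^ 2 * μ) = l ^ ((D : ℤ) - 4 + γ₁.order + γ₂.order) * b γ₁ γ₂ μ
  eq_zero : ∀ γ₁ γ₂ μ, δ < γ₁.order + γ₂.order → b γ₁ γ₂ μ = 0

/-- The integrand `(∂/∂L (𝔏[L] χ(y,z;L))) (C_H)_{φ²C}^I(y,z;z)`. -/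
def counterIntegrand {D : ℕ} (ζ : ℝ → ℝ) (δ N : ℕ) (H : Euc D → Euc D → ℝ) (C : Monomial D)
    (z : Euc D) (L : ℝ) (y : Euc D) : ℝ :=
  deriv (frakL D δ N (chi ζ y z)) L * coeffPhiSqC H C y z

/-- `b_C^H(L) = b_C^0 - ½ ∫_0^L dL' ∫ d^Dy (∂/∂L' (𝔏[L'] χ(y,z;L'))) (C_H)_{φ²C}^I(y,z;z)`
for `C = ∂_{γ₁}φ ∂_{γ₂}φ`. -/
def bH {D : ℕ} (ζ : ℝ → ℝ) (δ N : ℕ) (H : ℝ → Euc D → Euc D → ℝ) (b₀ : Counterterm D)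
    (γ₁ γ₂ : MultiIdx D) (μ : ℝ) (z : Euc D) (L : ℝ) : ℝ :=
  b₀ γ₁ γ₂ μ - 1 / 2 * ∫ L' in (0 : ℝ)..L, ∫ y, counterIntegrand ζ δ N (H μ) [γ₁, γ₂] z L' y

/-- The integrand `𝔏[L]χ(y,z;L) (C_H)_{φ²φ⋯φ}^I(y,x₁,…,x_n;z)`. -/
def flowIntegrand {D n : ℕ} (ζ : ℝ → ℝ) (δ N : ℕ) (H : Euc D → Euc D → ℝ)
    (x : Fin n → Euc D) (z : Euc D) (L : ℝ) (y : Euc D) : ℝ :=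
  frakL D δ N (chi ζ y z) L * coeffPhiSqPhi H y x z

/-- The right-hand side of the flow relation. -/
def flowRHS {D n : ℕ} (ζ : ℝ → ℝ) (δ N : ℕ) (H : ℝ → Euc D → Euc D → ℝ) (b₀ : Counterterm D)
    (μ : ℝ) (z : Euc D) (L : ℝ) (x : Fin n → Euc D) : ℝ :=
  -(1 / 2) * (∫ y, flowIntegrand ζ δ N (H μ) x z L y)
    - ∑ γ ∈ pairsUpTo D δ, bH ζ δ N H b₀ γ.1 γ.2 μ z L * coeffPhi (H μ) [γ.1, γ.2] x z

/-- The left-hand side `∂/∂m² (C_H)_{φ⋯φ}^I(x₁,…,x_n;z)` of the flow relation. -/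
def flowLHS {D n : ℕ} (H : ℝ → Euc D → Euc D → ℝ) (μ : ℝ) (z : Euc D)
    (x : Fin n → Euc D) : ℝ :=
  deriv (fun m => coeffPhi (H m) [] x z) μ

/-! ### Merger trees and asymptotic equivalence -/

/-- Merger trees for `n` points: rooted trees whose nodes are sets of points, the root being the
set of all points, the leaves the single points, and the children of a node partitioning it. -/
structure MergerTree (n : ℕ) where
  nodes : Finset (Finset (Fin n))
  root_mem : Finset.univ ∈ nodes
  leaf_mem : ∀ i, {i} ∈ nodes
  nonempty : ∀ S ∈ nodes, S.Nonempty
  laminar : ∀ S ∈ nodes, ∀ S' ∈ nodes, S ⊆ S' ∨ S' ⊆ S ∨ Disjoint S S'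

namespace MergerTree

/-- The strict ancestors of a node. -/
def ancestors {n : ℕ} (T : MergerTree n) (S : Finset (Fin n)) : Finset (Finset (Fin n)) :=
  T.nodes.filter (fun S' => S ⊂ S')

/-- The depth of a node: its distance from the root. -/
def depth {n : ℕ} (T : MergerTree n) (S : Finset (Fin n)) : ℕ := (T.ancestors S).card

/-- The configuration `x_i(ε) = z + ∑_{S ∋ i, S ≠ root} ε^{depth S} v_S`, with the root at `z`:
points below a common node of depth `d` approach each other at the rate `ε^(d+1)`. -/
def config {n D : ℕ} (T : MergerTree n) (z : Euc D) (v : Finset (Fin n) → Euc D) (ε : ℝ) :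
    Fin n → Euc D :=
  fun i => z + ∑ S ∈ T.nodes.filter (fun S => i ∈ S ∧ S ≠ Finset.univ), ε ^ T.depth S • v S

/-- The parameters for which different children of the same node are at different positions. -/
def params {n : ℕ} (T : MergerTree n) (D : ℕ) : Set (Finset (Fin n) → Euc D) :=
  {v | ∀ S ∈ T.nodes, ∀ S' ∈ T.nodes, S ≠ S' → T.ancestors S = T.ancestors S' → v S ≠ v S'}

/-- The trivial merger tree: all points merge at the same rate. -/
def trivial (n : ℕ) [NeZero n] : MergerTree n where
  nodes := insert Finset.univ (Finset.univ.image (fun i : Fin n => ({i} : Finset (Fin n))))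
  root_mem := by simp
  leaf_mem := by simp
  nonempty := by
    intro S hS
    simp only [Finset.mem_insert, Finset.mem_image, Finset.mem_univ, true_and] at hS
    rcases hS with rfl | ⟨i, rfl⟩
    · exact Finset.univ_nonempty
    · simp
  laminar := by
    intro S hS S' hS'
    simp only [Finset.mem_insert, Finset.mem_image, Finset.mem_univ, true_and] at hS hS'
    rcases hS with rfl | ⟨i, rfl⟩
    · exact Or.inr (Or.inl (Finset.subset_univ _))
    · rcases hS' with rfl | ⟨j, rfl⟩
      · exact Or.inl (Finset.subset_univ _)
      · by_cases h : i = j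
        · exact Or.inl (by simp [h])
        · exact Or.inr (Or.inr (by simpa using h))

end MergerTree

/-- `F ∼_{T,δ} G` at `z`, for functions of `n` points away from the diagonals: the difference is
`o(ε^δ)` along the configurations of the merger tree `T`, locally uniformly in the parameters. -/
def AsympEq {n D : ℕ} (T : MergerTree n) (δ : ℕ) (z : Euc D) (F G : (Fin n → Euc D) → ℝ) : Prop :=
  TendstoLocallyUniformlyOn
    (fun (ε : ℝ) (v : Finset (Fin n) → Euc D) =>
      (F (T.config z v ε) - G (T.config z v ε)) / ε ^ δ)
    (fun _ => 0) (𝓝[>] 0) (T.params D)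

/-- The flow relation for `(C_H)_{φ⋯φ}^I` with `n` factors of `φ`, with `𝔏[L]` and the counterterms
taken at scaling degree `δ`, holds in the sense of `∼_{T,δ'}`, for all `m²`, `z` and `L > 0`. -/
def FlowRelation {D : ℕ} (ζ : ℝ → ℝ) (δ N : ℕ) (H : ℝ → Euc D → Euc D → ℝ) (b₀ : Counterterm D)
    {n : ℕ} (T : MergerTree n) (δ' : ℕ) : Prop :=
  ∀ (μ : ℝ) (z : Euc D) (L : ℝ), 0 < L →
    AsympEq T δ' z (flowLHS H μ z) (flowRHS ζ δ N H b₀ μ z L)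

/-- The flow relation for `(C_H)_{φφ}^I` to scaling degree `δ`. -/
def TwoPointFlow {D : ℕ} (ζ : ℝ → ℝ) (δ N : ℕ) (H : ℝ → Euc D → Euc D → ℝ)
    (b₀ : Counterterm D) : Prop :=
  FlowRelation ζ δ N H b₀ (MergerTree.trivial 2) δ

/-- `w ∼_δ w'` for two-point functions, for all values of `m²` and all `z`. -/
def TwoPointEquiv {D : ℕ} (δ : ℕ) (w w' : ℝ → Euc D → Euc D → ℝ) : Prop :=
  ∀ (μ : ℝ) (z : Euc D), AsympEq (MergerTree.trivial 2) δ z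
    (fun x => w μ (x 0) (x 1)) (fun x => w' μ (x 0) (x 1))

/-- The parametrix `H` corresponds to the invariant function `f`: the two-point flow relation holds
with admissible `b⁰` for which `b⁰_{φ ∂_γ φ}` are the Taylor coefficients of `f`. -/
def Corresponds {D : ℕ} (ζ : ℝ → ℝ) (δ N : ℕ) (H f : ℝ → Euc D → Euc D → ℝ) : Prop :=
  ∃ b₀ : Counterterm D, IsAdmissible δ b₀ ∧ TwoPointFlow ζ δ N H b₀ ∧
    ∀ γ : MultiIdx D, γ.order ≤ δ → ∀ (μ : ℝ) (z : Euc D),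
      b₀ γ 0 μ = multiD γ (fun x => f μ x z) z

end

/-!
Invariance and scaling give a parametrix the form `H(x₁, x₂) = E(x₁ - x₂)` with
`E(u) = |u|^{-(D-2)} (e(m²|u|²) - v(m²|u|²) log |u|²)` for smooth `e`, `v`
(`IsHadamardParametrix.exists_kernel`). Everything follows from the behaviour of
`Q_L(x₁, x₂) = ∂_{m²} E(x₁ - x₂) + ∫ w_L(y) E(y - x₁) E(y - x₂) dy`, `w_L = 𝔏[L] χ`, at coinciding
points.

* With `K = -∂² + m²` and `K E = δ + h` one has `K ∂_{m²} E = -E + ∂_{m²} h`. Green's formula for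
  `∂_{m²} E` and the kernel `w_L E`, a fundamental solution up to a smooth error, thus expresses
  `Q_L` by integrals of `E`, `∂_{m²} E` against smooth functions, so that `Q_L` is smooth
  (`qreg_eq`, `contDiffOn_qreg`).
* The `L`-derivative of its Taylor coefficients `T_γ(L)` is an integral over an annulus. Without the
  operator `𝔏[L]` it would expand in terms `L^{-q-1} log^k L` with `q ≤ D - 4 + δ`, `k ≤ 2`, and
  integrable ones; `𝔏[L]` annihilates the former (`isZ_frakL'`). Hence `b⁰ = -lim_{L → 0} T(L)`
  exists, and then `b^H(L) = -T(L)` (`T_wcut`): the flow relation for two points is Taylor's theorem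
  for `Q_L`, and it determines the symmetric part of `b⁰` (`twoPointFlow_iff`).
* A dilation by `λ` changes `T(L)` homogeneously up to a polynomial in `log λ`, and so `b⁰`. As `b⁰`
  is smooth in `m²`, this polynomial is constant (`polynomial_log_eq_const`, `b0_scaling`).
* In the hafnian for `φ² φ ⋯ φ` the two factors of `φ²` are inserted into one propagator, just as
  `∂_{m²}` acts on one propagator. So the error for `n` points is a sum of two-point errors
  times `n/2 - 1` propagators (`hafnian_two_extra`, `flow_sub`). Along a merger tree these diverge
  at most like a fixed power of `ε`, which a large `δ` compensates (`flowRelation_of_symPart`).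
* If `H' - H` is a smooth function `g` of order `k`, then up to order `k` the coefficients `b⁰_{γ∅}`
  change by `-∂_γ ∂_{m²} g(0)`, the other terms being integrals over a ball shrinking with `L`
  (`b0_eq_sub`). This compares parametrices, and by induction on `k` realizes every `f`
  (`exists_of_homogeneousInvariant`), starting from one parametrix. Such a one exists: `∂/∂r²` maps
  radial solutions of the Klein-Gordon equation to solutions in two more dimensions, so that
  solutions in two and three dimensions suffice (`exists_kernelData`).
-/

open Real (exp log exp_pos norm_of_nonneg norm_eq_abs exp_neg log_pow log_exp rpow_natCast exp_log)
open Set (Ioi Iic Ioo univ mem_univ EqOn)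
open Finset (sum_congr mul_sum sum_mul sum_sub_distrib sum_add_distrib range mem_filter
  mem_insert_of_mem prod_congr sum_singleton sum_equiv sum_insert mem_insert_self sum_le_sum
  sum_const_zero sum_range_succ)
open Metric (ball closedBall mem_closedBall isOpen_ball)
open Polynomial (C X eval_mul eval_C eval_X eval_sub coeff_C_mul eval_finsetSum
  coeff_derivative coeff_sub)
open Equiv (swap Perm sumCongr swap_apply_of_ne_of_ne)
open Sum (inl inr)
open Function (comp_def uncurry comp_apply Injective)
-- `Smooth₂` and `SmoothOn₂` are about the joint smoothness of a curried function.
local notation "Smooth" => ContDiff ℝ ∞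
local notation "SmoothOn" => ContDiffOn ℝ ∞
local notation "Smooth₂" f:max => ContDiff ℝ ∞ (fun p => f (Prod.fst p) (Prod.snd p))
local notation "SmoothOn₂" f:max s:max =>
  ContDiffOn ℝ ∞ (fun p => f (Prod.fst p) (Prod.snd p)) s
local notation "Euc₂" D:max => Euc D × Euc D
local notation "MultiIdx₂" D:max => MultiIdx D × MultiIdx D
local notation "𝔹₂" ρ:max => (Set.ofPred fun p => ‖Prod.fst p‖ < ρ ∧ ‖Prod.snd p‖ < ρ)
local notation "𝐞" i:max => EuclideanSpace.single i (1 : ℝ)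

noncomputable section

/-! ### Iterated partial derivatives -/

lemma integral_congr_fun {α : Type*} [MeasurableSpace α] {ν : Measure α} {f g : α → ℝ}
    (h : ∀ x, f x = g x) : ∫ x, f x ∂ν = ∫ x, g x ∂ν := by
  simp only [h]

/-- The iterated partial derivative `∂_{i₁} ⋯ ∂_{i_k} f` along the list `[i₁, …, i_k]` of
coordinate directions. -/
def iterD {D : ℕ} (l : List (Fin D)) (f : Euc D → ℝ) : Euc D → ℝ :=
  l.foldr partialD f

/-- The list of directions of a multi-index: the direction `i` is repeated `γ i` times. -/
def idxList {D : ℕ} (γ : MultiIdx D) : List (Fin D) :=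
  (List.finRange D).flatMap (fun i => List.replicate (γ i) i)

section IterD

variable {D : ℕ} {f g : Euc D → ℝ} {U : Set (Euc D)}

@[simp] lemma iterD_nil (f : Euc D → ℝ) : iterD [] f = f := rfl

@[simp] lemma iterD_cons (i : Fin D) (l : List (Fin D)) (f : Euc D → ℝ) :
    iterD (i :: l) f = partialD i (iterD l f) := rfl

lemma iterD_append (l l' : List (Fin D)) (f : Euc D → ℝ) :
    iterD (l ++ l') f = iterD l (iterD l' f) := by
  simp [iterD, List.foldr_append]

lemma iterD_replicate (i : Fin D) (n : ℕ) (f : Euc D → ℝ) :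
    iterD (List.replicate n i) f = (partialD i)^[n] f := by
  induction n with
  | zero => rfl
  | succ n ih => rw [List.replicate_succ, iterD_cons, ih, Function.iterate_succ_apply']

lemma multiD_eq_iterD (γ : MultiIdx D) (f : Euc D → ℝ) : multiD γ f = iterD (idxList γ) f := by
  unfold multiD idxList
  generalize List.finRange D = l
  induction l with
  | nil => rfl
  | cons i l ih =>
    rw [List.foldr_cons, ih, List.flatMap_cons, iterD_append, iterD_replicate]

lemma count_idxList (γ : MultiIdx D) (i : Fin D) : (idxList γ).count i = γ i := by
  unfold idxList
  rw [List.count_flatMap]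
  have : ∀ l : List (Fin D), l.Nodup →
      (List.map (List.count i ∘ fun i => List.replicate (γ i) i) l).sum
        = if i ∈ l then γ i else 0 := by
    intro l hl
    induction l with
    | nil => simp
    | cons j l ih =>
      have hj := List.nodup_cons.1 hl
      rw [List.map_cons, List.sum_cons, ih hj.2]
      by_cases h : i = j
      · subst h
        simp [hj.1]
      · have h' : j ≠ i := fun h'' => h h''.symm
        simp [List.count_replicate, h, h']
  rw [this _ (List.nodup_finRange D)]
  simp

lemma length_idxList (γ : MultiIdx D) : (idxList γ).length = γ.order := by
  rw [MultiIdx.order, ← Multiset.coe_card, ← Multiset.sum_count_eq_card (s := Finset.univ)]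
  · simp [count_idxList]
  · intro a _
    exact Finset.mem_univ a

/-- The multi-index of a list of directions. -/
def listIdx (l : List (Fin D)) : MultiIdx D := fun i => l.count i

lemma idxList_listIdx_perm (l : List (Fin D)) : (idxList (listIdx l)).Perm l := by
  rw [List.perm_iff_count]
  intro i
  rw [count_idxList, listIdx]

lemma order_listIdx (l : List (Fin D)) : (listIdx l).order = l.length := by
  rw [← length_idxList, (idxList_listIdx_perm l).length_eq]

/-! ### Locality, linearity and smoothness of iterated derivatives -/

lemma partialD_congr (hU : IsOpen U) (h : EqOn f g U)
    (i : Fin D) : EqOn (partialD i f) (partialD i g) U := by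
  intro x hx
  have : f =ᶠ[𝓝 x] g := h.eventuallyEq_of_mem (hU.mem_nhds hx)
  simp only [partialD, this.fderiv_eq]

lemma iterD_congr (hU : IsOpen U) (h : EqOn f g U)
    (l : List (Fin D)) : EqOn (iterD l f) (iterD l g) U := by
  induction l with
  | nil => exact h
  | cons i l ih => exact partialD_congr hU ih i

lemma iterD_congr_nhds {x : Euc D} (h : f =ᶠ[𝓝 x] g)
    (l : List (Fin D)) : iterD l f x = iterD l g x := by
  obtain ⟨U, hU, hUo, hx⟩ := mem_nhds_iff.1 h
  exact iterD_congr hUo (fun y hy => hU hy) l hx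

lemma contDiffOn_partialD_param {P : Type*} [NormedAddCommGroup P] [NormedSpace ℝ P]
    {Ψ : P → Euc D → ℝ} {O : Set (P × Euc D)} (hO : IsOpen O) (h : SmoothOn₂ Ψ O) (i : Fin D) :
    SmoothOn (fun q : P × Euc D => partialD i (Ψ q.1) q.2) O := by
  have h1 : SmoothOn (fderiv ℝ (fun q : P × Euc D => Ψ q.1 q.2)) O :=
    h.fderiv_of_isOpen hO (by simp)
  have h2 : SmoothOn (fun q => fderiv ℝ (fun q : P × Euc D => Ψ q.1 q.2) q
      ((0 : P), (𝐞 i : Euc D))) O :=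
    h1.clm_apply contDiffOn_const
  refine h2.congr ?_
  rintro ⟨p, x⟩ hq
  have hd : DifferentiableAt ℝ (fun q : P × Euc D => Ψ q.1 q.2) (p, x) :=
    (h.contDiffAt (hO.mem_nhds hq)).differentiableAt (by simp)
  have hc : HasFDerivAt (fun y : Euc D => (p, y)) (ContinuousLinearMap.inr ℝ P (Euc D)) x :=
    hasFDerivAt_prodMk_right p x
  have := (hd.hasFDerivAt.comp x hc).fderiv
  simp only [partialD]
  change fderiv ℝ ((fun q : P × Euc D => Ψ q.1 q.2) ∘ fun y => (p, y)) x _ = _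
  rw [this]
  simp

lemma contDiffOn_iterD_param {P : Type*} [NormedAddCommGroup P] [NormedSpace ℝ P]
    {Ψ : P → Euc D → ℝ} {O : Set (P × Euc D)} (hO : IsOpen O)
    (h : SmoothOn₂ Ψ O) (l : List (Fin D)) :
    SmoothOn (fun q : P × Euc D => iterD l (Ψ q.1) q.2) O := by
  induction l with
  | nil => exact h
  | cons i l ih => exact contDiffOn_partialD_param (Ψ := fun p => iterD l (Ψ p)) hO ih i

lemma contDiff_iterD_param {P : Type*} [NormedAddCommGroup P] [NormedSpace ℝ P]
    {Ψ : P → Euc D → ℝ} (h : Smooth₂ Ψ) (l : List (Fin D)) :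
    Smooth (fun q : P × Euc D => iterD l (Ψ q.1) q.2) := by
  rw [← contDiffOn_univ] at *
  exact contDiffOn_iterD_param isOpen_univ h l

lemma ContDiffOn.partialD (hU : IsOpen U)
    (h : SmoothOn f U) (i : Fin D) : SmoothOn (partialD i f) U :=
  (h.fderiv_of_isOpen hU (by simp)).clm_apply contDiffOn_const

lemma ContDiffOn.iterD (hU : IsOpen U)
    (h : SmoothOn f U) (l : List (Fin D)) : SmoothOn (iterD l f) U := by
  induction l with
  | nil => exact h
  | cons i l ih => exact ih.partialD hU i

lemma ContDiff.iterD (h : Smooth f) (l : List (Fin D)) :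
    Smooth (iterD l f) := by
  rw [← contDiffOn_univ] at *
  exact h.iterD isOpen_univ l

lemma ContDiffOn.differentiableAt_of_isOpen {E F : Type*} [NormedAddCommGroup E] [NormedSpace ℝ E]
    [NormedAddCommGroup F] [NormedSpace ℝ F] {f : E → F} {U : Set E}
    (h : SmoothOn f U) (hU : IsOpen U) {x : E} (hx : x ∈ U) : DifferentiableAt ℝ f x :=
  (h.contDiffAt (hU.mem_nhds hx)).differentiableAt (by simp)

lemma iterD_add (hU : IsOpen U) (hf : SmoothOn f U) (hg : SmoothOn g U) (l : List (Fin D)) :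
    EqOn (iterD l (fun x => f x + g x)) (fun x => iterD l f x + iterD l g x) U := by
  induction l with
  | nil => exact fun x _ => rfl
  | cons i l ih =>
    intro x hx
    rw [iterD_cons, partialD_congr hU ih i hx]
    simp only [partialD, iterD_cons]
    rw [fderiv_fun_add ((hf.iterD hU l).differentiableAt_of_isOpen hU hx)
      ((hg.iterD hU l).differentiableAt_of_isOpen hU hx)]
    rfl

lemma iterD_const_mul (c : ℝ) (hU : IsOpen U) (hf : SmoothOn f U) (l : List (Fin D)) :
    EqOn (iterD l (fun x => c * f x)) (fun x => c * iterD l f x) U := by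
  induction l with
  | nil => exact fun x _ => rfl
  | cons i l ih =>
    intro x hx
    rw [iterD_cons, partialD_congr hU ih i hx]
    simp only [partialD, iterD_cons]
    rw [fderiv_const_mul ((hf.iterD hU l).differentiableAt_of_isOpen hU hx)]
    rfl

lemma iterD_zero (l : List (Fin D)) : iterD l (fun _ => (0 : ℝ)) = fun _ => 0 := by
  induction l with
  | nil => rfl
  | cons i l ih => rw [iterD_cons, ih]; ext x; simp [partialD]

lemma iterD_const {l : List (Fin D)} (hl : l ≠ []) (c : ℝ) :
    iterD l (fun _ => c) = fun _ => 0 := by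
  obtain ⟨i, l', rfl⟩ := List.exists_cons_of_ne_nil hl
  clear hl
  induction l' generalizing i with
  | nil => ext x; simp [partialD]
  | cons j l ih => rw [iterD_cons, ih]; ext x; simp [partialD]

lemma iterD_sum {ι : Type*} (s : Finset ι) {f : ι → Euc D → ℝ} (hU : IsOpen U)
    (hf : ∀ j ∈ s, SmoothOn (f j) U) (l : List (Fin D)) :
    EqOn (iterD l (fun x => ∑ j ∈ s, f j x)) (fun x => ∑ j ∈ s, iterD l (f j) x) U := by
  classical
  induction s using Finset.induction_on with
  | empty => intro x _; simp [iterD_zero]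
  | insert a s ha ih =>
    intro x hx
    have h1 : SmoothOn (fun x => ∑ j ∈ s, f j x) U :=
      ContDiffOn.sum fun j hj => hf j (mem_insert_of_mem hj)
    have := iterD_add hU (hf a (mem_insert_self _ _)) h1 l hx
    simp only [sum_insert ha]
    rw [this]
    exact congrArg (_ + ·) (ih (fun j hj => hf j (mem_insert_of_mem hj)) hx)

lemma iterD_sub (hU : IsOpen U) (hf : SmoothOn f U) (hg : SmoothOn g U) (l : List (Fin D)) :
    EqOn (iterD l (fun x => f x - g x)) (fun x => iterD l f x - iterD l g x) U := by
  intro x hx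
  have h1 : (fun x => f x - g x) = fun x => f x + (-1) * g x := by ext; ring
  rw [h1, iterD_add hU hf (contDiffOn_const.mul hg) l hx]
  simp only []
  rw [iterD_const_mul (-1) hU hg l hx]
  ring

/-! ### Translations and dilations -/

lemma iterD_comp_add (f : Euc D → ℝ) (a : Euc D) (l : List (Fin D)) :
    iterD l (fun x => f (x + a)) = fun x => iterD l f (x + a) := by
  induction l with
  | nil => rfl
  | cons i l ih =>
    rw [iterD_cons, ih]
    ext x
    simp only [partialD, iterD_cons]
    rw [fderiv_comp_add_right]

lemma iterD_comp_smul (f : Euc D → ℝ) (c : ℝ) (l : List (Fin D))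
    (hU : IsOpen U) (hf : SmoothOn f U) {x : Euc D} (hx : c • x ∈ U) :
    iterD l (fun x => f (c • x)) x = c ^ l.length * iterD l f (c • x) := by
  induction l generalizing x with
  | nil => simp
  | cons i l ih =>
    have hV : IsOpen ((fun x : Euc D => c • x) ⁻¹' U) := hU.preimage (continuous_const_smul c)
    rw [iterD_cons, partialD_congr hV (g := fun x => c ^ l.length * iterD l f (c • x))
      (fun y hy => ih hy) i hx]
    simp only [partialD, iterD_cons, List.length_cons]
    have hd := (hf.iterD hU l).differentiableAt_of_isOpen hU hx
    have h1 : HasFDerivAt (fun x : Euc D => c • x) (c • ContinuousLinearMap.id ℝ (Euc D)) x :=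
      (hasFDerivAt_id x).const_smul c
    have h2 := (hd.hasFDerivAt.comp x h1).const_mul (c ^ l.length)
    have h3 := h2.fderiv
    simp only [comp_def] at h3
    rw [h3]
    simp
    ring

end IterD

/-! ### Jets and Taylor estimates -/

section Jets

variable {D : ℕ} {f : Euc D → ℝ} {U : Set (Euc D)} {q : Euc D → Euc D → ℝ}

lemma two_le_infty : (2 : ℕ∞ω) ≤ ∞ := ENat.LEInfty.out

lemma partialD_comm (hU : IsOpen U) (hf : SmoothOn f U) (i j : Fin D) :
    EqOn (partialD i (partialD j f)) (partialD j (partialD i f)) U := by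
  intro x hx
  have hc := hf.contDiffAt (hU.mem_nhds hx)
  have hs : IsSymmSndFDerivAt ℝ f x := hc.isSymmSndFDerivAt (by simpa using two_le_infty)
  have hd : DifferentiableAt ℝ (fderiv ℝ f) x :=
    (hf.fderiv_of_isOpen hU (m := ∞) (by simp)).differentiableAt_of_isOpen hU hx
  have key : ∀ k m : Fin D, partialD k (partialD m f) x
      = fderiv ℝ (fderiv ℝ f) x (𝐞 k) (𝐞 m) := by
    intro k m
    unfold partialD
    have := (hd.hasFDerivAt.clm_apply
      (hasFDerivAt_const (𝐞 m : Euc D) x)).fderiv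
    rw [this]
    simp
  rw [key, key, hs]

lemma iterD_perm (hU : IsOpen U) (hf : SmoothOn f U) {l l' : List (Fin D)} (h : l.Perm l') :
    EqOn (iterD l f) (iterD l' f) U := by
  induction h with
  | nil => exact fun x _ => rfl
  | cons i _ ih => exact partialD_congr hU ih i
  | swap i j l => exact partialD_comm hU (hf.iterD hU l) j i
  | trans _ _ ih1 ih2 => exact ih1.trans ih2

/-- The mixed partial derivative `∂_l ∂_{l'} q` of a function of two points at the origin. -/
def jet (l l' : List (Fin D)) (q : Euc D → Euc D → ℝ) : ℝ :=
  iterD l (fun a => iterD l' (fun b => q a b) 0) 0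

lemma partialD_fst_eq (hq : Smooth₂ q) (i : Fin D) (a b : Euc D) : partialD i (fun a' => q a' b) a
      = fderiv ℝ (fun p : Euc₂ D => q p.1 p.2) (a, b) (𝐞 i, 0) := by
  have hd : DifferentiableAt ℝ (fun p : Euc₂ D => q p.1 p.2) (a, b) :=
    hq.differentiable (by simp) _
  have := (HasFDerivAt.comp (f := fun e : Euc D => (e, b)) a hd.hasFDerivAt
    (hasFDerivAt_prodMk_left a b)).fderiv
  unfold partialD
  change fderiv ℝ ((fun p : Euc₂ D => q p.1 p.2) ∘ fun y => (y, b)) a _ = _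
  rw [this]
  simp

lemma partialD_snd_eq (hq : Smooth₂ q) (i : Fin D) (a b : Euc D) : partialD i (fun b' => q a b') b
      = fderiv ℝ (fun p : Euc₂ D => q p.1 p.2) (a, b) (0, 𝐞 i) := by
  have hd : DifferentiableAt ℝ (fun p : Euc₂ D => q p.1 p.2) (a, b) :=
    hq.differentiable (by simp) _
  have := (hd.hasFDerivAt.comp b (hasFDerivAt_prodMk_right a b)).fderiv
  unfold partialD
  change fderiv ℝ ((fun p : Euc₂ D => q p.1 p.2) ∘ fun y => (a, y)) b _ = _
  rw [this]
  simp

lemma contDiff_partialD_fst (hq : Smooth₂ q) (i : Fin D) :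
    Smooth (fun p : Euc₂ D => partialD i (fun a => q a p.2) p.1) := by
  have : Smooth (fun p : Euc₂ D =>
      fderiv ℝ (fun p : Euc₂ D => q p.1 p.2) p (𝐞 i, 0)) :=
    (hq.fderiv_right (m := ∞) (by simp)).clm_apply contDiff_const
  convert this using 2 with p
  exact partialD_fst_eq hq i p.1 p.2

lemma partialD_swap (hq : Smooth₂ q) (i j : Fin D) (a b : Euc D) :
    partialD j (fun b' => partialD i (fun a' => q a' b') a) b
      = partialD i (fun a' => partialD j (fun b' => q a' b') b) a := by
  set F : Euc₂ D → ℝ := fun p => q p.1 p.2 with hF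
  have hs : IsSymmSndFDerivAt ℝ F (a, b) :=
    hq.contDiffAt.isSymmSndFDerivAt (by simpa using two_le_infty)
  have hd : DifferentiableAt ℝ (fderiv ℝ F) (a, b) :=
    (hq.fderiv_right (m := ∞) (by simp)).differentiable (by simp) _
  have e1 : (fun b' => partialD i (fun a' => q a' b') a)
      = fun b' => fderiv ℝ F (a, b') (𝐞 i, 0) := by
    ext b'; exact partialD_fst_eq hq i a b'
  have e2 : (fun a' => partialD j (fun b' => q a' b') b)
      = fun a' => fderiv ℝ F (a', b) (0, 𝐞 j) := by
    ext a'; exact partialD_snd_eq hq j a' b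
  rw [e1, e2]
  unfold partialD
  have h1 := ((hd.hasFDerivAt.comp b (hasFDerivAt_prodMk_right a b)).clm_apply
      (hasFDerivAt_const ((𝐞 i : Euc D), (0 : Euc D)) b)).fderiv
  have h2 := ((HasFDerivAt.comp (f := fun e : Euc D => (e, b)) a hd.hasFDerivAt
    (hasFDerivAt_prodMk_left a b)).clm_apply
      (hasFDerivAt_const ((0 : Euc D), (𝐞 j : Euc D)) a)).fderiv
  simp only [comp_def] at h1 h2
  rw [h1, h2]
  simp
  rw [hs]

lemma contDiff_iterD_snd (hq : Smooth₂ q) (l : List (Fin D)) :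
    Smooth (fun p : Euc₂ D => iterD l (fun b => q p.1 b) p.2) :=
  contDiff_iterD_param (Ψ := fun a b => q a b) hq l

lemma iterD_partialD_swap (hq : Smooth₂ q) (i : Fin D) (l : List (Fin D)) (a b : Euc D) :
    iterD l (fun b' => partialD i (fun a' => q a' b') a) b
      = partialD i (fun a' => iterD l (fun b' => q a' b') b) a := by
  induction l generalizing b with
  | nil => rfl
  | cons j l ih =>
    rw [iterD_cons, show iterD l (fun b' => partialD i (fun a' => q a' b') a)
      = fun b => partialD i (fun a' => iterD l (fun b' => q a' b') b) a from funext ih]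
    exact partialD_swap (q := fun a b => iterD l (fun b' => q a b') b)
      (contDiff_iterD_snd hq l) i j a b

lemma jet_partialD_fst (hq : Smooth₂ q) (i : Fin D) (l l' : List (Fin D)) :
    jet l l' (fun a b => partialD i (fun a' => q a' b) a) = jet (l ++ [i]) l' q := by
  unfold jet
  rw [iterD_append]
  congr 1
  ext a
  exact iterD_partialD_swap hq i l' a 0

lemma jet_partialD_snd (i : Fin D) (l l' : List (Fin D)) :
    jet l l' (fun a b => partialD i (fun b' => q a b') b) = jet l (l' ++ [i]) q := by
  unfold jet
  simp only [iterD_append]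
  rfl

lemma norm_le_sum_partialD (hq : Smooth₂ q) (p : Euc₂ D) :
    ‖fderiv ℝ (fun p : Euc₂ D => q p.1 p.2) p‖
      ≤ ∑ i, (|partialD i (fun a => q a p.2) p.1| + |partialD i (fun b => q p.1 b) p.2|) := by
  refine ContinuousLinearMap.opNorm_le_bound _ (Finset.sum_nonneg fun i _ => by positivity) ?_
  rintro ⟨u, v⟩
  set φ := fderiv ℝ (fun p : Euc₂ D => q p.1 p.2) p with hφ
  have hsum : ∀ u : Euc D, u = ∑ i, u i • 𝐞 i := by
    intro u
    ext j
    simp [Finset.sum_apply, Pi.single_apply]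
  have h1 : (u, v) = ∑ i, (u i • ((𝐞 i : Euc D), (0 : Euc D))
      + v i • ((0 : Euc D), (𝐞 i : Euc D))) := by
    rw [sum_add_distrib]
    refine Prod.ext ?_ ?_
    · simp only [Prod.fst_add, Prod.fst_sum, Prod.smul_mk, smul_zero, sum_const_zero,
        add_zero]
      exact hsum u
    · simp only [Prod.snd_add, Prod.snd_sum, Prod.smul_mk, smul_zero, sum_const_zero,
        zero_add]
      exact hsum v
  rw [h1, map_sum, ← h1, sum_mul]
  refine (norm_sum_le _ _).trans (sum_le_sum fun i _ => ?_)
  rw [map_add, map_smul, map_smul, ← partialD_fst_eq hq, ← partialD_snd_eq hq]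
  have hu : |u i| ≤ ‖(u, v)‖ := (PiLp.norm_apply_le u i).trans (norm_fst_le (u, v))
  have hv : |v i| ≤ ‖(u, v)‖ := (PiLp.norm_apply_le v i).trans (norm_snd_le (u, v))
  refine (norm_add_le _ _).trans ?_
  simp only [norm_smul, norm_eq_abs]
  rw [add_mul]
  refine add_le_add ?_ ?_
  · rw [mul_comm]; exact mul_le_mul_of_nonneg_left hu (abs_nonneg _)
  · rw [mul_comm]; exact mul_le_mul_of_nonneg_left hv (abs_nonneg _)

/-- If all mixed partial derivatives of order less than `m` vanish at the origin, then the function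
is of order `m` near the origin. -/
lemma exists_bound_of_jet_eq_zero (m : ℕ) (hq : Smooth₂ q)
    (h : ∀ l l' : List (Fin D), l.length + l'.length < m → jet l l' q = 0) :
    ∃ C : ℝ, 0 ≤ C ∧ ∀ p : Euc₂ D, ‖p‖ ≤ 1 → |q p.1 p.2| ≤ C * ‖p‖ ^ m := by
  induction m generalizing q with
  | zero =>
    obtain ⟨C, hC⟩ := (isCompact_closedBall (0 : Euc₂ D) 1).exists_bound_of_continuousOn
      hq.continuous.continuousOn
    refine ⟨max C 0, le_max_right _ _, fun p hp => ?_⟩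
    have := hC p (by simpa using hp)
    simp only [pow_zero, mul_one]
    exact this.trans (le_max_left _ _)
  | succ m ih =>
    have h1 : ∀ i : Fin D, ∃ C : ℝ, 0 ≤ C ∧ ∀ p : Euc₂ D, ‖p‖ ≤ 1 →
        |partialD i (fun a => q a p.2) p.1| ≤ C * ‖p‖ ^ m := fun i =>
      ih (q := fun a b => partialD i (fun a' => q a' b) a) (contDiff_partialD_fst hq i)
        fun l l' hl => by
          rw [jet_partialD_fst hq]
          exact h _ _ (by simp; omega)
    have h2 : ∀ i : Fin D, ∃ C : ℝ, 0 ≤ C ∧ ∀ p : Euc₂ D, ‖p‖ ≤ 1 →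
        |partialD i (fun b => q p.1 b) p.2| ≤ C * ‖p‖ ^ m := fun i =>
      ih (q := fun a b => partialD i (fun b' => q a b') b) (contDiff_iterD_snd hq [i])
        fun l l' hl => by
          rw [jet_partialD_snd]
          exact h _ _ (by simp; omega)
    choose C₁ hC₁ h1 using h1
    choose C₂ hC₂ h2 using h2
    have h0 : q 0 0 = 0 := by simpa [jet] using h [] [] (by simp)
    refine ⟨∑ i, (C₁ i + C₂ i), Finset.sum_nonneg fun i _ => add_nonneg (hC₁ i) (hC₂ i), ?_⟩
    intro p hp
    have key := Convex.norm_image_sub_le_of_norm_fderiv_le (𝕜 := ℝ)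
      (f := fun p : Euc₂ D => q p.1 p.2) (C := (∑ i, (C₁ i + C₂ i)) * ‖p‖ ^ m)
      (s := closedBall 0 ‖p‖) (x := 0) (y := p)
      (fun x _ => hq.differentiable (by simp) x) (fun x hx => ?_) (convex_closedBall _ _)
      (by simp) (by simp)
    · simp only [Prod.fst_zero, Prod.snd_zero, h0, sub_zero, norm_eq_abs] at key
      rw [pow_succ, ← mul_assoc]
      exact key
    · rw [mem_closedBall, dist_zero_right] at hx
      refine (norm_le_sum_partialD hq x).trans ?_
      rw [sum_mul]
      refine sum_le_sum fun i _ => ?_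
      rw [add_mul]
      have hm : ‖x‖ ^ m ≤ ‖p‖ ^ m := pow_le_pow_left₀ (norm_nonneg _) hx m
      exact add_le_add ((h1 i x (hx.trans hp)).trans (mul_le_mul_of_nonneg_left hm (hC₁ i)))
        ((h2 i x (hx.trans hp)).trans (mul_le_mul_of_nonneg_left hm (hC₂ i)))

/-! ### Taylor monomials -/

lemma taylorFactor_self (β : MultiIdx D) (z : Euc D) :
    taylorFactor β z z = if β = 0 then 1 else 0 := by
  unfold taylorFactor
  split_ifs with h
  · simp [h]
  · obtain ⟨i, hi⟩ := Function.ne_iff.1 h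
    refine Finset.prod_eq_zero (Finset.mem_univ i) ?_
    simp only [Pi.zero_apply] at hi
    simp [hi]

lemma taylorFactor_smul (β : MultiIdx D) (c : ℝ) (x : Euc D) :
    taylorFactor β (c • x) 0 = c ^ β.order * taylorFactor β x 0 := by
  unfold taylorFactor MultiIdx.order
  rw [← Finset.prod_pow_eq_pow_sum, ← Finset.prod_mul_distrib]
  refine prod_congr rfl fun i _ => ?_
  simp [mul_pow, mul_div_assoc]

lemma taylorFactor_sub (β : MultiIdx D) (x z : Euc D) :
    taylorFactor β x z = taylorFactor β (x - z) 0 := by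
  simp [taylorFactor]

lemma contDiff_taylorFactor (β : MultiIdx D) (z : Euc D) :
    Smooth (fun x => taylorFactor β x z) := by
  unfold taylorFactor
  refine contDiff_prod fun i _ =>
    ContDiff.div_const (ContDiff.pow (ContDiff.sub ?_ contDiff_const) _) _
  exact contDiff_piLp_apply (p := 2) (𝕜 := ℝ) (i := i)

lemma partialD_taylorFactor (i : Fin D) (β : MultiIdx D) (z : Euc D) :
    partialD i (fun x => taylorFactor β x z)
      = fun x => if β i = 0 then 0 else taylorFactor (Function.update β i (β i - 1)) x z := by
  ext x
  have hsplit : ∀ (β : MultiIdx D) (y : Euc D), taylorFactor β y z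
      = (∏ j ∈ Finset.univ.erase i, (y j - z j) ^ β j / (Nat.factorial (β j) : ℝ))
        * ((y i - z i) ^ β i / (Nat.factorial (β i) : ℝ)) := fun β y => by
    rw [taylorFactor, Finset.prod_erase_mul _ _ (Finset.mem_univ i)]
  have hlin : (fun t : ℝ => taylorFactor β (x + t • 𝐞 i) z)
      = fun t => (∏ j ∈ Finset.univ.erase i, (x j - z j) ^ β j / (Nat.factorial (β j) : ℝ))
        * ((x i + t - z i) ^ β i / (Nat.factorial (β i) : ℝ)) := by
    ext t
    rw [hsplit]
    congr 1
    · refine prod_congr rfl fun j hj => ?_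
      have := Finset.ne_of_mem_erase hj
      simp [this]
    · simp
  have hd : DifferentiableAt ℝ (fun x => taylorFactor β x z) x :=
    (contDiff_taylorFactor β z).differentiable (by simp) x
  have h1 : partialD i (fun x => taylorFactor β x z) x
      = lineDeriv ℝ (fun x => taylorFactor β x z) x (𝐞 i) := by
    rw [hd.lineDeriv_eq_fderiv]; rfl
  rw [h1, lineDeriv, hlin]
  have h2 : HasDerivAt (fun t : ℝ => (x i + t - z i)) 1 0 := by
    simpa using ((hasDerivAt_id (0 : ℝ)).const_add (x i)).sub_const (z i)
  have h3 := (((h2.pow (β i)).div_const (Nat.factorial (β i) : ℝ)).const_mul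
    (∏ j ∈ Finset.univ.erase i, (x j - z j) ^ β j / (Nat.factorial (β j) : ℝ))).deriv
  simp only [Pi.pow_apply] at h3
  rw [h3]
  split_ifs with h
  · simp [h]
  · rw [hsplit]
    obtain ⟨n, hn⟩ := Nat.exists_eq_succ_of_ne_zero h
    congr 1
    · refine prod_congr rfl fun j hj => ?_
      rw [Function.update_of_ne (Finset.ne_of_mem_erase hj)]
    · rw [Function.update_self, hn]
      simp only [Nat.succ_eq_add_one, Nat.add_sub_cancel, add_zero, Nat.factorial_succ]
      push_cast
      have : (n.factorial : ℝ) ≠ 0 := by positivity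
      field_simp

lemma iterD_taylorFactor (l : List (Fin D)) (β : MultiIdx D) (z : Euc D) :
    iterD l (fun x => taylorFactor β x z)
      = fun x => if ∀ i, l.count i ≤ β i then
          taylorFactor (fun i => β i - l.count i) x z else 0 := by
  induction l with
  | nil => simp
  | cons i l ih =>
    rw [iterD_cons, ih]
    by_cases h : ∀ j, l.count j ≤ β j
    · simp only [h, implies_true, if_true]
      rw [partialD_taylorFactor]
      ext x
      by_cases hi : β i - l.count i = 0
      · rw [if_pos hi, if_neg]
        intro h'
        have := h' i
        rw [List.count_cons_self] at this
        omega
      · rw [if_neg hi, if_pos]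
        · congr 1
          ext j
          by_cases hj : j = i
          · subst hj; simp; omega
          · rw [Function.update_of_ne hj, List.count_cons_of_ne (fun h => hj h.symm)]
        · intro j
          by_cases hj : j = i
          · subst hj
            rw [List.count_cons_self]
            omega
          · rw [List.count_cons_of_ne (fun h => hj h.symm)]
            exact h j
    · have h' : ¬ ∀ j, (i :: l).count j ≤ β j := fun h' =>
        h fun j => (List.count_le_count_cons).trans (h' j)
      ext x
      simp only [h, h', if_false, partialD]
      simp

lemma multiD_taylorFactor_self (γ β : MultiIdx D) (z : Euc D) :
    multiD γ (fun x => taylorFactor β x z) z = if γ = β then 1 else 0 := by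
  rw [multiD_eq_iterD, iterD_taylorFactor]
  simp only [count_idxList, taylorFactor_self]
  by_cases h : γ = β
  · subst h
    have : (fun i => γ i - γ i) = (0 : MultiIdx D) := by ext; simp
    rw [if_pos (fun _ => le_rfl), if_pos this, if_pos rfl]
  · rw [if_neg h]
    split_ifs with h1 h2
    · exact absurd (funext fun i => by
        have := congrFun h2 i
        have := h1 i
        simp at *; omega) h
    · rfl
    · rfl

end Jets

/-! ### Taylor polynomials in two points -/

section TaylorPair

variable {D : ℕ} {q q' : Euc D → Euc D → ℝ}

lemma mem_pairsUpTo {δ : ℕ} {γ : MultiIdx₂ D} :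
    γ ∈ pairsUpTo D δ ↔ γ.1.order + γ.2.order ≤ δ := by
  unfold pairsUpTo
  rw [mem_filter, and_iff_right_iff_imp]
  intro h
  have h1 : ∀ (β : MultiIdx D) i, β i ≤ β.order := fun β i =>
    Finset.single_le_sum (f := β) (fun _ _ => Nat.zero_le _) (Finset.mem_univ i)
  simp only [Finset.mem_product, Fintype.mem_piFinset, Finset.mem_range]
  exact ⟨fun i => by have := h1 γ.1 i; omega, fun i => by have := h1 γ.2 i; omega⟩

/-- The Taylor coefficient `∂_{γ₁} ∂_{γ₂} q` at the origin of a function of two points. -/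
def jetM (γ : MultiIdx₂ D) (q : Euc D → Euc D → ℝ) : ℝ :=
  jet (idxList γ.1) (idxList γ.2) q

lemma contDiff_iterD_snd_zero (hq : Smooth₂ q) (l : List (Fin D)) :
    Smooth (fun a => iterD l (fun b => q a b) 0) :=
  (contDiff_iterD_snd hq l).comp (contDiff_id.prodMk contDiff_const)

lemma contDiff_slice (hq : Smooth₂ q) (a : Euc D) :
    Smooth (fun b => q a b) :=
  hq.comp (contDiff_const.prodMk contDiff_id)

lemma jet_congr_nhds (h : ∀ᶠ p : Euc₂ D in 𝓝 0, q p.1 p.2 = q' p.1 p.2) (l l' : List (Fin D)) :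
    jet l l' q = jet l l' q' := by
  refine iterD_congr_nhds ?_ l
  rw [show (0 : Euc₂ D) = (0, 0) from rfl, nhds_prod_eq] at h
  have h1 : ∀ᶠ a in 𝓝 (0 : Euc D), ∀ᶠ b in 𝓝 (0 : Euc D), q a b = q' a b := h.curry
  filter_upwards [h1] with a ha
  exact iterD_congr_nhds ha l'

lemma jet_add (hq : Smooth₂ q) (hq' : Smooth₂ q') (l l' : List (Fin D)) :
    jet l l' (fun a b => q a b + q' a b) = jet l l' q + jet l l' q' := by
  unfold jet
  have : (fun a => iterD l' (fun b => q a b + q' a b) 0)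
      = fun a => iterD l' (fun b => q a b) 0 + iterD l' (fun b => q' a b) 0 := by
    ext a
    exact iterD_add isOpen_univ (contDiff_slice hq a).contDiffOn
      (contDiff_slice hq' a).contDiffOn l' (mem_univ _)
  rw [this]
  exact iterD_add isOpen_univ (contDiff_iterD_snd_zero hq l').contDiffOn
    (contDiff_iterD_snd_zero hq' l').contDiffOn l (mem_univ _)

lemma jet_const_mul (c : ℝ) (hq : Smooth₂ q) (l l' : List (Fin D)) :
    jet l l' (fun a b => c * q a b) = c * jet l l' q := by
  unfold jet
  have : (fun a => iterD l' (fun b => c * q a b) 0)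
      = fun a => c * iterD l' (fun b => q a b) 0 := by
    ext a
    exact iterD_const_mul c isOpen_univ (contDiff_slice hq a).contDiffOn l' (mem_univ _)
  rw [this]
  exact iterD_const_mul c isOpen_univ (contDiff_iterD_snd_zero hq l').contDiffOn l (mem_univ _)

lemma jet_sub (hq : Smooth₂ q) (hq' : Smooth₂ q') (l l' : List (Fin D)) :
    jet l l' (fun a b => q a b - q' a b) = jet l l' q - jet l l' q' := by
  have h1 : (fun a b => q a b - q' a b) = fun a b => q a b + (-1) * q' a b := by
    ext; ring
  rw [h1, jet_add hq (contDiff_const.mul hq'), jet_const_mul _ hq']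
  ring

lemma jet_zero (l l' : List (Fin D)) : jet l l' (fun _ _ => (0 : ℝ)) = 0 := by
  unfold jet
  simp only [iterD_zero]

lemma jet_sum {ι : Type*} (s : Finset ι) {q : ι → Euc D → Euc D → ℝ}
    (hq : ∀ j ∈ s, Smooth (fun p : Euc₂ D => q j p.1 p.2)) (l l' : List (Fin D)) :
    jet l l' (fun a b => ∑ j ∈ s, q j a b) = ∑ j ∈ s, jet l l' (q j) := by
  classical
  induction s using Finset.induction_on with
  | empty => simpa using jet_zero l l'
  | insert a s ha ih =>
    simp only [sum_insert ha]
    rw [jet_add (hq _ (mem_insert_self _ _))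
      (ContDiff.sum fun j hj => hq j (mem_insert_of_mem hj)),
      ih fun j hj => hq j (mem_insert_of_mem hj)]

lemma jet_mul_separate {f g : Euc D → ℝ} (hf : Smooth f) (hg : Smooth g)
    (l l' : List (Fin D)) : jet l l' (fun a b => f a * g b) = iterD l f 0 * iterD l' g 0 := by
  unfold jet
  have : (fun a => iterD l' (fun b => f a * g b) 0) = fun a => iterD l' g 0 * f a := by
    ext a
    rw [iterD_const_mul (f a) isOpen_univ hg.contDiffOn l' (mem_univ _)]
    ring
  rw [this, iterD_const_mul _ isOpen_univ hf.contDiffOn l (mem_univ _)]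
  ring

lemma jet_eq_jetM (hq : Smooth₂ q) (l l' : List (Fin D)) :
    jet l l' q = jetM (listIdx l, listIdx l') q := by
  unfold jetM jet
  have : (fun a => iterD (idxList (listIdx l')) (fun b => q a b) 0)
      = fun a => iterD l' (fun b => q a b) 0 := by
    ext a
    exact iterD_perm isOpen_univ (contDiff_slice hq a).contDiffOn (idxList_listIdx_perm l')
      (mem_univ _)
  rw [this]
  exact (iterD_perm isOpen_univ (contDiff_iterD_snd_zero hq l').contDiffOn
    (idxList_listIdx_perm l) (mem_univ _)).symm

/-- The polynomial `∑_γ c_γ S^{γ₁}(a) S^{γ₂}(b)` of degree at most `δ` in two points. -/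
def pairPoly (δ : ℕ) (c : MultiIdx₂ D → ℝ) (a b : Euc D) : ℝ :=
  ∑ γ ∈ pairsUpTo D δ, c γ * (taylorFactor γ.1 a 0 * taylorFactor γ.2 b 0)

lemma contDiff_taylorPair (γ : MultiIdx₂ D) :
    Smooth (fun p : Euc₂ D => taylorFactor γ.1 p.1 0 * taylorFactor γ.2 p.2 0) :=
  ((contDiff_taylorFactor γ.1 0).comp contDiff_fst).mul
    ((contDiff_taylorFactor γ.2 0).comp contDiff_snd)

lemma contDiff_pairPoly (δ : ℕ) (c : MultiIdx₂ D → ℝ) :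
    Smooth (fun p : Euc₂ D => pairPoly δ c p.1 p.2) :=
  ContDiff.sum fun γ _ => contDiff_const.mul (contDiff_taylorPair γ)

lemma jetM_pairPoly {δ : ℕ} (c : MultiIdx₂ D → ℝ) {γ : MultiIdx₂ D}
    (hγ : γ ∈ pairsUpTo D δ) : jetM γ (pairPoly δ c) = c γ := by
  unfold jetM pairPoly
  rw [jet_sum _ fun β _ => contDiff_const.mul (contDiff_taylorPair β)]
  rw [Finset.sum_eq_single γ]
  · rw [jet_const_mul _ (contDiff_taylorPair γ), jet_mul_separate (contDiff_taylorFactor _ _)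
      (contDiff_taylorFactor _ _), ← multiD_eq_iterD, ← multiD_eq_iterD,
      multiD_taylorFactor_self, multiD_taylorFactor_self]
    simp
  · intro β _ hβ
    rw [jet_const_mul _ (contDiff_taylorPair β), jet_mul_separate (contDiff_taylorFactor _ _)
      (contDiff_taylorFactor _ _), ← multiD_eq_iterD, ← multiD_eq_iterD,
      multiD_taylorFactor_self, multiD_taylorFactor_self]
    by_cases h1 : γ.1 = β.1
    · have h2 : γ.2 ≠ β.2 := fun h2 => hβ (Prod.ext h1 h2).symm
      simp [h2]
    · simp [h1]
  · exact fun h => absurd hγ h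

/-- Taylor's theorem in two points. -/
lemma exists_bound_sub_pairPoly (δ : ℕ) (hq : Smooth₂ q) :
    ∃ C : ℝ, 0 ≤ C ∧ ∀ p : Euc₂ D, ‖p‖ ≤ 1 →
      |q p.1 p.2 - pairPoly δ (fun γ => jetM γ q) p.1 p.2| ≤ C * ‖p‖ ^ (δ + 1) := by
  have hP := contDiff_pairPoly δ (fun γ => jetM γ q)
  refine exists_bound_of_jet_eq_zero (δ + 1)
    (q := fun a b => q a b - pairPoly δ (fun γ => jetM γ q) a b) (hq.sub hP) fun l l' hl => ?_
  rw [jet_sub hq hP, jet_eq_jetM hq, jet_eq_jetM hP, jetM_pairPoly, sub_self]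
  rw [mem_pairsUpTo]
  simp only [order_listIdx]
  omega

/-- A real polynomial of degree at most `δ` which is `o(ε^δ)` as `ε → 0⁺` vanishes. -/
lemma Polynomial.eq_zero_of_tendsto_div_pow {δ : ℕ} {p : Polynomial ℝ} (hp : p.natDegree ≤ δ)
    (h : Tendsto (fun ε : ℝ => p.eval ε / ε ^ δ) (𝓝[>] 0) (𝓝 0)) : p = 0 := by
  by_contra hne
  obtain ⟨r, hr, hnd⟩ := Polynomial.exists_eq_pow_rootMultiplicity_mul_and_not_dvd p hne 0
  set k := p.rootMultiplicity 0 with hk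
  have hr0 : r.eval 0 ≠ 0 := fun h0 => hnd (Polynomial.dvd_iff_isRoot.2 h0)
  have hkδ : k ≤ δ := by
    have := Polynomial.natDegree_le_of_dvd (Dvd.intro _ hr.symm) hne
    simp only [map_zero, sub_zero, Polynomial.natDegree_X_pow] at this
    omega
  have h1 : Tendsto (fun ε : ℝ => r.eval ε) (𝓝[>] 0) (𝓝 (r.eval 0)) :=
    (r.continuous.tendsto 0).mono_left nhdsWithin_le_nhds
  have h2 : Tendsto (fun ε : ℝ => p.eval ε / ε ^ δ * ε ^ (δ - k)) (𝓝[>] 0) (𝓝 (0 * 0 ^ (δ - k))) :=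
    h.mul (((continuous_pow _).tendsto 0).mono_left nhdsWithin_le_nhds)
  rw [zero_mul] at h2
  refine hr0 (tendsto_nhds_unique (h1.congr' ?_) h2)
  filter_upwards [self_mem_nhdsWithin] with ε hε
  have hε' : (ε : ℝ) ≠ 0 := ne_of_gt hε
  have h3 : p.eval ε = ε ^ k * r.eval ε := by
    conv_lhs => rw [hr]
    simp
  rw [h3]
  have h4 : ε ^ δ = ε ^ k * ε ^ (δ - k) := by rw [← pow_add]; congr 1; omega
  rw [h4]
  field_simp

lemma pairPoly_smul (δ : ℕ) (c : MultiIdx₂ D → ℝ) (ε : ℝ) (a b : Euc D) :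
    pairPoly δ c (ε • a) (ε • b) = ∑ γ ∈ pairsUpTo D δ,
      ε ^ (γ.1.order + γ.2.order) * (c γ * (taylorFactor γ.1 a 0 * taylorFactor γ.2 b 0)) := by
  refine sum_congr rfl fun γ _ => ?_
  rw [taylorFactor_smul, taylorFactor_smul, pow_add]
  ring

lemma pairPoly_eq_of_tendsto {δ : ℕ} {c c' : MultiIdx₂ D → ℝ} {a b a' b' : Euc D}
    (h : Tendsto (fun ε : ℝ => (pairPoly δ c (ε • a) (ε • b) - pairPoly δ c' (ε • a') (ε • b'))
      / ε ^ δ) (𝓝[>] 0) (𝓝 0)) :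
    pairPoly δ c a b = pairPoly δ c' a' b' := by
  set p : Polynomial ℝ := ∑ γ ∈ pairsUpTo D δ,
    C (c γ * (taylorFactor γ.1 a 0 * taylorFactor γ.2 b 0)
        - c' γ * (taylorFactor γ.1 a' 0 * taylorFactor γ.2 b' 0))
      * X ^ (γ.1.order + γ.2.order) with hp
  have he : ∀ ε : ℝ, p.eval ε
      = pairPoly δ c (ε • a) (ε • b) - pairPoly δ c' (ε • a') (ε • b') := by
    intro ε
    rw [pairPoly_smul, pairPoly_smul, hp, eval_finsetSum, ← sum_sub_distrib]
    refine sum_congr rfl fun γ _ => ?_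
    simp
    ring
  have hdeg : p.natDegree ≤ δ := by
    refine Polynomial.natDegree_sum_le_of_forall_le _ _ fun γ hγ => ?_
    exact (Polynomial.natDegree_C_mul_X_pow_le _ _).trans (mem_pairsUpTo.1 hγ)
  have h0 := Polynomial.eq_zero_of_tendsto_div_pow hdeg (by simpa only [he] using h)
  have := he 1
  rw [h0] at this
  simp only [Polynomial.eval_zero, one_smul] at this
  linarith

lemma pairPoly_eq_zero_of_tendsto {δ : ℕ} {c : MultiIdx₂ D → ℝ} {a b : Euc D}
    (h : Tendsto (fun ε : ℝ => pairPoly δ c (ε • a) (ε • b) / ε ^ δ) (𝓝[>] 0) (𝓝 0)) :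
    pairPoly δ c a b = 0 := by
  have h0 : ∀ a b : Euc D, pairPoly δ (fun _ => 0) a b = 0 := fun a b => by simp [pairPoly]
  rw [← h0 a b]
  exact pairPoly_eq_of_tendsto (by simpa only [h0, sub_zero] using h)

/-- Continuous functions of two points which agree off the diagonal agree everywhere. -/
lemma eqOn_of_eqOn_offDiag [NeZero D] {U : Set (Euc₂ D)} (hU : IsOpen U)
    {q q' : Euc₂ D → ℝ} (hq : ContinuousOn q U) (hq' : ContinuousOn q' U)
    (h : ∀ p ∈ U, p.1 ≠ p.2 → q p = q' p) : EqOn q q' U := by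
  rintro ⟨a, b⟩ hp
  by_cases hab : a = b
  · subst hab
    set e : Euc D := 𝐞 0 with he
    have hc : Continuous fun t : ℝ => (a, a + t • e) := by fun_prop
    have ht : Tendsto (fun t : ℝ => (a, a + t • e)) (𝓝[>] 0) (𝓝 (a, a)) := by
      have := (hc.tendsto 0).mono_left (nhdsWithin_le_nhds (s := Ioi 0))
      simpa using this
    have h1 := (hq.continuousAt (hU.mem_nhds hp)).tendsto.comp ht
    have h2 := (hq'.continuousAt (hU.mem_nhds hp)).tendsto.comp ht
    refine tendsto_nhds_unique h1 (h2.congr' ?_)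
    filter_upwards [ht (hU.mem_nhds hp), self_mem_nhdsWithin] with t ht1 ht2
    refine (h _ ht1 ?_).symm
    intro heq
    have h3 : t • e = 0 := by simpa using heq
    have h4 := congrArg (fun x : Euc D => x 0) h3
    simp [he] at h4
    exact (ne_of_gt ht2) h4
  · exact h _ hp hab

lemma pairPoly_eq_zero_of_offDiag [NeZero D] {δ : ℕ} {c : MultiIdx₂ D → ℝ}
    (h : ∀ a b : Euc D, a ≠ b → pairPoly δ c a b = 0) {γ : MultiIdx₂ D}
    (hγ : γ ∈ pairsUpTo D δ) : c γ = 0 := by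
  have h1 : ∀ a b : Euc D, pairPoly δ c a b = 0 := by
    intro a b
    have := eqOn_of_eqOn_offDiag isOpen_univ (q := fun p : Euc₂ D => pairPoly δ c p.1 p.2)
      (q' := fun _ => 0) (contDiff_pairPoly δ c).continuous.continuousOn continuousOn_const
      (fun p _ hp => h p.1 p.2 hp)
    exact this (x := (a, b)) (mem_univ (a, b))
  rw [← jetM_pairPoly c hγ, show pairPoly δ c = fun _ _ => 0 from funext₂ h1]
  exact jet_zero _ _

lemma contDiffAt_of_eventually_zero {E : Type*} [NormedAddCommGroup E] [NormedSpace ℝ E]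
    {f : E → ℝ} {x : E} (h : ∀ᶠ y in 𝓝 x, f y = 0) : ContDiffAt ℝ ∞ f x :=
  contDiffAt_const.congr_of_eventuallyEq h

lemma contDiff_mul_of_eventuallyEq_zero {E : Type*} [NormedAddCommGroup E] [NormedSpace ℝ E]
    {f g : E → ℝ} {U : Set E} (hU : IsOpen U) (hg : Smooth g) (hf : SmoothOn f U)
    (h : ∀ x, x ∉ U → ∀ᶠ y in 𝓝 x, g y = 0) : Smooth (fun y => g y * f y) := by
  rw [contDiff_iff_contDiffAt]
  intro x
  by_cases hx : x ∈ U
  · exact hg.contDiffAt.mul (hf.contDiffAt (hU.mem_nhds hx))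
  · refine ContDiffAt.congr_of_eventuallyEq (f := fun _ => (0 : ℝ)) contDiffAt_const ?_
    filter_upwards [h x hx] with y hy
    rw [hy, zero_mul]

lemma ContDiffBump.eventuallyEq_zero {E : Type*} [NormedAddCommGroup E] [NormedSpace ℝ E]
    [HasContDiffBump E] {x y : E} (b : ContDiffBump x) (hy : b.rOut < dist y x) :
    ∀ᶠ z in 𝓝 y, b z = 0 := by
  have ho : IsOpen {z | b.rOut < dist z x} := isOpen_lt continuous_const (by fun_prop)
  filter_upwards [ho.mem_nhds hy] with z hz using b.zero_of_le_dist (le_of_lt hz)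

/-- A function which is smooth near a point agrees near that point with a globally smooth one. -/
lemma exists_contDiff_eventuallyEq {E : Type*} [NormedAddCommGroup E] [NormedSpace ℝ E]
    [FiniteDimensional ℝ E] {f : E → ℝ} {U : Set E} (hU : IsOpen U) (hf : SmoothOn f U)
    {x : E} (hx : x ∈ U) : ∃ g : E → ℝ, Smooth g ∧ g =ᶠ[𝓝 x] f := by
  obtain ⟨r, hr, hrU⟩ := Metric.isOpen_iff.1 hU x hx
  let η : ContDiffBump x := ⟨r / 4, r / 2, by positivity, by linarith⟩
  refine ⟨fun y => η y * f y, contDiff_mul_of_eventuallyEq_zero hU η.contDiff hf fun y hy =>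
    η.eventuallyEq_zero (show r / 2 < dist y x from ?_), ?_⟩
  · by_contra hlt
    exact hy (hrU (Metric.mem_ball.2 (by linarith)))
  · filter_upwards [η.eventuallyEq_one] with y hy
    rw [hy, Pi.one_apply, one_mul]

end TaylorPair

/-! ### Integrals depending on parameters -/

section ParamIntegral

variable {P G : Type*} [NormedAddCommGroup P] [NormedSpace ℝ P] [NormedAddCommGroup G]
  [NormedSpace ℝ G]

lemma convolution_neg_eq_integral {G : Type*} [NormedAddCommGroup G] [MeasurableSpace G]
    {ν : Measure G} (f : G → ℝ) (Φ : G → ℝ) :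
    convolution f (fun t => Φ (-t)) (ContinuousLinearMap.mul ℝ ℝ) ν 0 = ∫ u, f u * Φ u ∂ν := by
  simp [convolution]

lemma contDiffOn_comp_neg_snd {Φ : P → G → ℝ} {s : Set P} {n : ℕ∞ω}
    (hΦ : ContDiffOn ℝ n (fun q : P × G => Φ q.1 q.2) (s ×ˢ univ)) :
    ContDiffOn ℝ n (uncurry fun p t => Φ p (-t)) (s ×ˢ univ) := by
  have h : ContDiffOn ℝ n (fun q : P × G => (q.1, -q.2)) (s ×ˢ univ) :=
    (contDiff_fst.prodMk contDiff_snd.neg).contDiffOn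
  exact hΦ.comp h fun q hq => ⟨hq.1, mem_univ _⟩

lemma contDiffOn_iterD_fst {D : ℕ} {Φ : Euc D → G → ℝ} {s : Set (Euc D)} (hs : IsOpen s)
    (hΦ : SmoothOn₂ Φ (s ×ˢ univ)) (l : List (Fin D)) :
    SmoothOn (fun q : Euc D × G => iterD l (fun x => Φ x q.2) q.1) (s ×ˢ univ) := by
  have hsw : SmoothOn (fun q : G × Euc D => Φ q.2 q.1) (univ ×ˢ s) :=
    hΦ.comp (contDiff_snd.prodMk contDiff_fst).contDiffOn fun q hq => ⟨hq.2, hq.1⟩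
  have := contDiffOn_iterD_param (Ψ := fun u x => Φ x u) (isOpen_univ.prod hs) hsw l
  exact this.comp (contDiff_snd.prodMk contDiff_fst).contDiffOn fun q hq => ⟨hq.2, hq.1⟩

variable [MeasurableSpace G] [BorelSpace G] {ν : Measure G}

/-- An integral of a locally integrable function against a smooth family of compactly supported
functions is smooth in the parameter. -/
lemma contDiffOn_integral_param {f : G → ℝ} (hf : LocallyIntegrable f ν) {Φ : P → G → ℝ}
    {s : Set P} (hs : IsOpen s) {k : Set G} (hk : IsCompact k)
    (hΦk : ∀ p ∈ s, ∀ u, u ∉ k → Φ p u = 0) (hΦ : SmoothOn₂ Φ (s ×ˢ univ)) :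
    SmoothOn (fun p => ∫ u, f u * Φ p u ∂ν) s := by
  have := contDiffOn_convolution_right_with_param_comp (μ := ν) (n := ⊤)
    (ContinuousLinearMap.mul ℝ ℝ) (s := s) (v := fun _ => (0 : G)) contDiffOn_const (f := f)
    (g := fun p t => Φ p (-t)) (k := -k) hs hk.neg
    (fun p x hp hx => hΦk p hp _ (by simpa using hx)) hf (contDiffOn_comp_neg_snd hΦ)
  exact this.congr fun p _ => (convolution_neg_eq_integral f (Φ p)).symm

/-- Differentiation under the integral sign. -/
lemma hasFDerivAt_integral_param {f : G → ℝ} (hf : LocallyIntegrable f ν) {Φ : P → G → ℝ}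
    {s : Set P} (hs : IsOpen s) {k : Set G} (hk : IsCompact k)
    (hΦk : ∀ p ∈ s, ∀ u, u ∉ k → Φ p u = 0) (hΦ : SmoothOn₂ Φ (s ×ˢ univ)) {p₀ : P} (hp₀ : p₀ ∈ s)
    (v : P) :
    fderiv ℝ (fun p => ∫ u, f u * Φ p u ∂ν) p₀ v
      = ∫ u, f u * fderiv ℝ (fun p => Φ p u) p₀ v ∂ν := by
  have hopen : IsOpen (s ×ˢ (univ : Set G)) := hs.prod isOpen_univ
  have hg := contDiffOn_comp_neg_snd hΦ
  set g : P → G → ℝ := fun p t => Φ p (-t) with hgdef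
  have hgk : ∀ p, ∀ x, p ∈ s → x ∉ -k → g p x = 0 := fun p x hp hx =>
    hΦk p hp _ (by simpa using hx)
  have h := hasFDerivAt_convolution_right_with_param (μ := ν) (ContinuousLinearMap.mul ℝ ℝ)
    (f := f) (g := g) (s := s) (k := -k) hs hk.neg hgk hf
    (hg.of_le (by simp)) (p₀, 0) hp₀
  have h2 := (HasFDerivAt.comp (f := fun p : P => (p, (0 : G))) p₀ h
    (hasFDerivAt_prodMk_left p₀ 0)).fderiv
  have e1 : (fun p => ∫ u, f u * Φ p u ∂ν)
      = (fun q : P × G => convolution f (g q.1) (ContinuousLinearMap.mul ℝ ℝ) ν q.2)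
        ∘ fun p => (p, (0 : G)) := by
    ext p
    exact (convolution_neg_eq_integral f (Φ p)).symm
  rw [e1, h2]
  have hdiff : ∀ x, DifferentiableAt ℝ (uncurry g) (p₀, x) := fun x =>
    hg.differentiableAt_of_isOpen hopen ⟨hp₀, mem_univ _⟩
  have hcont : Continuous fun x => fderiv ℝ (uncurry g) (p₀, x) := by
    have h3 := (hg.fderiv_of_isOpen hopen (m := ∞) (by simp)).continuousOn
    have h4 : Continuous fun x : G => (p₀, x) := by fun_prop
    rw [← continuousOn_univ] at h4 ⊢
    exact h3.comp h4 fun x _ => ⟨hp₀, mem_univ _⟩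
  have hcs : HasCompactSupport fun x => fderiv ℝ (uncurry g) (p₀, x) := by
    refine .intro hk.neg fun x hx => ?_
    have : uncurry g =ᶠ[𝓝 (p₀, x)] fun _ => 0 := by
      have hc : IsOpen (s ×ˢ (-k)ᶜ) := hs.prod hk.neg.isClosed.isOpen_compl
      filter_upwards [hc.mem_nhds ⟨hp₀, hx⟩] with q hq
      exact hgk _ _ hq.1 hq.2
    rw [this.fderiv_eq]
    simp
  change (convolution f (fun x => fderiv ℝ (uncurry g) (p₀, x))
    ((ContinuousLinearMap.mul ℝ ℝ).precompR (P × G)) ν 0) (v, 0) = _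
  rw [convolution_precompR_apply _ hf hcs hcont]
  simp only [convolution, ContinuousLinearMap.mul_apply']
  refine integral_congr_fun fun u => ?_
  congr 1
  have h5 := (HasFDerivAt.comp (f := fun p : P => (p, (0 : G) - u)) p₀
    (hdiff (0 - u)).hasFDerivAt (hasFDerivAt_prodMk_left p₀ (0 - u))).fderiv
  have e2 : (uncurry g) ∘ (fun p : P => (p, (0 : G) - u)) = fun p => Φ p u := by
    ext p
    simp [hgdef]
  rw [e2] at h5
  rw [h5]
  simp

lemma hasDerivAt_integral_param {f : G → ℝ} (hf : LocallyIntegrable f ν) {Φ : ℝ → G → ℝ}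
    {s : Set ℝ} (hs : IsOpen s) {k : Set G} (hk : IsCompact k)
    (hΦk : ∀ p ∈ s, ∀ u, u ∉ k → Φ p u = 0) (hΦ : SmoothOn₂ Φ (s ×ˢ univ)) {p₀ : ℝ} (hp₀ : p₀ ∈ s) :
    HasDerivAt (fun p => ∫ u, f u * Φ p u ∂ν) (∫ u, f u * deriv (fun p => Φ p u) p₀ ∂ν) p₀ := by
  have h1 := (contDiffOn_integral_param hf hs hk hΦk hΦ).differentiableAt_of_isOpen hs hp₀
  have h2 := hasFDerivAt_integral_param hf hs hk hΦk hΦ hp₀ 1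
  simp only [fderiv_apply_one_eq_deriv] at h2
  rw [← h2]
  exact h1.hasDerivAt

lemma iterD_integral_param {D : ℕ} {f : G → ℝ} (hf : LocallyIntegrable f ν) {Φ : Euc D → G → ℝ}
    {s : Set (Euc D)} (hs : IsOpen s) {k : Set G} (hk : IsCompact k)
    (hΦk : ∀ p ∈ s, ∀ u, u ∉ k → Φ p u = 0) (hΦ : SmoothOn₂ Φ (s ×ˢ univ)) (l : List (Fin D)) :
    EqOn (iterD l fun p => ∫ u, f u * Φ p u ∂ν)
      (fun p => ∫ u, f u * iterD l (fun p => Φ p u) p ∂ν) s := by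
  induction l with
  | nil => exact fun x _ => rfl
  | cons i l ih =>
    intro x hx
    rw [iterD_cons, partialD_congr hs ih i hx]
    refine hasFDerivAt_integral_param (Φ := fun p u => iterD l (fun p => Φ p u) p) hf hs hk ?_
      (contDiffOn_iterD_fst hs hΦ l) hx _
    intro p hp u hu
    rw [iterD_congr hs (g := fun _ => 0) (fun q hq => hΦk q hq u hu) l hp, iterD_zero]

end ParamIntegral

/-! ### The Klein–Gordon operator -/

section KleinGordon

variable {D : ℕ} {f g : Euc D → ℝ} {U : Set (Euc D)} {x : Euc D} {u v : Euc D → ℝ}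

/-- The operator `K = -∂² + μ`. -/
def kg (μ : ℝ) (f : Euc D → ℝ) : Euc D → ℝ :=
  fun x => -(Laplacian.laplacian f x) + μ * f x

lemma laplacian_eq_sum (hU : IsOpen U) (hf : SmoothOn f U) (hx : x ∈ U) :
    Laplacian.laplacian f x = ∑ i, partialD i (partialD i f) x := by
  rw [InnerProductSpace.laplacian_eq_iteratedFDeriv_orthonormalBasis f
    (EuclideanSpace.basisFun (Fin D) ℝ)]
  refine sum_congr rfl fun i _ => ?_
  rw [iteratedFDeriv_two_apply]
  have hd : DifferentiableAt ℝ (fderiv ℝ f) x :=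
    (hf.fderiv_of_isOpen hU (m := ∞) (by simp)).differentiableAt_of_isOpen hU hx
  unfold partialD
  have := (hd.hasFDerivAt.clm_apply
      (hasFDerivAt_const (𝐞 i : Euc D) x)).fderiv
  rw [this]
  simp

lemma kg_eq (hU : IsOpen U) (hf : SmoothOn f U) (hx : x ∈ U) (μ : ℝ) :
    kg μ f x = -(∑ i, iterD [i, i] f x) + μ * f x := by
  rw [kg, laplacian_eq_sum hU hf hx]
  rfl

lemma kg_congr_nhds (h : f =ᶠ[𝓝 x] g) (μ : ℝ) :
    kg μ f x = kg μ g x := by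
  unfold kg
  rw [(InnerProductSpace.laplacian_congr_nhds h).eq_of_nhds, h.eq_of_nhds]

lemma kg_sub (hU : IsOpen U) (hf : SmoothOn f U) (hg : SmoothOn g U) (hx : x ∈ U) (μ : ℝ) :
    kg μ (fun x => f x - g x) x = kg μ f x - kg μ g x := by
  rw [kg_eq hU hf hx, kg_eq hU hg hx, kg_eq hU (hf.sub hg) hx]
  simp only [iterD_sub hU hf hg _ hx, sum_sub_distrib]
  ring

lemma kg_zero (μ : ℝ) (x : Euc D) : kg μ (fun _ => 0) x = 0 := by
  rw [kg_eq isOpen_univ contDiffOn_const (mem_univ x)]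
  simp [iterD_zero, -iterD_cons]

lemma kg_comp_add (hU : IsOpen U) (hf : SmoothOn f U) (a : Euc D) (hx : x + a ∈ U) (μ : ℝ) :
    kg μ (fun x => f (x + a)) x = kg μ f (x + a) := by
  have hV : IsOpen ((fun x : Euc D => x + a) ⁻¹' U) := hU.preimage (by fun_prop)
  have hf' : SmoothOn (fun x => f (x + a)) ((fun x : Euc D => x + a) ⁻¹' U) :=
    hf.comp (by fun_prop) fun y hy => hy
  rw [kg_eq hU hf hx, kg_eq hV hf' hx]
  simp only [iterD_comp_add]

lemma contDiffOn_kg_param {P : Type*} [NormedAddCommGroup P] [NormedSpace ℝ P] {m : P → ℝ}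
    {Ψ : P → Euc D → ℝ} {O : Set (P × Euc D)} (hO : IsOpen O) (hm : Smooth m) (h : SmoothOn₂ Ψ O) :
    SmoothOn (fun q : P × Euc D => kg (m q.1) (Ψ q.1) q.2) O := by
  have h1 : SmoothOn (fun q : P × Euc D =>
      -(∑ i, iterD [i, i] (Ψ q.1) q.2) + m q.1 * Ψ q.1 q.2) O :=
    (ContDiffOn.sum fun i _ => contDiffOn_iterD_param hO h [i, i]).neg.add
      ((hm.comp contDiff_fst).contDiffOn.mul h)
  refine h1.congr ?_
  rintro ⟨p, x⟩ hq
  have hU : IsOpen {y : Euc D | (p, y) ∈ O} := hO.preimage (by fun_prop)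
  exact kg_eq hU (f := Ψ p) (h.comp (contDiff_const.prodMk contDiff_id).contDiffOn fun y hy => hy)
    hq _

lemma contDiffOn_kg (hU : IsOpen U) (hf : SmoothOn f U) (μ : ℝ) : SmoothOn (kg μ f) U := by
  have h1 : SmoothOn (fun x => -(∑ i, iterD [i, i] f x) + μ * f x) U :=
    (ContDiffOn.sum fun i _ => hf.iterD hU [i, i]).neg.add (contDiffOn_const.mul hf)
  exact h1.congr fun x hx => kg_eq hU hf hx μ

lemma contDiff_kg (hf : Smooth f) (μ : ℝ) : Smooth (kg μ f) := by
  rw [← contDiffOn_univ] at *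
  exact contDiffOn_kg isOpen_univ hf μ

lemma kg_eq_zero_of_notMem_tsupport (hx : x ∉ tsupport f) (μ : ℝ) :
    kg μ f x = 0 := by
  rw [kg_congr_nhds (g := fun _ => 0) (notMem_tsupport_iff_eventuallyEq.1 hx), kg_zero]

lemma hasCompactSupport_kg (hf : HasCompactSupport f) (μ : ℝ) : HasCompactSupport (kg μ f) :=
  .intro hf fun _ hx => kg_eq_zero_of_notMem_tsupport hx μ

lemma integral_mul_partialD (hu : Smooth u) (hv : Smooth v)
    (hc : HasCompactSupport u ∨ HasCompactSupport v) (i : Fin D) :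
    ∫ x, u x * partialD i v x = -∫ x, partialD i u x * v x := by
  have hu' : Smooth (partialD i u) := hu.iterD [i]
  have hv' : Smooth (partialD i v) := hv.iterD [i]
  have hcd : ∀ {f : Euc D → ℝ}, HasCompactSupport f → HasCompactSupport (partialD i f) :=
    fun hf => hf.fderiv_apply (𝕜 := ℝ) _
  refine integral_mul_fderiv_eq_neg_fderiv_mul_of_integrable ?_ ?_ ?_
    (fun x _ => hu.differentiable (by simp) x) (fun x _ => hv.differentiable (by simp) x)
  · refine (hu'.continuous.mul hv.continuous).integrable_of_hasCompactSupport ?_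
    exact hc.elim (fun h => (hcd h).mul_right) (fun h => h.mul_left)
  · refine (hu.continuous.mul hv'.continuous).integrable_of_hasCompactSupport ?_
    exact hc.elim (fun h => h.mul_right) (fun h => (hcd h).mul_left)
  · refine (hu.continuous.mul hv.continuous).integrable_of_hasCompactSupport ?_
    exact hc.elim (fun h => h.mul_right) (fun h => h.mul_left)

/-- Green's identity: `K` is symmetric. -/
lemma integral_mul_kg (hu : Smooth u) (hv : Smooth v)
    (hc : HasCompactSupport u ∨ HasCompactSupport v) (μ : ℝ) :
    ∫ x, u x * kg μ v x = ∫ x, kg μ u x * v x := by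
  have hcd : ∀ {f : Euc D → ℝ} (i : Fin D), HasCompactSupport f →
      HasCompactSupport (partialD i f) :=
    fun i hf => hf.fderiv_apply (𝕜 := ℝ) _
  have hint : ∀ (u v : Euc D → ℝ), Smooth u → Smooth v →
      (HasCompactSupport u ∨ HasCompactSupport v) → Integrable fun x => u x * v x := by
    intro u v hu hv hc
    exact (hu.continuous.mul hv.continuous).integrable_of_hasCompactSupport
      (hc.elim (fun h => h.mul_right) (fun h => h.mul_left))
  have h1 : ∀ i : Fin D, ∫ x, u x * iterD [i, i] v x = ∫ x, iterD [i, i] u x * v x := by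
    intro i
    simp only [iterD_cons, iterD_nil]
    rw [integral_mul_partialD (v := partialD i v) hu (hv.iterD [i]) (hc.imp id (hcd i)),
      integral_mul_partialD (u := partialD i u) (hu.iterD [i]) hv (hc.imp (hcd i) id), neg_neg]
  have e1 : ∀ x, u x * kg μ v x = -(∑ i, u x * iterD [i, i] v x) + μ * (u x * v x) := by
    intro x
    rw [kg_eq isOpen_univ hv.contDiffOn (mem_univ x), ← mul_sum]
    ring
  have e2 : ∀ x, kg μ u x * v x = -(∑ i, iterD [i, i] u x * v x) + μ * (u x * v x) := by
    intro x
    rw [kg_eq isOpen_univ hu.contDiffOn (mem_univ x), ← sum_mul]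
    ring
  have i1 : ∀ i : Fin D, Integrable fun x => u x * iterD [i, i] v x := fun i =>
    hint _ _ hu (hv.iterD _) (hc.imp id fun h => hcd i (hcd i h))
  have i2 : ∀ i : Fin D, Integrable fun x => iterD [i, i] u x * v x := fun i =>
    hint _ _ (hu.iterD _) hv (hc.imp (fun h => hcd i (hcd i h)) id)
  have i3 : Integrable fun x => μ * (u x * v x) := (hint _ _ hu hv hc).const_mul μ
  have j1 : Integrable fun x => -(∑ i, u x * iterD [i, i] v x) :=
    (integrable_finsetSum _ fun i _ => i1 i).neg
  have j2 : Integrable fun x => -(∑ i, iterD [i, i] u x * v x) :=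
    (integrable_finsetSum _ fun i _ => i2 i).neg
  simp only [e1, e2]
  rw [integral_add j1 i3, integral_add j2 i3, integral_neg, integral_neg,
    integral_finsetSum _ fun i _ => i1 i, integral_finsetSum _ fun i _ => i2 i]
  simp only [h1]

end KleinGordon

/-! ### Green's representation formula -/

section Green

variable {D : ℕ} {f g F ψ s : Euc D → ℝ} {U : Set (Euc D)} {μ : ℝ} {x : Euc D}

lemma continuous_mul_of_eventuallyEq_zero (hU : IsOpen U)
    (hg : Continuous g) (hf : ContinuousOn f U) (h : ∀ x, x ∉ U → ∀ᶠ y in 𝓝 x, g y = 0) :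
    Continuous (fun y => f y * g y) := continuous_iff_continuousAt.2 fun x => by
  by_cases hx : x ∈ U
  · exact (hf.continuousAt (hU.mem_nhds hx)).mul hg.continuousAt
  · exact (continuousAt_const (y := (0 : ℝ))).congr_of_eventuallyEq
      ((h x hx).mono fun y hy => by simp only [hy, mul_zero])

lemma integrable_mul_kg (hF : LocallyIntegrable F) (hψ : Smooth ψ)
    (hc : HasCompactSupport ψ) (μ : ℝ) : Integrable fun x => F x * kg μ ψ x := by
  simpa only [smul_eq_mul] using hF.integrable_smul_right_of_hasCompactSupport
    (contDiff_kg hψ μ).continuous (hasCompactSupport_kg hc μ)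

lemma integrable_mul_of_compact (hF : LocallyIntegrable F) (hψ : Continuous ψ)
    (hc : HasCompactSupport ψ) : Integrable fun x => F x * ψ x := by
  have := hF.integrable_smul_right_of_hasCompactSupport hψ hc
  simpa only [smul_eq_mul] using this

/-- A weak solution of `K F = s` which is smooth on an open set solves the equation pointwise
there. -/
lemma kg_eq_of_weak (hU : IsOpen U) (hF : SmoothOn F U) (hs : ContinuousOn s U)
    (h : ∀ ψ : Euc D → ℝ, Smooth ψ → HasCompactSupport ψ → tsupport ψ ⊆ U →
      ∫ x, F x * kg μ ψ x = ∫ x, s x * ψ x) (hx : x ∈ U) : kg μ F x = s x := by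
  obtain ⟨G, hG, hGF⟩ := exists_contDiff_eventuallyEq hU hF hx
  obtain ⟨W, hW, hWo, hxW⟩ := mem_nhds_iff.1 hGF
  set V := W ∩ U with hV
  have hVo : IsOpen V := hWo.inter hU
  have hxV : x ∈ V := ⟨hxW, hx⟩
  have hGV : ∀ y ∈ V, G y = F y := fun y hy => hW hy.1
  have hsV : ContinuousOn s V := hs.mono Set.inter_subset_right
  have hKG : Continuous (kg μ G) := (contDiff_kg hG μ).continuous
  have key : ∀ᵐ y, y ∈ V → kg μ G y - s y = 0 := by
    refine hVo.ae_eq_zero_of_integral_contDiff_smul_eq_zero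
      ((hKG.continuousOn.sub hsV).locallyIntegrableOn hVo.measurableSet) ?_
    intro ψ hψ hψc hψV
    have h1 : ∫ y, F y * kg μ ψ y = ∫ y, G y * kg μ ψ y := by
      refine integral_congr_fun fun y => ?_
      by_cases hy : y ∈ tsupport ψ
      · simp only [hGV y (hψV hy)]
      · simp only [kg_eq_zero_of_notMem_tsupport hy, mul_zero]
    have h2 := h ψ hψ hψc (hψV.trans Set.inter_subset_right)
    rw [h1, integral_mul_kg hG hψ (Or.inr hψc)] at h2
    have i1 : Integrable fun y => kg μ G y * ψ y :=
      (hKG.mul hψ.continuous).integrable_of_hasCompactSupport hψc.mul_left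
    have i2 : Integrable fun y => s y * ψ y :=
      (continuous_mul_of_eventuallyEq_zero hVo hψ.continuous hsV fun y hy =>
        notMem_tsupport_iff_eventuallyEq.1 fun h => hy (hψV h)).integrable_of_hasCompactSupport
        hψc.mul_left
    have h3 : ∀ y, ψ y • (kg μ G y - s y) = kg μ G y * ψ y - s y * ψ y := fun y => by
      rw [smul_eq_mul]; ring
    simp only [h3]
    rw [integral_sub i1 i2, h2, sub_self]
  have hae : kg μ G =ᵐ[volume.restrict V] s := by
    rw [EventuallyEq, ae_restrict_iff' hVo.measurableSet]
    filter_upwards [key] with y hy hyV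
    exact sub_eq_zero.1 (hy hyV)
  have := Measure.eqOn_open_of_ae_eq hae hVo hKG.continuousOn hsV hxV
  rw [← this]
  exact kg_congr_nhds (hGF.symm) μ

lemma integral_add_eq {p q r : Euc D → ℝ} (hp : Integrable p) (hq : Integrable q)
    (h : ∀ y, p y + q y = r y) : (∫ y, p y) + ∫ y, q y = ∫ y, r y := by
  rw [← integral_add hp hq]
  exact integral_congr_fun h

lemma ae_ne_point [NeZero D] (x : Euc D) : ∀ᵐ y : Euc D, y ≠ x := by
  have : Nontrivial (Euc D) := inferInstance
  exact (Set.finite_singleton x).measure_zero volume |> measure_eq_zero_iff_ae_notMem.1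

lemma contDiff_mul_of_compl_singleton (hg : Smooth g)
    (hf : SmoothOn f {x}ᶜ) (h : ∀ᶠ y in 𝓝 x, g y = 0) : Smooth (fun y => g y * f y) :=
  contDiff_mul_of_eventuallyEq_zero isOpen_compl_singleton hg hf fun y hy => by
    rwa [Set.notMem_compl_iff.1 hy]

/-- **Green's representation formula.** Let `A` be a compactly supported fundamental solution with
pole `x₁` up to the smooth error `k`, and let `F` be a weak solution of `K F = s`, smooth away from
`x₂ ≠ x₁`. Then `F(x₁) + ∫ k F = ∫ A s`. Split `A = ηA + (1 - η)A` near `x₁`: the first part sees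
`F` only where it agrees with the test function `ρF`, and the second is itself a test function. -/
theorem green_representation [NeZero D] {A k : Euc D → ℝ} {x₁ x₂ : Euc D} (hx : x₁ ≠ x₂)
    (hA : SmoothOn A {x₁}ᶜ) (hAc : HasCompactSupport A) (hAi : LocallyIntegrable A)
    (hk : Continuous k) (hkc : HasCompactSupport k)
    (hAd : ∀ ψ : Euc D → ℝ, Smooth ψ → HasCompactSupport ψ →
      ∫ x, A x * kg μ ψ x = ψ x₁ + ∫ x, k x * ψ x)
    (hAp : ∀ y, y ≠ x₁ → kg μ A y = k y)
    (hF : SmoothOn F {x₂}ᶜ) (hFi : LocallyIntegrable F) (hsi : LocallyIntegrable s)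
    (hFd : ∀ ψ : Euc D → ℝ, Smooth ψ → HasCompactSupport ψ →
      ∫ x, F x * kg μ ψ x = ∫ x, s x * ψ x)
    (hFp : ∀ y, y ≠ x₂ → kg μ F y = s y) :
    F x₁ + ∫ y, k y * F y = ∫ y, A y * s y := by
  set d := dist x₁ x₂ with hd
  have hdpos : 0 < d := dist_pos.2 hx
  let ρ : ContDiffBump x₁ := ⟨d / 2, 3 * d / 4, by positivity, by linarith⟩
  let η : ContDiffBump x₁ := ⟨d / 8, d / 4, by positivity, by linarith⟩
  set ψ : Euc D → ℝ := fun y => ρ y * F y with hψ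
  set B : Euc D → ℝ := fun y => (1 - η y) * A y with hB
  have hψs : Smooth ψ := contDiff_mul_of_compl_singleton ρ.contDiff hF
    (ρ.eventuallyEq_zero (show 3 * d / 4 < _ by rw [dist_comm, ← hd]; linarith))
  have hψc : HasCompactSupport ψ := ρ.hasCompactSupport.mul_right
  have hBs : Smooth B := contDiff_mul_of_compl_singleton (contDiff_const.sub η.contDiff) hA
    (η.eventuallyEq_one.mono fun z hz => by simp [hz])
  have hBc : HasCompactSupport B := hAc.mul_left
  have hψF : ∀ {y}, dist y x₁ < d / 2 → ψ =ᶠ[𝓝 y] F := fun hy =>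
    (ρ.eventuallyEq_one_of_mem_ball hy).mono fun z hz => by
      simp only [hψ, hz, Pi.one_apply, one_mul]
  -- on the support of `η` the function `ψ` solves the equation
  have h1 : ∀ᵐ y : Euc D, A y * s y + B y * kg μ ψ y = A y * kg μ ψ y + s y * B y := by
    filter_upwards [ae_ne_point x₂] with y hy
    rcases le_or_gt (d / 4) (dist y x₁) with h | h
    · simp only [hB, η.zero_of_le_dist h]
      ring
    · rw [kg_congr_nhds (hψF (h.trans (by linarith))), hFp y hy]
      ring
  have h2 : ∀ y, k y * F y + kg μ B y * ψ y = F y * kg μ B y + k y * ψ y := fun y => by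
    rcases lt_or_ge (dist y x₁) (d / 2) with h | h
    · rw [(hψF h).eq_of_nhds]
      ring
    · have e : B =ᶠ[𝓝 y] A := (η.eventuallyEq_zero (show d / 4 < _ by linarith)).mono fun z hz => by
        simp only [hB, hz, sub_zero, one_mul]
      rw [kg_congr_nhds e, hAp y (fun h' => by rw [h', dist_self] at h; linarith)]
      ring
  have I : Integrable fun y => A y * kg μ ψ y := integrable_mul_kg hAi hψs hψc μ
  have I' : Integrable fun y => s y * B y := integrable_mul_of_compact hsi hBs.continuous hBc
  have J : Integrable fun y => B y * kg μ ψ y :=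
    integrable_mul_kg hBs.continuous.locallyIntegrable hψs hψc μ
  have K : Integrable fun y => k y * F y :=
    (integrable_mul_of_compact hFi hk hkc).congr (.of_forall fun y => mul_comm _ _)
  have K' : Integrable fun y => k y * ψ y :=
    (hk.mul hψs.continuous).integrable_of_hasCompactSupport hkc.mul_right
  have M : Integrable fun y => F y * kg μ B y := integrable_mul_kg hFi hBs hBc μ
  have M' : Integrable fun y => kg μ B y * ψ y :=
    ((contDiff_kg hBs μ).continuous.mul hψs.continuous).integrable_of_hasCompactSupport hψc.mul_left
  have N : Integrable fun y => A y * s y :=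
    ((I.add I').sub J).congr (h1.mono fun y hy => (eq_sub_of_add_eq hy).symm)
  have e1 := integral_congr_ae h1
  have e2 := integral_congr_ae (μ := volume) (.of_forall h2)
  rw [integral_add N J, integral_add I I', hAd ψ hψs hψc, integral_mul_kg hBs hψs (Or.inr hψc) μ,
    ← hFd B hBs hBc] at e1
  rw [integral_add K M', integral_add M K'] at e2
  have e3 : ψ x₁ = F x₁ := (hψF (by rw [dist_self]; linarith)).eq_of_nhds
  linarith

/-! ### Local integrability of the singular kernels -/

lemma locallyIntegrable_fun_norm [NeZero D] {g : ℝ → ℝ}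
    (hg : ∀ R : ℝ, IntegrableOn (fun r => r ^ (D - 1) * g r) (Set.Ioc 0 R)) :
    LocallyIntegrable (fun x : Euc D => g ‖x‖) := by
  have : Nontrivial (Euc D) := inferInstance
  rw [locallyIntegrable_iff]
  intro k hk
  obtain ⟨R, hR⟩ := hk.isBounded.subset_closedBall 0
  have h1 : Integrable (fun x : Euc D => (Iic R).indicator g ‖x‖) := by
    rw [integrable_fun_norm_addHaar volume (f := (Iic R).indicator g)]
    rw [finrank_euclideanSpace_fin]
    have h2 : (fun y : ℝ => y ^ (D - 1) • (Iic R).indicator g y)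
        = (Iic R).indicator fun y => y ^ (D - 1) * g y := by
      ext y
      by_cases hy : y ∈ Iic R <;> simp [hy]
    rw [h2, integrableOn_indicator_iff measurableSet_Iic, Set.inter_comm, Set.Ioi_inter_Iic]
    exact hg R
  have h3 : IntegrableOn (fun x : Euc D => g ‖x‖) (closedBall 0 R) := by
    refine h1.integrableOn.congr_fun (fun x hx => ?_) measurableSet_closedBall
    have : ‖x‖ ∈ Iic R := by simpa using hx
    simp [this]
  exact h3.mono_set hR

/-- The leading singularity `|u|^{-(D-2)}`. -/
def singA (D : ℕ) (u : Euc D) : ℝ := (‖u‖ ^ (D - 2))⁻¹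

/-- The logarithmic singularity `|u|^{-(D-2)} log |u|²`. -/
def singB (D : ℕ) (u : Euc D) : ℝ := (‖u‖ ^ (D - 2))⁻¹ * log (‖u‖ ^ 2)

lemma pow_mul_inv_pow {D : ℕ} (hD : 2 ≤ D) {r : ℝ} (hr : 0 < r) :
    r ^ (D - 1) * (r ^ (D - 2))⁻¹ = r := by
  have : D - 1 = (D - 2) + 1 := by omega
  rw [this, pow_succ]
  field_simp

lemma locallyIntegrable_singA (hD : 2 ≤ D) : LocallyIntegrable (singA D) := by
  have : NeZero D := ⟨by omega⟩
  refine locallyIntegrable_fun_norm (g := fun r => (r ^ (D - 2))⁻¹) fun R => ?_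
  refine (continuous_id.integrableOn_Ioc (a := 0) (b := R)).congr_fun (fun r hr => ?_)
    measurableSet_Ioc
  exact (pow_mul_inv_pow hD hr.1).symm

lemma locallyIntegrable_singB (hD : 2 ≤ D) : LocallyIntegrable (singB D) := by
  have : NeZero D := ⟨by omega⟩
  refine locallyIntegrable_fun_norm (g := fun r => (r ^ (D - 2))⁻¹ * log (r ^ 2)) fun R => ?_
  have hc : Continuous fun r : ℝ => 2 * (r * log r) :=
    continuous_const.mul Real.continuous_mul_log
  refine (hc.integrableOn_Ioc (a := 0) (b := R)).congr_fun (fun r hr => ?_) measurableSet_Ioc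
  simp only
  rw [← mul_assoc (r ^ (D - 1)), pow_mul_inv_pow hD hr.1, log_pow]
  push_cast
  ring

end Green

/-! ### Radial kernels with a Hadamard singularity -/

section Kernels

variable {D : ℕ} {a b : ℝ → Euc D → ℝ} {μ : ℝ} {φ ψ : Euc D → ℝ} {e v : ℝ → ℝ}

/-- The kernel `|u|^{-(D-2)} (a(μ,u) - b(μ,u) log |u|²)`. -/
def singKer (a b : ℝ → Euc D → ℝ) (μ : ℝ) (u : Euc D) : ℝ :=
  singA D u * a μ u - singB D u * b μ u

/-- The radial kernel `|u|^{-(D-2)} (e(μ|u|²) - v(μ|u|²) log |u|²)`. -/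
def hadKer (D : ℕ) (e v : ℝ → ℝ) : ℝ → Euc D → ℝ :=
  singKer (fun μ u => e (μ * ‖u‖ ^ 2)) (fun μ u => v (μ * ‖u‖ ^ 2))

/-- The `μ`-derivative of `hadKer D e v`. -/
def dhadKer (D : ℕ) (e v : ℝ → ℝ) : ℝ → Euc D → ℝ :=
  singKer (fun μ u => ‖u‖ ^ 2 * deriv e (μ * ‖u‖ ^ 2)) (fun μ u => ‖u‖ ^ 2 * deriv v (μ * ‖u‖ ^ 2))

lemma contDiffOn_norm_pow (n : ℕ) : SmoothOn (fun u : Euc D => ‖u‖ ^ n) {0}ᶜ :=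
  fun _ hu => ((contDiffAt_norm ℝ hu).pow n).contDiffWithinAt

lemma contDiffOn_singA : SmoothOn (singA D) {0}ᶜ :=
  (contDiffOn_norm_pow _).inv fun _ hu => pow_ne_zero _ (norm_ne_zero_iff.2 hu)

lemma contDiffOn_singB : SmoothOn (singB D) {0}ᶜ :=
  contDiffOn_singA.mul ((contDiffOn_norm_pow 2).log fun _ hu =>
    pow_ne_zero _ (norm_ne_zero_iff.2 hu))

lemma contDiffOn_singKer (ha : Smooth₂ a) (hb : Smooth₂ b) :
    SmoothOn (fun q : ℝ × Euc D => singKer a b q.1 q.2) {q | q.2 ≠ 0} := by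
  have h2 : SmoothOn (fun q : ℝ × Euc D => q.2) {q | q.2 ≠ 0} := contDiff_snd.contDiffOn
  exact ((contDiffOn_singA.comp h2 fun q hq => hq).mul ha.contDiffOn).sub
    ((contDiffOn_singB.comp h2 fun q hq => hq).mul hb.contDiffOn)

lemma locallyIntegrable_singKer (hD : 2 ≤ D)
    (ha : Continuous (a μ)) (hb : Continuous (b μ)) : LocallyIntegrable (singKer a b μ) := by
  have h1 := (locallyIntegrable_singA hD).mul_continuous ha
  have h2 := (locallyIntegrable_singB hD).mul_continuous hb
  exact h1.sub h2

lemma continuous_slice (ha : Smooth₂ a) (μ : ℝ) : Continuous (a μ) :=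
  ha.continuous.comp (by fun_prop : Continuous fun u : Euc D => (μ, u))

lemma integral_singKer_mul (hD : 2 ≤ D) (ha : Continuous (a μ))
    (hb : Continuous (b μ)) (hφ : Continuous φ) (hc : HasCompactSupport φ) :
    ∫ u, singKer a b μ u * φ u
      = (∫ u, singA D u * (a μ u * φ u)) - ∫ u, singB D u * (b μ u * φ u) := by
  have i1 := integrable_mul_of_compact (locallyIntegrable_singA hD) (ha.mul hφ) hc.mul_left
  have i2 := integrable_mul_of_compact (locallyIntegrable_singB hD) (hb.mul hφ) hc.mul_left
  simp only [Pi.mul_apply] at i1 i2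
  rw [← integral_sub i1 i2]
  exact integral_congr_fun fun u => by rw [singKer]; ring

/-- Integrals of a singular kernel against a smooth compactly supported family depend smoothly on
the parameters. -/
lemma contDiffOn_integral_singKer (hD : 2 ≤ D) {P : Type*} [NormedAddCommGroup P]
    [NormedSpace ℝ P] {m : P → ℝ} (hm : Smooth m)
    (ha : Smooth₂ a) (hb : Smooth₂ b) {Φ : P → Euc D → ℝ}
    {s : Set P} (hs : IsOpen s) {k : Set (Euc D)} (hk : IsCompact k)
    (hΦk : ∀ p ∈ s, ∀ u, u ∉ k → Φ p u = 0) (hΦ : SmoothOn₂ Φ (s ×ˢ univ)) :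
    SmoothOn (fun p => ∫ u, singKer a b (m p) u * Φ p u) s := by
  have hc : ∀ {f : Euc D → ℝ}, LocallyIntegrable f → ∀ {a : ℝ → Euc D → ℝ}, Smooth₂ a →
      SmoothOn (fun p => ∫ u, f u * (a (m p) u * Φ p u)) s := fun hf a ha =>
    contDiffOn_integral_param hf hs hk (Φ := fun p u => a (m p) u * Φ p u)
      (fun p hp u hu => by rw [hΦk p hp u hu, mul_zero])
      ((ha.comp (f := fun q : P × Euc D => (m q.1, q.2)) ((hm.comp contDiff_fst).prodMk
        contDiff_snd)).contDiffOn.mul hΦ)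
  refine ((hc (locallyIntegrable_singA hD) ha).sub (hc (locallyIntegrable_singB hD) hb)).congr
    fun p hp => integral_singKer_mul hD (continuous_slice ha _) (continuous_slice hb _) ?_
      (.intro hk (hΦk p hp))
  rw [← continuousOn_univ]
  exact hΦ.continuousOn.comp (f := fun u : Euc D => (p, u)) (by fun_prop)
    fun u _ => ⟨hp, mem_univ _⟩

lemma contDiff_mul_norm_sq : Smooth (fun q : ℝ × Euc D => q.1 * ‖q.2‖ ^ 2) :=
  contDiff_fst.mul (contDiff_snd.norm_sq ℝ)

lemma contDiff_radial (he : Smooth e) :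
    Smooth (fun q : ℝ × Euc D => e (q.1 * ‖q.2‖ ^ 2)) :=
  he.comp contDiff_mul_norm_sq

lemma ContDiff.deriv_infty (he : Smooth e) : Smooth (deriv e) :=
  (contDiff_infty_iff_deriv.1 he).2

lemma contDiff_dradial (he : Smooth e) :
    Smooth (fun q : ℝ × Euc D => ‖q.2‖ ^ 2 * deriv e (q.1 * ‖q.2‖ ^ 2)) :=
  (contDiff_snd.norm_sq ℝ).mul (contDiff_radial he.deriv_infty)

lemma continuous_radial (he : Smooth e) (μ : ℝ) :
    Continuous fun u : Euc D => e (μ * ‖u‖ ^ 2) := he.continuous.comp (by fun_prop)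

lemma continuous_dradial (he : Smooth e) (μ : ℝ) :
    Continuous fun u : Euc D => ‖u‖ ^ 2 * deriv e (μ * ‖u‖ ^ 2) :=
  (continuous_norm.pow 2).mul (continuous_radial he.deriv_infty μ)

lemma hasDerivAt_radial (he : Smooth e) (c μ : ℝ) :
    HasDerivAt (fun m => e (m * c)) (c * deriv e (μ * c)) μ := by
  have := ((he.differentiable (by simp)) (μ * c)).hasDerivAt.comp μ
    ((hasDerivAt_id μ).mul_const c)
  rwa [one_mul, mul_comm] at this

lemma integral_hadKer_mul (hD : 2 ≤ D) (he : Smooth e) (hv : Smooth v) (μ : ℝ)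
    (hφ : Continuous φ) (hc : HasCompactSupport φ) :
    ∫ u, hadKer D e v μ u * φ u = (∫ u, singA D u * (e (μ * ‖u‖ ^ 2) * φ u))
      - ∫ u, singB D u * (v (μ * ‖u‖ ^ 2) * φ u) :=
  integral_singKer_mul hD (a := fun μ u => e (μ * ‖u‖ ^ 2)) (b := fun μ u => v (μ * ‖u‖ ^ 2))
    (continuous_radial he μ) (continuous_radial hv μ) hφ hc

lemma hasDerivAt_hadKer (he : Smooth e) (hv : Smooth v) (μ : ℝ)
    (u : Euc D) : HasDerivAt (fun m => hadKer D e v m u) (dhadKer D e v μ u) μ := by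
  simp only [hadKer, dhadKer, singKer]
  exact ((hasDerivAt_radial he _ μ).const_mul _).fun_sub ((hasDerivAt_radial hv _ μ).const_mul _)

/-- A parametrix of `K`: a radial kernel with a Hadamard singularity, together with its smooth
error `h`, so that `K hadKer = δ + h` weakly. -/
structure KernelData (D : ℕ) where
  hD : 2 ≤ D
  e : ℝ → ℝ
  v : ℝ → ℝ
  h : ℝ → Euc D → ℝ
  he : Smooth e
  hv : Smooth v
  hh : Smooth₂ h
  weak : ∀ (μ : ℝ) (ψ : Euc D → ℝ), Smooth ψ → HasCompactSupport ψ →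
    ∫ x, hadKer D e v μ x * kg μ ψ x = ψ 0 + ∫ x, h μ x * ψ x

namespace KernelData

variable (d : KernelData D)

/-- The kernel of the parametrix. -/
abbrev E : ℝ → Euc D → ℝ := hadKer D d.e d.v

/-- The `μ`-derivative of the kernel. -/
abbrev E' : ℝ → Euc D → ℝ := dhadKer D d.e d.v

/-- The `μ`-derivative of the smooth error. -/
def h' (μ : ℝ) (x : Euc D) : ℝ := deriv (fun m => d.h m x) μ

lemma neZero (d : KernelData D) : NeZero D := ⟨by have := d.hD; omega⟩

lemma contDiffOn_E : SmoothOn₂ d.E {q | q.2 ≠ 0} :=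
  contDiffOn_singKer (contDiff_radial d.he) (contDiff_radial d.hv)

lemma contDiffOn_E' : SmoothOn₂ d.E' {q | q.2 ≠ 0} :=
  contDiffOn_singKer (contDiff_dradial d.he) (contDiff_dradial d.hv)

/-- Compositions with the kernel are smooth where the argument does not vanish. -/
lemma contDiffAt_E_comp {P : Type*} [NormedAddCommGroup P] [NormedSpace ℝ P] {m : P → ℝ}
    {f : P → Euc D} {p : P} (hm : ContDiffAt ℝ ∞ m p) (hf : ContDiffAt ℝ ∞ f p) (h : f p ≠ 0) :
    ContDiffAt ℝ ∞ (fun q => d.E (m q) (f q)) p := by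
  have h1 : ContDiffAt ℝ ∞ (fun q : ℝ × Euc D => d.E q.1 q.2) (m p, f p) :=
    d.contDiffOn_E.contDiffAt ((isOpen_ne_fun continuous_snd continuous_const).mem_nhds h)
  exact ContDiffAt.comp (f := fun q => (m q, f q)) p h1 (hm.prodMk hf)

lemma locallyIntegrable_E (μ : ℝ) : LocallyIntegrable (d.E μ) :=
  locallyIntegrable_singKer d.hD (continuous_radial d.he μ) (continuous_radial d.hv μ)

lemma locallyIntegrable_E' (μ : ℝ) : LocallyIntegrable (d.E' μ) :=
  locallyIntegrable_singKer d.hD (continuous_dradial d.he μ) (continuous_dradial d.hv μ)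

lemma hasDerivAt_h (μ : ℝ) (x : Euc D) : HasDerivAt (fun m => d.h m x) (d.h' μ x) μ := by
  have : Smooth (fun m => d.h m x) := d.hh.comp (contDiff_id.prodMk contDiff_const)
  exact (this.differentiable (by simp) μ).hasDerivAt

lemma contDiff_h' : Smooth₂ d.h' := by
  have h1 : Smooth (fun q =>
      fderiv ℝ (fun q : ℝ × Euc D => d.h q.1 q.2) q ((1 : ℝ), (0 : Euc D))) :=
    (d.hh.fderiv_right (m := ∞) (by simp)).clm_apply contDiff_const
  convert h1 using 2 with q
  have h2 := (HasFDerivAt.comp (f := fun m : ℝ => (m, q.2)) q.1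
    ((d.hh.differentiable (by simp)) (q.1, q.2)).hasFDerivAt
      (hasFDerivAt_prodMk_left q.1 q.2)).hasDerivAt
  have h3 := h2.deriv
  simp only [comp_def] at h3
  rw [h', h3]
  simp

lemma contDiff_kg_fst (hψ : Smooth ψ) :
    Smooth (fun q : ℝ × Euc D => kg q.1 ψ q.2) := by
  have := contDiffOn_kg_param (m := fun m : ℝ => m) (Ψ := fun _ : ℝ => ψ) isOpen_univ contDiff_id
    (hψ.comp contDiff_snd).contDiffOn
  rwa [contDiffOn_univ] at this

lemma hasDerivAt_integral_singular {f : Euc D → ℝ} (hf : LocallyIntegrable f)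
    (he : Smooth e) (hψ : Smooth ψ) (hc : HasCompactSupport ψ) (μ : ℝ) :
    HasDerivAt (fun m => ∫ x, f x * (e (m * ‖x‖ ^ 2) * kg m ψ x))
      ((∫ x, f x * (‖x‖ ^ 2 * deriv e (μ * ‖x‖ ^ 2) * kg μ ψ x))
        + ∫ x, f x * (e (μ * ‖x‖ ^ 2) * ψ x)) μ := by
  have hΦ : Smooth (fun q : ℝ × Euc D => e (q.1 * ‖q.2‖ ^ 2) * kg q.1 ψ q.2) :=
    (contDiff_radial he).mul (contDiff_kg_fst hψ)
  convert hasDerivAt_integral_param hf isOpen_univ hc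
    (Φ := fun m x => e (m * ‖x‖ ^ 2) * kg m ψ x)
    (fun m _ x hx => by rw [kg_eq_zero_of_notMem_tsupport hx, mul_zero]) hΦ.contDiffOn
    (mem_univ μ) using 1
  refine integral_add_eq (integrable_mul_of_compact hf ((continuous_dradial he μ).mul
    (contDiff_kg hψ μ).continuous) (hasCompactSupport_kg hc μ).mul_left)
    (integrable_mul_of_compact hf ((continuous_radial he μ).mul hψ.continuous) hc.mul_left)
    fun x => ?_
  have h2 : HasDerivAt (fun m : ℝ => kg m ψ x) (ψ x) μ := by
    simpa [kg] using ((hasDerivAt_id μ).mul_const (ψ x)).const_add (-(Laplacian.laplacian ψ x))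
  rw [((hasDerivAt_radial he (‖x‖ ^ 2) μ).fun_mul h2).deriv, mul_add]

/-- The equation for the kernel, differentiated with respect to `μ`: `K E' = -E + h'` weakly. -/
lemma weak' (μ : ℝ) (hψ : Smooth ψ) (hc : HasCompactSupport ψ) :
    ∫ x, d.E' μ x * kg μ ψ x = ∫ x, (-d.E μ x + d.h' μ x) * ψ x := by
  have e1 : ∀ m, (∫ x, singA D x * (d.e (m * ‖x‖ ^ 2) * kg m ψ x))
      - (∫ x, singB D x * (d.v (m * ‖x‖ ^ 2) * kg m ψ x)) = ψ 0 + ∫ x, ψ x * d.h m x := fun m => by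
    simp only [mul_comm (ψ _)]
    rw [← d.weak m ψ hψ hc]
    exact (integral_hadKer_mul d.hD d.he d.hv m (contDiff_kg hψ m).continuous
      (hasCompactSupport_kg hc m)).symm
  have D1 := (hasDerivAt_integral_singular (locallyIntegrable_singA d.hD) d.he hψ hc μ).fun_sub
    (hasDerivAt_integral_singular (locallyIntegrable_singB d.hD) d.hv hψ hc μ)
  have D2 := (hasDerivAt_integral_param (f := fun _ : Euc D => (1 : ℝ)) (locallyIntegrable_const 1)
    isOpen_univ hc (Φ := fun m x => ψ x * d.h m x)
    (fun m _ x hx => by rw [image_eq_zero_of_notMem_tsupport hx, zero_mul])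
    ((hψ.comp contDiff_snd).mul d.hh).contDiffOn (mem_univ μ) (ν := volume)).const_add (ψ 0)
  simp only [one_mul, fun x => ((d.hasDerivAt_h μ x).const_mul (ψ x)).deriv] at D2
  simp only [e1] at D1
  have h1 := D1.unique D2
  have s1 := integral_singKer_mul d.hD (μ := μ) (a := fun m u => ‖u‖ ^ 2 * deriv d.e (m * ‖u‖ ^ 2))
    (b := fun m u => ‖u‖ ^ 2 * deriv d.v (m * ‖u‖ ^ 2)) (continuous_dradial d.he μ)
    (continuous_dradial d.hv μ) (contDiff_kg hψ μ).continuous (hasCompactSupport_kg hc μ)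
  have s2 := integral_hadKer_mul d.hD d.he d.hv μ hψ.continuous hc
  have s3 := integral_add_eq (integrable_mul_of_compact (d.locallyIntegrable_E μ) hψ.continuous hc)
    (integrable_mul_of_compact (LocallyIntegrable.add (d.locallyIntegrable_E μ).neg
      (continuous_slice d.contDiff_h' μ).locallyIntegrable) hψ.continuous hc)
    (r := fun x => ψ x * d.h' μ x) fun x => by simp only [Pi.add_apply, Pi.neg_apply]; ring
  simp only [Pi.add_apply, Pi.neg_apply] at s3
  rw [← dhadKer] at s1
  linarith

end KernelData

end Kernels

/-! ### Regularization of the two-point flow -/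

section Regularization

variable {D : ℕ} {f g w ψ : Euc D → ℝ} {x₁ x₂ x y : Euc D} {p : ℝ × Euc D}

/-- The product of two functions with integrable singularities at different points is integrable
against a compactly supported weight. -/
lemma integrable_mul_mul (hx : x₁ ≠ x₂) (hf : ContinuousOn f {x₁}ᶜ) (hfi : LocallyIntegrable f)
    (hg : ContinuousOn g {x₂}ᶜ) (hgi : LocallyIntegrable g)
    (hw : Continuous w) (hc : HasCompactSupport w) : Integrable fun y => w y * (f y * g y) := by
  have hd : 0 < dist x₁ x₂ := dist_pos.2 hx
  let θ : ContDiffBump x₁ := ⟨dist x₁ x₂ / 4, dist x₁ x₂ / 2, by positivity, by linarith⟩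
  have c1 : Continuous fun y => g y * (θ y * w y) :=
    continuous_mul_of_eventuallyEq_zero isOpen_compl_singleton (θ.continuous.mul hw) hg
      fun y hy => by
      rw [Set.notMem_compl_iff.1 hy]
      exact (θ.eventuallyEq_zero (show dist x₁ x₂ / 2 < _ by rw [dist_comm x₂]; linarith)).mono
        fun z hz => by rw [hz, zero_mul]
  have c2 : Continuous fun y => f y * ((1 - θ y) * w y) :=
    continuous_mul_of_eventuallyEq_zero isOpen_compl_singleton
      ((continuous_const.sub θ.continuous).mul hw) hf fun y hy => by
      rw [Set.notMem_compl_iff.1 hy]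
      exact θ.eventuallyEq_one.mono fun z hz => by simp [hz]
  have i1 := integrable_mul_of_compact hfi c1 ((hc.mul_left (f := θ)).mul_left (f := g))
  have i2 := integrable_mul_of_compact hgi c2
    ((hc.mul_left (f := fun y => 1 - θ y)).mul_left (f := f))
  refine (i1.add i2).congr (.of_forall fun y => ?_)
  simp only [Pi.add_apply]
  ring

/-- `w` is a smooth weight which equals `1` for `|y| < ρ` and `0` for `|y| > R`. -/
structure IsCut (w : Euc D → ℝ) (ρ R : ℝ) : Prop where
  smooth : Smooth w
  pos : 0 < ρ
  eq_one : ∀ y, ‖y‖ < ρ → w y = 1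
  eq_zero : ∀ y, R < ‖y‖ → w y = 0

namespace IsCut

variable {w : Euc D → ℝ} {ρ R : ℝ}

lemma hasCompactSupport (hw : IsCut w ρ R) : HasCompactSupport w :=
  .intro (isCompact_closedBall 0 R) fun y hy => hw.eq_zero y (by simpa using hy)

lemma eventually_eq_one (hw : IsCut w ρ R) (hx : ‖x‖ < ρ) :
    ∀ᶠ y in 𝓝 x, w y = 1 := by
  filter_upwards [(isOpen_lt continuous_norm continuous_const).mem_nhds hx] with y hy
  exact hw.eq_one y hy

lemma eventually_eq_zero (hw : IsCut w ρ R) (hx : R < ‖x‖) :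
    ∀ᶠ y in 𝓝 x, w y = 0 := by
  filter_upwards [(isOpen_lt continuous_const continuous_norm).mem_nhds hx] with y hy
  exact hw.eq_zero y hy

end IsCut

namespace KernelData

variable (d : KernelData D)

lemma contDiffOn_E_sub (μ : ℝ) (x : Euc D) : SmoothOn (fun y => d.E μ (y - x)) {x}ᶜ :=
  d.contDiffOn_E.comp (f := fun y => (μ, y - x)) (by fun_prop) fun y hy => sub_ne_zero.2 hy

lemma contDiffOn_E'_sub (μ : ℝ) (x : Euc D) : SmoothOn (fun y => d.E' μ (y - x)) {x}ᶜ :=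
  d.contDiffOn_E'.comp (f := fun y => (μ, y - x)) (by fun_prop) fun y hy => sub_ne_zero.2 hy

lemma _root_.MeasureTheory.LocallyIntegrable.comp_sub (hf : LocallyIntegrable f) (x : Euc D) :
    LocallyIntegrable fun y => f (y - x) := by
  rw [locallyIntegrable_iff] at *
  intro k hk
  have h1 : MeasurePreserving (fun y : Euc D => y - x) := measurePreserving_sub_right volume x
  have h2 : MeasurableEmbedding (fun y : Euc D => y - x) :=
    (Homeomorph.subRight x).measurableEmbedding
  have := hf _ (hk.image (by fun_prop : Continuous fun y : Euc D => y - x))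
  have h3 := (h1.integrableOn_comp_preimage h2 (f := f)).2 this
  exact h3.mono_set (Set.subset_preimage_image _ _)

lemma locallyIntegrable_E_sub (μ : ℝ) (x : Euc D) : LocallyIntegrable fun y => d.E μ (y - x) :=
  (d.locallyIntegrable_E μ).comp_sub x

lemma locallyIntegrable_E'_sub (μ : ℝ) (x : Euc D) : LocallyIntegrable fun y => d.E' μ (y - x) :=
  (d.locallyIntegrable_E' μ).comp_sub x

lemma contDiff_h_slice (μ : ℝ) : Smooth (d.h μ) :=
  d.hh.comp (contDiff_const.prodMk contDiff_id)

lemma contDiff_h'_slice (μ : ℝ) : Smooth (d.h' μ) :=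
  d.contDiff_h'.comp (contDiff_const.prodMk contDiff_id)

lemma integral_translate (x : Euc D) (hψ : Smooth ψ) (μ : ℝ) (c : ℝ)
    (h : ∫ y, f y * kg μ (fun y => ψ (y + x)) y = c + ∫ y, g y * ψ (y + x)) :
    ∫ y, f (y - x) * kg μ ψ y = c + ∫ y, g (y - x) * ψ y := by
  rw [← integral_add_right_eq_self (fun y => f (y - x) * kg μ ψ y) x,
    ← integral_add_right_eq_self (fun y => g (y - x) * ψ y) x]
  simp only [add_sub_cancel_right]
  rw [← h]
  refine integral_congr_fun fun y => ?_
  rw [kg_comp_add isOpen_univ hψ.contDiffOn x (mem_univ _)]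

lemma hasCompactSupport_comp_add (hc : HasCompactSupport ψ) (x : Euc D) :
    HasCompactSupport fun y => ψ (y + x) :=
  hc.comp_homeomorph (Homeomorph.addRight x)

lemma weak_sub (μ : ℝ) (x : Euc D) (hψ : Smooth ψ) (hc : HasCompactSupport ψ) :
    ∫ y, d.E μ (y - x) * kg μ ψ y = ψ x + ∫ y, d.h μ (y - x) * ψ y := by
  refine integral_translate x hψ μ _ ?_
  have := d.weak μ (fun y => ψ (y + x)) (by fun_prop) (hasCompactSupport_comp_add hc x)
  simpa using this

lemma weak'_sub (μ : ℝ) (x : Euc D) (hψ : Smooth ψ) (hc : HasCompactSupport ψ) :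
    ∫ y, d.E' μ (y - x) * kg μ ψ y = ∫ y, (-d.E μ (y - x) + d.h' μ (y - x)) * ψ y := by
  have := integral_translate (f := d.E' μ) (g := fun y => -d.E μ y + d.h' μ y) x hψ μ 0 (by
    rw [d.weak' μ (ψ := fun y => ψ (y + x)) (by fun_prop) (hasCompactSupport_comp_add hc x),
      zero_add])
  simpa using this

lemma kg_E_sub (μ : ℝ) (hy : y ≠ x) :
    kg μ (fun y => d.E μ (y - x)) y = d.h μ (y - x) := by
  refine kg_eq_of_weak (U := {x}ᶜ) (s := fun y => d.h μ (y - x)) isOpen_compl_singleton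
    (d.contDiffOn_E_sub μ x) ?_ (fun ψ hψ hc hs => ?_) hy
  · exact ((d.contDiff_h_slice μ).continuous.comp (by fun_prop)).continuousOn
  · rw [d.weak_sub μ x hψ hc]
    have : ψ x = 0 := by
      by_contra h
      exact hs (subset_tsupport ψ h) rfl
    rw [this, zero_add]

lemma kg_E'_sub (μ : ℝ) (hy : y ≠ x) :
    kg μ (fun y => d.E' μ (y - x)) y = -d.E μ (y - x) + d.h' μ (y - x) := by
  refine kg_eq_of_weak (U := {x}ᶜ) (s := fun y => -d.E μ (y - x) + d.h' μ (y - x))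
    isOpen_compl_singleton (d.contDiffOn_E'_sub μ x) ?_ (fun ψ hψ hc _ => d.weak'_sub μ x hψ hc) hy
  exact (d.contDiffOn_E_sub μ x).continuousOn.neg.add
    ((d.contDiff_h'_slice μ).continuous.comp (by fun_prop)).continuousOn

variable {w : Euc D → ℝ} {ρ R : ℝ}

/-- The part `(1 - w) E(· - x)` of the kernel which is cut off; it is smooth if `|x| < ρ`. -/
def outer (w : Euc D → ℝ) (p : ℝ × Euc D) (y : Euc D) : ℝ :=
  (1 - w y) * d.E p.1 (y - p.2)

/-- The error of the localized kernel `w E(· - x)` as a fundamental solution. -/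
def errK (w : Euc D → ℝ) (p : ℝ × Euc D) (y : Euc D) : ℝ :=
  d.h p.1 (y - p.2) - kg p.1 (d.outer w p) y

lemma contDiffOn_outer (hw : IsCut w ρ R) :
    SmoothOn (fun q : (ℝ × Euc D) × Euc D => d.outer w q.1 q.2)
      ({p | ‖p.2‖ < ρ} ×ˢ univ) := by
  rintro ⟨⟨μ, x⟩, y⟩ ⟨hx, -⟩
  replace hx : ‖x‖ < ρ := hx
  refine ContDiffAt.contDiffWithinAt ?_
  by_cases h : y = x
  · subst h
    refine contDiffAt_of_eventually_zero ?_
    filter_upwards [(continuous_snd.tendsto ((μ, y), y)).eventually (hw.eventually_eq_one hx)]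
      with q hq
    simp [outer, hq]
  · exact (contDiffAt_const.sub (hw.smooth.comp contDiff_snd).contDiffAt).mul
      (d.contDiffAt_E_comp (by fun_prop) (by fun_prop) (sub_ne_zero.2 h))

lemma contDiffOn_errK (hw : IsCut w ρ R) :
    SmoothOn (fun q : (ℝ × Euc D) × Euc D => d.errK w q.1 q.2)
      ({p | ‖p.2‖ < ρ} ×ˢ univ) := by
  have ho : IsOpen ({p : ℝ × Euc D | ‖p.2‖ < ρ} ×ˢ (univ : Set (Euc D))) :=
    (isOpen_lt (by fun_prop) (by fun_prop)).prod isOpen_univ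
  refine ContDiffOn.sub ?_ (contDiffOn_kg_param (m := fun p : ℝ × Euc D => p.1) ho contDiff_fst
    (d.contDiffOn_outer hw))
  exact (d.hh.comp (f := fun q : (ℝ × Euc D) × Euc D => (q.1.1, q.2 - q.1.2))
    (by fun_prop)).contDiffOn

lemma contDiff_outer_slice (hw : IsCut w ρ R) (hp : ‖p.2‖ < ρ) :
    Smooth (d.outer w p) := by
  rw [← contDiffOn_univ]
  exact (d.contDiffOn_outer hw).comp (f := fun y => (p, y)) (by fun_prop)
    fun y _ => ⟨hp, mem_univ _⟩

lemma contDiff_errK_slice (hw : IsCut w ρ R) (hp : ‖p.2‖ < ρ) :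
    Smooth (d.errK w p) := by
  rw [← contDiffOn_univ]
  exact (d.contDiffOn_errK hw).comp (f := fun y => (p, y)) (by fun_prop)
    fun y _ => ⟨hp, mem_univ _⟩

lemma cut_lt (hw : IsCut w ρ R) (hx : ‖x‖ < ρ) (hy : R < ‖y‖) : y ≠ x := by
  rintro rfl
  have := hw.eq_one y hx
  rw [hw.eq_zero y hy] at this
  exact zero_ne_one this

lemma errK_eq_zero (hw : IsCut w ρ R) (hp : ‖p.2‖ < ρ) (hy : R < ‖y‖) : d.errK w p y = 0 := by
  have h1 : d.outer w p =ᶠ[𝓝 y] fun y => d.E p.1 (y - p.2) := by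
    filter_upwards [hw.eventually_eq_zero hy] with z hz
    simp [outer, hz]
  rw [errK, kg_congr_nhds h1, d.kg_E_sub p.1 (cut_lt hw hp hy), sub_self]

lemma hasCompactSupport_errK (hw : IsCut w ρ R) (hp : ‖p.2‖ < ρ) :
    HasCompactSupport (d.errK w p) :=
  .intro (isCompact_closedBall 0 R) fun y hy =>
    d.errK_eq_zero hw hp (by simpa using hy)

/-- Green's representation formula for the localized kernel. -/
theorem green_cut (hw : IsCut w ρ R) {μ : ℝ} (hx : x₁ ≠ x₂) (hx₁ : ‖x₁‖ < ρ) {F s : Euc D → ℝ}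
    (hF : SmoothOn F {x₂}ᶜ) (hFi : LocallyIntegrable F) (hsi : LocallyIntegrable s)
    (hFd : ∀ ψ : Euc D → ℝ, Smooth ψ → HasCompactSupport ψ →
      ∫ x, F x * kg μ ψ x = ∫ x, s x * ψ x)
    (hFp : ∀ y, y ≠ x₂ → kg μ F y = s y) :
    F x₁ + ∫ y, d.errK w (μ, x₁) y * F y = ∫ y, (w y * d.E μ (y - x₁)) * s y := by
  have := d.neZero
  have hp : ‖((μ, x₁) : ℝ × Euc D).2‖ < ρ := hx₁
  have hk := d.contDiff_errK_slice hw hp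
  have hkc := d.hasCompactSupport_errK hw hp
  have ho := d.contDiff_outer_slice hw hp
  have hE := d.contDiffOn_E_sub μ x₁
  have hEi := d.locallyIntegrable_E_sub μ x₁
  have hwE : (fun y => w y * d.E μ (y - x₁)) = fun y => d.E μ (y - x₁) - d.outer w (μ, x₁) y := by
    ext y
    simp only [outer]
    ring
  refine green_representation (A := fun y => w y * d.E μ (y - x₁)) hx
    (hw.smooth.contDiffOn.mul hE) hw.hasCompactSupport.mul_right ?_ hk.continuous hkc ?_ ?_ hF hFi
    hsi hFd hFp
  · have := hEi.mul_continuous hw.smooth.continuous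
    simpa only [mul_comm] using this
  · intro ψ hψ hc
    have i1 := integrable_mul_kg hEi hψ hc μ
    have i2 := integrable_mul_kg ho.continuous.locallyIntegrable hψ hc μ
    have i3 : Integrable fun y => d.h μ (y - x₁) * ψ y :=
      (((d.contDiff_h_slice μ).continuous.comp (continuous_id.sub continuous_const)).mul
        hψ.continuous).integrable_of_hasCompactSupport hc.mul_left
    have i4 : Integrable fun y => kg μ (d.outer w (μ, x₁)) y * ψ y :=
      ((contDiff_kg ho μ).continuous.mul hψ.continuous).integrable_of_hasCompactSupport hc.mul_left
    have e1 : ∫ y, (w y * d.E μ (y - x₁)) * kg μ ψ y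
        = (∫ y, d.E μ (y - x₁) * kg μ ψ y) - ∫ y, d.outer w (μ, x₁) y * kg μ ψ y := by
      rw [← integral_sub i1 i2]
      refine integral_congr_fun fun y => ?_
      simp only [outer]
      ring
    have e2 : ∫ y, d.errK w (μ, x₁) y * ψ y
        = (∫ y, d.h μ (y - x₁) * ψ y) - ∫ y, kg μ (d.outer w (μ, x₁)) y * ψ y := by
      rw [← integral_sub i3 i4]
      refine integral_congr_fun fun y => ?_
      simp only [errK]
      ring
    rw [e1, e2, d.weak_sub μ x₁ hψ hc, integral_mul_kg ho hψ (Or.inr hc)]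
    ring
  · intro y hy
    have := kg_sub isOpen_compl_singleton hE (ho.contDiffOn (s := {x₁}ᶜ)) hy μ
    rw [hwE, this, d.kg_E_sub μ hy, errK]

/-- The regular expression for `∂_μ E(x₁ - x₂) + ∫ w(y) E(y - x₁) E(y - x₂) dy`. -/
def qreg (w : Euc D → ℝ) (μ : ℝ) (x₁ x₂ : Euc D) : ℝ :=
  (∫ y, (w y * d.E μ (y - x₁)) * d.h' μ (y - x₂)) - ∫ y, d.errK w (μ, x₁) y * d.E' μ (y - x₂)

lemma integrable_cut_E_E (hw : Continuous w) (hc : HasCompactSupport w) (μ : ℝ) (hx : x₁ ≠ x₂) :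
    Integrable fun y => w y * (d.E μ (y - x₁) * d.E μ (y - x₂)) :=
  integrable_mul_mul hx (d.contDiffOn_E_sub μ x₁).continuousOn (d.locallyIntegrable_E_sub μ x₁)
    (d.contDiffOn_E_sub μ x₂).continuousOn (d.locallyIntegrable_E_sub μ x₂) hw hc

/-- The singularities of `∂_μ E` and of the integral cancel, by Green's formula for the localized
kernel and `∂_μ E`, since `K ∂_μ E = -E + h'`. -/
theorem qreg_eq (hw : IsCut w ρ R) (μ : ℝ) (hx : x₁ ≠ x₂) (hx₁ : ‖x₁‖ < ρ) :
    d.E' μ (x₁ - x₂) + ∫ y, w y * (d.E μ (y - x₁) * d.E μ (y - x₂)) = d.qreg w μ x₁ x₂ := by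
  have hh' : Continuous fun y => d.h' μ (y - x₂) :=
    (d.contDiff_h'_slice μ).continuous.comp (continuous_id.sub continuous_const)
  have hsi : LocallyIntegrable fun y => -d.E μ (y - x₂) + d.h' μ (y - x₂) :=
    (d.locallyIntegrable_E_sub μ x₂).neg.add hh'.locallyIntegrable
  have key := d.green_cut hw hx hx₁ (F := fun y => d.E' μ (y - x₂)) (d.contDiffOn_E'_sub μ x₂)
    (d.locallyIntegrable_E'_sub μ x₂) hsi (fun ψ hψ hc => d.weak'_sub μ x₂ hψ hc)
    (fun y hy => d.kg_E'_sub μ hy)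
  have i1 := d.integrable_cut_E_E hw.smooth.continuous hw.hasCompactSupport μ hx
  have i2 : Integrable fun y => (w y * d.E μ (y - x₁)) * d.h' μ (y - x₂) := by
    have := integrable_mul_of_compact (d.locallyIntegrable_E_sub μ x₁)
      (hw.smooth.continuous.mul hh') hw.hasCompactSupport.mul_right
    refine this.congr (.of_forall fun y => ?_)
    simp only [Pi.mul_apply]
    ring
  have e1 : ∫ y, (w y * d.E μ (y - x₁)) * (-d.E μ (y - x₂) + d.h' μ (y - x₂))
      = (∫ y, (w y * d.E μ (y - x₁)) * d.h' μ (y - x₂))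
        - ∫ y, w y * (d.E μ (y - x₁) * d.E μ (y - x₂)) := by
    rw [← integral_sub i2 i1]
    exact integral_congr_fun fun y => by ring
  rw [e1] at key
  rw [qreg]
  linarith

lemma notMem_closedBall_add {u : Euc D} (hx : ‖x‖ < ρ)
    (hu : u ∉ closedBall (0 : Euc D) (R + ρ)) : R < ‖u + x‖ := by
  rw [mem_closedBall, dist_zero_right, not_le] at hu
  have := norm_sub_le (u + x) x
  rw [add_sub_cancel_right] at this
  linarith

lemma isOpen_norm_lt : IsOpen {q : ℝ × Euc₂ D | ‖q.2.1‖ < ρ ∧ ‖q.2.2‖ < ρ} :=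
  IsOpen.and (isOpen_lt (by fun_prop) continuous_const) (isOpen_lt (by fun_prop) continuous_const)

lemma contDiffOn_integral_E (hw : IsCut w ρ R) {g : ℝ × Euc D → ℝ} (hg : Smooth g) :
    SmoothOn (fun q : ℝ × Euc₂ D =>
      ∫ y, (w y * d.E q.1 (y - q.2.1)) * g (q.1, y - q.2.2))
      {q | ‖q.2.1‖ < ρ ∧ ‖q.2.2‖ < ρ} := by
  have c1 : Smooth fun q : (ℝ × Euc₂ D) × Euc D => w (q.2 + q.1.2.1) :=
    hw.smooth.comp (by fun_prop)
  have c2 : Smooth fun q : (ℝ × Euc₂ D) × Euc D =>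
      g (q.1.1, q.2 + q.1.2.1 - q.1.2.2) := hg.comp (by fun_prop)
  have h1 := contDiffOn_integral_singKer d.hD (P := ℝ × Euc₂ D)
    (a := fun μ u => d.e (μ * ‖u‖ ^ 2)) (b := fun μ u => d.v (μ * ‖u‖ ^ 2)) (m := fun q => q.1)
    contDiff_fst (contDiff_radial d.he) (contDiff_radial d.hv) (isOpen_norm_lt (ρ := ρ))
    (isCompact_closedBall (0 : Euc D) (R + ρ))
    (Φ := fun q u => w (u + q.2.1) * g (q.1, u + q.2.1 - q.2.2))
    (fun p hp u hu => by rw [hw.eq_zero _ (notMem_closedBall_add hp.1 hu), zero_mul])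
    (c1.mul c2).contDiffOn
  refine h1.congr fun q _ => ?_
  rw [← integral_add_right_eq_self _ q.2.1]
  refine integral_congr_fun fun u => ?_
  simp only [add_sub_cancel_right]
  change _ = d.E q.1 u * _
  ring

lemma contDiffOn_errK_translate (hw : IsCut w ρ R) :
    SmoothOn (fun q : (ℝ × Euc₂ D) × Euc D =>
      d.errK w (q.1.1, q.1.2.1) (q.2 + q.1.2.2))
      ({q : ℝ × Euc₂ D | ‖q.2.1‖ < ρ ∧ ‖q.2.2‖ < ρ} ×ˢ univ) := by
  have hm : Smooth (fun q : (ℝ × Euc₂ D) × Euc D =>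
      (((q.1.1, q.1.2.1), q.2 + q.1.2.2) : (ℝ × Euc D) × Euc D)) := by fun_prop
  have h := d.contDiffOn_errK hw
  refine ContDiffOn.comp (t := {p : ℝ × Euc D | ‖p.2‖ < ρ} ×ˢ univ) h hm.contDiffOn ?_
  intro q hq
  exact Set.mk_mem_prod hq.1.1 (mem_univ _)

lemma contDiffOn_integral_errK (hw : IsCut w ρ R) :
    SmoothOn (fun q : ℝ × Euc₂ D =>
      ∫ y, d.errK w (q.1, q.2.1) y * d.E' q.1 (y - q.2.2))
      {q | ‖q.2.1‖ < ρ ∧ ‖q.2.2‖ < ρ} := by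
  have h2 := contDiffOn_integral_singKer d.hD (P := ℝ × Euc₂ D)
    (a := fun μ u => ‖u‖ ^ 2 * deriv d.e (μ * ‖u‖ ^ 2))
    (b := fun μ u => ‖u‖ ^ 2 * deriv d.v (μ * ‖u‖ ^ 2)) (m := fun q => q.1)
    contDiff_fst (contDiff_dradial d.he) (contDiff_dradial d.hv) (isOpen_norm_lt (ρ := ρ))
    (isCompact_closedBall (0 : Euc D) (R + ρ))
    (Φ := fun q u => d.errK w (q.1, q.2.1) (u + q.2.2))
    (fun p hp u hu => d.errK_eq_zero hw (p := (p.1, p.2.1)) hp.1 (notMem_closedBall_add hp.2 hu))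
    (d.contDiffOn_errK_translate hw)
  refine h2.congr fun q _ => ?_
  rw [← integral_add_right_eq_self _ q.2.2]
  refine integral_congr_fun fun u => ?_
  simp only [add_sub_cancel_right]
  change _ = d.E' q.1 u * _
  ring

/-- The regular expression is smooth in all variables. -/
theorem contDiffOn_qreg (hw : IsCut w ρ R) :
    SmoothOn (fun q : ℝ × Euc₂ D => d.qreg w q.1 q.2.1 q.2.2)
      {q | ‖q.2.1‖ < ρ ∧ ‖q.2.2‖ < ρ} :=
  (d.contDiffOn_integral_E hw d.contDiff_h').sub (d.contDiffOn_integral_errK hw)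

end KernelData

end Regularization

/-! ### Comparison of kernels and the Taylor coefficients of the regular expression -/

section Comparison

variable {D : ℕ} {q : Euc D → Euc D → ℝ} {U : Set (Euc₂ D)} {δ : ℕ} {ρ : ℝ}

/-- Taylor's formula for a function of two points which is smooth near the origin. -/
lemma exists_bound_sub_pairPoly_of_contDiffOn (δ : ℕ) (hU : IsOpen U) (h0 : 0 ∈ U)
    (hq : SmoothOn₂ q U) :
    ∃ C : ℝ, 0 ≤ C ∧ ∃ r : ℝ, 0 < r ∧ ∀ p : Euc₂ D, ‖p‖ ≤ r →
      |q p.1 p.2 - pairPoly δ (fun γ => jetM γ q) p.1 p.2| ≤ C * ‖p‖ ^ (δ + 1) := by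
  obtain ⟨g, hg, hgq⟩ := exists_contDiff_eventuallyEq hU hq h0
  obtain ⟨C, hC, hb⟩ := exists_bound_sub_pairPoly δ (q := fun a b => g (a, b)) hg
  have hj : (fun γ => jetM γ q) = fun γ => jetM γ fun a b => g (a, b) := by
    ext γ
    exact (jet_congr_nhds (q := fun a b => g (a, b)) (q' := q) hgq _ _).symm
  obtain ⟨r, hr, hrg⟩ := Metric.eventually_nhds_iff.1 hgq
  refine ⟨C, hC, min (r / 2) 1, by positivity, fun p hp => ?_⟩
  have h1 := hrg (y := p) (by
    rw [dist_zero_right]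
    exact lt_of_le_of_lt (hp.trans (min_le_left _ _)) (by linarith))
  rw [hj, show q p.1 p.2 = g p from h1.symm]
  exact hb p (hp.trans (min_le_right _ _))

/-- Functions which agree off the diagonal have the same Taylor coefficients. -/
lemma jet_congr_offDiag [NeZero D] {q' : Euc D → Euc D → ℝ} (hU : IsOpen U) (h0 : 0 ∈ U)
    (hq : ContinuousOn (fun p : Euc₂ D => q p.1 p.2) U)
    (hq' : ContinuousOn (fun p : Euc₂ D => q' p.1 p.2) U)
    (h : ∀ p ∈ U, p.1 ≠ p.2 → q p.1 p.2 = q' p.1 p.2) (l l' : List (Fin D)) :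
    jet l l' q = jet l l' q' := by
  refine jet_congr_nhds ?_ l l'
  filter_upwards [hU.mem_nhds h0] with p hp
  exact eqOn_of_eqOn_offDiag hU hq hq' h hp

/-- The Taylor polynomial is unique. -/
lemma pairPoly_eq_of_bound {c c' : MultiIdx₂ D → ℝ} {C r : ℝ} (hr : 0 < r) (a b a' b' : Euc D)
    (h : ∀ ε : ℝ, 0 < ε → ε < r →
      |pairPoly δ c (ε • a) (ε • b) - pairPoly δ c' (ε • a') (ε • b')| ≤ C * ε ^ (δ + 1)) :
    pairPoly δ c a b = pairPoly δ c' a' b' := by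
  refine pairPoly_eq_of_tendsto ?_
  have h1 : Tendsto (fun ε : ℝ => C * ε) (𝓝[>] 0) (𝓝 0) := by
    have hc : Continuous fun ε : ℝ => C * ε := by fun_prop
    have := (hc.tendsto 0).mono_left (nhdsWithin_le_nhds (s := Ioi 0))
    simpa using this
  refine squeeze_zero_norm' ?_ h1
  filter_upwards [self_mem_nhdsWithin, nhdsWithin_le_nhds (gt_mem_nhds hr)] with ε hε hεr
  have hε' : (0 : ℝ) < ε := hε
  rw [norm_eq_abs, abs_div, abs_of_pos (pow_pos hε' δ), div_le_iff₀ (pow_pos hε' δ)]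
  refine (h ε hε' hεr).trans (le_of_eq ?_)
  ring

lemma isOpen_two_balls : IsOpen (𝔹₂ ρ : Set (Euc₂ D)) :=
  IsOpen.and (isOpen_lt (by fun_prop) continuous_const) (isOpen_lt (by fun_prop) continuous_const)

lemma zero_mem_two_balls (hρ : 0 < ρ) : (0 : Euc₂ D) ∈ (𝔹₂ ρ : Set (Euc₂ D)) := by
  simpa using hρ

/-- A linear isometry under which a function of two points is invariant leaves its Taylor
polynomial invariant. -/
lemma pairPoly_jetM_invariant (hρ : 0 < ρ) (hq : SmoothOn₂ q (𝔹₂ ρ)) (T : Euc₂ D ≃ₗᵢ[ℝ] Euc₂ D)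
    (hT : ∀ p : Euc₂ D, ‖p.1‖ < ρ → ‖p.2‖ < ρ → q (T p).1 (T p).2 = q p.1 p.2) (p : Euc₂ D) :
    pairPoly δ (fun γ => jetM γ q) (T p).1 (T p).2 = pairPoly δ (fun γ => jetM γ q) p.1 p.2 := by
  obtain ⟨C, hC, r, hr, hb⟩ := exists_bound_sub_pairPoly_of_contDiffOn δ isOpen_two_balls
    (zero_mem_two_balls hρ) hq
  set m := min r (ρ / 2) with hm
  have hmpos : 0 < m := lt_min hr (by positivity)
  refine pairPoly_eq_of_bound (C := 2 * (C * ‖p‖ ^ (δ + 1))) (r := m / (‖p‖ + 1))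
    (by positivity) _ _ _ _ fun ε hε hεr => ?_
  have h0 : ‖ε • p‖ ≤ m := by
    rw [norm_smul, norm_of_nonneg hε.le]
    rw [lt_div_iff₀ (by positivity)] at hεr
    nlinarith [norm_nonneg p]
  have h1 : ‖(ε • p).1‖ < ρ :=
    lt_of_le_of_lt ((norm_fst_le _).trans (h0.trans (min_le_right _ _))) (by linarith)
  have h2 : ‖(ε • p).2‖ < ρ :=
    lt_of_le_of_lt ((norm_snd_le _).trans (h0.trans (min_le_right _ _))) (by linarith)
  have h3 := hb (ε • p) (h0.trans (min_le_left _ _))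
  have h4 := hb (T (ε • p)) (by rw [T.norm_map]; exact h0.trans (min_le_left _ _))
  rw [hT _ h1 h2, T.norm_map] at h4
  have e1 : T (ε • p) = ε • T p := T.map_smul ε p
  rw [e1] at h4
  have e2 : ‖ε • p‖ ^ (δ + 1) = ‖p‖ ^ (δ + 1) * ε ^ (δ + 1) := by
    rw [norm_smul, norm_of_nonneg hε.le, mul_pow, mul_comm]
  rw [e2] at h3 h4
  simp only [Prod.smul_fst, Prod.smul_snd] at h3 h4 ⊢
  rw [abs_le] at *
  constructor <;> nlinarith

lemma exists_isCut (D : ℕ) : ∃ w : Euc D → ℝ, IsCut w 1 2 := by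
  let η : ContDiffBump (0 : Euc D) := ⟨1, 2, by norm_num, by norm_num⟩
  refine ⟨η, η.contDiff, one_pos, fun y hy => ?_, fun y hy => ?_⟩
  · exact η.one_of_mem_closedBall (by simpa using hy.le)
  · exact η.zero_of_le_dist (by simpa using hy.le)

namespace KernelData

variable (d d' : KernelData D)

/-- Two parametrices differ by a smooth function. -/
theorem exists_smooth_sub : ∃ g : ℝ → Euc D → ℝ, Smooth₂ g ∧
    ∀ μ u, u ≠ 0 → d'.E μ u = d.E μ u + g μ u := by
  classical
  obtain ⟨w, hw⟩ := exists_isCut D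
  set G : ℝ × Euc D → ℝ := fun q =>
    (∫ y, (w y * d.E q.1 (y - q.2)) * (d'.h q.1 y - d.h q.1 y))
      - ∫ y, d.errK w (q.1, q.2) y * (d'.E q.1 y - d.E q.1 y) with hG
  have hdh : Smooth (fun q : ℝ × Euc D => d'.h q.1 q.2 - d.h q.1 q.2) := d'.hh.sub d.hh
  have hsm : SmoothOn G {q | ‖q.2‖ < 1} := by
    have ho : IsOpen {q : ℝ × Euc D | ‖q.2‖ < 1} :=
      isOpen_lt (by fun_prop) continuous_const
    have h1 := (d.contDiffOn_integral_E hw hdh).comp (s := {q : ℝ × Euc D | ‖q.2‖ < 1})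
      (f := fun q : ℝ × Euc D => (q.1, q.2, (0 : Euc D))) (by fun_prop)
      (fun q hq => ⟨hq, by simp⟩)
    have c1 : SmoothOn (fun q : (ℝ × Euc D) × Euc D => d.errK w q.1 q.2)
      ({p | ‖p.2‖ < 1} ×ˢ univ) := d.contDiffOn_errK hw
    have h2 : ∀ d₁ : KernelData D, SmoothOn
        (fun q : ℝ × Euc D => ∫ u, d₁.E q.1 u * d.errK w q u) {q | ‖q.2‖ < 1} := fun d₁ =>
      contDiffOn_integral_singKer d₁.hD (P := ℝ × Euc D)
        (a := fun μ u => d₁.e (μ * ‖u‖ ^ 2)) (b := fun μ u => d₁.v (μ * ‖u‖ ^ 2))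
        (m := fun q => q.1) contDiff_fst (contDiff_radial d₁.he) (contDiff_radial d₁.hv) ho
        (isCompact_closedBall (0 : Euc D) 2)
        (Φ := fun q u => d.errK w q u)
        (fun p hp u hu => d.errK_eq_zero hw hp (by simpa using hu)) c1
    refine (h1.sub ((h2 d').sub (h2 d))).congr fun q hq => ?_
    have hk := (d.contDiff_errK_slice hw (p := q) hq).continuous
    have hkc := d.hasCompactSupport_errK hw (p := q) hq
    have i1 := integrable_mul_of_compact (d'.locallyIntegrable_E q.1) hk hkc
    have i2 := integrable_mul_of_compact (d.locallyIntegrable_E q.1) hk hkc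
    simp only [hG, Function.comp, sub_zero]
    rw [← integral_sub i1 i2]
    congr 1
    exact integral_congr_fun fun u => by ring
  have hG0 : ∀ (μ : ℝ) (u : Euc D), u ≠ 0 → ‖u‖ < 1 → d'.E μ u - d.E μ u = G (μ, u) := by
    intro μ u hu hu1
    have t1 : LocallyIntegrable fun y => d'.E μ y - d.E μ y :=
      (d'.locallyIntegrable_E μ).sub (d.locallyIntegrable_E μ)
    have t2 : LocallyIntegrable fun y => d'.h μ y - d.h μ y :=
      ((d'.contDiff_h_slice μ).sub (d.contDiff_h_slice μ)).continuous.locallyIntegrable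
    have t3 : ∀ d₁ : KernelData D, SmoothOn (d₁.E μ) {0}ᶜ := fun d₁ => by
      simpa using d₁.contDiffOn_E_sub μ 0
    have t4 : ∀ (d₁ : KernelData D) (y : Euc D), y ≠ 0 → kg μ (d₁.E μ) y = d₁.h μ y :=
      fun d₁ y hy => by simpa using d₁.kg_E_sub μ hy
    have key := d.green_cut hw (μ := μ) hu hu1 (F := fun y => d'.E μ y - d.E μ y)
      (s := fun y => d'.h μ y - d.h μ y) ((t3 d').sub (t3 d)) t1 t2 ?_ ?_
    · simp only [hG]
      linarith
    · intro ψ hψ hc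
      have i1 := integrable_mul_kg (d'.locallyIntegrable_E μ) hψ hc μ
      have i2 := integrable_mul_kg (d.locallyIntegrable_E μ) hψ hc μ
      have i3 := integrable_mul_of_compact (d'.contDiff_h_slice μ).continuous.locallyIntegrable
        hψ.continuous hc
      have i4 := integrable_mul_of_compact (d.contDiff_h_slice μ).continuous.locallyIntegrable
        hψ.continuous hc
      simp only [sub_mul]
      rw [integral_sub i1 i2, integral_sub i3 i4, d.weak μ ψ hψ hc, d'.weak μ ψ hψ hc]
      ring
    · intro y hy
      rw [kg_sub isOpen_compl_singleton (t3 d') (t3 d) hy, t4 d y hy, t4 d' y hy]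
  refine ⟨fun μ u => if u = 0 then G (μ, 0) else d'.E μ u - d.E μ u, ?_, ?_⟩
  · rw [contDiff_iff_contDiffAt]
    rintro ⟨μ, u⟩
    by_cases hu : u = 0
    · subst hu
      have ho : {q : ℝ × Euc D | ‖q.2‖ < 1} ∈ 𝓝 (μ, (0 : Euc D)) :=
        (isOpen_lt (by fun_prop) continuous_const).mem_nhds (by simp)
      refine (hsm.contDiffAt ho).congr_of_eventuallyEq ?_
      filter_upwards [ho] with q hq
      split_ifs with h
      · rw [← h]
      · exact hG0 q.1 q.2 h hq
    · have ho : {q : ℝ × Euc D | q.2 ≠ 0} ∈ 𝓝 (μ, u) :=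
        (isOpen_ne_fun continuous_snd continuous_const).mem_nhds hu
      refine ((d'.contDiffOn_E.sub d.contDiffOn_E).contDiffAt ho).congr_of_eventuallyEq ?_
      filter_upwards [ho] with q hq
      rw [if_neg hq]
  · intro μ u hu
    simp only [if_neg hu]
    ring

end KernelData

end Comparison

/-! ### Taylor coefficients and their dependence on the weight -/

section TaylorCoefficients

variable {D : ℕ} {u u' a b : Euc D} {W f : Euc D → ℝ}

namespace KernelData

variable (d : KernelData D) {w : Euc D → ℝ} {ρ R : ℝ}

/-- The Taylor coefficients of the regular expression. -/
def T (w : Euc D → ℝ) (γ : MultiIdx₂ D) (μ : ℝ) : ℝ :=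
  jetM γ (d.qreg w μ)

lemma contDiffOn_qreg_slice (hw : IsCut w ρ R) (μ : ℝ) :
    SmoothOn (fun p : Euc₂ D => d.qreg w μ p.1 p.2) (𝔹₂ ρ) :=
  (d.contDiffOn_qreg hw).comp (f := fun p : Euc₂ D => (μ, p)) (by fun_prop) fun _ hp => hp

/-- The Taylor coefficients at the origin of a smooth family depend smoothly on the parameter. -/
lemma contDiff_jet_param {q : ℝ → Euc D → Euc D → ℝ} {ρ : ℝ} (hρ : 0 < ρ)
    (hq : SmoothOn (fun p : ℝ × Euc₂ D => q p.1 p.2.1 p.2.2)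
      {p | ‖p.2.1‖ < ρ ∧ ‖p.2.2‖ < ρ}) (l l' : List (Fin D)) :
    Smooth fun μ => jet l l' (q μ) := by
  have o1 : IsOpen {p : (ℝ × Euc D) × Euc D | ‖p.1.2‖ < ρ ∧ ‖p.2‖ < ρ} :=
    IsOpen.and (isOpen_lt (by fun_prop) continuous_const) (isOpen_lt (by fun_prop) continuous_const)
  have o2 : IsOpen {p : ℝ × Euc D | ‖p.2‖ < ρ} :=
    isOpen_lt (by fun_prop) continuous_const
  have h1 : SmoothOn (fun p : (ℝ × Euc D) × Euc D => q p.1.1 p.1.2 p.2)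
      {p | ‖p.1.2‖ < ρ ∧ ‖p.2‖ < ρ} :=
    hq.comp (f := fun p : (ℝ × Euc D) × Euc D => (p.1.1, p.1.2, p.2)) (by fun_prop) fun _ hp => hp
  have h2 := contDiffOn_iterD_param (P := ℝ × Euc D) (Ψ := fun p b => q p.1 p.2 b) o1 h1 l'
  have h3 : SmoothOn (fun p : ℝ × Euc D => iterD l' (fun b => q p.1 p.2 b) 0)
      {p | ‖p.2‖ < ρ} :=
    h2.comp (f := fun p : ℝ × Euc D => (p, (0 : Euc D))) (by fun_prop)
      fun p hp => ⟨hp, by simpa using hρ⟩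
  have h4 := contDiffOn_iterD_param (P := ℝ)
    (Ψ := fun μ a => iterD l' (fun b => q μ a b) 0) o2 h3 l
  rw [← contDiffOn_univ]
  exact h4.comp (f := fun μ : ℝ => (μ, (0 : Euc D))) (by fun_prop)
    fun μ _ => show ‖(0 : Euc D)‖ < ρ by simpa using hρ

lemma contDiff_T (hw : IsCut w ρ R) (γ : MultiIdx₂ D) : Smooth (d.T w γ) :=
  contDiff_jet_param hw.pos (d.contDiffOn_qreg hw) _ _

lemma exists_bound_T (hw : IsCut w ρ R) (μ : ℝ) (δ : ℕ) :
    ∃ C : ℝ, 0 ≤ C ∧ ∃ r : ℝ, 0 < r ∧ ∀ p : Euc₂ D, ‖p‖ ≤ r →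
      |d.qreg w μ p.1 p.2 - pairPoly δ (fun γ => d.T w γ μ) p.1 p.2| ≤ C * ‖p‖ ^ (δ + 1) :=
  exists_bound_sub_pairPoly_of_contDiffOn δ isOpen_two_balls (zero_mem_two_balls hw.pos)
    (d.contDiffOn_qreg_slice hw μ)

lemma E_eq_of_norm_eq (μ : ℝ) (h : ‖u‖ = ‖u'‖) : d.E μ u = d.E μ u' := by
  simp [hadKer, singKer, singA, singB, h]

lemma E'_eq_of_norm_eq (μ : ℝ) (h : ‖u‖ = ‖u'‖) : d.E' μ u = d.E' μ u' := by
  simp [dhadKer, singKer, singA, singB, h]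

lemma qreg_comm_of_ne (hw : IsCut w ρ R) (μ : ℝ) (hab : a ≠ b) (ha : ‖a‖ < ρ)
    (hb : ‖b‖ < ρ) : d.qreg w μ b a = d.qreg w μ a b := by
  rw [← d.qreg_eq hw μ hab ha, ← d.qreg_eq hw μ hab.symm hb,
    d.E'_eq_of_norm_eq μ (norm_sub_rev b a)]
  congr 1
  exact integral_congr_fun fun y => by ring

lemma qreg_comm (hw : IsCut w ρ R) (μ : ℝ) (ha : ‖a‖ < ρ) (hb : ‖b‖ < ρ) :
    d.qreg w μ b a = d.qreg w μ a b := by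
  have := d.neZero
  have h1 := (d.contDiffOn_qreg_slice hw μ).continuousOn
  have h2 : ContinuousOn (fun p : Euc₂ D => d.qreg w μ p.2 p.1)
      (𝔹₂ ρ) :=
    h1.comp (f := fun p : Euc₂ D => (p.2, p.1)) (by fun_prop) fun p hp => ⟨hp.2, hp.1⟩
  exact eqOn_of_eqOn_offDiag isOpen_two_balls h2 h1
    (fun p hp hne => d.qreg_comm_of_ne hw μ hne hp.1 hp.2) (x := (a, b)) ⟨ha, hb⟩

lemma qreg_map (hw : IsCut w ρ R) (hr : ∀ y y', ‖y‖ = ‖y'‖ → w y = w y')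
    (g : Euc D ≃ₗᵢ[ℝ] Euc D) (μ : ℝ) (ha : ‖a‖ < ρ) (hb : ‖b‖ < ρ) :
    d.qreg w μ (g a) (g b) = d.qreg w μ a b := by
  have := d.neZero
  have h1 := (d.contDiffOn_qreg_slice hw μ).continuousOn
  have h2 : ContinuousOn (fun p : Euc₂ D => d.qreg w μ (g p.1) (g p.2))
      (𝔹₂ ρ) :=
    h1.comp (f := fun p : Euc₂ D => (g p.1, g p.2))
      (((g.continuous.comp continuous_fst).prodMk (g.continuous.comp continuous_snd)).continuousOn)
      fun p hp => by simpa using hp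
  refine eqOn_of_eqOn_offDiag isOpen_two_balls h2 h1
    (fun p hp hne => ?_) (x := (a, b)) ⟨ha, hb⟩
  rw [← d.qreg_eq hw μ hne hp.1,
    ← d.qreg_eq hw μ (g.injective.ne hne) (by rw [g.norm_map]; exact hp.1), ← map_sub,
    d.E'_eq_of_norm_eq μ (g.norm_map _)]
  congr 1
  rw [← (g.measurePreserving).integral_comp g.toHomeomorph.measurableEmbedding]
  refine integral_congr_fun fun y => ?_
  rw [hr (g y) y (g.norm_map y), ← map_sub, ← map_sub, d.E_eq_of_norm_eq μ (g.norm_map _),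
    d.E_eq_of_norm_eq μ (g.norm_map (y - p.2))]

lemma T_swap (hw : IsCut w ρ R) (μ : ℝ) (γ : MultiIdx₂ D) :
    d.T w γ.swap μ = d.T w γ μ := by
  have := d.neZero
  set δ := γ.1.order + γ.2.order with hδ
  have h0 := pairPoly_jetM_invariant (δ := δ) hw.pos (d.contDiffOn_qreg_slice hw μ)
    (LinearIsometryEquiv.prodComm ℝ (Euc D) (Euc D)) (fun p h1 h2 => d.qreg_comm hw μ h1 h2)
  have h1 : ∀ a b : Euc D, pairPoly δ (fun γ => d.T w γ.swap μ - d.T w γ μ) a b = 0 := by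
    intro a b
    have h2 := h0 (a, b)
    have h3 : pairPoly δ (fun γ => jetM γ (d.qreg w μ)) b a
        = pairPoly δ (fun γ => d.T w γ.swap μ) a b := by
      refine sum_equiv (Equiv.prodComm _ _) (fun γ => ?_) fun γ _ => ?_
      · simp [mem_pairsUpTo, add_comm]
      · simp only [T, Equiv.prodComm_apply, Prod.swap_swap, Prod.fst_swap, Prod.snd_swap]
        ring
    have h4 : pairPoly δ (fun γ => jetM γ (d.qreg w μ)) b a
        = pairPoly δ (fun γ => d.T w γ μ) a b := h2
    have h5 : pairPoly δ (fun γ => d.T w γ.swap μ - d.T w γ μ) a b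
        = pairPoly δ (fun γ => d.T w γ.swap μ) a b - pairPoly δ (fun γ => d.T w γ μ) a b := by
      simp only [pairPoly, ← sum_sub_distrib, sub_mul]
    rw [h5, ← h3, h4, sub_self]
  have h2 := pairPoly_eq_zero_of_offDiag (fun a b _ => h1 a b) (mem_pairsUpTo.2 hδ.ge)
  linarith

lemma pairPoly_T_map (hw : IsCut w ρ R) (hr : ∀ y y', ‖y‖ = ‖y'‖ → w y = w y')
    (g : Euc D ≃ₗᵢ[ℝ] Euc D) (μ : ℝ) (δ : ℕ) (a b : Euc D) :
    pairPoly δ (fun γ => d.T w γ μ) (g a) (g b) = pairPoly δ (fun γ => d.T w γ μ) a b := by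
  let G : Euc₂ D ≃ₗᵢ[ℝ] Euc₂ D :=
    ⟨g.toLinearEquiv.prodCongr g.toLinearEquiv, fun p => by
      simp [Prod.norm_def]⟩
  exact pairPoly_jetM_invariant (δ := δ) hw.pos (d.contDiffOn_qreg_slice hw μ) G
    (fun p h1 h2 => d.qreg_map hw hr g μ h1 h2) (a, b)

/-- The derivative `∂_l E(y - a)` with respect to `a` at `a = 0`. -/
def dE (l : List (Fin D)) (μ : ℝ) (y : Euc D) : ℝ :=
  iterD l (fun a => d.E μ (y - a)) 0

lemma contDiffOn_E_diff :
    SmoothOn (fun q : (ℝ × Euc D) × Euc D => d.E q.1.1 (q.1.2 - q.2)) {q | q.1.2 ≠ q.2} :=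
  d.contDiffOn_E.comp (f := fun q : (ℝ × Euc D) × Euc D => (q.1.1, q.1.2 - q.2)) (by fun_prop)
    fun _ hq => sub_ne_zero.2 hq

lemma contDiffOn_dE (l : List (Fin D)) :
    SmoothOn (fun q : ℝ × Euc D => d.dE l q.1 q.2) {q | q.2 ≠ 0} := by
  have ho : IsOpen {q : (ℝ × Euc D) × Euc D | q.1.2 ≠ q.2} :=
    isOpen_ne_fun (continuous_snd.comp continuous_fst) continuous_snd
  have := contDiffOn_iterD_param (P := ℝ × Euc D) (Ψ := fun p a => d.E p.1 (p.2 - a)) ho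
    d.contDiffOn_E_diff l
  exact this.comp (f := fun q : ℝ × Euc D => (q, (0 : Euc D))) (by fun_prop) fun _ hq => hq

/-- A weight which vanishes near the origin cuts off the singularities there. -/
lemma contDiffAt_mul_of_vanish {P : Type*} [NormedAddCommGroup P] [NormedSpace ℝ P]
    (hW : Smooth W) (h0 : ∀ y, ‖y‖ < ρ → W y = 0) {F : P × Euc D → ℝ}
    {q₀ : P × Euc D} (hF : ρ ≤ ‖q₀.2‖ → ContDiffAt ℝ ∞ F q₀) :
    ContDiffAt ℝ ∞ (fun q : P × Euc D => W q.2 * F q) q₀ := by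
  rcases lt_or_ge ‖q₀.2‖ ρ with hy | hy
  · have ho : IsOpen {q : P × Euc D | ‖q.2‖ < ρ} := isOpen_lt (by fun_prop) continuous_const
    refine contDiffAt_of_eventually_zero ?_
    filter_upwards [ho.mem_nhds hy] with q hq
    rw [h0 _ hq, zero_mul]
  · exact (hW.comp contDiff_snd).contDiffAt.mul (hF hy)

lemma ne_zero_of_norm_lt {y : Euc D} {r : ℝ} (ha : ‖a‖ < r) (hy : r ≤ ‖y‖) : y - a ≠ 0 :=
  sub_ne_zero.2 fun h => (h ▸ ha).not_ge hy

lemma contDiffOn_weighted (hW : Smooth W) (h0 : ∀ y, ‖y‖ < ρ → W y = 0)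
    (hf : SmoothOn f {y | ρ / 2 < ‖y‖}) (μ : ℝ) :
    SmoothOn (fun q : Euc₂ D => W q.2 * f q.2 * d.E μ (q.2 - q.1))
      ({a | ‖a‖ < ρ / 2} ×ˢ univ) := by
  simp only [mul_assoc]
  rintro ⟨a, y⟩ ⟨ha, -⟩
  replace ha : ‖a‖ < ρ / 2 := ha
  have hρ := norm_nonneg a
  refine (contDiffAt_mul_of_vanish hW h0 fun hy => ?_).contDiffWithinAt
  replace hy : ρ ≤ ‖y‖ := hy
  have h4 : ContDiffAt ℝ ∞ f y := hf.contDiffAt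
    ((isOpen_lt continuous_const continuous_norm).mem_nhds (show ρ / 2 < ‖y‖ by linarith))
  have h5 : ContDiffAt ℝ ∞ (fun q : Euc₂ D => f q.2) (a, y) :=
    ContDiffAt.comp (g := f) (a, y) h4 contDiffAt_snd
  exact h5.mul (d.contDiffAt_E_comp contDiffAt_const (by fun_prop)
    (ne_zero_of_norm_lt ha (by linarith : ρ / 2 ≤ ‖y‖)))

lemma iterD_integral_weighted (hW : Smooth W) (h0 : ∀ y, ‖y‖ < ρ → W y = 0)
    (hR : ∀ y, R < ‖y‖ → W y = 0) (hρ : 0 < ρ) (hf : SmoothOn f {y | ρ / 2 < ‖y‖})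
    (μ : ℝ) (l : List (Fin D)) :
    iterD l (fun a => ∫ y, W y * f y * d.E μ (y - a)) 0 = ∫ y, W y * f y * d.dE l μ y := by
  have ho : IsOpen {a : Euc D | ‖a‖ < ρ / 2} := isOpen_lt continuous_norm continuous_const
  have h0m : (0 : Euc D) ∈ {a : Euc D | ‖a‖ < ρ / 2} := by
    show ‖(0 : Euc D)‖ < ρ / 2
    simpa using hρ
  have h1 := iterD_integral_param (f := fun _ : Euc D => (1 : ℝ)) (ν := volume)
    (locallyIntegrable_const 1) ho (isCompact_closedBall (0 : Euc D) R)
    (Φ := fun a y => W y * f y * d.E μ (y - a))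
    (fun a _ y hy => by rw [hR y (by simpa using hy), zero_mul, zero_mul])
    (d.contDiffOn_weighted hW h0 hf μ) l h0m
  simp only [one_mul] at h1
  rw [h1]
  refine integral_congr_fun fun y => ?_
  by_cases hy : ‖y‖ < ρ
  · simp [h0 y hy, iterD_zero]
  · refine iterD_const_mul (W y * f y) ho (f := fun a => d.E μ (y - a)) ?_ l h0m
    refine d.contDiffOn_E.comp (f := fun a : Euc D => (μ, y - a)) (by fun_prop) fun a ha => ?_
    refine sub_ne_zero.2 fun h => ?_
    subst h
    replace ha : ‖y‖ < ρ / 2 := ha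
    linarith

lemma jet_integral_weighted (hW : Smooth W) (h0 : ∀ y, ‖y‖ < ρ → W y = 0)
    (hR : ∀ y, R < ‖y‖ → W y = 0) (hρ : 0 < ρ) (μ : ℝ) (l l' : List (Fin D)) :
    jet l l' (fun a b => ∫ y, W y * (d.E μ (y - a) * d.E μ (y - b)))
      = ∫ y, W y * (d.dE l μ y * d.dE l' μ y) := by
  unfold jet
  have h1 : ∀ a : Euc D, ‖a‖ < ρ / 2 →
      iterD l' (fun b => ∫ y, W y * (d.E μ (y - a) * d.E μ (y - b))) 0
        = ∫ y, W y * d.dE l' μ y * d.E μ (y - a) := by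
    intro a ha
    have := d.iterD_integral_weighted hW h0 hR hρ (f := fun y => d.E μ (y - a))
      ((d.contDiffOn_E_sub μ a).mono fun y hy h => by
        rw [Set.mem_singleton_iff] at h
        subst h
        replace hy : ρ / 2 < ‖y‖ := hy
        linarith) μ l'
    simp only [← mul_assoc]
    rw [this]
    exact integral_congr_fun fun y => by ring
  have hev : (fun a => iterD l' (fun b => ∫ y, W y * (d.E μ (y - a) * d.E μ (y - b))) 0)
      =ᶠ[𝓝 0] fun a => ∫ y, W y * d.dE l' μ y * d.E μ (y - a) := by
    filter_upwards [(isOpen_lt continuous_norm continuous_const).mem_nhds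
      (show ‖(0 : Euc D)‖ < ρ / 2 by simpa using hρ)] with a ha
    exact h1 a ha
  rw [iterD_congr_nhds hev, d.iterD_integral_weighted hW h0 hR hρ ?_ μ l]
  · exact integral_congr_fun fun y => by ring
  · refine (d.contDiffOn_dE l').comp (f := fun y : Euc D => (μ, y)) (by fun_prop) fun y hy h => ?_
    replace hy : ρ / 2 < ‖y‖ := hy
    rw [show y = 0 from h, norm_zero] at hy
    linarith

lemma contDiffOn_weighted_pair (hW : Smooth W) (h0 : ∀ y, ‖y‖ < ρ → W y = 0) (μ : ℝ) :
    SmoothOn (fun q : (Euc₂ D) × Euc D =>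
      W q.2 * (d.E μ (q.2 - q.1.1) * d.E μ (q.2 - q.1.2)))
      ((𝔹₂ ρ : Set (Euc₂ D)) ×ˢ univ) := by
  rintro ⟨⟨a, b⟩, y⟩ ⟨⟨ha, hb⟩, -⟩
  refine (contDiffAt_mul_of_vanish hW h0 fun hy => ?_).contDiffWithinAt
  exact .mul (d.contDiffAt_E_comp contDiffAt_const (by fun_prop) (ne_zero_of_norm_lt ha hy))
    (d.contDiffAt_E_comp contDiffAt_const (by fun_prop) (ne_zero_of_norm_lt hb hy))

lemma contDiffOn_integral_weighted (hW : Smooth W)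
    (h0 : ∀ y, ‖y‖ < ρ → W y = 0) (hR : ∀ y, R < ‖y‖ → W y = 0) (μ : ℝ) :
    SmoothOn (fun p : Euc₂ D => ∫ y, W y * (d.E μ (y - p.1) * d.E μ (y - p.2)))
      (𝔹₂ ρ) := by
  have h1 : ∀ p ∈ (𝔹₂ ρ : Set (Euc₂ D)), ∀ y,
      y ∉ closedBall (0 : Euc D) R → W y * (d.E μ (y - p.1) * d.E μ (y - p.2)) = 0 :=
    fun p _ y hy => by rw [hR y (by simpa using hy), zero_mul]
  have := contDiffOn_integral_param (f := fun _ : Euc D => (1 : ℝ)) (ν := volume)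
    (locallyIntegrable_const 1) isOpen_two_balls (isCompact_closedBall (0 : Euc D) R)
    (Φ := fun (p : Euc₂ D) y => W y * (d.E μ (y - p.1) * d.E μ (y - p.2))) h1
    (d.contDiffOn_weighted_pair hW h0 μ)
  simpa only [one_mul] using this

/-- The dependence of the Taylor coefficients on the cutoff. -/
theorem T_sub {w' : Euc D → ℝ} {ρ' R' : ℝ} (hw : IsCut w ρ R) (hw' : IsCut w' ρ' R')
    (γ : MultiIdx₂ D) (μ : ℝ) :
    d.T w γ μ - d.T w' γ μ
      = ∫ y, (w y - w' y) * (d.dE (idxList γ.1) μ y * d.dE (idxList γ.2) μ y) := by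
  have := d.neZero
  set r := min ρ ρ' with hr
  have hrpos : 0 < r := lt_min hw.pos hw'.pos
  have hW : Smooth fun y => w y - w' y := hw.smooth.sub hw'.smooth
  have hW0 : ∀ y, ‖y‖ < r → w y - w' y = 0 := fun y hy => by
    rw [hw.eq_one y (hy.trans_le (min_le_left _ _)), hw'.eq_one y (hy.trans_le (min_le_right _ _)),
      sub_self]
  have hWR : ∀ y, max R R' < ‖y‖ → w y - w' y = 0 := fun y hy => by
    rw [hw.eq_zero y ((le_max_left _ _).trans_lt hy),
      hw'.eq_zero y ((le_max_right _ _).trans_lt hy), sub_self]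
  rw [← d.jet_integral_weighted hW hW0 hWR hrpos]
  have h0 : (0 : Euc₂ D) ∈ (𝔹₂ r : Set (Euc₂ D)) :=
    zero_mem_two_balls hrpos
  have s1 := (d.contDiffOn_qreg_slice hw μ).mono (t := (𝔹₂ r : Set (Euc₂ D)))
    fun p hp => ⟨hp.1.trans_le (min_le_left _ _), hp.2.trans_le (min_le_left _ _)⟩
  have s2 := (d.contDiffOn_qreg_slice hw' μ).mono (t := (𝔹₂ r : Set (Euc₂ D)))
    fun p hp => ⟨hp.1.trans_le (min_le_right _ _), hp.2.trans_le (min_le_right _ _)⟩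
  obtain ⟨g, hg, hge⟩ := exists_contDiff_eventuallyEq isOpen_two_balls s1 h0
  obtain ⟨g', hg', hge'⟩ := exists_contDiff_eventuallyEq isOpen_two_balls s2 h0
  have e1 : d.T w γ μ = jetM γ fun a b => g (a, b) :=
    (jet_congr_nhds (q := fun a b => g (a, b)) (q' := d.qreg w μ) hge _ _).symm
  have e2 : d.T w' γ μ = jetM γ fun a b => g' (a, b) :=
    (jet_congr_nhds (q := fun a b => g' (a, b)) (q' := d.qreg w' μ) hge' _ _).symm
  rw [e1, e2, jetM, jetM, ← jet_sub hg hg']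
  have e3 : jet (idxList γ.1) (idxList γ.2) (fun a b => g (a, b) - g' (a, b))
      = jet (idxList γ.1) (idxList γ.2) (fun a b => d.qreg w μ a b - d.qreg w' μ a b) := by
    refine jet_congr_nhds ?_ _ _
    filter_upwards [hge, hge'] with p hp hp'
    rw [show g (p.1, p.2) = d.qreg w μ p.1 p.2 from hp,
      show g' (p.1, p.2) = d.qreg w' μ p.1 p.2 from hp']
  rw [e3]
  refine jet_congr_offDiag isOpen_two_balls h0 (s1.sub s2).continuousOn
    (d.contDiffOn_integral_weighted hW hW0 hWR μ).continuousOn (fun p hp hne => ?_) _ _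
  have i1 := d.integrable_cut_E_E hw.smooth.continuous hw.hasCompactSupport μ hne
  have i2 := d.integrable_cut_E_E hw'.smooth.continuous hw'.hasCompactSupport μ hne
  rw [← d.qreg_eq hw μ hne (hp.1.trans_le (min_le_left _ _)),
    ← d.qreg_eq hw' μ hne (hp.1.trans_le (min_le_right _ _)), add_sub_add_left_eq_sub,
    ← integral_sub i1 i2]
  exact integral_congr_fun fun y => by ring

end KernelData

end TaylorCoefficients

/-! ### Hadamard parametrices and their radial kernels -/

section Structure

variable {D : ℕ} {u u' : Euc D}

lemma exists_isometry_of_norm_eq (h : ‖u‖ = ‖u'‖) :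
    ∃ g : Euc D ≃ₗᵢ[ℝ] Euc D, g u = u' :=
  ⟨_, Submodule.reflection_sub h⟩

lemma hadKer_scaling (e v : ℝ → ℝ) {l : ℝ} (hl : 0 < l) (μ : ℝ)
    (hu : u ≠ 0) : hadKer D e v (l ^ 2 * μ) (l⁻¹ • u)
      = l ^ (D - 2) * (hadKer D e v μ u + (singA D u * v (μ * ‖u‖ ^ 2)) * log (l ^ 2)) := by
  have hn : 0 < ‖u‖ := norm_pos_iff.2 hu
  have e1 : l ^ 2 * μ * ‖l⁻¹ • u‖ ^ 2 = μ * ‖u‖ ^ 2 := by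
    rw [norm_smul, norm_of_nonneg (inv_nonneg.2 hl.le)]
    field_simp
  have e2 : singA D (l⁻¹ • u) = l ^ (D - 2) * singA D u := by
    simp only [singA]
    rw [norm_smul, norm_of_nonneg (inv_nonneg.2 hl.le), mul_pow, mul_inv, inv_pow, inv_inv]
  have e3 : log (‖l⁻¹ • u‖ ^ 2) = log (‖u‖ ^ 2) - log (l ^ 2) := by
    rw [norm_smul, norm_of_nonneg (inv_nonneg.2 hl.le), mul_pow,
      Real.log_mul (by positivity) (by positivity), inv_pow, Real.log_inv]
    ring
  simp only [hadKer, singKer, singB] at *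
  rw [e1]
  have e4 : (‖l⁻¹ • u‖ ^ (D - 2))⁻¹ = l ^ (D - 2) * (‖u‖ ^ (D - 2))⁻¹ := e2
  rw [e2, e3, e4]
  simp only [singA]
  ring

variable {H : ℝ → Euc D → Euc D → ℝ}

lemma eq_sub_of_invariant
    (hH : ∀ μ (g : Euc D ≃ᵢ Euc D) x y, H μ (g x) (g y) = H μ x y) (μ : ℝ) (x y : Euc D) :
    H μ x y = H μ (x - y) 0 := by
  have := hH μ (IsometryEquiv.subRight y) x y
  simpa using this.symm

lemma eq_of_norm_eq_of_invariant
    (hH : ∀ μ (g : Euc D ≃ᵢ Euc D) x y, H μ (g x) (g y) = H μ x y) (μ : ℝ)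
    (h : ‖u‖ = ‖u'‖) : H μ u 0 = H μ u' 0 := by
  obtain ⟨g, hg⟩ := exists_isometry_of_norm_eq h
  have := hH μ g.toIsometryEquiv u 0
  rw [← this]
  simp [hg]

/-- Off the diagonal, `H` is given by the radial kernel of `d`. -/
def KernelData.Represents (d : KernelData D) (H : ℝ → Euc D → Euc D → ℝ) : Prop :=
  ∀ μ x y, x ≠ y → H μ x y = d.E μ (x - y)

namespace IsHadamardParametrix

/-- A Euclidean-invariant Hadamard parametrix is given by a radial kernel: scaling to `|u| = 1`
determines it by two smooth functions of `μ |u|²`, the second of which belongs to the logarithmic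
term. -/
theorem exists_kernel (hD : 2 ≤ D) (hH : IsHadamardParametrix H) :
    ∃ d : KernelData D, d.Represents H ∧
      ∃ V : ℝ → Euc D → ℝ, Smooth₂ V ∧
        ∀ μ u, u ≠ 0 → V μ u = singA D u * d.v (μ * ‖u‖ ^ 2) := by
  have hne : NeZero D := ⟨by omega⟩
  obtain ⟨V, hV, hVs⟩ := hH.scaling
  obtain ⟨h, hh, -, hw⟩ := hH.parametrix
  set e₁ : Euc D := 𝐞 0 with he₁
  have hn₁ : ‖e₁‖ = 1 := by simp [he₁]
  have hne₁ : e₁ ≠ 0 := norm_pos_iff.1 (by rw [hn₁]; exact one_pos)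
  have hs : ∀ (l : ℝ), 0 < l → ∀ (μ : ℝ) (x : Euc D), x ≠ 0 →
      H (l ^ 2 * μ) (l⁻¹ • x) 0 = l ^ (D - 2) * (H μ x 0 + V μ x 0 * log (l ^ 2)) := by
    intro l hl μ x hx
    have := hVs l hl μ x 0 hx
    rwa [smul_zero] at this
  have hlog : log ((2 : ℝ) ^ 2) ≠ 0 := by
    have : 0 < log ((2 : ℝ) ^ 2) := Real.log_pos (by norm_num)
    exact this.ne'
  -- the logarithmic term is invariant and exactly homogeneous, being determined by `H`
  have hVn : ∀ (μ : ℝ) {u u' : Euc D}, u ≠ 0 → ‖u‖ = ‖u'‖ → V μ u 0 = V μ u' 0 := by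
    intro μ u u' hu huu
    have hu' : u' ≠ 0 := norm_ne_zero_iff.1 (huu ▸ norm_ne_zero_iff.2 hu)
    have h1 := hs 2 two_pos μ u hu
    have h2 := hs 2 two_pos μ u' hu'
    rw [eq_of_norm_eq_of_invariant hH.invariant (u := (2 : ℝ)⁻¹ • u) (u' := (2 : ℝ)⁻¹ • u') _ (by
      rw [norm_smul, norm_smul, huu]), h2, eq_of_norm_eq_of_invariant hH.invariant μ huu] at h1
    have h3 := mul_left_cancel₀ (pow_ne_zero _ two_ne_zero) h1
    exact (mul_right_cancel₀ hlog (add_left_cancel h3)).symm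
  have hVh : ∀ (l : ℝ), 0 < l → ∀ (μ : ℝ) (x : Euc D), x ≠ 0 →
      V (l ^ 2 * μ) (l⁻¹ • x) 0 = l ^ (D - 2) * V μ x 0 := by
    intro l hl μ x hx
    have h1 := hs (2 * l) (by positivity) μ x hx
    have h2 := hs 2 two_pos (l ^ 2 * μ) (l⁻¹ • x) (smul_ne_zero (inv_ne_zero hl.ne') hx)
    rw [hs l hl μ x hx, smul_smul] at h2
    rw [show (2 * l) ^ 2 * μ = 2 ^ 2 * (l ^ 2 * μ) by ring, mul_inv, h2, mul_pow, mul_pow,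
      Real.log_mul (by norm_num) (by positivity)] at h1
    have h3 : (2 : ℝ) ^ (D - 2) ≠ 0 := pow_ne_zero _ two_ne_zero
    rw [mul_assoc] at h1
    have h4 := mul_left_cancel₀ h3 h1
    have h5 : V (l ^ 2 * μ) (l⁻¹ • x) 0 * log ((2 : ℝ) ^ 2)
        = (l ^ (D - 2) * V μ x 0) * log ((2 : ℝ) ^ 2) := by linarith
    exact mul_right_cancel₀ hlog h5
  have hunit : ∀ u : Euc D, u ≠ 0 → ‖‖u‖⁻¹ • u‖ = ‖e₁‖ := fun u hu => by
    rw [norm_smul, norm_inv, norm_norm, inv_mul_cancel₀ (norm_ne_zero_iff.2 hu), hn₁]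
  set e : ℝ → ℝ := fun t => H t e₁ 0 with he
  set v : ℝ → ℝ := fun t => V t e₁ 0 with hv
  have hVv : ∀ μ (u : Euc D), u ≠ 0 → V μ u 0 = singA D u * v (μ * ‖u‖ ^ 2) := by
    intro μ u hu
    have hn : 0 < ‖u‖ := norm_pos_iff.2 hu
    have h1 := hVh ‖u‖ hn μ u hu
    rw [hVn _ (smul_ne_zero (inv_ne_zero hn.ne') hu) (hunit u hu), mul_comm (‖u‖ ^ 2)] at h1
    simp only [hv, singA]
    rw [h1, inv_mul_cancel_left₀ (pow_ne_zero _ hn.ne')]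
  have hE : ∀ μ (u : Euc D), u ≠ 0 → H μ u 0 = hadKer D e v μ u := by
    intro μ u hu
    have hn : 0 < ‖u‖ := norm_pos_iff.2 hu
    have h1 := hs ‖u‖ hn μ u hu
    rw [eq_of_norm_eq_of_invariant hH.invariant _ (hunit u hu), mul_comm (‖u‖ ^ 2),
      hVv μ u hu] at h1
    have h2 : e (μ * ‖u‖ ^ 2) = H (μ * ‖u‖ ^ 2) e₁ 0 := rfl
    simp only [hadKer, singKer, singB]
    rw [h2, h1]
    simp only [singA]
    field_simp
    ring
  refine ⟨⟨hD, e, v, fun μ x => h μ x 0, ?_, ?_, ?_, ?_⟩, ?_, fun μ u => V μ u 0, ?_, hVv⟩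
  · rw [← contDiffOn_univ]
    exact hH.smooth.comp (f := fun t : ℝ => (t, e₁, (0 : Euc D))) (by fun_prop) fun t _ => hne₁
  · exact hV.comp (f := fun t : ℝ => (t, e₁, (0 : Euc D))) (by fun_prop)
  · exact hh.comp (f := fun q : ℝ × Euc D => (q.1, q.2, (0 : Euc D))) (by fun_prop)
  · intro μ ψ hψ hc
    rw [← hw μ 0 ψ hψ hc]
    refine integral_congr_ae ?_
    filter_upwards [ae_ne_point (0 : Euc D)] with x hx
    rw [hE μ x hx]
    rfl
  · intro μ x y hxy
    rw [eq_sub_of_invariant hH.invariant, hE μ _ (sub_ne_zero.2 hxy)]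
  · exact hV.comp (f := fun q : ℝ × Euc D => (q.1, q.2, (0 : Euc D))) (by fun_prop)

end IsHadamardParametrix

namespace KernelData

variable (d : KernelData D)

lemma h_neg (μ : ℝ) (u : Euc D) : d.h μ (-u) = d.h μ u := by
  by_cases hu : u = 0
  · simp [hu]
  have h1 := d.kg_E_sub μ (x := 0) hu
  have h2 := d.kg_E_sub μ (x := 0) (neg_ne_zero.2 hu)
  simp only [sub_zero] at h1 h2
  have hs : SmoothOn (d.E μ) {0}ᶜ := by simpa using d.contDiffOn_E_sub μ 0
  rw [← h1, ← h2, kg_eq isOpen_compl_singleton hs hu,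
    kg_eq isOpen_compl_singleton hs (x := -u) (neg_ne_zero.2 hu),
    d.E_eq_of_norm_eq μ (norm_neg u)]
  congr 2
  refine sum_congr rfl fun i _ => ?_
  have h3 := iterD_comp_smul (d.E μ) (-1) [i, i] (U := {0}ᶜ) isOpen_compl_singleton hs (x := u)
    (by simpa using hu)
  have h4 : (fun x : Euc D => d.E μ ((-1 : ℝ) • x)) = d.E μ := by
    ext x
    exact d.E_eq_of_norm_eq μ (by simp)
  rw [h4] at h3
  rw [h3]
  simp

/-- A radial kernel with smooth logarithmic coefficient defines a Hadamard parametrix. -/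
theorem isHadamardParametrix {V : ℝ → Euc D → ℝ} (hV : Smooth₂ V)
    (hVv : ∀ μ u, u ≠ 0 → V μ u = singA D u * d.v (μ * ‖u‖ ^ 2)) :
    IsHadamardParametrix fun μ x y => d.E μ (x - y) where
  invariant μ g x y := d.E_eq_of_norm_eq μ (by
    rw [← dist_eq_norm, ← dist_eq_norm, g.dist_eq])
  smooth := d.contDiffOn_E.comp (f := fun p : ℝ × Euc₂ D => (p.1, p.2.1 - p.2.2))
    (by fun_prop) fun _ hp => sub_ne_zero.2 hp
  locallyIntegrable μ y := d.locallyIntegrable_E_sub μ y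
  parametrix := by
    refine ⟨fun μ x y => d.h μ (x - y), d.hh.comp (f := fun p : ℝ × Euc₂ D =>
      (p.1, p.2.1 - p.2.2)) (by fun_prop), fun μ x y => ?_, fun μ y f hf hc => ?_⟩
    · simp only
      rw [← d.h_neg, neg_sub]
    · exact d.weak_sub μ y hf hc
  scaling := by
    refine ⟨fun μ x y => V μ (x - y), hV.comp (f := fun p : ℝ × Euc₂ D =>
      (p.1, p.2.1 - p.2.2)) (by fun_prop), fun l hl μ x y hxy => ?_⟩
    simp only
    rw [← smul_sub, hVv μ _ (sub_ne_zero.2 hxy)]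
    exact hadKer_scaling d.e d.v hl μ (sub_ne_zero.2 hxy)

/-- Adding a smooth homogeneous function to a parametrix. -/
def addSmooth {ε : ℝ → ℝ} {g : ℝ → Euc D → ℝ} (hε : Smooth ε)
    (hg : Smooth₂ g)
    (hgε : ∀ μ u, u ≠ 0 → g μ u = singA D u * ε (μ * ‖u‖ ^ 2)) : KernelData D where
  hD := d.hD
  e := fun t => d.e t + ε t
  v := d.v
  h := fun μ x => d.h μ x + kg μ (g μ) x
  he := d.he.add hε
  hv := d.hv
  hh := by
    refine d.hh.add ?_
    have := contDiffOn_kg_param (P := ℝ) (m := fun m : ℝ => m) (Ψ := g) isOpen_univ contDiff_id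
      hg.contDiffOn
    rwa [contDiffOn_univ] at this
  weak := by
    intro μ ψ hψ hc
    have := d.neZero
    have hgs : Smooth (g μ) := hg.comp (f := fun u : Euc D => (μ, u)) (by fun_prop)
    have i1 := integrable_mul_kg (d.locallyIntegrable_E μ) hψ hc μ
    have i2 := integrable_mul_kg hgs.continuous.locallyIntegrable hψ hc μ
    have i3 := integrable_mul_of_compact (d.contDiff_h_slice μ).continuous.locallyIntegrable
      hψ.continuous hc
    have i4 := integrable_mul_of_compact (contDiff_kg hgs μ).continuous.locallyIntegrable
      hψ.continuous hc
    simp only [add_mul]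
    rw [integral_add i3 i4, ← add_assoc, ← d.weak μ ψ hψ hc, ← integral_mul_kg hgs hψ (Or.inr hc),
      ← integral_add i1 i2]
    refine integral_congr_ae ?_
    filter_upwards [ae_ne_point (0 : Euc D)] with x hx
    rw [hgε μ x hx]
    simp only [hadKer, singKer]
    ring

lemma addSmooth_E {ε : ℝ → ℝ} {g : ℝ → Euc D → ℝ} (hε : Smooth ε) (hg : Smooth₂ g)
    (hgε : ∀ μ u, u ≠ 0 → g μ u = singA D u * ε (μ * ‖u‖ ^ 2)) (μ : ℝ) (hu : u ≠ 0) :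
    (d.addSmooth hε hg hgε).E μ u = d.E μ u + g μ u := by
  rw [hgε μ u hu]
  simp only [hadKer, singKer, addSmooth]
  ring

end KernelData

end Structure

/-! ### First-order differential operators in the cutoff scale -/

section Operators

variable {F : ℕ → (ℝ → ℝ) → (ℝ → ℝ)} {u : ℝ → ℝ} {L : ℝ} {F' : (ℝ → ℝ) → (ℝ → ℝ)}

/-- The first-order operator `u ↦ α u + β u'`. -/
def dop (α : ℝ) (β : ℝ → ℝ) (u : ℝ → ℝ) : ℝ → ℝ := fun L => α * u L + β L * deriv u L

/-- Compositions of first-order operators with coefficients smooth on `(0, ∞)`. -/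
inductive IsOp : ((ℝ → ℝ) → (ℝ → ℝ)) → Prop
  | id : IsOp id
  | dop (α : ℝ) (β : ℝ → ℝ) (hβ : SmoothOn β (Ioi 0)) : IsOp (dop α β)
  | comp (F G : (ℝ → ℝ) → (ℝ → ℝ)) : IsOp F → IsOp G → IsOp (F ∘ G)

lemma opProd_induction {P : ((ℝ → ℝ) → (ℝ → ℝ)) → Prop} (h1 : P id)
    (h2 : ∀ F G, P F → P G → P (F ∘ G)) (hF : ∀ k, P (F (k + 1))) (n : ℕ) : P (opProd F n) := by
  induction n with
  | zero => exact h1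
  | succ n ih => exact h2 _ _ ih (hF n)

lemma iterate_induction {P : ((ℝ → ℝ) → (ℝ → ℝ)) → Prop} (h1 : P id)
    (h2 : ∀ F G, P F → P G → P (F ∘ G)) {F : (ℝ → ℝ) → (ℝ → ℝ)} (hF : P F) (n : ℕ) : P (F^[n]) := by
  induction n with
  | zero => exact h1
  | succ n ih => exact h2 _ _ ih hF

lemma opL_eq_dop (Δ : ℕ) : opL Δ = dop 1 fun L => (Δ : ℝ)⁻¹ * L := by
  funext u L
  simp [opL, dop]

lemma opLog_eq_dop (k : ℕ) : opLog k = dop 1 fun L => -((k : ℝ)⁻¹ * L * log L) := by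
  funext u L
  simp only [opLog, dop]
  ring

/-- The scaling derivative `L ∂/∂L`. -/
def theta : (ℝ → ℝ) → (ℝ → ℝ) := dop 0 fun L => L

lemma theta_apply (u : ℝ → ℝ) (L : ℝ) : theta u L = L * deriv u L := by simp [theta, dop]

/-- The operator intertwined with `opLog k` by the scaling derivative. -/
def opLog' (k : ℕ) : (ℝ → ℝ) → (ℝ → ℝ) :=
  dop ((k - 1) / k) fun L => -((k : ℝ)⁻¹ * L * log L)

/-- The operator intertwined with `frakL D δ N` by the scaling derivative. -/
def frakL' (D δ N : ℕ) : (ℝ → ℝ) → (ℝ → ℝ) :=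
  opProd opLog' N ∘ opProd (fun Δ => (opL Δ)^[N]) (D + δ - 4)

lemma contDiffOn_mul_log (c : ℝ) :
    SmoothOn (fun L : ℝ => -(c * L * log L)) (Ioi 0) :=
  ((contDiffOn_const.mul contDiffOn_id).mul
    (contDiffOn_id.log fun _ hx => (ne_of_gt hx))).neg

lemma isOp_opL (Δ : ℕ) : IsOp (opL Δ) := by
  rw [opL_eq_dop]
  exact IsOp.dop _ _ (contDiffOn_const.mul contDiffOn_id)

lemma isOp_opLog (k : ℕ) : IsOp (opLog k) := by
  rw [opLog_eq_dop]
  exact IsOp.dop _ _ (contDiffOn_mul_log _)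

lemma isOp_opLog' (k : ℕ) : IsOp (opLog' k) := IsOp.dop _ _ (contDiffOn_mul_log _)

lemma isOp_theta : IsOp theta := IsOp.dop _ _ contDiffOn_id

lemma isOp_opProd_opL (N n : ℕ) : IsOp (opProd (fun Δ => (opL Δ)^[N]) n) :=
  opProd_induction (F := fun Δ => (opL Δ)^[N]) .id .comp
    (fun k => iterate_induction .id .comp (isOp_opL (k + 1)) N) n

lemma isOp_frakL (D δ N : ℕ) : IsOp (frakL D δ N) :=
  .comp _ _ (opProd_induction .id .comp (fun _ => isOp_opLog _) _) (isOp_opProd_opL N _)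

lemma isOp_frakL' (D δ N : ℕ) : IsOp (frakL' D δ N) :=
  .comp _ _ (opProd_induction .id .comp (fun _ => isOp_opLog' _) _) (isOp_opProd_opL N _)

namespace IsOp

variable {F : (ℝ → ℝ) → (ℝ → ℝ)}

lemma congr_nhds (hF : IsOp F) : ∀ {u v : ℝ → ℝ} {x : ℝ}, u =ᶠ[𝓝 x] v → F u =ᶠ[𝓝 x] F v := by
  induction hF with
  | id => exact fun h => h
  | dop α β _ =>
    intro u v x₀ h
    filter_upwards [h, h.deriv] with x hx hx'
    simp [_root_.dop, hx, hx']
  | comp F G _ _ ih1 ih2 => exact fun h => ih1 (ih2 h)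

lemma congr (hF : IsOp F) {v : ℝ → ℝ} (h : EqOn u v (Ioi 0)) :
    EqOn (F u) (F v) (Ioi 0) := fun _ hL =>
  (hF.congr_nhds (h.eventuallyEq_of_mem (isOpen_Ioi.mem_nhds hL))).eq_of_nhds

lemma map_zero (hF : IsOp F) : F (fun _ => 0) = fun _ => 0 := by
  induction hF with
  | id => rfl
  | dop α β _ =>
    ext L
    simp [_root_.dop]
  | comp F G _ _ ih1 ih2 => rw [comp_apply, ih2, ih1]

/-- The operators act smoothly on smooth families. -/
lemma contDiffOn_param (hF : IsOp F) : ∀ {P : Type} [NormedAddCommGroup P]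
    [NormedSpace ℝ P] {Ψ : P → ℝ → ℝ},
    SmoothOn₂ Ψ (univ ×ˢ Ioi 0) →
    SmoothOn (fun q : P × ℝ => F (Ψ q.1) q.2) (univ ×ˢ Ioi 0) := by
  induction hF with
  | id => exact fun h => h
  | comp F G _ _ ih1 ih2 =>
    intro P _ _ Ψ h
    exact ih1 (Ψ := fun p => G (Ψ p)) (ih2 h)
  | dop α β hβ =>
    intro P _ _ Ψ h
    have ho : IsOpen ((univ : Set P) ×ˢ Ioi (0 : ℝ)) := isOpen_univ.prod isOpen_Ioi
    have h1 : SmoothOn (fun q : P × ℝ => deriv (Ψ q.1) q.2) (univ ×ˢ Ioi 0) := by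
      have h2 : SmoothOn (fun q => fderiv ℝ (fun q : P × ℝ => Ψ q.1 q.2) q ((0 : P), (1 : ℝ)))
          (univ ×ˢ Ioi 0) :=
        (h.fderiv_of_isOpen ho (m := ∞) (by simp)).clm_apply contDiffOn_const
      refine h2.congr fun q hq => ?_
      have h3 : HasFDerivAt (fun q : P × ℝ => Ψ q.1 q.2)
          (fderiv ℝ (fun q : P × ℝ => Ψ q.1 q.2) (q.1, q.2)) (q.1, q.2) :=
        (h.differentiableAt_of_isOpen ho hq).hasFDerivAt
      have h4 := (HasFDerivAt.comp q.2 h3 (hasFDerivAt_prodMk_right q.1 q.2)).hasDerivAt.deriv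
      simp only [comp_def] at h4
      rw [h4]
      simp
    have hβ' : SmoothOn (fun q : P × ℝ => β q.2) (univ ×ˢ Ioi 0) :=
      hβ.comp contDiff_snd.contDiffOn fun q hq => hq.2
    exact (contDiffOn_const.mul h).add (hβ'.mul h1)

lemma contDiffOn (hF : IsOp F) (hu : SmoothOn u (Ioi 0)) :
    SmoothOn (F u) (Ioi 0) := by
  have h1 : SmoothOn (fun q : ℝ × ℝ => u q.2) (univ ×ˢ Ioi 0) :=
    hu.comp contDiff_snd.contDiffOn fun q hq => hq.2
  have := hF.contDiffOn_param (P := ℝ) (Ψ := fun _ => u) h1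
  exact this.comp (f := fun L : ℝ => ((0 : ℝ), L)) (by fun_prop) fun L hL => ⟨mem_univ _, hL⟩

lemma map_add (hF : IsOp F) : ∀ {u v : ℝ → ℝ}, SmoothOn u (Ioi 0) →
    SmoothOn v (Ioi 0) →
    EqOn (F fun L => u L + v L) (fun L => F u L + F v L) (Ioi 0) := by
  induction hF with
  | id => exact fun _ _ _ _ => rfl
  | dop α β _ =>
    intro u v hu hv L hL
    have h1 := hu.differentiableAt_of_isOpen isOpen_Ioi hL
    have h2 := hv.differentiableAt_of_isOpen isOpen_Ioi hL
    simp only [_root_.dop]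
    rw [deriv_fun_add h1 h2]
    ring
  | comp F G hF hG ih1 ih2 =>
    intro u v hu hv
    exact (hF.congr (ih2 hu hv)).trans (ih1 (hG.contDiffOn hu) (hG.contDiffOn hv))

lemma map_const_mul (hF : IsOp F) (c : ℝ) : ∀ {u : ℝ → ℝ},
    F (fun L => c * u L) = fun L => c * F u L := by
  induction hF with
  | id => exact fun {_} => rfl
  | dop α β _ =>
    intro u
    ext L
    simp only [_root_.dop]
    rw [deriv_const_mul_field]
    ring
  | comp F G hF hG ih1 ih2 =>
    intro u
    rw [comp_apply, ih2, ih1]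
    rfl

lemma map_mul_const (hF : IsOp F) (c : ℝ) (u : ℝ → ℝ) :
    F (fun L => u L * c) = fun L => F u L * c := by
  simp only [mul_comm _ c]
  exact hF.map_const_mul c

lemma map_sum (hF : IsOp F) {ι : Type*} (s : Finset ι) {u : ι → ℝ → ℝ}
    (hu : ∀ i ∈ s, SmoothOn (u i) (Ioi 0)) :
    EqOn (F fun L => ∑ i ∈ s, u i L) (fun L => ∑ i ∈ s, F (u i) L) (Ioi 0) := by
  classical
  induction s using Finset.induction_on with
  | empty => simp only [Finset.sum_empty, hF.map_zero]; exact fun _ _ => rfl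
  | insert j s hj ih =>
    have h1 : ∀ i ∈ s, SmoothOn (u i) (Ioi 0) := fun i hi =>
      hu i (mem_insert_of_mem hi)
    intro L hL
    simp only [sum_insert hj]
    rw [hF.map_add (hu j (mem_insert_self _ _)) (ContDiffOn.sum fun i hi => h1 i hi) hL]
    exact congrArg (F (u j) L + ·) (ih h1 hL)

end IsOp

lemma eventuallyEq_one_opProd
    (hF : ∀ k u, u =ᶠ[𝓝 L] (fun _ => (1 : ℝ)) → F (k + 1) u =ᶠ[𝓝 L] fun _ => 1) (n : ℕ)
    (u : ℝ → ℝ) (hu : u =ᶠ[𝓝 L] fun _ => 1) : opProd F n u =ᶠ[𝓝 L] fun _ => 1 :=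
  opProd_induction (P := fun G => ∀ u, u =ᶠ[𝓝 L] (fun _ => (1 : ℝ)) → G u =ᶠ[𝓝 L] fun _ => 1)
    (fun _ h => h) (fun _ _ h1 h2 u hu => h1 _ (h2 u hu)) hF n u hu

lemma eventuallyEq_one_dop {β : ℝ → ℝ} (u : ℝ → ℝ) (hu : u =ᶠ[𝓝 L] fun _ => 1) :
    dop 1 β u =ᶠ[𝓝 L] fun _ => 1 := by
  filter_upwards [hu, hu.deriv] with x hx hx'
  simp [dop, hx, hx']

lemma frakL_eventuallyEq_one (D δ N : ℕ) {L : ℝ} {u : ℝ → ℝ} (hu : u =ᶠ[𝓝 L] fun _ => 1) :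
    frakL D δ N u =ᶠ[𝓝 L] fun _ => 1 := by
  refine eventuallyEq_one_opProd (fun k u hu => ?_) N _
    (eventuallyEq_one_opProd (fun k u hu => ?_) _ u hu)
  · rw [opLog_eq_dop]
    exact eventuallyEq_one_dop u hu
  · refine iterate_induction (P := fun G => ∀ u, u =ᶠ[𝓝 L] (fun _ => (1 : ℝ)) →
      G u =ᶠ[𝓝 L] fun _ => 1) (fun _ h => h) (fun _ _ h1 h2 u hu => h1 _ (h2 u hu)) (fun u hu => ?_)
      N u hu
    rw [opL_eq_dop]
    exact eventuallyEq_one_dop u hu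

/-- `F` and `F'` are intertwined by the scaling derivative. -/
def Intertwined (F F' : (ℝ → ℝ) → (ℝ → ℝ)) : Prop :=
  IsOp F ∧ IsOp F' ∧ ∀ u, SmoothOn u (Ioi 0) →
    EqOn (theta (F u)) (F' (theta u)) (Ioi 0)

namespace Intertwined

lemma id : Intertwined id id := ⟨.id, .id, fun _ _ _ _ => rfl⟩

lemma comp {F G G' : (ℝ → ℝ) → (ℝ → ℝ)} (h1 : Intertwined F F') (h2 : Intertwined G G') :
    Intertwined (F ∘ G) (F' ∘ G') :=
  ⟨.comp _ _ h1.1 h2.1, .comp _ _ h1.2.1 h2.2.1, fun u hu =>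
    (h1.2.2 _ (h2.1.contDiffOn hu)).trans (h1.2.1.congr (h2.2.2 u hu))⟩

lemma opProd {F' : ℕ → (ℝ → ℝ) → (ℝ → ℝ)} (h : ∀ k, Intertwined (F (k + 1)) (F' (k + 1)))
    (n : ℕ) : Intertwined (opProd F n) (opProd F' n) := by
  induction n with
  | zero => exact id
  | succ n ih => exact ih.comp (h n)

lemma iterate {F : (ℝ → ℝ) → (ℝ → ℝ)} (h : Intertwined F F') (n : ℕ) :
    Intertwined (F^[n]) (F'^[n]) := by
  induction n with
  | zero => exact id
  | succ n ih => exact ih.comp h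

end Intertwined

lemma intertwined_opL (Δ : ℕ) : Intertwined (opL Δ) (opL Δ) := by
  refine ⟨isOp_opL Δ, isOp_opL Δ, fun u hu L hL => ?_⟩
  have hu' : SmoothOn (deriv u) (Ioi 0) := hu.deriv_of_isOpen isOpen_Ioi (by simp)
  have h1 := (hu.differentiableAt_of_isOpen isOpen_Ioi hL).hasDerivAt
  have h2 := (hu'.differentiableAt_of_isOpen isOpen_Ioi hL).hasDerivAt
  have e1 : theta u = fun L => L * deriv u L := funext (theta_apply u)
  have d1 := (h1.add (((hasDerivAt_id L).const_mul (Δ : ℝ)⁻¹).mul h2)).deriv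
  have d2 := ((hasDerivAt_id L).mul h2).deriv
  have e2 : deriv (opL Δ u) L
      = deriv u L + ((Δ : ℝ)⁻¹ * 1 * deriv u L + (Δ : ℝ)⁻¹ * L * deriv (deriv u) L) := d1
  have e3 : deriv (fun L => L * deriv u L) L = 1 * deriv u L + L * deriv (deriv u) L := d2
  rw [theta_apply, e2, e1]
  simp only [opL]
  rw [e3]
  ring

lemma intertwined_opLog (k : ℕ) : Intertwined (opLog (k + 1)) (opLog' (k + 1)) := by
  refine ⟨isOp_opLog _, isOp_opLog' _, fun u hu L hL => ?_⟩
  have hL0 : L ≠ 0 := ne_of_gt hL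
  have hu' : SmoothOn (deriv u) (Ioi 0) := hu.deriv_of_isOpen isOpen_Ioi (by simp)
  have h1 := (hu.differentiableAt_of_isOpen isOpen_Ioi hL).hasDerivAt
  have h2 := (hu'.differentiableAt_of_isOpen isOpen_Ioi hL).hasDerivAt
  have e1 : theta u = fun L => L * deriv u L := funext (theta_apply u)
  have d1 := (h1.sub ((((hasDerivAt_id L).const_mul ((k + 1 : ℕ) : ℝ)⁻¹).mul
    (Real.hasDerivAt_log hL0)).mul h2)).deriv
  have d2 := ((hasDerivAt_id L).mul h2).deriv
  have e2 : deriv (opLog (k + 1) u) L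
      = deriv u L - ((((k + 1 : ℕ) : ℝ)⁻¹ * 1 * log L + ((k + 1 : ℕ) : ℝ)⁻¹ * L * L⁻¹) * deriv u L
        + ((k + 1 : ℕ) : ℝ)⁻¹ * L * log L * deriv (deriv u) L) := d1
  have e3 : deriv (fun L => L * deriv u L) L = 1 * deriv u L + L * deriv (deriv u) L := d2
  rw [theta_apply, e2, e1]
  simp only [opLog', dop]
  rw [e3]
  push_cast
  field_simp
  ring

lemma intertwined_frakL (D δ N : ℕ) : Intertwined (frakL D δ N) (frakL' D δ N) :=
  (Intertwined.opProd intertwined_opLog N).comp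
    (Intertwined.opProd (fun _ => (intertwined_opL _).iterate N) _)

end Operators

/-! ### Scale dependence integrable at small scales -/

section Scale

variable {D : ℕ}

/-- Operators in the cutoff scale commute with the integration over a smooth family of compactly
supported functions. -/
lemma IsOp.integral_comm {F : (ℝ → ℝ) → (ℝ → ℝ)} (hF : IsOp F) : ∀ {Ψ : Euc D → ℝ → ℝ},
    SmoothOn₂ Ψ (univ ×ˢ Ioi 0) →
    (∀ y L, 0 < L → 2 * L < ‖y‖ → Ψ y L = 0) →
    EqOn (fun L => ∫ y, F (Ψ y) L) (F fun L => ∫ y, Ψ y L) (Ioi 0) := by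
  induction hF with
  | id => exact fun _ _ _ _ => rfl
  | dop α β hβ =>
    intro Ψ hs hz L hL
    have hL' : (0 : ℝ) < L := hL
    have hs' : SmoothOn (fun q : ℝ × Euc D => Ψ q.2 q.1) (Ioo 0 (2 * L) ×ˢ univ) :=
      hs.comp (f := fun q : ℝ × Euc D => (q.2, q.1)) (by fun_prop)
        fun q hq => ⟨mem_univ _, hq.1.1⟩
    have hk : ∀ p ∈ Ioo 0 (2 * L), ∀ y, y ∉ closedBall (0 : Euc D) (4 * L) →
        Ψ y p = 0 := fun p hp y hy => by
      refine hz y p hp.1 ?_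
      rw [mem_closedBall, dist_zero_right, not_le] at hy
      linarith [hp.2]
    have hm : L ∈ Ioo 0 (2 * L) := ⟨hL', by linarith⟩
    have hd := hasDerivAt_integral_param (f := fun _ : Euc D => (1 : ℝ)) (ν := volume)
      (locallyIntegrable_const 1) isOpen_Ioo (isCompact_closedBall (0 : Euc D) (4 * L))
      (Φ := fun L y => Ψ y L) hk hs' hm
    simp only [one_mul] at hd
    have hc1 : Continuous fun y => Ψ y L := by
      rw [← continuousOn_univ]
      exact hs.continuousOn.comp (f := fun y : Euc D => (y, L)) (by fun_prop)
        fun y _ => ⟨mem_univ _, hL⟩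
    have hD : IsOp (_root_.dop 0 fun _ => 1) := .dop _ _ contDiffOn_const
    have hc2 : Continuous fun y => deriv (Ψ y) L := by
      have := hD.contDiffOn_param (P := Euc D) (Ψ := Ψ) hs
      rw [← continuousOn_univ]
      have h2 := this.continuousOn.comp (f := fun y : Euc D => (y, L)) (s := univ) (by fun_prop)
        fun y _ => ⟨mem_univ _, hL⟩
      simpa [_root_.dop, comp_def] using h2
    have i1 : Integrable fun y => Ψ y L := hc1.integrable_of_hasCompactSupport
      (.intro (isCompact_closedBall (0 : Euc D) (4 * L)) fun y hy => hk L hm y hy)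
    have i2 : Integrable fun y => deriv (Ψ y) L := hc2.integrable_of_hasCompactSupport
      (.intro (isCompact_closedBall (0 : Euc D) (4 * L)) fun y hy => by
        have : Ψ y =ᶠ[𝓝 L] fun _ => 0 := by
          filter_upwards [isOpen_Ioo.mem_nhds hm] with p hp
          exact hk p hp y hy
        rw [this.deriv_eq]
        simp)
    simp only [_root_.dop]
    rw [hd.deriv, integral_add (i1.const_mul α) (i2.const_mul _), integral_const_mul,
      integral_const_mul]
  | comp F G hF hG ih1 ih2 =>
    intro Ψ hs hz
    have h1 := ih1 (Ψ := fun y => G (Ψ y)) (hG.contDiffOn_param (P := Euc D) (Ψ := Ψ) hs)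
      (fun y L hL hy => by
        have h2 : Ψ y =ᶠ[𝓝 L] fun _ => 0 := by
          filter_upwards [lt_mem_nhds hL,
            (continuous_const.mul continuous_id).continuousAt.eventually
            (gt_mem_nhds hy)] with p hp hp'
          exact hz y p hp hp'
        rw [(hG.congr_nhds h2).eq_of_nhds, hG.map_zero])
    exact h1.trans (hF.congr (ih2 hs hz))

lemma intervalIntegrable_log_pow (k : ℕ) {b : ℝ} (hb : 0 < b) :
    IntervalIntegrable (fun x => log x ^ k) volume 0 b := by
  have h1 : IntervalIntegrable (fun x => log x ^ k) volume 0 1 := by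
    have h2 : IntervalIntegrable (fun x : ℝ => (2 * k + 2 : ℝ) ^ k * x ^ (-(1 / 2) : ℝ))
        volume 0 1 :=
      (intervalIntegral.intervalIntegrable_rpow' (by norm_num)).const_mul _
    refine h2.mono_fun ?_ ?_
    · exact (Real.measurable_log.pow_const k).aestronglyMeasurable
    · rw [EventuallyLE, ae_restrict_iff' measurableSet_uIoc]
      refine Eventually.of_forall fun x hx => ?_
      rw [Set.uIoc_of_le zero_le_one] at hx
      set t : ℝ := 1 / (2 * k + 2) with ht
      have htp : 0 < t := by positivity
      have h3 := Real.abs_log_mul_self_rpow_lt x t hx.1 hx.2 htp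
      have hxt : 0 < x ^ t := Real.rpow_pos_of_pos hx.1 t
      rw [abs_mul, abs_of_pos hxt] at h3
      have h4 : |log x| ≤ (2 * k + 2) * x ^ (-t) := by
        rw [Real.rpow_neg hx.1.le, ← div_eq_mul_inv, le_div_iff₀ hxt]
        refine h3.le.trans (le_of_eq ?_)
        rw [ht, one_div_one_div]
      have h5 : (x ^ (-t)) ^ k ≤ x ^ (-(1 / 2) : ℝ) := by
        rw [← rpow_natCast, ← Real.rpow_mul hx.1.le]
        refine Real.rpow_le_rpow_of_exponent_ge hx.1 hx.2 ?_
        have : t * k ≤ 1 / 2 := by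
          rw [ht, div_mul_eq_mul_div, one_mul, div_le_iff₀ (by positivity)]
          linarith
        linarith
      rw [norm_pow, norm_eq_abs, norm_of_nonneg (by
        have := Real.rpow_pos_of_pos hx.1 (-(1 / 2) : ℝ)
        positivity)]
      calc |log x| ^ k ≤ ((2 * k + 2) * x ^ (-t)) ^ k :=
            pow_le_pow_left₀ (abs_nonneg _) h4 k
        _ = (2 * k + 2 : ℝ) ^ k * (x ^ (-t)) ^ k := mul_pow _ _ _
        _ ≤ _ := by gcongr
  have h2 : IntervalIntegrable (fun x => log x ^ k) volume 1 b := by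
    refine ContinuousOn.intervalIntegrable fun x hx => ?_
    have : 0 < x := by
      rw [Set.mem_uIcc] at hx
      rcases hx with h | h <;> linarith [h.1]
    exact ((Real.continuousAt_log this.ne').pow k).continuousWithinAt
  exact h1.trans h2

/-- The class of functions of `(μ, L)` spanned by `μ^j L^(p+1) log^k L B(μ L²)` with smooth `B`. -/
inductive IsZ : (ℝ → ℝ → ℝ) → Prop
  | mono (j p k : ℕ) (B : ℝ → ℝ) (hB : Smooth B) :
      IsZ fun μ L => μ ^ j * (L ^ (p + 1) * log L ^ k * B (μ * L ^ 2))
  | add (f g : ℝ → ℝ → ℝ) : IsZ f → IsZ g → IsZ fun μ L => f μ L + g μ L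
  | congr (f g : ℝ → ℝ → ℝ) : (∀ μ L, 0 < L → f μ L = g μ L) → IsZ f → IsZ g

namespace IsZ

variable {f : ℝ → ℝ → ℝ}

lemma zero : IsZ fun _ _ => 0 :=
  .congr _ _ (fun μ L _ => by simp) (mono 0 0 0 (fun _ => 0) contDiff_const)

lemma sum {ι : Type*} (s : Finset ι) {f : ι → ℝ → ℝ → ℝ} (hf : ∀ i ∈ s, IsZ (f i)) :
    IsZ fun μ L => ∑ i ∈ s, f i μ L := by
  classical
  induction s using Finset.induction_on with
  | empty => simpa using zero
  | insert j s hj ih =>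
    simp only [sum_insert hj]
    exact add _ _ (hf j (mem_insert_self _ _))
      (ih fun i hi => hf i (mem_insert_of_mem hi))

lemma contDiffOn (hf : IsZ f) (μ : ℝ) : SmoothOn (f μ) (Ioi 0) := by
  induction hf with
  | mono j p k B hB =>
    have h1 : SmoothOn (fun L => log L ^ k) (Ioi 0) :=
      (contDiffOn_id.log fun _ hx => ne_of_gt hx).pow k
    have h2 : Smooth fun L : ℝ => B (μ * L ^ 2) := hB.comp (by fun_prop)
    exact contDiffOn_const.mul (((contDiffOn_id.pow _).mul h1).mul h2.contDiffOn)
  | add f g _ _ ih1 ih2 => exact ih1.add ih2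
  | congr f g h _ ih => exact ih.congr fun L hL => (h μ L hL).symm

lemma const_mul (hf : IsZ f) (c : ℝ) : IsZ fun μ L => c * f μ L := by
  induction hf with
  | mono j p k B hB =>
    refine .congr _ _ (fun μ L _ => ?_) (mono j p k (fun t => c * B t) (contDiff_const.mul hB))
    ring
  | add f g _ _ ih1 ih2 => exact .congr _ _ (fun μ L _ => by ring) (add _ _ ih1 ih2)
  | congr f g h _ ih => exact .congr _ _ (fun μ L hL => by rw [h μ L hL]) ih

lemma log_mul (hf : IsZ f) : IsZ fun μ L => log L * f μ L := by
  induction hf with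
  | mono j p k B hB =>
    refine .congr _ _ (fun μ L _ => ?_) (mono j p (k + 1) B hB)
    ring
  | add f g _ _ ih1 ih2 => exact .congr _ _ (fun μ L _ => by ring) (add _ _ ih1 ih2)
  | congr f g h _ ih => exact .congr _ _ (fun μ L hL => by rw [h μ L hL]) ih

lemma theta (hf : IsZ f) : IsZ fun μ L => L * deriv (f μ) L := by
  induction hf with
  | mono j p k B hB =>
    have z1 := (mono j p k B hB).const_mul (p + 1)
    have z2 := (mono j p (k - 1) B hB).const_mul k
    have z3 := (mono j p k (fun t => 2 * (t * deriv B t))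
      (contDiff_const.mul (contDiff_id.mul hB.deriv_infty)))
    refine .congr _ _ (fun μ L hL => ?_) (add _ _ (add _ _ z1 z2) z3)
    have hL0 : L ≠ 0 := hL.ne'
    have d1 := hasDerivAt_pow (p + 1) L
    have d2 := (Real.hasDerivAt_log hL0).pow k
    have d3 : HasDerivAt (fun L : ℝ => μ * L ^ 2) (μ * (2 * L)) L := by
      simpa using (hasDerivAt_pow 2 L).const_mul μ
    have d4 := ((hB.differentiable (by simp)) (μ * L ^ 2)).hasDerivAt.comp L d3
    have d5 := (((d1.mul d2).mul d4).const_mul (μ ^ j)).deriv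
    have d6 : deriv (fun L => μ ^ j * (L ^ (p + 1) * log L ^ k * B (μ * L ^ 2))) L = _ := d5
    rw [d6]
    simp only [Pi.mul_apply, Pi.pow_apply, Function.comp, Nat.cast_add, Nat.cast_one,
      Nat.add_sub_cancel]
    field_simp
    ring
  | add f g hf hg ih1 ih2 =>
    refine .congr _ _ (fun μ L hL => ?_) (add _ _ ih1 ih2)
    rw [deriv_fun_add ((hf.contDiffOn μ).differentiableAt_of_isOpen isOpen_Ioi hL)
      ((hg.contDiffOn μ).differentiableAt_of_isOpen isOpen_Ioi hL)]
    ring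
  | congr f g h _ ih =>
    refine .congr _ _ (fun μ L hL => ?_) ih
    have : f μ =ᶠ[𝓝 L] g μ := by
      filter_upwards [lt_mem_nhds hL] with x hx
      exact h μ x hx
    rw [this.deriv_eq]

lemma opL (hf : IsZ f) (Δ : ℕ) : IsZ fun μ => _root_.opL Δ (f μ) :=
  .congr _ _ (fun μ L _ => by simp only [_root_.opL]; ring)
    (add _ _ hf (hf.theta.const_mul (Δ : ℝ)⁻¹))

lemma opLog' (hf : IsZ f) (k : ℕ) : IsZ fun μ => _root_.opLog' k (f μ) :=
  .congr _ _ (fun μ L _ => by simp only [_root_.opLog', dop]; ring)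
    (add _ _ (hf.const_mul ((k - 1) / k)) (hf.theta.log_mul.const_mul (-(k : ℝ)⁻¹)))

lemma frakL' (hf : IsZ f) (D δ N : ℕ) : IsZ fun μ => _root_.frakL' D δ N (f μ) := by
  have h1 : ∀ n, ∀ f, IsZ f → IsZ fun μ => opProd (fun Δ => (_root_.opL Δ)^[N]) n (f μ) := fun n =>
    opProd_induction (P := fun G => ∀ f, IsZ f → IsZ fun μ => G (f μ)) (fun _ h => h)
      (fun F G h1 h2 f hf => h1 _ (h2 f hf))
      (fun k => iterate_induction (P := fun G => ∀ f, IsZ f → IsZ fun μ => G (f μ)) (fun _ h => h)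
        (fun F G h1 h2 f hf => h1 _ (h2 f hf)) (fun f hf => hf.opL _) N) n
  have h2 : ∀ n, ∀ f, IsZ f → IsZ fun μ => opProd _root_.opLog' n (f μ) := fun n =>
    opProd_induction (P := fun G => ∀ f, IsZ f → IsZ fun μ => G (f μ)) (fun _ h => h)
      (fun F G h1 h2 f hf => h1 _ (h2 f hf)) (fun k f hf => hf.opLog' _) n
  exact h2 _ _ (h1 _ _ hf)

lemma intervalIntegrable_div (hf : IsZ f) (μ : ℝ) {b : ℝ} (hb : 0 < b) :
    IntervalIntegrable (fun L => f μ L / L) volume 0 b := by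
  induction hf with
  | mono j p k B hB =>
    have h1 : Continuous fun L : ℝ => μ ^ j * (L ^ p * B (μ * L ^ 2)) := by
      have : Continuous fun L : ℝ => B (μ * L ^ 2) := hB.continuous.comp (by fun_prop)
      fun_prop
    have h2 := (intervalIntegrable_log_pow k hb).mul_continuousOn
      (h1.continuousOn (s := Set.uIcc 0 b))
    refine h2.congr fun L hL => ?_
    rw [Set.uIoc_of_le hb.le] at hL
    have : L ≠ 0 := hL.1.ne'
    simp only
    field_simp
    ring
  | add f g _ _ ih1 ih2 =>
    refine (ih1.add ih2).congr fun L _ => ?_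
    simp only
    ring
  | congr f g h _ ih =>
    refine ih.congr fun L hL => ?_
    rw [Set.uIoc_of_le hb.le] at hL
    simp only [h μ L hL.1]

lemma contDiff_integral_div (hf : IsZ f) : Smooth fun μ => ∫ L in (0 : ℝ)..1, f μ L / L := by
  induction hf with
  | mono j p k B hB =>
    let η : ContDiffBump (0 : ℝ) := ⟨1, 2, one_pos, one_lt_two⟩
    have hloc : LocallyIntegrable ((Set.Ioc (0 : ℝ) 1).indicator fun L => log L ^ k) :=
      ((intervalIntegrable_iff_integrableOn_Ioc_of_le zero_le_one).1
        (intervalIntegrable_log_pow k one_pos)).integrable_indicator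
          measurableSet_Ioc |>.locallyIntegrable
    have hB' : Smooth fun q : ℝ × ℝ => B (q.1 * q.2 ^ 2) := hB.comp (by fun_prop)
    have hη : Smooth fun q : ℝ × ℝ => η q.2 := η.contDiff.comp contDiff_snd
    have h1 := contDiffOn_integral_param (ν := volume) hloc (P := ℝ) isOpen_univ
      (isCompact_closedBall (0 : ℝ) 2)
      (Φ := fun μ L => η L * (μ ^ j * L ^ p * B (μ * L ^ 2)))
      (fun μ _ L hL => by
        rw [η.zero_of_le_dist (by
          rw [mem_closedBall, not_le] at hL
          exact hL.le), zero_mul])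
      (hη.mul (((contDiff_fst.pow _).mul (contDiff_snd.pow _)).mul hB')).contDiffOn
    rw [contDiffOn_univ] at h1
    convert h1 using 2 with μ
    rw [intervalIntegral.integral_of_le zero_le_one, ← integral_indicator measurableSet_Ioc]
    refine integral_congr_fun fun L => ?_
    by_cases hL : L ∈ Set.Ioc (0 : ℝ) 1
    · have : L ≠ 0 := hL.1.ne'
      have h2 : η L = 1 := η.one_of_mem_closedBall (by
        rw [mem_closedBall, Real.dist_eq, sub_zero, abs_of_pos hL.1]
        exact hL.2)
      simp only [Set.indicator_of_mem hL, h2]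
      field_simp
      ring
    · simp [Set.indicator_of_notMem hL]
  | add f g hf hg ih1 ih2 =>
    convert ih1.add ih2 using 2 with μ
    rw [← intervalIntegral.integral_add (hf.intervalIntegrable_div μ one_pos)
      (hg.intervalIntegrable_div μ one_pos)]
    congr 1
    ext L
    ring
  | congr f g h _ ih =>
    convert ih using 2 with μ
    refine intervalIntegral.integral_congr_ae (.of_forall fun L hL => ?_)
    rw [Set.uIoc_of_le zero_le_one] at hL
    rw [h μ L hL.1]

end IsZ

end Scale

/-! ### Powers of the scale annihilated by `frakL'` -/

section PolyLog

variable {n q N m D δ k : ℕ} {u f : ℝ → ℝ}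

/-- The function `L^(-q) p(log L)`. -/
def polyLog (q : ℕ) (p : Polynomial ℝ) : ℝ → ℝ :=
  fun L => L ^ (-(q : ℤ)) * p.eval (log L)

lemma hasDerivAt_polyLog (q : ℕ) (p : Polynomial ℝ) {L : ℝ} (hL : 0 < L) :
    HasDerivAt (polyLog q p) (L⁻¹ * polyLog q (p.derivative - C (q : ℝ) * p) L) L := by
  have h1 := hasDerivAt_zpow (-(q : ℤ)) L (Or.inl hL.ne')
  have h2 := (p.hasDerivAt (log L)).comp L (Real.hasDerivAt_log hL.ne')
  refine (h1.mul h2).congr_deriv ?_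
  simp only [polyLog, eval_sub, eval_mul, eval_C, Function.comp]
  rw [zpow_sub_one₀ hL.ne']
  push_cast
  ring

lemma opL_polyLog (Δ q : ℕ) (p : Polynomial ℝ) : EqOn (opL Δ (polyLog q p))
    (polyLog q (p + C (Δ : ℝ)⁻¹ * (p.derivative - C (q : ℝ) * p))) (Ioi 0) := by
  intro L hL
  have hL' : (0 : ℝ) < L := hL
  simp only [opL]
  rw [(hasDerivAt_polyLog q p hL).deriv]
  simp only [polyLog, eval_sub, eval_mul, eval_C,
    Polynomial.eval_add]
  field_simp

lemma opLog'_polyLog (k : ℕ) (p : Polynomial ℝ) : EqOn (opLog' (k + 1) (polyLog 0 p))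
    (polyLog 0 (C ((k + 1 : ℝ)⁻¹) *
      (C (k : ℝ) * p - X * p.derivative))) (Ioi 0) := by
  intro L hL
  have hL' : (0 : ℝ) < L := hL
  simp only [opLog', dop]
  rw [(hasDerivAt_polyLog 0 p hL).deriv]
  simp only [polyLog, eval_sub, eval_mul, eval_C,
    eval_X, Nat.cast_zero, neg_zero, zpow_zero, Nat.cast_add, Nat.cast_one]
  field_simp
  ring

lemma coeff_opL_poly (c d : ℝ) {p : Polynomial ℝ} (hp : ∀ i, n ≤ i → p.coeff i = 0) :
    ∀ i, n ≤ i → (p + C c * (p.derivative - C d * p)).coeff i = 0 := by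
  intro i hi
  simp [coeff_derivative, hp i hi, hp (i + 1) (by omega)]

/-- `u` is of the form `L^(-q) p(log L)` with `deg p < n`. -/
def IsPolyLog (q n : ℕ) (u : ℝ → ℝ) : Prop :=
  ∃ p : Polynomial ℝ, (∀ i, n ≤ i → p.coeff i = 0) ∧ EqOn u (polyLog q p) (Ioi 0)

lemma IsPolyLog.eq_zero (h : IsPolyLog q 0 u) :
    EqOn u (fun _ => 0) (Ioi 0) := by
  obtain ⟨p, hp, hu⟩ := h
  have : p = 0 := Polynomial.ext fun i => by simpa using hp i (Nat.zero_le _)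
  intro L hL
  rw [hu hL, this]
  simp [polyLog]

lemma IsPolyLog.opL (h : IsPolyLog q n u) (Δ : ℕ) :
    IsPolyLog q n (opL Δ u) := by
  obtain ⟨p, hp, hu⟩ := h
  exact ⟨_, coeff_opL_poly _ _ hp, ((isOp_opL Δ).congr hu).trans (opL_polyLog Δ q p)⟩

/-- `opL q` lowers the degree of the polynomial of `log L`. -/
lemma IsPolyLog.opL_self (h : IsPolyLog (q + 1) (n + 1) u) :
    IsPolyLog (q + 1) n (_root_.opL (q + 1) u) := by
  obtain ⟨p, hp, hu⟩ := h
  refine ⟨_, fun i hi => ?_, ((isOp_opL (q + 1)).congr hu).trans (opL_polyLog (q + 1) (q + 1) p)⟩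
  have hq : (q + 1 : ℝ) ≠ 0 := by positivity
  simp only [Polynomial.coeff_add, coeff_C_mul, coeff_sub,
    coeff_derivative, hp (i + 1) (by omega)]
  push_cast
  field_simp
  ring

lemma IsPolyLog.opL_iterate (h : IsPolyLog q n u) (Δ N : ℕ) :
    IsPolyLog q n ((_root_.opL Δ)^[N] u) := by
  induction N with
  | zero => exact h
  | succ N ih =>
    rw [Function.iterate_succ_apply']
    exact ih.opL Δ

lemma IsPolyLog.opL_self_iterate (h : IsPolyLog (q + 1) n u)
    (hN : n ≤ N) : EqOn ((_root_.opL (q + 1))^[N] u) (fun _ => 0) (Ioi 0) := by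
  have key : ∀ k, k ≤ n → IsPolyLog (q + 1) (n - k) ((_root_.opL (q + 1))^[k] u) := by
    intro k
    induction k with
    | zero => exact fun _ => h
    | succ k ih =>
      intro hk
      rw [Function.iterate_succ_apply']
      have := ih (by omega)
      rw [show n - k = (n - (k + 1)) + 1 by omega] at this
      exact this.opL_self
  have h1 := key n le_rfl
  rw [Nat.sub_self] at h1
  obtain ⟨m, rfl⟩ := Nat.exists_eq_add_of_le hN
  rw [Nat.add_comm n m, Function.iterate_add_apply]
  have h2 : IsPolyLog (q + 1) 0 ((_root_.opL (q + 1))^[m] ((_root_.opL (q + 1))^[n] u)) :=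
    h1.opL_iterate _ _
  exact h2.eq_zero

lemma IsPolyLog.opProd_opL (h : IsPolyLog q n u) (N m : ℕ) :
    IsPolyLog q n (opProd (fun Δ => (_root_.opL Δ)^[N]) m u) := by
  induction m generalizing u with
  | zero => exact h
  | succ m ih => exact ih (h.opL_iterate _ _)

/-- The product of the operators `opL` annihilates the negative powers of `L`. -/
lemma IsPolyLog.opProd_opL_eq_zero (h : IsPolyLog (q + 1) n u) (hN : n ≤ N) (hm : q < m) :
    EqOn (opProd (fun Δ => (_root_.opL Δ)^[N]) m u) (fun _ => 0) (Ioi 0) := by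
  induction m generalizing u with
  | zero => omega
  | succ m ih =>
    by_cases hq : q = m
    · subst hq
      have h1 := (isOp_opProd_opL N q).congr (h.opL_self_iterate hN)
      rwa [(isOp_opProd_opL N q).map_zero] at h1
    · exact ih (h.opL_iterate _ _) (by omega)

lemma isOp_opProd_opLog' (n : ℕ) : IsOp (opProd opLog' n) :=
  opProd_induction .id .comp (fun _ => isOp_opLog' _) _

/-- The product of the operators `opLog'` annihilates the polynomials of `log L`. -/
lemma IsPolyLog.opProd_opLog'_eq_zero (h : IsPolyLog 0 n u) :
    EqOn (opProd _root_.opLog' n u) (fun _ => 0) (Ioi 0) := by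
  induction n generalizing u with
  | zero => exact h.eq_zero
  | succ n ih =>
    refine ih (u := _root_.opLog' (n + 1) u) ?_
    obtain ⟨p, hp, hu⟩ := h
    refine ⟨_, fun i hi => ?_, ((isOp_opLog' (n + 1)).congr hu).trans (opLog'_polyLog n p)⟩
    have h1 : (X * p.derivative).coeff i = i * p.coeff i := by
      cases i with
      | zero => simp
      | succ i =>
        rw [Polynomial.coeff_X_mul, coeff_derivative]
        push_cast
        ring
    rw [coeff_C_mul, coeff_sub, coeff_C_mul, h1]
    rcases Nat.eq_or_lt_of_le hi with rfl | hlt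
    · ring
    · rw [hp i hlt]
      ring

lemma IsPolyLog.mono (h : IsPolyLog q n u) (hnm : n ≤ m) :
    IsPolyLog q m u := by
  obtain ⟨p, hp, hu⟩ := h
  exact ⟨p, fun i hi => hp i (hnm.trans hi), hu⟩

/-- The operator `frakL'` annihilates `L^(-q) log^k L` for `k < 3` and `q ≤ D - 4 + δ`. -/
lemma frakL'_polyLog (hN : 2 < N) (hk : k < 3) (hq : q = 0 ∨ q + 4 ≤ D + δ) :
    EqOn (frakL' D δ N fun L => L ^ (-(q : ℤ)) * log L ^ k) (fun _ => 0) (Ioi 0) := by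
  have h : IsPolyLog q 3 fun L => L ^ (-(q : ℤ)) * log L ^ k := by
    refine ⟨X ^ k, fun i hi => ?_, fun L _ => by simp [polyLog]⟩
    rw [Polynomial.coeff_X_pow, if_neg (by omega)]
  rcases Nat.eq_zero_or_pos q with rfl | hpos
  · exact ((h.mono hN).opProd_opL N _).opProd_opLog'_eq_zero
  · obtain ⟨q, rfl⟩ : ∃ r, q = r + 1 := ⟨q - 1, by omega⟩
    have h1 := (isOp_opProd_opLog' N).congr
      ((h.mono hN).opProd_opL_eq_zero (m := D + δ - 4) le_rfl (by omega))
    rwa [(isOp_opProd_opLog' N).map_zero] at h1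

lemma contDiff_integral_zero_one {P : Type*} [NormedAddCommGroup P] [NormedSpace ℝ P]
    {Φ : P → ℝ → ℝ} (hΦ : Smooth₂ Φ) :
    Smooth fun p => ∫ s in (0 : ℝ)..1, Φ p s := by
  let η : ContDiffBump (0 : ℝ) := ⟨1, 2, one_pos, one_lt_two⟩
  have hloc : LocallyIntegrable ((Set.Ioc (0 : ℝ) 1).indicator fun _ => (1 : ℝ)) :=
    (locallyIntegrable_const 1).indicator measurableSet_Ioc
  have hη : Smooth fun q : P × ℝ => η q.2 := η.contDiff.comp contDiff_snd
  have h1 := contDiffOn_integral_param (ν := volume) hloc (P := P) isOpen_univ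
    (isCompact_closedBall (0 : ℝ) 2) (Φ := fun p s => η s * Φ p s)
    (fun p _ s hs => by
      rw [η.zero_of_le_dist (by
        rw [mem_closedBall, not_le] at hs
        exact hs.le), zero_mul]) (hη.mul hΦ).contDiffOn
  rw [contDiffOn_univ] at h1
  convert h1 using 2 with p
  rw [intervalIntegral.integral_of_le zero_le_one, ← integral_indicator measurableSet_Ioc]
  refine integral_congr_fun fun s => ?_
  by_cases hs : s ∈ Set.Ioc (0 : ℝ) 1
  · have h4 : η s = 1 := η.one_of_mem_closedBall (by
      rw [mem_closedBall, Real.dist_eq, sub_zero, abs_of_pos hs.1]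
      exact hs.2)
    simp [Set.indicator_of_mem hs, h4]
  · simp [Set.indicator_of_notMem hs]

lemma contDiff_deriv_fst {P : Type*} [NormedAddCommGroup P] [NormedSpace ℝ P]
    {f : ℝ → P → ℝ} (hf : Smooth₂ f) :
    Smooth fun q : ℝ × P => deriv (fun t => f t q.2) q.1 := by
  have h1 : Smooth fun q : ℝ × P => fderiv ℝ (fun t => f t q.2) q.1 1 :=
    (ContDiff.fderiv (f := fun (q : ℝ × P) t => f t q.2) (n := ∞) (m := ∞)
      (hf.comp (f := fun r : (ℝ × P) × ℝ => (r.2, r.1.2)) (by fun_prop)) contDiff_fst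
      (by simp)).clm_apply contDiff_const
  simpa only [fderiv_apply_one_eq_deriv] using h1

/-- Hadamard's lemma, with parameters. -/
lemma exists_contDiff_eq_add_mul_param {P : Type*} [NormedAddCommGroup P] [NormedSpace ℝ P]
    {f : ℝ → P → ℝ} (hf : Smooth₂ f) :
    ∃ g : ℝ → P → ℝ, Smooth₂ g ∧
      ∀ t p, f t p = f 0 p + t * g t p := by
  have hd := contDiff_deriv_fst hf
  refine ⟨fun t p => ∫ s in (0 : ℝ)..1, deriv (fun t => f t p) (s * t),
    contDiff_integral_zero_one (Φ := fun (q : ℝ × P) s => deriv (fun t => f t q.2) (s * q.1))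
      (hd.comp (f := fun r : (ℝ × P) × ℝ => (r.2 * r.1.1, r.1.2)) (by fun_prop)), fun t p => ?_⟩
  have hfp : Smooth fun t => f t p := hf.comp (f := fun t : ℝ => (t, p)) (by fun_prop)
  have h2 : ∫ s in (0 : ℝ)..1, t * deriv (fun t => f t p) (s * t) = f (1 * t) p - f (0 * t) p := by
    refine intervalIntegral.integral_eq_sub_of_hasDerivAt (f := fun s => f (s * t) p)
      (fun s _ => ?_) ?_
    · have := ((hfp.differentiable (by simp)) (s * t)).hasDerivAt.comp s
        ((hasDerivAt_id s).mul_const t)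
      simpa [mul_comm, comp_def] using this
    · refine Continuous.intervalIntegrable ?_ _ _
      have := hfp.deriv_infty.continuous
      fun_prop
  rw [intervalIntegral.integral_const_mul, one_mul, zero_mul] at h2
  linarith

lemma exists_contDiff_eq_add_mul (hf : Smooth f) :
    ∃ g : ℝ → ℝ, Smooth g ∧ ∀ t, f t = f 0 + t * g t := by
  obtain ⟨g, hg, h⟩ := exists_contDiff_eq_add_mul_param (P := ℝ) (f := fun t _ => f t)
    (hf.comp contDiff_fst)
  exact ⟨fun t => g t 0, hg.comp (f := fun t : ℝ => (t, (0 : ℝ))) (by fun_prop), fun t => h t 0⟩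

/-- Taylor's formula with a smooth remainder. -/
lemma exists_contDiff_taylor (hf : Smooth f) (J : ℕ) :
    ∃ (c : ℕ → ℝ) (g : ℝ → ℝ), Smooth g ∧
      ∀ t, f t = ∑ j ∈ range J, c j * t ^ j + t ^ J * g t := by
  induction J with
  | zero => exact ⟨0, f, hf, by simp⟩
  | succ J ih =>
    obtain ⟨c, g, hg, h⟩ := ih
    obtain ⟨g', hg', h'⟩ := exists_contDiff_eq_add_mul hg
    refine ⟨fun j => if j = J then g 0 else c j, g', hg', fun t => ?_⟩
    rw [h t, h' t, sum_range_succ]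
    have : ∑ j ∈ range J, (if j = J then g 0 else c j) * t ^ j
        = ∑ j ∈ range J, c j * t ^ j :=
      sum_congr rfl fun j hj => by rw [if_neg (Finset.mem_range.1 hj).ne]
    rw [this]
    simp only [if_true]
    ring

lemma contDiffOn_zpow_Ioi (n : ℤ) : SmoothOn (fun L : ℝ => L ^ n) (Ioi 0) := by
  cases n with
  | ofNat n => simpa using contDiffOn_id.pow n
  | negSucc n =>
    simp only [zpow_negSucc]
    exact (contDiffOn_id.pow _).inv fun _ hx => pow_ne_zero _ (ne_of_gt hx)

/-- The operator `frakL'` maps `L^(-a) log^k L A(μ L²)` to an integrable scale dependence. -/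
theorem isZ_frakL' {a : ℤ} (hN : 2 < N) (hk : k < 3) (ha : a + 4 ≤ D + δ) {A : ℝ → ℝ}
    (hA : Smooth A) : ∃ z, IsZ z ∧ ∀ μ, EqOn
      (frakL' D δ N fun L => L ^ (-a) * log L ^ k * A (μ * L ^ 2)) (z μ) (Ioi 0) := by
  obtain ⟨J, hJ⟩ : ∃ J : ℕ, a + 1 ≤ 2 * J := ⟨(a + 1).toNat, by omega⟩
  -- the terms with nonpositive powers of `L` are annihilated, all others are integrable
  obtain ⟨c, g, hg, hT⟩ := exists_contDiff_taylor hA J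
  have hop := isOp_frakL' D δ N
  have hlog : SmoothOn (fun L => log L ^ k) (Ioi 0) :=
    (contDiffOn_id.log fun _ hx => ne_of_gt hx).pow k
  have hz := contDiffOn_zpow_Ioi
  set M : ℕ → ℝ → ℝ → ℝ := fun j μ L => (c j * μ ^ j) * (L ^ (2 * j - a : ℤ) * log L ^ k) with hM
  set Rm : ℝ → ℝ → ℝ := fun μ L => L ^ (2 * J - a : ℤ) * log L ^ k * (μ ^ J * g (μ * L ^ 2))
    with hRm
  have hpow : ∀ {L : ℝ} (j : ℕ), 0 < L → L ^ (2 * j - a : ℤ) = L ^ (-a) * (L ^ 2) ^ j := by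
    intro L j hL
    rw [sub_eq_add_neg, zpow_add₀ hL.ne', mul_comm, ← pow_mul]
    congr 1
  have hsplit : ∀ μ, EqOn (fun L => L ^ (-a) * log L ^ k * A (μ * L ^ 2))
      (fun L => (∑ j ∈ range J, M j μ L) + Rm μ L) (Ioi 0) := by
    intro μ L hL
    simp only [hM, hRm]
    rw [hT, hpow J hL, mul_add, mul_sum, mul_pow]
    congr 1
    · refine sum_congr rfl fun j _ => ?_
      rw [hpow j hL, mul_pow]
      ring
    · ring
  have hRz : IsZ Rm := by
    obtain ⟨p, hp⟩ : ∃ p : ℕ, (2 * J - a : ℤ) = (p + 1 : ℕ) := ⟨(2 * J - a - 1).toNat, by omega⟩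
    refine .congr _ _ (fun μ L hL => ?_) (IsZ.mono J p k g hg)
    simp only [hRm]
    rw [hp, zpow_natCast]
    ring
  have hMs : ∀ j μ, SmoothOn (M j μ) (Ioi 0) := fun j μ =>
    contDiffOn_const.mul ((hz _).mul hlog)
  have hMz : ∀ j, ∃ z, IsZ z ∧ ∀ μ, EqOn (frakL' D δ N (M j μ)) (z μ) (Ioi 0) := by
    intro j
    rcases le_or_gt (2 * j - a : ℤ) 0 with h | h
    · obtain ⟨q, hq⟩ : ∃ q : ℕ, (2 * j - a : ℤ) = -(q : ℤ) := ⟨(a - 2 * j).toNat, by omega⟩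
      refine ⟨_, IsZ.zero, fun μ L hL => ?_⟩
      simp only [hM]
      rw [hop.map_const_mul, hq]
      simp only
      rw [frakL'_polyLog hN hk (by omega) hL, mul_zero]
    · obtain ⟨p, hp⟩ : ∃ p : ℕ, (2 * j - a : ℤ) = (p + 1 : ℕ) := ⟨(2 * j - a - 1).toNat, by omega⟩
      have : IsZ (M j) := by
        refine .congr _ _ (fun μ L hL => ?_) (IsZ.mono j p k (fun _ => c j) contDiff_const)
        simp only [hM]
        rw [hp, zpow_natCast]
        ring
      exact ⟨_, this.frakL' D δ N, fun μ _ _ => rfl⟩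
  choose z hz1 hz2 using hMz
  refine ⟨fun μ L => (∑ j ∈ range J, z j μ L) + frakL' D δ N (Rm μ) L,
    .add _ _ (IsZ.sum _ fun j _ => hz1 j) (hRz.frakL' D δ N), fun μ L hL => ?_⟩
  rw [hop.congr (hsplit μ) hL,
    hop.map_add (ContDiffOn.sum fun j _ => hMs j μ) (hRz.contDiffOn μ) hL]
  have h1 := hop.map_sum (range J) (fun j _ => hMs j μ) hL
  simp only at h1 ⊢
  rw [h1]
  congr 1
  exact sum_congr rfl fun j _ => hz2 j μ hL

end PolyLog

/-! ### Dependence of the Taylor coefficients on the scale -/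

section ScaleDependence

variable {D : ℕ} {e v : ℝ → ℝ} {L : ℝ} {u y : Euc D} {K : ℝ × Euc D → ℝ}

/-- The derivative `∂_l` with respect to `a`, at `a = 0`, of `hadKer D e v μ (y - a)`. -/
def dker (e v : ℝ → ℝ) (l : List (Fin D)) (μ : ℝ) (y : Euc D) : ℝ :=
  iterD l (fun a => hadKer D e v μ (y - a)) 0

lemma contDiffOn_hadKer (he : Smooth e) (hv : Smooth v) :
    SmoothOn (fun q : ℝ × Euc D => hadKer D e v q.1 q.2) {q | q.2 ≠ 0} :=
  contDiffOn_singKer (contDiff_radial he) (contDiff_radial hv)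

lemma contDiffOn_hadKer_sub (he : Smooth e) (hv : Smooth v) (μ : ℝ)
    (y : Euc D) : SmoothOn (fun a => hadKer D e v μ (y - a)) {y}ᶜ :=
  (contDiffOn_hadKer he hv).comp (f := fun a : Euc D => (μ, y - a)) (by fun_prop)
    fun _ ha => sub_ne_zero.2 (Ne.symm ha)

lemma contDiffOn_dker (he : Smooth e) (hv : Smooth v)
    (l : List (Fin D)) : SmoothOn (fun q : ℝ × Euc D => dker e v l q.1 q.2) {q | q.2 ≠ 0} := by
  have ho : IsOpen {q : (ℝ × Euc D) × Euc D | q.1.2 ≠ q.2} :=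
    isOpen_ne_fun (continuous_snd.comp continuous_fst) continuous_snd
  have h : SmoothOn (fun q : (ℝ × Euc D) × Euc D => hadKer D e v q.1.1 (q.1.2 - q.2))
      {q | q.1.2 ≠ q.2} :=
    (contDiffOn_hadKer he hv).comp (f := fun q : (ℝ × Euc D) × Euc D => (q.1.1, q.1.2 - q.2))
      (by fun_prop) fun _ hq => sub_ne_zero.2 hq
  have := contDiffOn_iterD_param (P := ℝ × Euc D)
      (Ψ := fun p a => hadKer D e v p.1 (p.2 - a)) ho h l
  exact this.comp (f := fun q : ℝ × Euc D => (q, (0 : Euc D))) (by fun_prop) fun _ hq => hq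

/-- Scaling of the derivatives of the kernel. -/
lemma dker_smul (he : Smooth e) (hv : Smooth v) (l : List (Fin D))
    (μ : ℝ) (hL : 0 < L) (hu : u ≠ 0) :
    dker e v l μ (L • u) = (L ^ (D - 2 + l.length))⁻¹ *
      (dker e v l (μ * L ^ 2) u - 2 * log L * dker v (fun _ => 0) l (μ * L ^ 2) u) := by
  have hz : Smooth (fun _ : ℝ => (0 : ℝ)) := contDiff_const
  have h1 := iterD_comp_smul (fun a => hadKer D e v μ (L • u - a)) L l (U := {L • u}ᶜ)
    isOpen_compl_singleton (contDiffOn_hadKer_sub he hv μ _) (x := 0)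
    (by simpa [eq_comm] using smul_ne_zero hL.ne' hu)
  rw [smul_zero] at h1
  have h2 : EqOn (fun a => hadKer D e v μ (L • u - L • a)) (fun a => (L ^ (D - 2))⁻¹ *
      (hadKer D e v (μ * L ^ 2) (u - a)
        - (2 * log L) * hadKer D v (fun _ => 0) (μ * L ^ 2) (u - a))) {u}ᶜ := by
    intro a ha
    have hne : u - a ≠ 0 := sub_ne_zero.2 (Ne.symm ha)
    have h3 := hadKer_scaling e v (inv_pos.2 hL) (μ * L ^ 2) hne
    have h4 : (L⁻¹) ^ 2 * (μ * L ^ 2) = μ := by field_simp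
    rw [h4, inv_inv, smul_sub, inv_pow, inv_pow, Real.log_inv, log_pow] at h3
    simp only
    rw [h3]
    simp only [hadKer, singKer]
    push_cast
    ring
  have h0 : (0 : Euc D) ∈ ({u}ᶜ : Set (Euc D)) := by simpa [eq_comm] using hu
  have s1 := contDiffOn_hadKer_sub he hv (μ * L ^ 2) u
  have s2 := contDiffOn_hadKer_sub hv hz (μ * L ^ 2) u
  rw [iterD_congr isOpen_compl_singleton h2 l h0,
    iterD_const_mul _ isOpen_compl_singleton (s1.sub (contDiffOn_const.mul s2)) l h0] at h1
  simp only at h1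
  rw [iterD_sub isOpen_compl_singleton s1 (contDiffOn_const.mul s2) l h0] at h1
  simp only at h1
  rw [iterD_const_mul _ isOpen_compl_singleton s2 l h0] at h1
  change _ = _ * dker e v l μ (L • u) at h1
  have hLl : L ^ l.length ≠ 0 := pow_ne_zero _ hL.ne'
  rw [pow_add, mul_inv, mul_comm (L ^ (D - 2))⁻¹, mul_assoc]
  change _ = _ * ((L ^ (D - 2))⁻¹ * (iterD l (fun a => hadKer D e v (μ * L ^ 2) (u - a)) 0
    - 2 * log L * iterD l (fun a => hadKer D v (fun _ => 0) (μ * L ^ 2) (u - a)) 0))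
  rw [h1, inv_mul_cancel_left₀ hLl]

variable {ζ : ℝ → ℝ}

lemma chi_zero (y : Euc D) (L : ℝ) : chi ζ y 0 L = ζ ((L ^ 2)⁻¹ * ‖y‖ ^ 2) := by
  simp [chi]

lemma contDiffOn_chi (hζ : IsCutoff ζ) :
    SmoothOn (fun q : Euc D × ℝ => chi ζ q.1 0 q.2) (univ ×ˢ Ioi 0) := by
  have h1 : SmoothOn (fun q : Euc D × ℝ => (q.2 ^ 2)⁻¹ * ‖q.1‖ ^ 2)
      (univ ×ˢ Ioi 0) := by
    refine ContDiffOn.mul ?_ (contDiff_fst.norm_sq ℝ).contDiffOn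
    exact (contDiff_snd.pow 2).contDiffOn.inv fun q hq => pow_ne_zero _ (ne_of_gt hq.2)
  refine (hζ.smooth.comp_contDiffOn h1).congr fun q _ => ?_
  simp [chi_zero]

lemma chi_eventuallyEq_one (hζ : IsCutoff ζ) (hL : 0 < L) (hy : ‖y‖ < L) :
    chi ζ y 0 =ᶠ[𝓝 L] fun _ => 1 := by
  filter_upwards [lt_mem_nhds hy, lt_mem_nhds hL] with x hx hx0
  rw [chi_zero]
  refine hζ.eq_one _ ?_
  rw [abs_of_nonneg (by positivity), inv_mul_le_iff₀ (by positivity), mul_one]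
  exact pow_le_pow_left₀ (norm_nonneg _) hx.le 2

lemma chi_eventuallyEq_zero (hζ : IsCutoff ζ) (hL : 0 < L)
    (hy : 2 * L < ‖y‖) : chi ζ y 0 =ᶠ[𝓝 L] fun _ => 0 := by
  have h2 : ∀ᶠ x in 𝓝 L, 2 * x < ‖y‖ :=
    (continuous_const.mul continuous_id).continuousAt.eventually (gt_mem_nhds hy)
  filter_upwards [h2, lt_mem_nhds hL] with x hx hx0
  rw [chi_zero]
  refine hζ.eq_zero _ ?_
  rw [abs_of_nonneg (by positivity), inv_mul_eq_div, le_div_iff₀ (by positivity)]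
  nlinarith

/-- The cutoff function `𝔏[L] χ(·, 0; L)`. -/
def wcut (ζ : ℝ → ℝ) (δ N : ℕ) (L : ℝ) (y : Euc D) : ℝ :=
  frakL D δ N (chi ζ y 0) L

lemma contDiffOn_wcut (hζ : IsCutoff ζ) (δ N : ℕ) :
    SmoothOn (fun q : Euc D × ℝ => wcut ζ δ N q.2 q.1) (univ ×ˢ Ioi 0) :=
  (isOp_frakL D δ N).contDiffOn_param (P := Euc D) (Ψ := fun y => chi ζ y 0) (contDiffOn_chi hζ)

lemma isCut_wcut (hζ : IsCutoff ζ) (δ N : ℕ) (hL : 0 < L) :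
    IsCut (wcut ζ δ N L : Euc D → ℝ) L (2 * L) where
  smooth := by
    rw [← contDiffOn_univ]
    exact (contDiffOn_wcut hζ δ N).comp (f := fun y : Euc D => (y, L)) (by fun_prop)
      fun y _ => ⟨mem_univ _, hL⟩
  pos := hL
  eq_one y hy := (frakL_eventuallyEq_one D δ N (chi_eventuallyEq_one hζ hL hy)).eq_of_nhds
  eq_zero y hy := by
    have := ((isOp_frakL D δ N).congr_nhds (chi_eventuallyEq_zero hζ hL hy)).eq_of_nhds
    rwa [(isOp_frakL D δ N).map_zero] at this

lemma wcut_eq_of_norm_eq (δ N : ℕ) (L : ℝ) (y y' : Euc D) (h : ‖y‖ = ‖y'‖) :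
    wcut ζ δ N L y = wcut ζ δ N L y' := by
  have : chi ζ y 0 = chi ζ y' 0 := funext fun L => by rw [chi_zero, chi_zero, h]
  rw [wcut, wcut, this]

/-- The profile of the scaling derivative of the cutoff function. -/
def profile (ζ : ℝ → ℝ) (u : Euc D) : ℝ := -2 * (‖u‖ ^ 2 * deriv ζ (‖u‖ ^ 2))

lemma theta_chi (hζ : IsCutoff ζ) (u : Euc D) (hL : 0 < L) :
    theta (chi ζ (L • u) 0) L = profile ζ u := by
  have h0 : chi ζ (L • u) 0 = fun x => ζ ((x ^ 2)⁻¹ * ‖L • u‖ ^ 2) := funext (chi_zero _)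
  have h1 : HasDerivAt (fun x : ℝ => (x ^ 2)⁻¹ * ‖L • u‖ ^ 2)
      (-(2 * L) / (L ^ 2) ^ 2 * ‖L • u‖ ^ 2) L := by
    have := ((hasDerivAt_pow 2 L).fun_inv (pow_ne_zero _ hL.ne')).mul_const (‖L • u‖ ^ 2)
    simpa using this
  have h2 := ((hζ.smooth.differentiable (by simp)) ((L ^ 2)⁻¹ * ‖L • u‖ ^ 2)).hasDerivAt.comp L h1
  rw [theta_apply, h0, show deriv (fun x => ζ ((x ^ 2)⁻¹ * ‖L • u‖ ^ 2)) L = _ from h2.deriv]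
  have h3 : ‖L • u‖ ^ 2 = L ^ 2 * ‖u‖ ^ 2 := by
    rw [norm_smul, norm_of_nonneg hL.le, mul_pow]
  have h4 : (L ^ 2)⁻¹ * (L ^ 2 * ‖u‖ ^ 2) = ‖u‖ ^ 2 := by field_simp
  rw [h3, h4, profile]
  field_simp

lemma contDiff_profile (hζ : IsCutoff ζ) : Smooth (profile ζ : Euc D → ℝ) :=
  contDiff_const.mul ((contDiff_id.norm_sq ℝ).mul
    (hζ.smooth.deriv_infty.comp (contDiff_id.norm_sq ℝ)))

lemma profile_eq_zero (hζ : IsCutoff ζ) (hu : ‖u‖ < 1 ∨ 2 < ‖u‖) : profile ζ u = 0 := by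
  have h1 := theta_chi hζ u one_pos
  rw [one_smul] at h1
  rw [← h1, theta_apply, one_mul]
  rcases hu with hu | hu
  · rw [(chi_eventuallyEq_one hζ one_pos hu).deriv_eq]
    simp
  · rw [(chi_eventuallyEq_zero hζ one_pos (by linarith)).deriv_eq]
    simp

/-- Integrals over the annulus of the profile depend smoothly on the parameter. -/
lemma contDiffOn_profile_mul (hζ : IsCutoff ζ) (hK : SmoothOn K {q | q.2 ≠ 0}) :
    Smooth fun q : ℝ × Euc D => profile ζ q.2 * K q := by
  refine contDiff_mul_of_eventuallyEq_zero
    (isOpen_ne_fun continuous_snd continuous_const) ((contDiff_profile hζ).comp contDiff_snd) hK ?_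
  intro q hq
  have hq0 : q.2 = 0 := by simpa using hq
  have : ∀ᶠ p : ℝ × Euc D in 𝓝 q, ‖p.2‖ < 1 :=
    (isOpen_lt (by fun_prop) continuous_const).mem_nhds (by
      show ‖q.2‖ < 1
      rw [hq0, norm_zero]
      exact one_pos)
  filter_upwards [this] with p hp
  exact profile_eq_zero hζ (Or.inl hp)

lemma contDiff_integral_profile (hζ : IsCutoff ζ)
    (hK : SmoothOn K {q | q.2 ≠ 0}) : Smooth fun t => ∫ u, profile ζ u * K (t, u) := by
  have := contDiffOn_integral_param (f := fun _ : Euc D => (1 : ℝ)) (ν := volume)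
    (locallyIntegrable_const 1) (P := ℝ) isOpen_univ (isCompact_closedBall (0 : Euc D) 2)
    (Φ := fun t u => profile ζ u * K (t, u))
    (fun t _ u hu => by rw [profile_eq_zero hζ (Or.inr (by simpa using hu)), zero_mul])
    (contDiffOn_profile_mul hζ hK).contDiffOn
  rw [contDiffOn_univ] at this
  simpa only [one_mul] using this

lemma integrable_profile (hζ : IsCutoff ζ) (hK : SmoothOn K {q | q.2 ≠ 0}) (t : ℝ) :
    Integrable fun u => profile ζ u * K (t, u) := by
  have h1 : Continuous fun u : Euc D => profile ζ u * K (t, u) :=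
    (contDiffOn_profile_mul hζ hK).continuous.comp (f := fun u : Euc D => (t, u)) (by fun_prop)
  exact h1.integrable_of_hasCompactSupport (.intro
    (isCompact_closedBall (0 : Euc D) 2) fun u hu => by
      rw [profile_eq_zero hζ (Or.inr (by simpa using hu)), zero_mul])

namespace KernelData

variable (d : KernelData D)

lemma dE_eq_dker (l : List (Fin D)) : d.dE l = dker d.e d.v l := rfl

/-- The scale dependence of the integral of the scaling derivative of the cutoff function: two
kernels contribute at most two logarithms. -/
lemma exists_scaling_expansion (hζ : IsCutoff ζ) (l l' : List (Fin D)) :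
    ∃ A : ℕ → ℝ → ℝ, (∀ k, Smooth (A k)) ∧ ∀ μ L, 0 < L →
      ∫ y, theta (chi ζ y 0) L * (d.dE l μ y * d.dE l' μ y)
        = ∑ k ∈ range 3, L ^ (-((D : ℤ) - 4 + l.length + l'.length)) * log L ^ k
            * A k (μ * L ^ 2) := by
  have hne := d.neZero
  have hz : Smooth (fun _ : ℝ => (0 : ℝ)) := contDiff_const
  have s1 := contDiffOn_dker d.he d.hv l
  have s2 := contDiffOn_dker d.he d.hv l'
  have s3 := contDiffOn_dker d.hv hz l
  have s4 := contDiffOn_dker d.hv hz l'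
  -- the coefficients of the powers of `-2 log L` in the product of the rescaled kernels
  set K0 : ℝ × Euc D → ℝ := fun q => dker d.e d.v l q.1 q.2 * dker d.e d.v l' q.1 q.2 with hK0
  set K1 : ℝ × Euc D → ℝ := fun q => dker d.e d.v l q.1 q.2 * dker d.v (fun _ => 0) l' q.1 q.2
    + dker d.v (fun _ => 0) l q.1 q.2 * dker d.e d.v l' q.1 q.2 with hK1
  set K2 : ℝ × Euc D → ℝ := fun q => dker d.v (fun _ => 0) l q.1 q.2
    * dker d.v (fun _ => 0) l' q.1 q.2 with hK2
  have c0 : SmoothOn K0 {q | q.2 ≠ 0} := s1.mul s2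
  have c1 : SmoothOn K1 {q | q.2 ≠ 0} := (s1.mul s4).add (s3.mul s2)
  have c2 : SmoothOn K2 {q | q.2 ≠ 0} := s3.mul s4
  refine ⟨fun k => match k with
    | 0 => fun t => ∫ u, profile ζ u * K0 (t, u)
    | 1 => fun t => -2 * ∫ u, profile ζ u * K1 (t, u)
    | _ => fun t => 4 * ∫ u, profile ζ u * K2 (t, u), fun k => ?_, fun μ L hL => ?_⟩
  · match k with
    | 0 => exact contDiff_integral_profile hζ c0
    | 1 => exact contDiff_const.mul (contDiff_integral_profile hζ c1)
    | (k + 2) => exact contDiff_const.mul (contDiff_integral_profile hζ c2)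
  · have hsub := Measure.integral_comp_smul (volume : Measure (Euc D))
      (fun y => theta (chi ζ y 0) L * (d.dE l μ y * d.dE l' μ y)) L
    rw [finrank_euclideanSpace, Fintype.card_fin, abs_of_pos (by positivity), smul_eq_mul] at hsub
    have hLD : L ^ D ≠ 0 := pow_ne_zero _ hL.ne'
    have hpt : ∫ u, theta (chi ζ (L • u) 0) L * (d.dE l μ (L • u) * d.dE l' μ (L • u))
        = ((L ^ (D - 2 + l.length))⁻¹ * (L ^ (D - 2 + l'.length))⁻¹) *
          ((∫ u, profile ζ u * K0 (μ * L ^ 2, u))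
            + (-2 * log L) * (∫ u, profile ζ u * K1 (μ * L ^ 2, u))
            + (4 * log L ^ 2) * ∫ u, profile ζ u * K2 (μ * L ^ 2, u)) := by
      have i0 := integrable_profile hζ c0 (μ * L ^ 2)
      have i1 := (integrable_profile hζ c1 (μ * L ^ 2)).const_mul (-2 * log L)
      have i2 := (integrable_profile hζ c2 (μ * L ^ 2)).const_mul (4 * log L ^ 2)
      have i01 : Integrable fun u => profile ζ u * K0 (μ * L ^ 2, u)
          + -2 * log L * (profile ζ u * K1 (μ * L ^ 2, u)) := i0.add i1
      rw [← integral_const_mul (-2 * log L), ← integral_const_mul (4 * log L ^ 2),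
        ← integral_add i0 i1, ← integral_add i01 i2, ← integral_const_mul]
      refine integral_congr_ae ?_
      filter_upwards [ae_ne_point (0 : Euc D)] with u hu
      rw [theta_chi hζ u hL, d.dE_eq_dker, d.dE_eq_dker, dker_smul d.he d.hv l μ hL hu,
        dker_smul d.he d.hv l' μ hL hu]
      simp only [hK0, hK1, hK2]
      ring
    rw [hpt] at hsub
    have hD := d.hD
    have hp : L ^ (-((D : ℤ) - 4 + l.length + l'.length))
        = L ^ D * ((L ^ (D - 2 + l.length))⁻¹ * (L ^ (D - 2 + l'.length))⁻¹) := by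
      rw [← zpow_natCast, ← zpow_natCast, ← zpow_natCast, ← zpow_neg, ← zpow_neg,
        ← zpow_add₀ hL.ne', ← zpow_add₀ hL.ne']
      congr 1
      push_cast [hD]
      ring
    have h5 : ∫ y, theta (chi ζ y 0) L * (d.dE l μ y * d.dE l' μ y)
        = L ^ D * ((L ^ D)⁻¹ * ∫ y, theta (chi ζ y 0) L * (d.dE l μ y * d.dE l' μ y)) := by
      rw [mul_inv_cancel_left₀ hLD]
    rw [h5, ← hsub, ← mul_assoc, ← hp, sum_range_succ, sum_range_succ,
      Finset.sum_range_one]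
    simp only [pow_zero, pow_one]
    ring

lemma contDiffOn_dE_slice (l : List (Fin D)) (μ : ℝ) : SmoothOn (d.dE l μ) {0}ᶜ :=
  (d.contDiffOn_dE l).comp (f := fun y : Euc D => (μ, y)) (by fun_prop) fun _ hy => hy

/-- A smooth family of weights which vanish near the origin, multiplied by a function which is
smooth away from the origin, is a smooth family. -/
lemma contDiffOn_weight_mul {F : Euc D → ℝ} (hF : SmoothOn F {0}ᶜ)
    {w : Euc D × ℝ → ℝ} (hw : SmoothOn w (univ ×ˢ Ioi 0))
    (h0 : ∀ L, 0 < L → ∀ᶠ q : Euc D × ℝ in 𝓝 (0, L), w q = 0) :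
    SmoothOn (fun q : Euc D × ℝ => w q * F q.1) (univ ×ˢ Ioi 0) := by
  rintro ⟨y, L⟩ ⟨-, hL⟩
  replace hL : 0 < L := hL
  refine ContDiffAt.contDiffWithinAt ?_
  by_cases hy : y = 0
  · subst hy
    refine ContDiffAt.congr_of_eventuallyEq (f := fun _ => (0 : ℝ)) contDiffAt_const ?_
    filter_upwards [h0 L hL] with q hq
    rw [hq, zero_mul]
  · have h1 : ContDiffAt ℝ ∞ (fun q : Euc D × ℝ => F q.1) (y, L) :=
      ContDiffAt.comp (g := F) (f := fun q : Euc D × ℝ => q.1) (y, L)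
        (hF.contDiffAt (isOpen_compl_singleton.mem_nhds hy)) contDiffAt_fst
    have h2 : (y, L) ∈ (univ : Set (Euc D)) ×ˢ Ioi (0 : ℝ) := ⟨mem_univ _, hL⟩
    exact (hw.contDiffAt ((isOpen_univ.prod isOpen_Ioi).mem_nhds h2)).mul h1

end KernelData

end ScaleDependence

/-! ### The canonical counterterm as a limit of small scales -/

section ScaleFlow

variable {D : ℕ} {ζ : ℝ → ℝ} {L : ℝ} {δ N : ℕ} {γ : MultiIdx₂ D}

namespace KernelData

variable (d : KernelData D)

/-- The scale derivative of the Taylor coefficients. -/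
def scaleD (ζ : ℝ → ℝ) (δ N : ℕ) (γ : MultiIdx₂ D) (μ L : ℝ) : ℝ :=
  ∫ y, deriv (frakL D δ N (chi ζ y 0)) L * (d.dE (idxList γ.1) μ y * d.dE (idxList γ.2) μ y)

lemma wcut_eventually_one (hζ : IsCutoff ζ) (δ N : ℕ) (hL : 0 < L) :
    ∀ᶠ q : Euc D × ℝ in 𝓝 (0, L), wcut ζ δ N q.2 q.1 = 1 := by
  have h1 : ∀ᶠ q : Euc D × ℝ in 𝓝 (0, L), ‖q.1‖ < L / 2 :=
    (isOpen_lt (by fun_prop) continuous_const).mem_nhds (by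
      show ‖(0 : Euc D)‖ < L / 2
      simpa using hL)
  have h2 : ∀ᶠ q : Euc D × ℝ in 𝓝 (0, L), L / 2 < q.2 :=
    (isOpen_lt continuous_const continuous_snd).mem_nhds (by
      show L / 2 < L
      linarith)
  filter_upwards [h1, h2] with q hq1 hq2
  exact (isCut_wcut hζ δ N (by linarith)).eq_one _ (hq1.trans hq2)

lemma hasDerivAt_T (hζ : IsCutoff ζ) (δ N : ℕ) (γ : MultiIdx₂ D) (μ : ℝ) (hL : 0 < L) :
    HasDerivAt (fun L => d.T (wcut ζ δ N L) γ μ) (d.scaleD ζ δ N γ μ L) L := by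
  set F : Euc D → ℝ := fun y => d.dE (idxList γ.1) μ y * d.dE (idxList γ.2) μ y with hF
  have hFs : SmoothOn F {0}ᶜ := (d.contDiffOn_dE_slice _ μ).mul (d.contDiffOn_dE_slice _ μ)
  have hw0 : IsCut (wcut ζ δ N L : Euc D → ℝ) L (2 * L) := isCut_wcut hζ δ N hL
  have hs1 : SmoothOn (fun q : Euc D × ℝ => wcut ζ δ N q.2 q.1 - wcut ζ δ N L q.1)
      (univ ×ˢ Ioi 0) :=
    (contDiffOn_wcut hζ δ N).sub (hw0.smooth.comp contDiff_fst).contDiffOn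
  have hs2 := contDiffOn_weight_mul hFs hs1 (fun L' hL' => by
    have h1 : ∀ᶠ q : Euc D × ℝ in 𝓝 (0, L'), wcut ζ δ N L q.1 = 1 :=
      (continuous_fst.tendsto ((0 : Euc D), L')).eventually
        (hw0.eventually_eq_one (by simpa using hL))
    filter_upwards [wcut_eventually_one hζ δ N hL', h1] with q hq hq'
    rw [hq, hq', sub_self])
  have hs3 : SmoothOn (fun q : ℝ × Euc D => (wcut ζ δ N q.1 q.2 - wcut ζ δ N L q.2) * F q.2)
      (Ioo 0 (2 * L) ×ˢ univ) :=
    hs2.comp (f := fun q : ℝ × Euc D => (q.2, q.1)) (by fun_prop)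
      fun q hq => ⟨mem_univ _, hq.1.1⟩
  have hk : ∀ p ∈ Ioo 0 (2 * L), ∀ y, y ∉ closedBall (0 : Euc D) (4 * L) →
      (wcut ζ δ N p y - wcut ζ δ N L y) * F y = 0 := fun p hp y hy => by
    rw [mem_closedBall, dist_zero_right, not_le] at hy
    rw [hw0.eq_zero y (by linarith), (isCut_wcut hζ δ N hp.1).eq_zero y (by linarith [hp.2]),
      sub_self, zero_mul]
  have hd := hasDerivAt_integral_param (f := fun _ : Euc D => (1 : ℝ)) (ν := volume)
    (locallyIntegrable_const 1) isOpen_Ioo (isCompact_closedBall (0 : Euc D) (4 * L))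
    (Φ := fun p y => (wcut ζ δ N p y - wcut ζ δ N L y) * F y) hk hs3 (p₀ := L)
    ⟨hL, by linarith⟩
  simp only [one_mul] at hd
  have he : (fun L' => d.T (wcut ζ δ N L') γ μ) =ᶠ[𝓝 L]
      fun L' => d.T (wcut ζ δ N L) γ μ + ∫ y, (wcut ζ δ N L' y - wcut ζ δ N L y) * F y := by
    filter_upwards [lt_mem_nhds hL] with L' hL'
    rw [← d.T_sub (isCut_wcut hζ δ N hL') hw0]
    ring
  refine ((hd.const_add _).congr_of_eventuallyEq he).congr_deriv ?_
  refine integral_congr_fun fun y => ?_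
  rw [deriv_mul_const_field, deriv_sub_const_fun]
  rfl

/-- The scale derivative is integrable at small scales, since the operator `frakL` removes all the
singular terms of its expansion. -/
theorem exists_isZ_scaleD (hζ : IsCutoff ζ) (hN : 2 < N) (hγ : γ.1.order + γ.2.order ≤ δ) :
    ∃ z, IsZ z ∧ ∀ μ L, 0 < L → d.scaleD ζ δ N γ μ L = z μ L / L := by
  obtain ⟨A, hA, hexp⟩ := d.exists_scaling_expansion hζ (idxList γ.1) (idxList γ.2)
  simp only [length_idxList] at hexp
  have hZ : ∀ k ∈ range 3, ∃ z, IsZ z ∧ ∀ μ, EqOn (frakL' D δ N fun L =>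
      L ^ (-((D : ℤ) - 4 + γ.1.order + γ.2.order)) * log L ^ k * A k (μ * L ^ 2)) (z μ)
      (Ioi 0) := fun k hk =>
    isZ_frakL' hN (Finset.mem_range.1 hk) (by omega) (hA k)
  choose! z hz1 hz2 using hZ
  refine ⟨fun μ L => ∑ k ∈ range 3, z k μ L, IsZ.sum _ hz1, fun μ L hL => ?_⟩
  have hop := isOp_frakL' D δ N
  set F : Euc D → ℝ := fun y => d.dE (idxList γ.1) μ y * d.dE (idxList γ.2) μ y with hF
  have hFs : SmoothOn F {0}ᶜ := (d.contDiffOn_dE_slice _ μ).mul (d.contDiffOn_dE_slice _ μ)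
  have ht : SmoothOn (fun q : Euc D × ℝ => theta (chi ζ q.1 0) q.2)
      (univ ×ˢ Ioi 0) :=
    isOp_theta.contDiffOn_param (P := Euc D) (Ψ := fun y => chi ζ y 0) (contDiffOn_chi hζ)
  have ht2 := contDiffOn_weight_mul hFs ht (fun L' hL' => by
    have h1 : ∀ᶠ q : Euc D × ℝ in 𝓝 (0, L'), ‖q.1‖ < q.2 :=
      (isOpen_lt (continuous_norm.comp continuous_fst) continuous_snd).mem_nhds (by
        show ‖(0 : Euc D)‖ < L'
        simpa using hL')
    have h2 : ∀ᶠ q : Euc D × ℝ in 𝓝 (0, L'), 0 < q.2 :=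
      (isOpen_lt continuous_const continuous_snd).mem_nhds hL'
    filter_upwards [h1, h2] with q hq hq'
    rw [theta_apply, (chi_eventuallyEq_one hζ hq' hq).deriv_eq]
    simp)
  have hint := hop.integral_comm (Ψ := fun y L => theta (chi ζ y 0) L * F y) ht2
    (fun y L hL hy => by
      rw [theta_apply, (chi_eventuallyEq_zero hζ hL hy).deriv_eq]
      simp) hL
  simp only at hint
  have hcs : ∀ k ∈ range 3, SmoothOn (fun L : ℝ =>
      L ^ (-((D : ℤ) - 4 + γ.1.order + γ.2.order)) * log L ^ k * A k (μ * L ^ 2))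
      (Ioi 0) := by
    intro k _
    have h1 : SmoothOn (fun L => log L ^ k) (Ioi 0) :=
      (contDiffOn_id.log fun _ hx => ne_of_gt hx).pow k
    have h2 : Smooth fun L : ℝ => A k (μ * L ^ 2) := (hA k).comp (by fun_prop)
    exact ((contDiffOn_zpow_Ioi _).mul h1).mul h2.contDiffOn
  have h3 : EqOn (fun L => ∫ y, theta (chi ζ y 0) L * F y) (fun L => ∑ k ∈ range 3,
      L ^ (-((D : ℤ) - 4 + γ.1.order + γ.2.order)) * log L ^ k * A k (μ * L ^ 2))
      (Ioi 0) := fun L hL => hexp μ L hL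
  have h4 : (∑ k ∈ range 3, z k μ L)
      = frakL' D δ N (fun L => ∫ y, theta (chi ζ y 0) L * F y) L := by
    rw [hop.congr h3 hL]
    have := hop.map_sum (range 3) hcs hL
    simp only at this
    rw [this]
    exact sum_congr rfl fun k hk => (hz2 k hk μ hL).symm
  simp only
  rw [h4, ← hint, scaleD, eq_div_iff hL.ne', ← integral_mul_const]
  refine integral_congr_fun fun y => ?_
  have h5 : SmoothOn (chi ζ y 0) (Ioi 0) :=
    (contDiffOn_chi hζ).comp (f := fun L : ℝ => (y, L)) (by fun_prop)
      fun L hL => ⟨mem_univ _, hL⟩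
  rw [hop.map_mul_const]
  change _ = frakL' D δ N (theta (chi ζ y 0)) L * F y
  rw [← (intertwined_frakL D δ N).2.2 _ h5 hL, theta_apply, hF]
  ring

lemma intervalIntegrable_scaleD (hζ : IsCutoff ζ) (hN : 2 < N)
    (hγ : γ.1.order + γ.2.order ≤ δ) (μ : ℝ) {b : ℝ} (hb : 0 < b) :
    IntervalIntegrable (d.scaleD ζ δ N γ μ) volume 0 b := by
  obtain ⟨z, hz, h⟩ := d.exists_isZ_scaleD hζ hN hγ
  refine (hz.intervalIntegrable_div μ hb).congr fun L hL => ?_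
  rw [Set.uIoc_of_le hb.le] at hL
  exact (h μ L hL.1).symm

/-- The counterterm of the two-point flow relation: minus the limit of the Taylor coefficients of
the regular expression as the cutoff scale tends to zero. -/
def b0 (ζ : ℝ → ℝ) (δ N : ℕ) (γ : MultiIdx₂ D) (μ : ℝ) : ℝ :=
  (∫ L in (0 : ℝ)..1, d.scaleD ζ δ N γ μ L) - d.T (wcut ζ δ N 1) γ μ

lemma contDiff_b0 (hζ : IsCutoff ζ) (hN : 2 < N) (hγ : γ.1.order + γ.2.order ≤ δ) :
    Smooth (d.b0 ζ δ N γ) := by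
  obtain ⟨z, hz, h⟩ := d.exists_isZ_scaleD hζ hN hγ
  refine ContDiff.sub ?_ (d.contDiff_T (isCut_wcut hζ δ N one_pos) γ)
  convert hz.contDiff_integral_div using 2 with μ
  refine intervalIntegral.integral_congr_ae (.of_forall fun L hL => ?_)
  rw [Set.uIoc_of_le zero_le_one] at hL
  exact h μ L hL.1

/-- The right-hand side is `-b^H(L)`. -/
lemma T_wcut (hζ : IsCutoff ζ) (hN : 2 < N) (hγ : γ.1.order + γ.2.order ≤ δ) (μ : ℝ) (hL : 0 < L) :
    d.T (wcut ζ δ N L) γ μ = -(d.b0 ζ δ N γ μ - ∫ L' in (0 : ℝ)..L, d.scaleD ζ δ N γ μ L') := by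
  have i1 := d.intervalIntegrable_scaleD hζ hN hγ μ one_pos
  have i2 := d.intervalIntegrable_scaleD hζ hN hγ μ hL
  have h1 : ∫ x in L..1, d.scaleD ζ δ N γ μ x
      = d.T (wcut ζ δ N 1) γ μ - d.T (wcut ζ δ N L) γ μ := by
    refine intervalIntegral.integral_eq_sub_of_hasDerivAt
      (f := fun x => d.T (wcut ζ δ N x) γ μ) (fun x hx => ?_) (i2.symm.trans i1)
    have hx0 : 0 < x := by
      rw [Set.mem_uIcc] at hx
      rcases hx with hx | hx <;> linarith [hx.1]
    exact d.hasDerivAt_T hζ δ N γ μ hx0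
  have h2 := intervalIntegral.integral_add_adjacent_intervals i2 (i2.symm.trans i1)
  rw [b0, ← h2, h1]
  ring

lemma tendsto_T_wcut (hζ : IsCutoff ζ) (hN : 2 < N) (hγ : γ.1.order + γ.2.order ≤ δ) (μ : ℝ) :
    Tendsto (fun L => d.T (wcut ζ δ N L) γ μ) (𝓝[>] 0) (𝓝 (-d.b0 ζ δ N γ μ)) := by
  have i1 := d.intervalIntegrable_scaleD hζ hN hγ μ one_pos
  have hc : ContinuousWithinAt (fun L => ∫ x in (0 : ℝ)..L, d.scaleD ζ δ N γ μ x)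
      (Set.Icc 0 1) 0 := by
    have := intervalIntegral.continuousOn_primitive_interval' i1 (Set.left_mem_uIcc)
    rw [Set.uIcc_of_le zero_le_one] at this
    exact this 0 ⟨le_rfl, zero_le_one⟩
  have h1 : Tendsto (fun L => ∫ x in (0 : ℝ)..L, d.scaleD ζ δ N γ μ x) (𝓝[>] 0) (𝓝 0) := by
    have h2 := hc.tendsto
    rw [intervalIntegral.integral_same] at h2
    refine h2.mono_left ?_
    rw [← nhdsWithin_Ioo_eq_nhdsGT (zero_lt_one' ℝ)]
    exact nhdsWithin_mono _ Set.Ioo_subset_Icc_self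
  have h3 : Tendsto (fun L => -(d.b0 ζ δ N γ μ - ∫ L' in (0 : ℝ)..L, d.scaleD ζ δ N γ μ L'))
      (𝓝[>] 0) (𝓝 (-(d.b0 ζ δ N γ μ - 0))) := (tendsto_const_nhds.sub h1).neg
  rw [sub_zero] at h3
  refine h3.congr' ?_
  filter_upwards [self_mem_nhdsWithin] with L hL
  exact (d.T_wcut hζ hN hγ μ hL).symm

end KernelData

end ScaleFlow

/-! ### Polynomial dependence on a real variable -/

section PolyIn

variable {M M' : ℕ} {f f' : ℝ → ℝ}

/-- `f` is a polynomial function of degree at most `M`. -/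
def PolyIn (M : ℕ) (f : ℝ → ℝ) : Prop := ∃ p : Polynomial ℝ, p.natDegree ≤ M ∧ ∀ s, f s = p.eval s

namespace PolyIn

lemma mono (h : PolyIn M f) (hM : M ≤ M') : PolyIn M' f := by
  obtain ⟨p, hp, h⟩ := h
  exact ⟨p, hp.trans hM, h⟩

lemma congr (h : PolyIn M f) (h' : ∀ s, f' s = f s) : PolyIn M f' := by
  obtain ⟨p, hp, h⟩ := h
  exact ⟨p, hp, fun s => (h' s).trans (h s)⟩

lemma const (c : ℝ) : PolyIn 0 fun _ => c := ⟨C c, by simp, by simp⟩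

lemma linear (c c' : ℝ) : PolyIn 1 fun s => c + c' * s :=
  ⟨C c' * X + C c, Polynomial.natDegree_linear_le, fun s => by
    simp
    ring⟩

lemma mul (h : PolyIn M f) (h' : PolyIn M' f') :
    PolyIn (M + M') fun s => f s * f' s := by
  obtain ⟨p, hp, h⟩ := h
  obtain ⟨p', hp', h'⟩ := h'
  exact ⟨p * p', Polynomial.natDegree_mul_le.trans (add_le_add hp hp'), fun s => by simp [h, h']⟩

lemma add (h : PolyIn M f) (h' : PolyIn M f') :
    PolyIn M fun s => f s + f' s := by
  obtain ⟨p, hp, h⟩ := h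
  obtain ⟨p', hp', h'⟩ := h'
  exact ⟨p + p', (Polynomial.natDegree_add_le _ _).trans (max_le hp hp'), fun s => by simp [h, h']⟩

lemma const_mul (h : PolyIn M f) (c : ℝ) : PolyIn M fun s => c * f s :=
  ((const c).mul h).mono (by simp)

lemma sub (h : PolyIn M f) (h' : PolyIn M f') :
    PolyIn M fun s => f s - f' s := by
  simpa [sub_eq_add_neg] using h.add (h'.const_mul (-1))

/-- The Lagrange interpolation polynomials for the nodes `0, …, M`. -/
def lag (M j : ℕ) : Polynomial ℝ :=
  Lagrange.basis (range (M + 1)) (fun i : ℕ => (i : ℝ)) j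

lemma injOn_cast (M : ℕ) : Set.InjOn (fun i : ℕ => (i : ℝ)) (range (M + 1) : Finset ℕ) :=
  fun _ _ _ _ h => Nat.cast_injective h

lemma eq_sum (h : PolyIn M f) (s : ℝ) :
    f s = ∑ j ∈ range (M + 1), (lag M j).eval s * f j := by
  obtain ⟨p, hp, h⟩ := h
  have h1 := Lagrange.eq_interpolate_of_eval_eq (s := range (M + 1))
    (v := fun i : ℕ => (i : ℝ)) (r := fun i => f i) (f := p) (injOn_cast M)
    (by
      rw [Finset.card_range]
      exact lt_of_le_of_lt Polynomial.degree_le_natDegree (by exact_mod_cast Nat.lt_succ_of_le hp))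
    (fun i _ => (h i).symm)
  rw [h s, h1, Lagrange.interpolate_apply, eval_finsetSum]
  refine sum_congr rfl fun j _ => ?_
  rw [eval_mul, eval_C, mul_comm, lag]

lemma of_eq_sum (h : ∀ s, f s = ∑ j ∈ range (M + 1), (lag M j).eval s * f j) : PolyIn M f := by
  refine ⟨∑ j ∈ range (M + 1), lag M j * C (f j), ?_, fun s => by
    rw [h s, eval_finsetSum]
    simp⟩
  refine Polynomial.natDegree_sum_le_of_forall_le _ _ fun j hj => ?_
  refine (Polynomial.natDegree_mul_C_le _ _).trans ?_
  rw [lag, Lagrange.natDegree_basis (injOn_cast M) hj]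
  simp

/-- Polynomials of bounded degree are closed under pointwise limits. -/
lemma of_tendsto {ι : Type*} {l : Filter ι} [l.NeBot] {F : ι → ℝ → ℝ}
    (hF : ∀ᶠ i in l, PolyIn M (F i)) (h : ∀ s, Tendsto (fun i => F i s) l (𝓝 (f s))) :
    PolyIn M f := by
  refine of_eq_sum fun s => tendsto_nhds_unique (h s) ?_
  refine (tendsto_finsetSum (range (M + 1)) fun j _ => (h j).const_mul _).congr' ?_
  filter_upwards [hF] with i hi
  exact (hi.eq_sum s).symm

lemma integral {X : Type*} [MeasurableSpace X] {ν : Measure X} {G : ℝ → X → ℝ}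
    (hG : ∀ s, Integrable (G s) ν) (h : ∀ᵐ y ∂ν, PolyIn M fun s => G s y) :
    PolyIn M fun s => ∫ y, G s y ∂ν := by
  refine of_eq_sum fun s => ?_
  simp_rw [← integral_const_mul]
  rw [← integral_finsetSum _ fun (j : ℕ) _ => (hG j).const_mul ((lag M j).eval s)]
  refine integral_congr_ae ?_
  filter_upwards [h] with y hy
  exact hy.eq_sum s

lemma iterD {D : ℕ} {M : ℕ} {f : ℝ → Euc D → ℝ} {U : Set (Euc D)} (hU : IsOpen U)
    (hf : ∀ s, SmoothOn (f s) U) (h : ∀ x ∈ U, PolyIn M fun s => f s x)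
    (l : List (Fin D)) : ∀ x ∈ U, PolyIn M fun s => _root_.iterD l (f s) x := by
  induction l with
  | nil => exact h
  | cons i l ih =>
    intro x hx
    have hc : Tendsto (fun t : ℝ => x + t • 𝐞 i) (𝓝[≠] 0) (𝓝 x) := by
      have : Continuous fun t : ℝ => x + t • 𝐞 i := by fun_prop
      simpa using (this.tendsto 0).mono_left nhdsWithin_le_nhds
    refine of_tendsto (l := 𝓝[≠] (0 : ℝ)) (F := fun t s => t⁻¹ *
      (_root_.iterD l (f s) (x + t • 𝐞 i) - _root_.iterD l (f s) x)) ?_ ?_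
    · filter_upwards [hc.eventually (hU.mem_nhds hx)] with t ht
      exact ((ih _ ht).sub (ih _ hx)).const_mul _
    · intro s
      have h1 := (((hf s).iterD hU l).differentiableAt_of_isOpen hU hx).hasFDerivAt
      have h2 := h1.hasLineDerivAt (𝐞 i)
      exact h2.tendsto_slope_zero

end PolyIn

/-- No logarithms occur in the Taylor expansion of a smooth function. -/
theorem polynomial_log_eq_const {F : ℝ → ℝ} (hF : Smooth F) {a : ℤ}
    (hf : PolyIn M f) (h : ∀ l : ℝ, 0 < l → F (l ^ 2) = l ^ a * f (log l)) (s : ℝ) :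
    f s = f 0 := by
  obtain ⟨p, -, hp⟩ := hf
  have key : ∀ (n : ℕ) (a : ℤ) (F : ℝ → ℝ), a ≤ 2 * n → Smooth F →
      (∀ l : ℝ, 0 < l → F (l ^ 2) = l ^ a * p.eval (log l)) → p.natDegree = 0 := by
    have hlow : ∀ (a : ℤ) (F : ℝ → ℝ), a ≤ 0 → Smooth F →
        (∀ l : ℝ, 0 < l → F (l ^ 2) = l ^ a * p.eval (log l)) → p.natDegree = 0 := by
      intro a F ha hF h
      obtain ⟨m, rfl⟩ : ∃ m : ℕ, a = -m := ⟨a.natAbs, by omega⟩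
      have h1 : Tendsto (fun t : ℝ => exp (-t) ^ m * F (exp (-t) ^ 2)) atTop
          (𝓝 (0 ^ m * F (0 ^ 2))) := by
        have h2 : Tendsto (fun t : ℝ => exp (-t)) atTop (𝓝 0) :=
          Real.tendsto_exp_atBot.comp tendsto_neg_atTop_atBot
        have h3 : Continuous fun x : ℝ => x ^ m * F (x ^ 2) :=
          (continuous_pow m).mul (hF.continuous.comp (continuous_pow 2))
        exact (h3.tendsto 0).comp h2
      have h4 : (fun t : ℝ => exp (-t) ^ m * F (exp (-t) ^ 2))
          = fun t => (p.comp (-X)).eval t := by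
        ext t
        rw [h _ (exp_pos _), log_exp, zpow_neg, zpow_natCast, ← mul_assoc,
          mul_inv_cancel₀ (by positivity), one_mul]
        simp
      rw [h4] at h1
      have h5 := (Polynomial.tendsto_nhds_iff _).1 h1
      have h6 : (p.comp (-X)).natDegree = 0 :=
        Polynomial.natDegree_eq_zero_iff_degree_le_zero.2 h5.2
      rw [Polynomial.natDegree_comp, Polynomial.natDegree_neg, Polynomial.natDegree_X] at h6
      omega
    intro n
    induction n with
    | zero => exact fun a F ha => hlow a F (by simpa using ha)
    | succ n ih =>
      intro a F ha hF h
      rcases le_or_gt a 0 with h0 | h0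
      · exact hlow a F h0 hF h
      · obtain ⟨G, hG, hFG⟩ := exists_contDiff_eq_add_mul hF
        -- for `a > 0` the value at `0` vanishes, as powers beat logarithms
        have hF0 : F 0 = 0 := by
          obtain ⟨m, rfl⟩ : ∃ m : ℕ, a = m + 1 := ⟨(a - 1).natAbs, by omega⟩
          have h1 : Tendsto (fun t : ℝ => F (exp (-t) ^ 2)) atTop (𝓝 (F 0)) := by
            have h2 : Tendsto (fun t : ℝ => exp (-t)) atTop (𝓝 0) :=
              Real.tendsto_exp_atBot.comp tendsto_neg_atTop_atBot
            have h3 : Continuous fun x : ℝ => F (x ^ 2) := hF.continuous.comp (continuous_pow 2)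
            simpa [comp_def] using (h3.tendsto 0).comp h2
          have h4 : Tendsto (fun t : ℝ => exp (-t) ^ m *
              ((p.comp (-X)).eval t / exp t)) atTop (𝓝 (0 ^ m * 0)) := by
            have h2 : Tendsto (fun t : ℝ => exp (-t)) atTop (𝓝 0) :=
              Real.tendsto_exp_atBot.comp tendsto_neg_atTop_atBot
            exact (h2.pow m).mul (Polynomial.tendsto_div_exp_atTop _)
          rw [mul_zero] at h4
          refine tendsto_nhds_unique h1 (h4.congr fun t => ?_)
          rw [h _ (exp_pos _), log_exp, zpow_add₀ (exp_pos _).ne', zpow_natCast,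
            zpow_one, Polynomial.eval_comp, exp_neg]
          simp only [Polynomial.eval_neg, eval_X]
          ring
        refine ih (a - 2) G (by push_cast at ha; omega) hG fun l hl => ?_
        have := h l hl
        rw [hFG, hF0, zero_add] at this
        rw [zpow_sub₀ hl.ne', div_mul_eq_mul_div, eq_div_iff (by positivity), ← this]
        norm_cast
        ring
  have := key a.natAbs a F (by omega) hF fun l hl => by rw [h l hl, hp]
  rw [hp, hp, Polynomial.eq_C_of_natDegree_eq_zero this]
  simp

end PolyIn

/-! ### The canonical counterterm is admissible -/

section Admissible

variable {D : ℕ} {ζ : ℝ → ℝ} {l L : ℝ} {u a b : Euc D} {δ N : ℕ} {γ : MultiIdx₂ D}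

lemma opProd_opL_comp_mul (N n : ℕ) (l : ℝ) (u : ℝ → ℝ) :
    opProd (fun Δ => (opL Δ)^[N]) n (fun x => u (l * x))
      = fun x => opProd (fun Δ => (opL Δ)^[N]) n u (l * x) := by
  let P : ((ℝ → ℝ) → (ℝ → ℝ)) → Prop := fun F =>
    ∀ u : ℝ → ℝ, F (fun x => u (l * x)) = fun x => F u (l * x)
  have h2 : ∀ F G, P F → P G → P (F ∘ G) := fun F G hF hG u => by
    rw [comp_apply, hG, hF]
    rfl
  refine opProd_induction (P := P) (fun _ => rfl) h2 (fun k => ?_) n u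
  refine iterate_induction (P := P) (fun _ => rfl) h2 (fun u => ?_) N
  ext x
  simp only [opL, deriv_comp_mul_left, smul_eq_mul]
  ring

lemma opLog_comp_mul (k : ℕ) (hl : 0 < l) (u : ℝ → ℝ) :
    EqOn (opLog k fun x => u (l * x))
      (fun x => opLog k u (l * x) + ((k : ℝ)⁻¹ * log l) * theta u (l * x)) (Ioi 0) := by
  intro x hx
  simp only [opLog, deriv_comp_mul_left, smul_eq_mul, theta_apply,
    Real.log_mul hl.ne' (ne_of_gt hx)]
  ring

lemma contDiffOn_comp_mul {u : ℝ → ℝ} (hu : SmoothOn u (Ioi 0)) (hl : 0 < l) :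
    SmoothOn (fun x => u (l * x)) (Ioi 0) :=
  hu.comp (f := fun x : ℝ => l * x) (by fun_prop) fun _ hx => mul_pos hl hx

lemma isOp_opProd_opLog (n : ℕ) : IsOp (opProd opLog n) :=
  opProd_induction .id .comp (fun _ => isOp_opLog _) n

/-- Rescaling changes the logarithms in the scale operator by a polynomial in the logarithm of the
scaling factor. -/
lemma polyIn_opProd_opLog (n : ℕ) : ∀ {u : ℝ → ℝ}, SmoothOn u (Ioi 0) → ∀ {L : ℝ},
    0 < L → PolyIn n fun s =>
      opProd opLog n (fun x => u (exp s * x)) (exp (-s) * L) := by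
  induction n with
  | zero =>
    intro u _ L _
    refine ⟨C (u L), by simp, fun s => ?_⟩
    simp [opProd, ← mul_assoc, ← Real.exp_add]
  | succ n ih =>
    intro u hu L hL
    have h1 := (isOp_opLog (n + 1)).contDiffOn hu
    have h2 := isOp_theta.contDiffOn hu
    have key : ∀ s, opProd opLog (n + 1) (fun x => u (exp s * x)) (exp (-s) * L)
        = opProd opLog n (fun x => opLog (n + 1) u (exp s * x)) (exp (-s) * L)
          + (((n + 1 : ℕ) : ℝ)⁻¹ * s) *
            opProd opLog n (fun x => theta u (exp s * x)) (exp (-s) * L) := fun s => by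
      have hpos : exp (-s) * L ∈ Ioi (0 : ℝ) := mul_pos (exp_pos _) hL
      have e1 := (isOp_opProd_opLog n).congr (opLog_comp_mul (n + 1) (exp_pos s) u) hpos
      rw [log_exp] at e1
      have e2 := (isOp_opProd_opLog n).map_add (contDiffOn_comp_mul h1 (exp_pos s))
        ((contDiff_const (c := ((n + 1 : ℕ) : ℝ)⁻¹ * s)).contDiffOn.mul
          (contDiffOn_comp_mul h2 (exp_pos s))) hpos
      have e3 := congrFun ((isOp_opProd_opLog n).map_const_mul (((n + 1 : ℕ) : ℝ)⁻¹ * s)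
        (u := fun x => theta u (exp s * x))) (exp (-s) * L)
      exact e1.trans (e2.trans (by simp only [e3]))
    have h3 := ((ih h1 hL).mono n.le_succ).add
      (((PolyIn.linear 0 ((n + 1 : ℕ) : ℝ)⁻¹).mul (ih h2 hL)).mono (by omega))
    refine h3.congr fun s => ?_
    rw [key]
    ring

lemma polyIn_wcut (hζ : IsCutoff ζ) (δ N : ℕ) (y : Euc D) (hL : 0 < L) :
    PolyIn N fun s => wcut ζ δ N (exp (-s) * L) (exp (-s) • y) := by
  have h1 : SmoothOn (chi ζ y 0) (Ioi 0) :=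
    (contDiffOn_chi hζ).comp (f := fun L : ℝ => (y, L)) (by fun_prop)
      fun L hL => ⟨mem_univ _, hL⟩
  have h2 := (isOp_opProd_opL N (D + δ - 4)).contDiffOn h1
  refine (polyIn_opProd_opLog N h2 hL).congr fun s => ?_
  rw [← opProd_opL_comp_mul, wcut, frakL]
  have : chi ζ (exp (-s) • y) 0 = fun x => chi ζ y 0 (exp s * x) := by
    ext x
    rw [chi_zero, chi_zero, norm_smul, norm_of_nonneg (exp_pos _).le, exp_neg,
      mul_pow, mul_pow, mul_inv, inv_pow]
    congr 1
    ring
  rw [this]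
  rfl

namespace KernelData

variable (d : KernelData D)

lemma polyIn_E (μ : ℝ) (hu : u ≠ 0) :
    PolyIn 1 fun s => (exp s ^ (D - 2))⁻¹ *
      d.E (exp s ^ 2 * μ) (exp (-s) • u) := by
  refine (PolyIn.linear (d.E μ u) (2 * (singA D u * d.v (μ * ‖u‖ ^ 2)))).congr fun s => ?_
  have h1 : d.E (exp s ^ 2 * μ) ((exp s)⁻¹ • u) = _ :=
    hadKer_scaling d.e d.v (exp_pos s) μ hu
  rw [exp_neg, h1, log_pow, log_exp, ← mul_assoc, inv_mul_cancel₀ (by positivity), one_mul]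
  push_cast
  ring

lemma polyIn_E' (μ : ℝ) (hu : u ≠ 0) :
    PolyIn 1 fun s => (exp s ^ (D - 2))⁻¹ * exp s ^ 2 *
      d.E' (exp s ^ 2 * μ) (exp (-s) • u) := by
  refine (PolyIn.linear (d.E' μ u)
    (2 * (singA D u * (deriv d.v (μ * ‖u‖ ^ 2) * ‖u‖ ^ 2)))).congr fun s => ?_
  rw [exp_neg]
  have h1 := (hasDerivAt_hadKer d.he d.hv (exp s ^ 2 * μ) ((exp s)⁻¹ • u)).comp μ
    ((hasDerivAt_id μ).const_mul (exp s ^ 2))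
  have h2 := (hasDerivAt_hadKer d.he d.hv μ u).add
    ((((d.hv.differentiable (by simp)) (μ * ‖u‖ ^ 2)).hasDerivAt.comp μ
      ((hasDerivAt_id μ).mul_const (‖u‖ ^ 2))).const_mul (singA D u) |>.mul_const
        (log (exp s ^ 2)))
  have h3 := h1.unique ((h2.const_mul (exp s ^ (D - 2))).congr_of_eventuallyEq
    (.of_forall fun m => hadKer_scaling d.e d.v (exp_pos s) m hu))
  rw [log_pow, log_exp] at h3
  simp only [mul_one, one_mul] at h3
  rw [mul_assoc, mul_comm (exp s ^ 2), h3, ← mul_assoc, inv_mul_cancel₀ (by positivity),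
    one_mul]
  push_cast
  ring

lemma polyIn_qreg_of_ne (hζ : IsCutoff ζ) (δ N : ℕ) (μ : ℝ) (hL : 0 < L)
    (ha : ‖a‖ < L) (hab : a ≠ b) :
    PolyIn (N + 2) fun s => (exp s ^ (D - 2))⁻¹ * exp s ^ 2 *
      d.qreg (wcut ζ δ N (exp (-s) * L)) (exp s ^ 2 * μ) (exp (-s) • a)
        (exp (-s) • b) := by
  have hne := d.neZero
  set W : ℝ → Euc D → ℝ := fun s y => wcut ζ δ N (exp (-s) * L) (exp (-s) • y) with hW
  set X : ℝ → Euc D → Euc D → ℝ := fun s x y => (exp s ^ (D - 2))⁻¹ *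
    d.E (exp s ^ 2 * μ) (exp (-s) • (y - x)) with hX
  have hcut : ∀ s, IsCut (wcut ζ δ N (exp (-s) * L) : Euc D → ℝ) (exp (-s) * L)
      (2 * (exp (-s) * L)) := fun s => isCut_wcut hζ δ N (mul_pos (exp_pos _) hL)
  have hsmul : ∀ s, exp (-s) • a ≠ exp (-s) • b := fun s h =>
    hab (smul_right_injective _ (exp_pos (-s)).ne' h)
  have hX' : ∀ s x y, X s x y = (exp s ^ (D - 2))⁻¹ *
      d.E (exp s ^ 2 * μ) (exp (-s) • y - exp (-s) • x) := fun s x y => by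
    rw [hX]
    simp only [smul_sub]
  have hi0 : ∀ s, Integrable fun y => wcut ζ δ N (exp (-s) * L) y *
      (d.E (exp s ^ 2 * μ) (y - exp (-s) • a) *
        d.E (exp s ^ 2 * μ) (y - exp (-s) • b)) := fun s =>
    d.integrable_cut_E_E (hcut s).smooth.continuous (hcut s).hasCompactSupport _ (hsmul s)
  have hint : ∀ s, Integrable fun y => W s y * (X s a y * X s b y) := fun s => by
    have := ((hi0 s).comp_smul (exp_pos (-s)).ne').const_mul
      ((exp s ^ (D - 2))⁻¹ * (exp s ^ (D - 2))⁻¹)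
    refine this.congr (.of_forall fun y => ?_)
    simp only [hW, hX']
    ring
  have hpoly : PolyIn (N + 2) fun s => ∫ y, W s y * (X s a y * X s b y) := by
    refine PolyIn.integral hint ?_
    filter_upwards [ae_ne_point a, ae_ne_point b] with y ha hb
    exact (polyIn_wcut hζ δ N y hL).mul
      ((d.polyIn_E μ (sub_ne_zero.2 ha)).mul (d.polyIn_E μ (sub_ne_zero.2 hb)))
  refine (((d.polyIn_E' μ (sub_ne_zero.2 hab)).mono (by omega)).add hpoly).congr fun s => ?_
  have hna : ‖exp (-s) • a‖ < exp (-s) * L := by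
    rw [norm_smul, norm_of_nonneg (exp_pos _).le]
    exact mul_lt_mul_of_pos_left ha (exp_pos _)
  rw [← d.qreg_eq (hcut s) _ (hsmul s) hna, mul_add, smul_sub]
  congr 1
  have h1 := Measure.integral_comp_smul_of_nonneg (μ := (volume : Measure (Euc D)))
    (fun y => wcut ζ δ N (exp (-s) * L) y *
      (d.E (exp s ^ 2 * μ) (y - exp (-s) • a) *
        d.E (exp s ^ 2 * μ) (y - exp (-s) • b))) (exp (-s)) (hR := (exp_pos _).le)
  have h2 : (∫ y, W s y * (X s a y * X s b y)) = (exp s ^ (D - 2))⁻¹ *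
      (exp s ^ (D - 2))⁻¹ * ∫ y, wcut ζ δ N (exp (-s) * L) (exp (-s) • y) *
      (d.E (exp s ^ 2 * μ) (exp (-s) • y - exp (-s) • a) *
        d.E (exp s ^ 2 * μ) (exp (-s) • y - exp (-s) • b)) := by
    rw [← integral_const_mul]
    refine integral_congr_fun fun y => ?_
    simp only [hW, hX']
    ring
  rw [h2, h1, finrank_euclideanSpace, Fintype.card_fin, smul_eq_mul, ← mul_assoc]
  congr 1
  obtain ⟨D', rfl⟩ : ∃ D', D = D' + 2 := ⟨D - 2, by have := d.hD; omega⟩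
  rw [exp_neg, inv_pow, inv_inv, Nat.add_sub_cancel, pow_add]
  have := (exp_pos s).ne'
  field_simp

lemma polyIn_qreg (hζ : IsCutoff ζ) (δ N : ℕ) (μ : ℝ) (hL : 0 < L) (ha : ‖a‖ < L) (hb : ‖b‖ < L) :
    PolyIn (N + 2) fun s => (exp s ^ (D - 2))⁻¹ * exp s ^ 2 *
      d.qreg (wcut ζ δ N (exp (-s) * L)) (exp s ^ 2 * μ) (exp (-s) • a)
        (exp (-s) • b) := by
  by_cases hab : a = b
  · have hne := d.neZero
    subst hab
    refine PolyIn.of_tendsto (l := 𝓝[≠] a) (F := fun b s => (exp s ^ (D - 2))⁻¹ *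
      exp s ^ 2 * d.qreg (wcut ζ δ N (exp (-s) * L)) (exp s ^ 2 * μ)
        (exp (-s) • a) (exp (-s) • b)) ?_ fun s => ?_
    · filter_upwards [self_mem_nhdsWithin] with b hb
      exact d.polyIn_qreg_of_ne hζ δ N μ hL ha (Ne.symm hb)
    · refine Tendsto.const_mul _ (Tendsto.mono_left ?_ nhdsWithin_le_nhds)
      have hc := (d.contDiffOn_qreg_slice (isCut_wcut (D := D) hζ δ N
        (mul_pos (exp_pos (-s)) hL)) (exp s ^ 2 * μ)).continuousOn
      have hna : ‖exp (-s) • a‖ < exp (-s) * L := by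
        rw [norm_smul, norm_of_nonneg (exp_pos _).le]
        exact mul_lt_mul_of_pos_left ha (exp_pos _)
      have h1 := (hc.continuousAt (x := (exp (-s) • a, exp (-s) • a))
        (isOpen_two_balls.mem_nhds ⟨hna, hna⟩))
      have h2 : Continuous fun b : Euc D => (exp (-s) • a, exp (-s) • b) := by fun_prop
      exact ContinuousAt.comp (f := fun b : Euc D => (exp (-s) • a, exp (-s) • b))
        (x := a) h1 h2.continuousAt
  · exact d.polyIn_qreg_of_ne hζ δ N μ hL ha hab

end KernelData

lemma jet_const_mul_comp_smul {q : Euc D → Euc D → ℝ} {ρ : ℝ} (hρ : 0 < ρ) (hq : SmoothOn₂ q (𝔹₂ ρ))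
    (c s : ℝ) (l l' : List (Fin D)) :
    jet l l' (fun a b => c * q (s • a) (s • b)) = c * s ^ (l.length + l'.length) * jet l l' q := by
  have hb : IsOpen (ball (0 : Euc D) ρ) := isOpen_ball
  have hc : Continuous fun x : Euc D => s • x := continuous_const_smul s
  have h0 : s • (0 : Euc D) ∈ ball (0 : Euc D) ρ := by simpa using hρ
  have hb' := hb.preimage hc
  have h1 : ∀ a ∈ ball (0 : Euc D) ρ, SmoothOn (q a) (ball 0 ρ) :=
    fun a ha => hq.comp (f := fun b : Euc D => (a, b)) (by fun_prop) fun b hb =>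
      ⟨by simpa using ha, by simpa using hb⟩
  have hG : SmoothOn (fun a => iterD l' (q a) 0) (ball 0 ρ) :=
    (contDiffOn_iterD_param (P := Euc D) (Ψ := q) isOpen_two_balls hq l').comp
      (f := fun a : Euc D => (a, (0 : Euc D))) (by fun_prop) fun a ha =>
        ⟨by simpa using ha, by simpa using hρ⟩
  have h2 : (fun a => iterD l' (fun b => c * q (s • a) (s • b)) 0) =ᶠ[𝓝 0]
      fun a => (c * s ^ l'.length) * iterD l' (q (s • a)) 0 := by
    filter_upwards [hb'.mem_nhds h0] with a ha
    have e1 := iterD_const_mul c hb' ((h1 _ ha).comp (f := fun b : Euc D => s • b) (by fun_prop)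
      fun _ h => h) l' h0
    have e2 := iterD_comp_smul (q (s • a)) s l' hb (h1 _ ha) h0
    simp only [comp_def] at e1
    rw [e1, e2, smul_zero, mul_assoc]
  unfold jet
  rw [iterD_congr_nhds h2]
  have e1 := iterD_const_mul (c * s ^ l'.length) hb' (hG.comp (f := fun b : Euc D => s • b)
    (by fun_prop) fun _ h => h) l h0
  have e2 := iterD_comp_smul (fun a => iterD l' (q a) 0) s l hb hG h0
  simp only [comp_def] at e1
  rw [e1, e2, smul_zero]
  ring

namespace KernelData

variable (d : KernelData D)

lemma polyIn_T (hζ : IsCutoff ζ) (δ N : ℕ) (γ : MultiIdx₂ D) (μ : ℝ)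
    (hL : 0 < L) : PolyIn (N + 2) fun s => (exp s ^ (D - 2))⁻¹ * exp s ^ 2 *
      exp (-s) ^ (γ.1.order + γ.2.order) *
        d.T (wcut ζ δ N (exp (-s) * L)) γ (exp s ^ 2 * μ) := by
  set q : ℝ → Euc D → Euc D → ℝ := fun s =>
    d.qreg (wcut ζ δ N (exp (-s) * L)) (exp s ^ 2 * μ) with hq
  set c : ℝ → ℝ := fun s => (exp s ^ (D - 2))⁻¹ * exp s ^ 2 with hc
  have hcut : ∀ s, IsCut (wcut ζ δ N (exp (-s) * L) : Euc D → ℝ) (exp (-s) * L)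
      (2 * (exp (-s) * L)) := fun s => isCut_wcut hζ δ N (mul_pos (exp_pos _) hL)
  have hsm := fun s => d.contDiffOn_qreg_slice (hcut s) (exp s ^ 2 * μ)
  set Q : ℝ → Euc D → Euc D → ℝ := fun s a b =>
    c s * q s (exp (-s) • a) (exp (-s) • b) with hQ
  have hQs : ∀ s, SmoothOn (fun p : Euc₂ D => Q s p.1 p.2)
      (𝔹₂ L) := fun s => by
    refine contDiffOn_const.mul ((hsm s).comp (f := fun p : Euc₂ D =>
      (exp (-s) • p.1, exp (-s) • p.2)) (by fun_prop) fun p hp => ?_)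
    simp only [Set.mem_ofPred_eq, norm_smul, norm_of_nonneg (exp_pos (-s)).le]
    exact ⟨mul_lt_mul_of_pos_left hp.1 (exp_pos _),
      mul_lt_mul_of_pos_left hp.2 (exp_pos _)⟩
  have h0 : (0 : Euc D) ∈ ball (0 : Euc D) L := by simpa using hL
  have hball : ∀ a ∈ ball (0 : Euc D) L, ‖a‖ < L := fun a ha => by simpa using ha
  have h1 : ∀ a ∈ ball (0 : Euc D) L,
      PolyIn (N + 2) fun s => iterD (idxList γ.2) (Q s a) 0 := fun a ha =>
    PolyIn.iterD isOpen_ball (fun s => (hQs s).comp (f := fun b : Euc D => (a, b))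
      (by fun_prop) fun b hb => ⟨hball a ha, hball b hb⟩)
      (fun b hb => d.polyIn_qreg hζ δ N μ hL (hball a ha) (hball b hb)) _ 0 h0
  have h2 : PolyIn (N + 2) fun s => jet (idxList γ.1) (idxList γ.2) (Q s) :=
    PolyIn.iterD isOpen_ball (fun s => (contDiffOn_iterD_param (P := Euc D) (Ψ := Q s)
      isOpen_two_balls (hQs s) _).comp (f := fun a : Euc D => (a, (0 : Euc D))) (by fun_prop)
      fun a ha => ⟨hball a ha, hball 0 h0⟩) h1 _ 0 h0
  refine h2.congr fun s => ?_
  rw [hQ]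
  simp only
  rw [jet_const_mul_comp_smul (hcut s).pos (hsm s), length_idxList, length_idxList]
  rfl

/-- Rescaling all variables introduces only powers of the logarithm of the scaling factor, which
are excluded by smoothness in `μ`. -/
theorem b0_scaling (hζ : IsCutoff ζ) (hN : 2 < N)
    (hγ : γ.1.order + γ.2.order ≤ δ) (hl : 0 < l) (μ : ℝ) :
    d.b0 ζ δ N γ (l ^ 2 * μ)
      = l ^ ((D : ℤ) - 4 + γ.1.order + γ.2.order) * d.b0 ζ δ N γ μ := by
  set a : ℤ := (D : ℤ) - 4 + γ.1.order + γ.2.order with ha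
  have hpre : ∀ s, (exp s ^ (D - 2))⁻¹ * exp s ^ 2 *
      exp (-s) ^ (γ.1.order + γ.2.order) = exp s ^ (-a) := fun s => by
    have h0 := (exp_pos s).ne'
    rw [exp_neg, inv_pow, ← zpow_natCast, ← zpow_natCast, ← zpow_natCast, ← zpow_neg,
      ← zpow_neg, ← zpow_add₀ h0, ← zpow_add₀ h0]
    congr 1
    have := d.hD
    push_cast [Nat.cast_sub this]
    omega
  have h1 : PolyIn (N + 2) fun s => exp s ^ (-a) * d.b0 ζ δ N γ (exp s ^ 2 * μ) := by
    have h2 : PolyIn (N + 2) fun s => exp s ^ (-a) *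
        -d.b0 ζ δ N γ (exp s ^ 2 * μ) := by
      refine PolyIn.of_tendsto (l := 𝓝[>] (0 : ℝ)) (F := fun L s => exp s ^ (-a) *
        d.T (wcut ζ δ N (exp (-s) * L)) γ (exp s ^ 2 * μ)) ?_ fun s => ?_
      · filter_upwards [self_mem_nhdsWithin] with L hL
        simpa only [hpre] using d.polyIn_T hζ δ N γ μ hL
      · refine ((d.tendsto_T_wcut hζ hN hγ (exp s ^ 2 * μ)).comp ?_).const_mul _
        refine tendsto_nhdsWithin_iff.2 ⟨?_, ?_⟩
        · have : Continuous fun L : ℝ => exp (-s) * L := by fun_prop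
          simpa using (this.tendsto 0).mono_left nhdsWithin_le_nhds
        · filter_upwards [self_mem_nhdsWithin] with L hL
          exact mul_pos (exp_pos _) hL
    simpa using h2.const_mul (-1)
  have h3 := polynomial_log_eq_const (F := fun t => d.b0 ζ δ N γ (t * μ))
    ((d.contDiff_b0 hζ hN hγ).comp (by fun_prop)) (a := a) h1 (fun l hl => by
      rw [exp_log hl, ← mul_assoc, ← zpow_add₀ hl.ne']
      simp) (log l)
  simp only [exp_log hl, Real.exp_zero, one_zpow, one_pow, one_mul] at h3
  rw [← h3, ← mul_assoc, ← zpow_add₀ hl.ne']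
  simp

lemma b0_swap (hζ : IsCutoff ζ) (hN : 2 < N)
    (hγ : γ.1.order + γ.2.order ≤ δ) (μ : ℝ) : d.b0 ζ δ N γ.swap μ = d.b0 ζ δ N γ μ := by
  have h1 := d.tendsto_T_wcut hζ hN (γ := γ.swap) (by simpa [add_comm] using hγ) μ
  have h2 := d.tendsto_T_wcut hζ hN hγ μ
  refine neg_injective (tendsto_nhds_unique (h1.congr' ?_) h2)
  filter_upwards [self_mem_nhdsWithin] with L hL
  exact d.T_swap (isCut_wcut hζ δ N hL) μ γ

/-- The canonical counterterm, cut off at order `δ`. -/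
def counterterm (ζ : ℝ → ℝ) (δ N : ℕ) : Counterterm D := fun γ₁ γ₂ μ =>
  if γ₁.order + γ₂.order ≤ δ then d.b0 ζ δ N (γ₁, γ₂) μ else 0

lemma counterterm_of_le (hγ : γ.1.order + γ.2.order ≤ δ) :
    d.counterterm ζ δ N γ.1 γ.2 = d.b0 ζ δ N γ := by
  ext μ
  rw [counterterm, if_pos hγ]

theorem isAdmissible_counterterm (hζ : IsCutoff ζ) (hN : 2 < N) :
    IsAdmissible δ (d.counterterm ζ δ N) where
  symm γ₁ γ₂ μ := by
    simp only [counterterm, add_comm γ₁.order]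
    split_ifs with h
    · exact d.b0_swap hζ hN (γ := (γ₂, γ₁)) h μ
    · rfl
  invariant μ g u v := by
    have hlim : ∀ u v : Euc D, Tendsto (fun L => pairPoly δ (fun γ => d.T (wcut ζ δ N L) γ μ) u v)
        (𝓝[>] 0) (𝓝 (-∑ γ ∈ pairsUpTo D δ, d.counterterm ζ δ N γ.1 γ.2 μ *
          taylorFactor γ.1 u 0 * taylorFactor γ.2 v 0)) := fun u v => by
      rw [← Finset.sum_neg_distrib]
      refine tendsto_finsetSum _ fun γ hγ => ?_
      have hγ' := mem_pairsUpTo.1 hγ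
      rw [d.counterterm_of_le hγ', mul_assoc, ← neg_mul]
      exact (d.tendsto_T_wcut hζ hN hγ' μ).mul_const _
    refine neg_injective (tendsto_nhds_unique ((hlim (g u) (g v)).congr' ?_) (hlim u v))
    filter_upwards [self_mem_nhdsWithin] with L hL
    exact d.pairPoly_T_map (isCut_wcut hζ δ N hL) (wcut_eq_of_norm_eq δ N L) g μ δ u v
  smooth γ₁ γ₂ := by
    by_cases h : γ₁.order + γ₂.order ≤ δ
    · rw [d.counterterm_of_le (γ := (γ₁, γ₂)) h]
      exact d.contDiff_b0 hζ hN h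
    · unfold counterterm
      simp only [if_neg h]
      exact contDiff_const
  scaling γ₁ γ₂ l hl μ := by
    simp only [counterterm]
    split_ifs with h
    · exact d.b0_scaling hζ hN h hl μ
    · simp
  eq_zero γ₁ γ₂ μ h := by rw [counterterm, if_neg (by omega)]

end KernelData

end Admissible

/-! ### Changing the parametrix by a smooth function -/

section Comparison

lemma exists_contDiff_eq_pow_mul {P : Type*} [NormedAddCommGroup P] [NormedSpace ℝ P] (k : ℕ) :
    ∀ {F : ℝ → P → ℝ}, Smooth₂ F →
    (∀ p, ∃ C : ℝ, ∀ᶠ t in 𝓝[≠] 0, |F t p| ≤ C * |t| ^ k) →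
    ∃ G : ℝ → P → ℝ, Smooth₂ G ∧ ∀ t p, F t p = t ^ k * G t p := by
  induction k with
  | zero => exact fun {F} hF _ => ⟨F, hF, by simp⟩
  | succ k ih =>
    intro F hF hb
    obtain ⟨G, hG, hFG⟩ := exists_contDiff_eq_add_mul_param hF
    have h0 : ∀ p, F 0 p = 0 := fun p => by
      obtain ⟨C, hC⟩ := hb p
      have h1 : Continuous fun t => F t p :=
        hF.continuous.comp (by fun_prop : Continuous fun t : ℝ => (t, p))
      have h2 : Tendsto (fun t : ℝ => C * |t| ^ (k + 1)) (𝓝[≠] 0) (𝓝 0) := by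
        have : Continuous fun t : ℝ => C * |t| ^ (k + 1) := by fun_prop
        simpa using (this.tendsto 0).mono_left nhdsWithin_le_nhds
      exact tendsto_nhds_unique ((h1.tendsto 0).mono_left nhdsWithin_le_nhds)
        (squeeze_zero_norm' hC h2)
    obtain ⟨G', hG', h'⟩ := ih hG fun p => by
      obtain ⟨C, hC⟩ := hb p
      refine ⟨C, ?_⟩
      filter_upwards [hC, self_mem_nhdsWithin] with t ht ht0
      rw [hFG, h0, zero_add, abs_mul, pow_succ', mul_left_comm] at ht
      exact le_of_mul_le_mul_left ht (abs_pos.2 ht0)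
    exact ⟨G', hG', fun t p => by rw [hFG, h0, zero_add, h', pow_succ']; ring⟩

variable {D : ℕ} {ζ : ℝ → ℝ} {k : ℕ} {g W : Euc D → ℝ} {L ρ R : ℝ} {e v : ℝ → ℝ}

/-- `g` vanishes to order `k` at the origin. -/
def VanishesTo (k : ℕ) (g : Euc D → ℝ) : Prop := ∃ C : ℝ, ∀ u, ‖u‖ ≤ 1 → |g u| ≤ C * ‖u‖ ^ k

lemma VanishesTo.exists_eq_pow_mul (h : VanishesTo k g) (hg : Smooth g) : ∃ G : ℝ → Euc D → ℝ,
      Smooth₂ G ∧ ∀ t u, g (t • u) = t ^ k * G t u := by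
  obtain ⟨C, hC⟩ := h
  refine exists_contDiff_eq_pow_mul k (F := fun t u => g (t • u)) (hg.comp (by fun_prop))
    fun u => ⟨C * ‖u‖ ^ k, ?_⟩
  have h1 : Tendsto (fun t : ℝ => ‖t • u‖) (𝓝 0) (𝓝 0) := by
    have : Continuous fun t : ℝ => ‖t • u‖ := by fun_prop
    simpa using this.tendsto 0
  filter_upwards [nhdsWithin_le_nhds (h1.eventually (ge_mem_nhds one_pos))] with t ht
  refine (hC _ ht).trans_eq ?_
  rw [norm_smul, norm_eq_abs]
  ring

lemma vanishesTo_of_iterD (hg : Smooth g)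
    (h : ∀ l : List (Fin D), l.length < k → iterD l g 0 = 0) : VanishesTo k g := by
  obtain ⟨C, -, hC⟩ := exists_bound_of_jet_eq_zero k (q := fun a _ => g a) (hg.comp contDiff_fst)
    fun l l' hl => by
      unfold jet
      rcases eq_or_ne l' [] with rfl | hl'
      · exact h l (by simpa using hl)
      · simp only [iterD_const hl', iterD_zero]
  refine ⟨C, fun u hu => ?_⟩
  have hn : ‖(u, (0 : Euc D))‖ = ‖u‖ := by simp [Prod.norm_def]
  have := hC (u, 0) (by rwa [hn])
  rwa [hn] at this

lemma tendsto_mul_eval_log (p : Polynomial ℝ) :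
    Tendsto (fun L : ℝ => L * p.eval (-log L)) (𝓝[>] 0) (𝓝 0) := by
  have h1 := (Polynomial.tendsto_div_exp_atTop p).comp
    (tendsto_neg_atBot_atTop.comp Real.tendsto_log_nhdsGT_zero)
  refine h1.congr' ?_
  filter_upwards [self_mem_nhdsWithin] with L hL
  simp only [comp_apply]
  rw [exp_neg, exp_log hL, div_inv_eq_mul, mul_comm]

/-- In rescaled variables, the cutoff is a combination of fixed cutoffs. -/
lemma wcut_smul (hζ : IsCutoff ζ) (δ N : ℕ) (hL : 0 < L) (u : Euc D) :
    wcut ζ δ N L (L • u) = ∑ j ∈ range (N + 1), (PolyIn.lag N j).eval (-log L) *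
      wcut ζ δ N (exp (-(j : ℝ))) (exp (-(j : ℝ)) • u) := by
  have h := (polyIn_wcut hζ δ N u one_pos).eq_sum (-log L)
  simpa only [neg_neg, exp_log hL, mul_one] using h

lemma hadKer_smul (he : Smooth e) (hv : Smooth v) (μ : ℝ) (hL : 0 < L) {u : Euc D} (hu : u ≠ 0) :
    hadKer D e v μ (L • u) = (L ^ (D - 2))⁻¹ * (hadKer D e v (μ * L ^ 2) u
      - 2 * log L * hadKer D v (fun _ => 0) (μ * L ^ 2) u) := by
  simpa [dker] using dker_smul he hv [] μ hL hu

/-- The rescaled integral, for a fixed cutoff `W`. -/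
lemma contDiffOn_rescaled (hD : 2 ≤ D) (he : Smooth e) (hv : Smooth v)
    (μ : ℝ) (hW : IsCut W ρ R) {G : ℝ → Euc D → ℝ} (hG : Smooth₂ G) (τ σ : ℝ) :
    SmoothOn (fun q : ℝ × Euc D => ∫ u, hadKer D e v (μ * q.1 ^ 2) u *
      (W (u + τ • q.2) * G q.1 (u + σ • q.2))) (univ ×ˢ ball 0 1) := by
  refine contDiffOn_integral_singKer hD (P := ℝ × Euc D) (m := fun q => μ * q.1 ^ 2)
    (a := fun μ u => e (μ * ‖u‖ ^ 2)) (b := fun μ u => v (μ * ‖u‖ ^ 2)) (by fun_prop)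
    (contDiff_radial he) (contDiff_radial hv) (isOpen_univ.prod isOpen_ball)
    (isCompact_closedBall (0 : Euc D) (R + |τ|))
    (Φ := fun q u => W (u + τ • q.2) * G q.1 (u + σ • q.2)) (fun q hq u hu => ?_) ?_
  · rw [hW.eq_zero, zero_mul]
    rw [mem_closedBall, dist_zero_right, not_le] at hu
    have h1 : ‖q.2‖ ≤ 1 := by simpa using (Metric.mem_ball.1 hq.2).le
    have h2 : ‖τ • q.2‖ ≤ |τ| := by
      rw [norm_smul, norm_eq_abs]
      exact mul_le_of_le_one_right (abs_nonneg _) h1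
    have h3 := norm_sub_le (u + τ • q.2) (τ • q.2)
    rw [add_sub_cancel_right] at h3
    linarith
  · exact ((hW.smooth.comp (by fun_prop)).mul (hG.comp (f := fun r : (ℝ × Euc D) × Euc D =>
      (r.1.1, r.2 + σ • r.1.2)) (by fun_prop))).contDiffOn

lemma isCut_comp_smul {c : ℝ} (hW : IsCut W ρ R) (hc : 0 < c) :
    IsCut (fun u => W (c • u)) (ρ / c) (R / c) where
  smooth := hW.smooth.comp (by fun_prop)
  pos := div_pos hW.pos hc
  eq_one y hy := hW.eq_one _ (by
    rw [norm_smul, norm_of_nonneg hc.le]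
    rwa [lt_div_iff₀' hc] at hy)
  eq_zero y hy := hW.eq_zero _ (by
    rw [norm_smul, norm_of_nonneg hc.le]
    rwa [div_lt_iff₀' hc] at hy)

/-- Integrals over the small ball of radius `L` of the kernel against a function vanishing to
order `k`, differentiated at most `k` times, are of order `L²` up to logarithms. -/
lemma tendsto_iterD_integral_wcut (hζ : IsCutoff ζ) (δ N : ℕ) (hD : 2 ≤ D)
    (he : Smooth e) (hv : Smooth v) (μ : ℝ)
    (hg : Smooth g) (hk : VanishesTo k g) (τ σ : ℝ) (l : List (Fin D)) (hl : l.length ≤ k) :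
    Tendsto (fun L => iterD l (fun a => ∫ y, hadKer D e v μ y *
      (wcut ζ δ N L (y + τ • a) * g (y + σ • a))) 0) (𝓝[>] 0) (𝓝 0) := by
  have hne : NeZero D := ⟨by omega⟩
  obtain ⟨G, hG, hgG⟩ := hk.exists_eq_pow_mul hg
  -- in the variable `u = y / L` all dependence on `L` is smooth, up to powers of `L` and `log L`
  set W : ℕ → Euc D → ℝ := fun j u =>
    wcut ζ δ N (exp (-(j : ℝ))) (exp (-(j : ℝ)) • u) with hWdef
  have hW : ∀ j, ∃ ρ R, IsCut (W j) ρ R := fun j =>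
    ⟨_, _, isCut_comp_smul (isCut_wcut hζ δ N (exp_pos _)) (exp_pos _)⟩
  set S : (ℝ → ℝ) → (ℝ → ℝ) → ℕ → ℝ → Euc D → ℝ := fun e v j L α =>
    ∫ u, hadKer D e v (μ * L ^ 2) u * (W j (u + τ • α) * G L (u + σ • α)) with hS
  have hSs : ∀ {e v : ℝ → ℝ}, Smooth e → Smooth v → ∀ j,
      SmoothOn (fun q : ℝ × Euc D => S e v j q.1 q.2) (univ ×ˢ ball 0 1) :=
    fun he hv j => by
      obtain ⟨ρ, R, h⟩ := hW j
      exact contDiffOn_rescaled hD he hv μ h hG τ σ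
  have hv0 : Smooth fun _ : ℝ => (0 : ℝ) := contDiff_const
  set Z : (ℝ → ℝ) → (ℝ → ℝ) → ℕ → ℝ → ℝ := fun e v j L => iterD l (S e v j L) 0 with hZ
  have hopen : IsOpen ((univ : Set ℝ) ×ˢ ball (0 : Euc D) 1) :=
    isOpen_univ.prod isOpen_ball
  have hZc : ∀ {e v : ℝ → ℝ}, Smooth e → Smooth v → ∀ j,
      Tendsto (Z e v j) (𝓝[>] 0) (𝓝 (Z e v j 0)) := fun he hv j => by
    have h1 := (contDiffOn_iterD_param hopen (hSs he hv j) l).continuousOn.continuousAt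
      (x := ((0 : ℝ), (0 : Euc D))) (hopen.mem_nhds ⟨mem_univ _, by simp⟩)
    have h2 : Continuous fun L : ℝ => (L, (0 : Euc D)) := by fun_prop
    exact (ContinuousAt.comp (f := fun L : ℝ => (L, (0 : Euc D))) (x := 0) h1
      h2.continuousAt).tendsto.mono_left nhdsWithin_le_nhds
  have hint : ∀ {e v : ℝ → ℝ}, Smooth e → Smooth v → ∀ j L α,
      Integrable fun u => hadKer D e v (μ * L ^ 2) u * (W j (u + τ • α) * G L (u + σ • α)) :=
    fun he hv j L α => by
      obtain ⟨ρ, R, h⟩ := hW j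
      have hc : HasCompactSupport fun u => W j (u + τ • α) :=
        h.hasCompactSupport.comp_homeomorph (Homeomorph.addRight (τ • α))
      refine integrable_mul_of_compact (locallyIntegrable_singKer hD
        (he.continuous.comp (by fun_prop : Continuous fun u : Euc D => μ * L ^ 2 * ‖u‖ ^ 2))
        (hv.continuous.comp (by fun_prop : Continuous fun u : Euc D => μ * L ^ 2 * ‖u‖ ^ 2)))
        ?_ hc.mul_right
      have h1 : Continuous fun u => W j (u + τ • α) := h.smooth.continuous.comp (by fun_prop)
      have h2 : Continuous fun u => G L (u + σ • α) := hG.continuous.comp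
        (by fun_prop : Continuous fun u : Euc D => (L, u + σ • α))
      exact h1.mul h2
  have key : ∀ L : ℝ, 0 < L → ∀ a, (∫ y, hadKer D e v μ y *
      (wcut ζ δ N L (y + τ • a) * g (y + σ • a)))
      = ∑ j ∈ range (N + 1), (L ^ (2 + k) * (PolyIn.lag N j).eval (-log L)) *
        (S e v j L (L⁻¹ • a) + (-2 * log L) * S v (fun _ => 0) j L (L⁻¹ • a)) := by
    intro L hL a
    have hpt : ∀ᵐ u : Euc D, hadKer D e v μ (L • u) * (wcut ζ δ N L (L • u + τ • a) *
        g (L • u + σ • a)) = ∑ j ∈ range (N + 1),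
          ((L ^ (D - 2))⁻¹ * L ^ k * (PolyIn.lag N j).eval (-log L)) *
          (hadKer D e v (μ * L ^ 2) u * (W j (u + τ • L⁻¹ • a) * G L (u + σ • L⁻¹ • a))
          + (-2 * log L) * (hadKer D v (fun _ => 0) (μ * L ^ 2) u *
            (W j (u + τ • L⁻¹ • a) * G L (u + σ • L⁻¹ • a)))) := by
      filter_upwards [ae_ne_point (0 : Euc D)] with u hu
      have e1 : ∀ t : ℝ, L • u + t • a = L • (u + t • L⁻¹ • a) := fun t => by
        rw [smul_add, smul_comm t, smul_smul, mul_inv_cancel₀ hL.ne', one_smul]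
      rw [e1, e1, hgG, wcut_smul hζ δ N hL, hadKer_smul he hv μ hL hu, sum_mul,
        mul_sum]
      exact sum_congr rfl fun j _ => by ring
    have h1 := Measure.integral_comp_smul_of_nonneg (μ := (volume : Measure (Euc D)))
      (fun y => hadKer D e v μ y * (wcut ζ δ N L (y + τ • a) * g (y + σ • a))) L (hR := hL.le)
    rw [finrank_euclideanSpace, Fintype.card_fin, smul_eq_mul,
      eq_inv_mul_iff_mul_eq₀ (by positivity)] at h1
    have i3 : ∀ j, Integrable fun u => hadKer D e v (μ * L ^ 2) u *
        (W j (u + τ • L⁻¹ • a) * G L (u + σ • L⁻¹ • a)) + (-2 * log L) *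
          (hadKer D v (fun _ => 0) (μ * L ^ 2) u *
            (W j (u + τ • L⁻¹ • a) * G L (u + σ • L⁻¹ • a))) := fun j =>
      (hint he hv j L _).add ((hint hv hv0 j L _).const_mul _)
    rw [← h1, integral_congr_ae hpt, integral_finsetSum _ fun j _ => (i3 j).const_mul _,
      mul_sum]
    refine sum_congr rfl fun j _ => ?_
    rw [integral_const_mul, integral_add (hint he hv j L _) ((hint hv hv0 j L _).const_mul _),
      integral_const_mul, ← mul_assoc]
    congr 1
    obtain ⟨D', rfl⟩ : ∃ D', D = D' + 2 := ⟨D - 2, by omega⟩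
    rw [Nat.add_sub_cancel, pow_add L D', pow_add]
    field_simp
  have hder : ∀ L : ℝ, 0 < L → iterD l (fun a => ∫ y, hadKer D e v μ y *
      (wcut ζ δ N L (y + τ • a) * g (y + σ • a))) 0
      = ∑ j ∈ range (N + 1), L ^ (1 + (k - l.length)) *
        ((L * (PolyIn.lag N j).eval (-log L)) * Z e v j L +
          (L * (2 * X * PolyIn.lag N j).eval (-log L)) * Z v (fun _ => 0) j L) := by
    intro L hL
    have hb' : IsOpen ((fun a : Euc D => L⁻¹ • a) ⁻¹' ball 0 1) :=
      Metric.isOpen_ball.preimage (continuous_const_smul _)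
    have h0 : (0 : Euc D) ∈ (fun a : Euc D => L⁻¹ • a) ⁻¹' ball 0 1 := by simp
    have hs1 : ∀ {e v : ℝ → ℝ}, Smooth e → Smooth v → ∀ j,
        SmoothOn (S e v j L) (ball 0 1) := fun he hv j =>
      (hSs he hv j).comp (f := fun a : Euc D => (L, a)) (by fun_prop) fun a ha =>
        ⟨mem_univ _, ha⟩
    have hs2 : ∀ {e v : ℝ → ℝ}, Smooth e → Smooth v → ∀ j,
        SmoothOn (fun a => S e v j L (L⁻¹ • a))
          ((fun a : Euc D => L⁻¹ • a) ⁻¹' ball 0 1) := fun he hv j =>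
      (hs1 he hv j).comp (f := fun a : Euc D => L⁻¹ • a) (by fun_prop) fun a ha => ha
    have hs3 : ∀ {e v : ℝ → ℝ}, Smooth e → Smooth v → ∀ j,
        iterD l (fun a => S e v j L (L⁻¹ • a)) 0 = L⁻¹ ^ l.length * Z e v j L := fun he hv j => by
      rw [iterD_comp_smul _ _ l isOpen_ball (hs1 he hv j) (by simp), smul_zero]
    rw [funext (key L hL), iterD_sum _ hb' (fun j _ => contDiffOn_const.mul
      ((hs2 he hv j).add (contDiffOn_const.mul (hs2 hv hv0 j)))) l h0]
    refine sum_congr rfl fun j _ => ?_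
    have h2 := iterD_const_mul (L ^ (2 + k) * (PolyIn.lag N j).eval (-log L)) hb'
      ((hs2 he hv j).add (contDiffOn_const.mul (hs2 hv hv0 j) (f := fun _ => -2 * log L))) l h0
    have h3 := iterD_add hb' (hs2 he hv j)
      (contDiffOn_const.mul (hs2 hv hv0 j) (f := fun _ => -2 * log L)) l h0
    have h4 := iterD_const_mul (-2 * log L) hb' (hs2 hv hv0 j) l h0
    simp only at h2 h3 h4
    rw [h2, h3, h4, hs3 he hv, hs3 hv hv0]
    obtain ⟨m, rfl⟩ : ∃ m, k = m + l.length := ⟨k - l.length, by omega⟩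
    rw [Nat.add_sub_cancel, inv_pow, pow_add, pow_add, pow_add]
    simp only [eval_mul, eval_X, Polynomial.eval_ofNat]
    field_simp
  have hlim : Tendsto (fun L : ℝ => ∑ j ∈ range (N + 1), L ^ (1 + (k - l.length)) *
        ((L * (PolyIn.lag N j).eval (-log L)) * Z e v j L +
          (L * (2 * X * PolyIn.lag N j).eval (-log L)) * Z v (fun _ => 0) j L))
      (𝓝[>] 0) (𝓝 (∑ j ∈ range (N + 1), 0 ^ (1 + (k - l.length)) *
        (0 * Z e v j 0 + 0 * Z v (fun _ => 0) j 0))) := by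
    refine tendsto_finsetSum _ fun j _ => Tendsto.mul ?_
      (((tendsto_mul_eval_log _).mul (hZc he hv j)).add
        ((tendsto_mul_eval_log _).mul (hZc hv hv0 j)))
    exact ((continuous_pow _).tendsto 0).mono_left nhdsWithin_le_nhds
  simp only [zero_mul, add_zero, mul_zero, sum_const_zero] at hlim
  refine hlim.congr' ?_
  filter_upwards [self_mem_nhdsWithin] with L hL
  exact (hder L hL).symm

end Comparison

/-! ### The canonical counterterm of a changed parametrix -/

section Comparison

variable {D : ℕ} {ζ : ℝ → ℝ} {g : ℝ → Euc D → ℝ} {ρ R : ℝ}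

lemma contDiff_pslice (hg : Smooth₂ g)
    (μ : ℝ) : Smooth (g μ) := hg.comp (f := fun u : Euc D => (μ, u)) (by fun_prop)

lemma hasDerivAt_fst (hg : Smooth₂ g)
    (μ : ℝ) (u : Euc D) : HasDerivAt (fun m => g m u) (deriv (fun m => g m u) μ) μ :=
  ((hg.comp (f := fun m : ℝ => (m, u)) (by fun_prop)).differentiable (by simp) μ).hasDerivAt

lemma idxList_zero : idxList (0 : MultiIdx D) = [] :=
  List.eq_nil_of_length_eq_zero (by simp [length_idxList, MultiIdx.order])

/-- A locally integrable kernel against a smooth family depends smoothly on translations. -/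
lemma contDiffOn_integral_cut {F : Euc D → ℝ} (hF : LocallyIntegrable F) {W g : Euc D → ℝ}
    (hW : IsCut W ρ R) (hg : Smooth g) (τ σ : ℝ) :
    SmoothOn (fun a => ∫ u, F u * (W (u + τ • a) * g (u + σ • a))) (ball 0 1) := by
  refine contDiffOn_integral_param hF isOpen_ball
    (isCompact_closedBall (0 : Euc D) (R + |τ|))
    (Φ := fun a u => W (u + τ • a) * g (u + σ • a)) (fun a ha u hu => ?_)
    ((hW.smooth.comp (by fun_prop)).mul (hg.comp (by fun_prop))).contDiffOn
  rw [hW.eq_zero, zero_mul]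
  rw [mem_closedBall, dist_zero_right, not_le] at hu
  have h1 : ‖a‖ ≤ 1 := by simpa using (Metric.mem_ball.1 ha).le
  have h2 : ‖τ • a‖ ≤ |τ| := by
    rw [norm_smul, norm_eq_abs]
    exact mul_le_of_le_one_right (abs_nonneg _) h1
  have h3 := norm_sub_le (u + τ • a) (τ • a)
  rw [add_sub_cancel_right] at h3
  linarith

namespace KernelData

variable {d d' : KernelData D} {g : ℝ → Euc D → ℝ}

lemma E'_eq_add (hg : Smooth₂ g)
    (hE : ∀ μ u, u ≠ 0 → d'.E μ u = d.E μ u + g μ u) (μ : ℝ) {u : Euc D} (hu : u ≠ 0) :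
    d'.E' μ u = d.E' μ u + deriv (fun m => g m u) μ :=
  (hasDerivAt_hadKer d'.he d'.hv μ u).unique
    (((hasDerivAt_hadKer d.he d.hv μ u).add (hasDerivAt_fst hg μ u)).congr_of_eventuallyEq
      (.of_forall fun m => hE m u hu))

lemma qreg_sub (hg : Smooth₂ g) (hE : ∀ μ u, u ≠ 0 → d'.E μ u = d.E μ u + g μ u) {w : Euc D → ℝ}
    (hw : IsCut w ρ R) (μ : ℝ) {a : Euc D} (ha : a ≠ 0) (haρ : ‖a‖ < ρ) :
    d'.qreg w μ a 0 - d.qreg w μ a 0 = deriv (fun m => g m a) μ +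
      ((∫ u, d.E μ u * (w (u + (1 : ℝ) • a) * g μ (u + (1 : ℝ) • a)))
        + ∫ u, d'.E μ u * (w (u + (0 : ℝ) • a) * g μ (u + (-1 : ℝ) • a))) := by
  have hne := d.neZero
  have hgc : Continuous (g μ) := continuous_slice hg μ
  have i1 := d.integrable_cut_E_E hw.smooth.continuous hw.hasCompactSupport μ ha
  have i1' := d'.integrable_cut_E_E hw.smooth.continuous hw.hasCompactSupport μ ha
  have i2 : Integrable fun y => w y * g μ y * d.E μ (y - a) := by
    refine (integrable_mul_of_compact (d.locallyIntegrable_E_sub μ a)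
      (hw.smooth.continuous.mul hgc) hw.hasCompactSupport.mul_right).congr
      (.of_forall fun y => ?_)
    simp only [Pi.mul_apply]
    ring
  have i3 : Integrable fun y => d'.E μ y * (w y * g μ (y - a)) :=
    integrable_mul_of_compact (d'.locallyIntegrable_E μ) (hw.smooth.continuous.mul
      (hgc.comp (by fun_prop : Continuous fun y : Euc D => y - a))) hw.hasCompactSupport.mul_right
  have e1 : ∫ u, d.E μ u * (w (u + (1 : ℝ) • a) * g μ (u + (1 : ℝ) • a))
      = ∫ y, w y * g μ y * d.E μ (y - a) := by
    rw [← integral_add_right_eq_self (fun y => w y * g μ y * d.E μ (y - a)) a]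
    refine integral_congr_fun fun y => ?_
    simp only [one_smul, add_sub_cancel_right]
    ring
  have e2 : ∫ u, d'.E μ u * (w (u + (0 : ℝ) • a) * g μ (u + (-1 : ℝ) • a))
      = ∫ y, d'.E μ y * (w y * g μ (y - a)) := by
    simp [sub_eq_add_neg]
  rw [e1, e2, ← integral_add i2 i3, ← d'.qreg_eq hw μ ha haρ, ← d.qreg_eq hw μ ha haρ, sub_zero,
    E'_eq_add hg hE μ ha]
  have e3 : (∫ y, w y * (d'.E μ (y - a) * d'.E μ (y - 0))) -
      ∫ y, w y * (d.E μ (y - a) * d.E μ (y - 0))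
      = ∫ y, (w y * g μ y * d.E μ (y - a) + d'.E μ y * (w y * g μ (y - a))) := by
    rw [← integral_sub i1' i1]
    refine integral_congr_ae ?_
    filter_upwards [ae_ne_point a, ae_ne_point (0 : Euc D)] with y hy hy0
    rw [sub_zero, hE μ y hy0, hE μ _ (sub_ne_zero.2 hy)]
    ring
  rw [← e3]
  ring

/-- Changing the parametrix by a smooth function `g` which vanishes to order `k` changes the
counterterms of `φ ∂^γ φ` with `|γ| ≤ k` by the Taylor coefficients of `-∂g/∂m²`: the other
terms come from integrals over a ball whose radius tends to zero. -/
theorem b0_eq_sub (hζ : IsCutoff ζ) {δ N : ℕ} (hN : 2 < N) (hg : Smooth₂ g)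
    (hE : ∀ μ u, u ≠ 0 → d'.E μ u = d.E μ u + g μ u) (μ : ℝ) {k : ℕ} (hk : VanishesTo k (g μ))
    {γ : MultiIdx D} (hγk : γ.order ≤ k) (hγ : γ.order ≤ δ) :
    d'.b0 ζ δ N (γ, 0) μ = d.b0 ζ δ N (γ, 0) μ
      - iterD (idxList γ) (fun u => deriv (fun m => g m u) μ) 0 := by
  have hne := d.neZero
  set l := idxList γ with hl
  have hlk : l.length ≤ k := by rwa [hl, length_idxList]
  have hγ' : (γ, (0 : MultiIdx D)).1.order + (γ, (0 : MultiIdx D)).2.order ≤ δ := by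
    simpa [MultiIdx.order] using hγ
  have hgμ := contDiff_pslice hg μ
  have hg' : Smooth fun u => deriv (fun m => g m u) μ :=
    (contDiff_deriv_fst hg).comp (f := fun u : Euc D => (μ, u)) (by fun_prop)
  have key : ∀ L : ℝ, 0 < L → d'.T (wcut ζ δ N L) (γ, 0) μ - d.T (wcut ζ δ N L) (γ, 0) μ
      = iterD l (fun u => deriv (fun m => g m u) μ) 0 +
      (iterD l (fun a => ∫ u, d.E μ u * (wcut ζ δ N L (u + (1 : ℝ) • a) * g μ (u + (1 : ℝ) • a))) 0
      + iterD l (fun a => ∫ u, d'.E μ u *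
          (wcut ζ δ N L (u + (0 : ℝ) • a) * g μ (u + (-1 : ℝ) • a))) 0) := by
    intro L hL
    have hw : IsCut (wcut ζ δ N L : Euc D → ℝ) L (2 * L) := isCut_wcut hζ δ N hL
    have c1 := contDiffOn_integral_cut (d.locallyIntegrable_E μ) hw hgμ 1 1
    have c2 := contDiffOn_integral_cut (d'.locallyIntegrable_E μ) hw hgμ 0 (-1)
    have hU : IsOpen (ball (0 : Euc D) (min L 1)) := isOpen_ball
    have h0 : (0 : Euc D) ∈ ball (0 : Euc D) (min L 1) := by simp [hL]
    have hs : ball (0 : Euc D) (min L 1) ⊆ ball 0 1 :=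
      Metric.ball_subset_ball (min_le_right _ _)
    have cq : ∀ d : KernelData D, SmoothOn (fun a => d.qreg (wcut ζ δ N L) μ a 0)
        (ball 0 (min L 1)) := fun d =>
      (d.contDiffOn_qreg_slice hw μ).comp (f := fun a : Euc D => (a, (0 : Euc D))) (by fun_prop)
        fun a ha => ⟨by
          rw [Metric.mem_ball, dist_zero_right] at ha
          exact ha.trans_le (min_le_left _ _), by simpa using hL⟩
    have cr := hg'.contDiffOn.add ((c1.mono hs).add (c2.mono hs))
    have heq : EqOn (fun a => d'.qreg (wcut ζ δ N L) μ a 0 - d.qreg (wcut ζ δ N L) μ a 0)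
        (fun a => deriv (fun m => g m a) μ +
      ((∫ u, d.E μ u * (wcut ζ δ N L (u + (1 : ℝ) • a) * g μ (u + (1 : ℝ) • a)))
        + ∫ u, d'.E μ u * (wcut ζ δ N L (u + (0 : ℝ) • a) * g μ (u + (-1 : ℝ) • a))))
        (ball 0 (min L 1)) := by
      have hoff : ∀ a ∈ ball (0 : Euc D) (min L 1), a ≠ 0 → _ := fun a ha ha0 =>
        qreg_sub hg hE hw μ ha0 (by
          rw [Metric.mem_ball, dist_zero_right] at ha
          exact ha.trans_le (min_le_left _ _))
      intro a ha
      -- at `a = 0` the identity follows by continuity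
      by_cases ha0 : a = 0
      · subst ha0
        refine tendsto_nhds_unique (((((cq d').sub (cq d)).continuousOn.continuousAt
          (hU.mem_nhds h0)).tendsto).mono_left (nhdsWithin_le_nhds (s := {0}ᶜ)))
          (((cr.continuousOn.continuousAt (hU.mem_nhds h0)).tendsto.mono_left
            nhdsWithin_le_nhds).congr' ?_)
        filter_upwards [self_mem_nhdsWithin, nhdsWithin_le_nhds (hU.mem_nhds h0)] with a ha0 ha
        exact (hoff a ha ha0).symm
      · exact hoff a ha ha0
    have e1 := iterD_congr hU heq l h0
    have e2 := iterD_sub hU (cq d') (cq d) l h0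
    have e3 := iterD_add hU hg'.contDiffOn ((c1.mono hs).add (c2.mono hs)) l h0
    have e4 := iterD_add hU (c1.mono hs) (c2.mono hs) l h0
    simp only at e2 e3 e4
    rw [e2] at e1
    rw [← e4, ← e3, ← e1]
    simp only [T, jetM, jet, idxList_zero, iterD_nil]
    rfl
  have h1 := (d'.tendsto_T_wcut hζ hN hγ' μ).sub (d.tendsto_T_wcut hζ hN hγ' μ)
  have h2 := (tendsto_iterD_integral_wcut hζ δ N d.hD d.he d.hv μ hgμ hk 1 1 l hlk).add
    (tendsto_iterD_integral_wcut hζ δ N d'.hD d'.he d'.hv μ hgμ hk 0 (-1) l hlk)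
  have h3 := (h2.const_add (iterD l (fun u => deriv (fun m => g m u) μ) 0)).congr'
    (f₂ := fun L => d'.T (wcut ζ δ N L) (γ, 0) μ - d.T (wcut ζ δ N L) (γ, 0) μ) (by
      filter_upwards [self_mem_nhdsWithin] with L hL
      exact (key L hL).symm)
  have := tendsto_nhds_unique h1 h3
  simp only [add_zero] at this
  linarith

end KernelData

end Comparison

/-! ### Hafnians and operator product coefficients -/

section Hafnian

/-- The perfect matchings of `ι`, as fixed-point-free involutions. -/
def matchings (ι : Type*) [Fintype ι] [DecidableEq ι] : Finset (Perm ι) :=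
  Finset.univ.filter fun σ => ∀ p, σ p ≠ p ∧ σ (σ p) = p

lemma mem_matchings {ι : Type*} [Fintype ι] [DecidableEq ι] {σ : Perm ι} :
    σ ∈ matchings ι ↔ ∀ p, σ p ≠ p ∧ σ (σ p) = p := by simp [matchings]

/-- The smaller elements of the pairs of a matching. -/
def pairsOf {ι : Type*} [Fintype ι] [LinearOrder ι] (σ : Perm ι) : Finset ι :=
  Finset.univ.filter fun p => p < σ p

lemma mem_pairsOf {ι : Type*} [Fintype ι] [LinearOrder ι] {σ : Perm ι} {p : ι} :
    p ∈ pairsOf σ ↔ p < σ p := by simp [pairsOf]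

lemma hafnian_eq {ι : Type*} [Fintype ι] [LinearOrder ι] (N : ι → ι → ℝ) :
    hafnian N = ∑ σ ∈ matchings ι, ∏ p ∈ pairsOf σ, N p (σ p) := by
  unfold hafnian matchings pairsOf
  congr!

lemma hafnian_orderIso {ι κ : Type*} [Fintype ι] [LinearOrder ι] [Fintype κ] [LinearOrder κ]
    (e : κ ≃o ι) (N : ι → ι → ℝ) : hafnian N = hafnian fun p q => N (e p) (e q) := by
  rw [hafnian_eq, hafnian_eq]
  refine sum_equiv e.symm.toEquiv.permCongr (fun σ => ?_) fun σ _ => ?_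
  · rw [mem_matchings, mem_matchings]
    refine ⟨fun h p => ?_, fun h p => ?_⟩
    · have := h (e p)
      simpa [Equiv.permCongr_apply, OrderIso.symm_apply_eq] using this
    · have := h (e.symm p)
      simpa [Equiv.permCongr_apply] using this
  · refine Finset.prod_equiv e.symm.toEquiv (fun p => ?_) fun p _ => ?_
    · simp [mem_pairsOf, Equiv.permCongr_apply]
    · simp [Equiv.permCongr_apply]

variable {κ : Type*} [LinearOrder κ]

/-- The matching of two extra points `0, 1` and `κ` in which `0, 1` are joined to the two ends of
the pair of `σ` through `a`. -/
def splice (σ : Perm κ) (a : κ) : Perm (Fin 2 ⊕ₗ κ) :=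
  let c : Perm (Fin 2 ⊕ κ) := swap (inl 1) (inr a)
  (c * sumCongr (swap 0 1) σ * c : Perm (Fin 2 ⊕ κ))

section splice

variable (σ : Perm κ) (a : κ)

lemma splice_apply (p : Fin 2 ⊕ κ) : splice σ a (toLex p) = toLex
    (swap (inl 1 : Fin 2 ⊕ κ) (inr a) (sumCongr (swap (0 : Fin 2) 1) σ
      (swap (inl 1 : Fin 2 ⊕ κ) (inr a) p))) := rfl

lemma splice_zero : splice σ a (toLex (inl 0)) = toLex (inr a) := by
  rw [splice_apply, swap_apply_of_ne_of_ne (x := (inl 0 : Fin 2 ⊕ κ)) (by simp)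
    (by simp)]
  simp

lemma splice_one (h : σ a ≠ a) : splice σ a (toLex (inl 1)) = toLex (inr (σ a)) := by
  rw [splice_apply, Equiv.swap_apply_left, Equiv.sumCongr_apply, Sum.map_inr,
    swap_apply_of_ne_of_ne (by simp) (by simpa using h)]

lemma splice_inr (k : κ) (h : ∀ p, σ p ≠ p ∧ σ (σ p) = p) :
    splice σ a (toLex (inr k)) = if k = a then toLex (inl 0)
      else if k = σ a then toLex (inl 1) else toLex (inr (σ k)) := by
  rw [splice_apply]
  split_ifs with h1 h2
  · subst h1
    rw [Equiv.swap_apply_right, Equiv.sumCongr_apply, Sum.map_inl, Equiv.swap_apply_right,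
      swap_apply_of_ne_of_ne (by simp) (by simp)]
  · rw [swap_apply_of_ne_of_ne (x := (inr k : Fin 2 ⊕ κ)) (by simp)
      (by simpa using h1), Equiv.sumCongr_apply, Sum.map_inr, h2, (h a).2, Equiv.swap_apply_right]
  · rw [swap_apply_of_ne_of_ne (x := (inr k : Fin 2 ⊕ κ)) (by simp)
      (by simpa using h1), Equiv.sumCongr_apply, Sum.map_inr,
      swap_apply_of_ne_of_ne (by simp) ?_]
    simp only [ne_eq, inr.injEq]
    rintro rfl
    exact h2 (h k).2.symm

end splice

variable [Fintype κ]

lemma splice_mem {σ : Perm κ} (hσ : σ ∈ matchings κ) (a : κ) :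
    splice σ a ∈ matchings (Fin 2 ⊕ₗ κ) := by
  have h := mem_matchings.1 hσ
  let c : Perm (Fin 2 ⊕ κ) := swap (inl 1) (inr a)
  have hc : ∀ p, c (c p) = p := fun p => Equiv.swap_apply_self _ _ _
  have hs : ∀ p : Fin 2 ⊕ κ, sumCongr (swap (0 : Fin 2) 1) σ p ≠ p ∧
      sumCongr (swap (0 : Fin 2) 1) σ (sumCongr (swap (0 : Fin 2) 1) σ p)
        = p := by
    rintro (i | k)
    · fin_cases i <;> simp
    · simpa using h k
  refine mem_matchings.2 fun p => ⟨fun hp => (hs (c p)).1 ?_, ?_⟩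
  · change c (sumCongr (swap (0 : Fin 2) 1) σ (c p)) = p at hp
    rw [← hc (sumCongr _ _ _), hp]
  · change c (sumCongr (swap (0 : Fin 2) 1) σ (c (c (sumCongr
      (swap (0 : Fin 2) 1) σ (c p))))) = p
    rw [hc, (hs _).2]
    exact hc p

lemma exists_splice {τ : Perm (Fin 2 ⊕ₗ κ)} (hτ : τ ∈ matchings (Fin 2 ⊕ₗ κ))
    (h01 : τ (toLex (inl 0)) ≠ toLex (inl 1)) :
    ∃ σ ∈ matchings κ, ∃ a, splice σ a = τ := by
  have h := mem_matchings.1 hτ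
  let τ' : Perm (Fin 2 ⊕ κ) := τ
  have h' : ∀ p, τ' p ≠ p ∧ τ' (τ' p) = p := h
  obtain ⟨a, ha⟩ : ∃ a, τ' (inl 0) = inr a := by
    rcases hx : τ' (inl 0) with i | a
    · fin_cases i
      · exact absurd hx (h' _).1
      · exact absurd hx h01
    · exact ⟨a, rfl⟩
  let c : Perm (Fin 2 ⊕ κ) := swap (inl 1) (inr a)
  have hc : ∀ p, c (c p) = p := fun p => Equiv.swap_apply_self _ _ _
  let ρ : Perm (Fin 2 ⊕ κ) := c * τ' * c
  have hρ : ∀ p, ρ p ≠ p ∧ ρ (ρ p) = p := fun p => by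
    refine ⟨fun hp => (h' (c p)).1 ?_, ?_⟩
    · change c (τ' (c p)) = p at hp
      rw [← hc (τ' _), hp]
    · change c (τ' (c (c (τ' (c p))))) = p
      rw [hc, (h' _).2, hc]
  have h0 : ρ (inl 0) = inl 1 := by
    change c (τ' (c (inl 0))) = _
    rw [show c (inl 0) = inl 0 from swap_apply_of_ne_of_ne (by simp) (by simp), ha]
    exact Equiv.swap_apply_right _ _
  have h1 : ρ (inl 1) = inl 0 := by rw [← h0, (hρ _).2]
  obtain ⟨⟨s, σ⟩, hsσ⟩ := Perm.mem_sumCongrHom_range_of_perm_mapsTo_inl (σ := ρ) (by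
    rintro - ⟨i, rfl⟩
    fin_cases i
    · exact ⟨1, h0.symm⟩
    · exact ⟨0, h1.symm⟩)
  have hsσ' : ∀ p, sumCongr s σ p = ρ p := fun p => congrArg (fun e => e p) hsσ
  have hs : s = swap 0 1 := by
    have e0 : s 0 = 1 := Sum.inl_injective ((hsσ' (inl 0)).trans h0)
    have e1 : s 1 = 0 := Sum.inl_injective ((hsσ' (inl 1)).trans h1)
    ext i
    fin_cases i
    · simp [e0]
    · simp [e1]
  refine ⟨σ, mem_matchings.2 fun k => ?_, a, ?_⟩
  · have hk := hρ (inr k)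
    rw [← hsσ', ← hsσ'] at hk
    simpa using hk
  · refine Equiv.ext fun p => ?_
    change c (sumCongr (swap 0 1) σ (c p)) = τ' p
    rw [← hs, hsσ']
    change c (c (τ' (c (c p)))) = _
    rw [hc]
    exact congrArg τ' (hc p)

lemma prod_splice {N : Fin 2 ⊕ₗ κ → Fin 2 ⊕ₗ κ → ℝ} {σ : Perm κ} (hσ : σ ∈ matchings κ)
    (a : κ) : ∏ p ∈ pairsOf (splice σ a), N p (splice σ a p)
      = N (toLex (inl 0)) (toLex (inr a)) * N (toLex (inl 1)) (toLex (inr (σ a))) *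
        ∏ q ∈ Finset.univ.filter (fun q => q < σ q ∧ q ≠ a ∧ q ≠ σ a),
          N (toLex (inr q)) (toLex (inr (σ q))) := by
  have h := mem_matchings.1 hσ
  rw [pairsOf, Finset.prod_filter, Finset.prod_filter,
    ← (toLex : Fin 2 ⊕ κ ≃ Fin 2 ⊕ₗ κ).prod_comp, Fintype.prod_sum_type, Fin.prod_univ_two,
    splice_zero, splice_one _ _ (h a).1, if_pos (Sum.Lex.inl_lt_inr _ _),
    if_pos (Sum.Lex.inl_lt_inr _ _)]
  congr 1
  refine prod_congr rfl fun k _ => ?_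
  rw [splice_inr _ _ _ h]
  by_cases h1 : k = a
  · rw [if_pos h1, if_neg Sum.Lex.not_inr_lt_inl, if_neg (by tauto)]
  · by_cases h2 : k = σ a
    · rw [if_neg h1, if_pos h2, if_neg Sum.Lex.not_inr_lt_inl, if_neg (by tauto)]
    · rw [if_neg h1, if_neg h2]
      simp [h1, h2]

/-- The hafnian with two extra labels which are not connected to each other: the two labels are
attached to the two ends of one of the pairs. -/
theorem hafnian_two_extra {N : Fin 2 ⊕ₗ κ → Fin 2 ⊕ₗ κ → ℝ}
    (h0 : N (toLex (inl 0)) (toLex (inl 1)) = 0) :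
    hafnian N = ∑ σ ∈ matchings κ, ∑ p ∈ pairsOf σ,
      (N (toLex (inl 0)) (toLex (inr p)) * N (toLex (inl 1)) (toLex (inr (σ p))) +
        N (toLex (inl 0)) (toLex (inr (σ p))) * N (toLex (inl 1)) (toLex (inr p))) *
        ∏ q ∈ (pairsOf σ).erase p, N (toLex (inr q)) (toLex (inr (σ q))) := by
  -- every matching which does not join the two extra labels is a splice in exactly one way
  have h1 : hafnian N = ∑ x ∈ matchings κ ×ˢ (Finset.univ : Finset κ),
      ∏ p ∈ pairsOf (splice x.1 x.2), N p (splice x.1 x.2 p) := by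
    rw [hafnian_eq, ← Finset.sum_filter_of_ne
      (p := fun τ : Perm (Fin 2 ⊕ₗ κ) => τ (toLex (inl 0)) ≠ toLex (inl 1))]
    · refine (Finset.sum_bij (fun x _ => splice x.1 x.2) (fun x hx => ?_) (fun x hx y hy hxy => ?_)
        (fun τ hτ => ?_) fun _ _ => rfl).symm
      · refine mem_filter.2 ⟨splice_mem (Finset.mem_product.1 hx).1 _, ?_⟩
        rw [splice_zero]
        simp
      · have ha : x.2 = y.2 := by
          have := congrArg (fun τ : Perm (Fin 2 ⊕ₗ κ) => τ (toLex (inl 0))) hxy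
          simp only [splice_zero] at this
          simpa using this
        have hs : x.1 = y.1 := by
          have hxy : (swap (inl 1) (inr x.2) * sumCongr (swap 0 1) x.1 *
              swap (inl 1) (inr x.2) : Perm (Fin 2 ⊕ κ)) =
            swap (inl 1) (inr y.2) * sumCongr (swap 0 1) y.1 *
              swap (inl 1) (inr y.2) := hxy
          rw [ha] at hxy
          have := mul_left_cancel (mul_right_cancel hxy)
          refine Equiv.ext fun k => Sum.inr_injective (α := Fin 2) ?_
          exact congrArg (fun e : Perm (Fin 2 ⊕ κ) => e (inr k)) this
        exact Prod.ext hs ha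
      · obtain ⟨hτ, h01⟩ := mem_filter.1 hτ
        obtain ⟨σ, hσ, a, rfl⟩ := exists_splice hτ h01
        exact ⟨(σ, a), Finset.mem_product.2 ⟨hσ, Finset.mem_univ _⟩, rfl⟩
    · intro τ _ hne h01
      refine hne (Finset.prod_eq_zero (i := toLex (inl 0)) ?_ (by rw [h01, h0]))
      rw [mem_pairsOf, h01]
      simp
  rw [h1, Finset.sum_product]
  refine sum_congr rfl fun σ hσ => ?_
  have h := mem_matchings.1 hσ
  simp only [prod_splice hσ]
  -- group the two ends of each pair
  rw [← Finset.sum_filter_add_sum_filter_not Finset.univ (fun a => a < σ a)]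
  have h2 : ∀ f : κ → ℝ, ∑ a ∈ Finset.univ.filter (fun a => ¬a < σ a), f a
      = ∑ a ∈ Finset.univ.filter (fun a => a < σ a), f (σ a) := fun f => by
    refine (sum_equiv σ (fun a => ?_) fun _ _ => rfl).symm
    simp only [mem_filter, Finset.mem_univ, true_and, (h a).2, not_lt]
    exact ⟨le_of_lt, fun hle => lt_of_le_of_ne hle (h a).1.symm⟩
  rw [h2, ← sum_add_distrib]
  refine sum_congr rfl fun p hp => ?_
  rw [mem_pairsOf] at hp
  have h3 : Finset.univ.filter (fun q => q < σ q ∧ q ≠ p ∧ q ≠ σ p) = (pairsOf σ).erase p := by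
    ext q
    simp only [mem_filter, Finset.mem_univ, true_and, Finset.mem_erase, mem_pairsOf]
    refine ⟨fun hq => ⟨hq.2.1, hq.1⟩, fun hq => ⟨hq.2, hq.1, ?_⟩⟩
    rintro rfl
    rw [(h p).2] at hq
    exact lt_asymm hp hq.2
  have h4 : Finset.univ.filter (fun q => q < σ q ∧ q ≠ σ p ∧ q ≠ σ (σ p))
      = (pairsOf σ).erase p := by
    rw [← h3, (h p).2]
    ext q
    simp only [mem_filter]
    tauto
  rw [h3, h4, (h p).2]
  ring

lemma hasDerivAt_hafnian {N : ℝ → κ → κ → ℝ} {N' : κ → κ → ℝ} {μ : ℝ}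
    (h : ∀ p q, p < q → HasDerivAt (fun m => N m p q) (N' p q) μ) :
    HasDerivAt (fun m => hafnian (N m)) (∑ σ ∈ matchings κ, ∑ p ∈ pairsOf σ,
      N' p (σ p) * ∏ q ∈ (pairsOf σ).erase p, N μ q (σ q)) μ := by
  simp only [hafnian_eq]
  refine HasDerivAt.fun_sum fun σ _ => ?_
  refine (HasDerivAt.fun_finsetProd (u := pairsOf σ) (f := fun p m => N m p (σ p))
    (f' := fun p => N' p (σ p)) fun p hp => h _ _ (mem_pairsOf.1 hp)).congr_deriv ?_
  exact sum_congr rfl fun p _ => by rw [smul_eq_mul, mul_comm]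

end Hafnian

section Coefficients

variable {D n : ℕ}

lemma multiD_zero (f : Euc D → ℝ) : multiD 0 f = f := by
  rw [multiD_eq_iterD, idxList_zero, iterD_nil]

/-- The labels of an operator product of `n` factors `φ`. -/
def labelPhi (n : ℕ) : Fin n ≃o OpeLabel (fun _ : Fin n => phi D) ([] : Monomial D) :=
  StrictMono.orderIsoOfSurjective (fun i => toLex ⟨i.succ, ⟨0, Nat.one_pos⟩⟩)
    (fun i j h => by
      rw [Sigma.Lex.lt_def]
      exact Or.inl (Fin.succ_lt_succ_iff.2 h))
    (by
      rintro ⟨v, k⟩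
      induction v using Fin.cases with
      | zero => exact k.elim0
      | succ v =>
        refine ⟨v, ?_⟩
        have : k = ⟨0, Nat.one_pos⟩ := Fin.ext (Nat.lt_one_iff.1 k.2)
        rw [this]
        rfl)

/-- The labels of `n` factors `φ` and of an operator with two factors. -/
def labelPair (n : ℕ) (γ : MultiIdx₂ D) :
    Fin 2 ⊕ₗ Fin n ≃o OpeLabel (fun _ : Fin n => phi D) [γ.1, γ.2] :=
  StrictMono.orderIsoOfSurjective (fun p => Sum.elim (fun i => toLex ⟨0, i⟩)
      (fun i : Fin n => toLex ⟨i.succ, ⟨0, Nat.one_pos⟩⟩) (ofLex p))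
    (by
      rintro (i | i) (j | j) h
      · rw [Sigma.Lex.lt_def]
        exact Or.inr ⟨rfl, Sum.Lex.inl_lt_inl_iff.1 h⟩
      · rw [Sigma.Lex.lt_def]
        exact Or.inl (Fin.succ_pos j)
      · exact absurd h Sum.Lex.not_inr_lt_inl
      · rw [Sigma.Lex.lt_def]
        exact Or.inl (Fin.succ_lt_succ_iff.2 (Sum.Lex.inr_lt_inr_iff.1 h)))
    (by
      rintro ⟨v, k⟩
      induction v using Fin.cases with
      | zero => exact ⟨toLex (inl k), rfl⟩
      | succ v =>
        refine ⟨toLex (inr v), ?_⟩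
        have : k = ⟨0, Nat.one_pos⟩ := Fin.ext (Nat.lt_one_iff.1 k.2)
        rw [this]
        rfl)

/-- The labels of `φ²` and of `n` factors `φ`. -/
def labelSq (n : ℕ) : Fin 2 ⊕ₗ Fin n ≃o
    OpeLabel (Fin.cons (phiSq D) (fun _ : Fin n => phi D) : Fin (n + 1) → Monomial D) [] :=
  StrictMono.orderIsoOfSurjective (fun p => Sum.elim (fun i => toLex ⟨Fin.succ 0, i⟩)
      (fun i : Fin n => toLex ⟨i.succ.succ, ⟨0, Nat.one_pos⟩⟩) (ofLex p))
    (by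
      rintro (i | i) (j | j) h
      · rw [Sigma.Lex.lt_def]
        exact Or.inr ⟨rfl, Sum.Lex.inl_lt_inl_iff.1 h⟩
      · rw [Sigma.Lex.lt_def]
        exact Or.inl (Fin.succ_lt_succ_iff.2 (Fin.succ_pos j))
      · exact absurd h Sum.Lex.not_inr_lt_inl
      · rw [Sigma.Lex.lt_def]
        exact Or.inl (Fin.succ_lt_succ_iff.2 (Fin.succ_lt_succ_iff.2
          (Sum.Lex.inr_lt_inr_iff.1 h))))
    (by
      rintro ⟨v, k⟩
      induction v using Fin.cases with
      | zero => exact k.elim0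
      | succ v =>
        induction v using Fin.cases with
        | zero => exact ⟨toLex (inl k), rfl⟩
        | succ v =>
          refine ⟨toLex (inr v), ?_⟩
          have : k = ⟨0, Nat.one_pos⟩ := Fin.ext (Nat.lt_one_iff.1 k.2)
          rw [this]
          rfl)

/-- The labels of `φ²` and of an operator with two factors. -/
def labelSqPair (γ : MultiIdx₂ D) :
    Fin 2 ⊕ₗ Fin 2 ≃o OpeLabel ![phiSq D, [γ.1, γ.2]] ([] : Monomial D) :=
  StrictMono.orderIsoOfSurjective (fun p => Sum.elim (fun i => toLex ⟨1, i⟩)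
      (fun i => toLex ⟨2, i⟩) (ofLex p))
    (by
      rintro (i | i) (j | j) h
      · rw [Sigma.Lex.lt_def]
        exact Or.inr ⟨rfl, Sum.Lex.inl_lt_inl_iff.1 h⟩
      · rw [Sigma.Lex.lt_def]
        exact Or.inl (by decide : (1 : Fin 3) < 2)
      · exact absurd h Sum.Lex.not_inr_lt_inl
      · rw [Sigma.Lex.lt_def]
        exact Or.inr ⟨rfl, Sum.Lex.inr_lt_inr_iff.1 h⟩)
    (by
      rintro ⟨v, k⟩
      match v, k with
      | 0, k => exact k.elim0
      | 1, k => exact ⟨toLex (inl k), rfl⟩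
      | 2, k => exact ⟨toLex (inr k), rfl⟩)

lemma coeffPhi_nil (H : Euc D → Euc D → ℝ) (x : Fin n → Euc D) (z : Euc D) :
    coeffPhi H [] x z = hafnian fun i j : Fin n => if i = j then 0 else H (x i) (x j) := by
  rw [coeffPhi, opeCoeff, hafnian_orderIso (labelPhi n)]
  simp only [List.length_nil, Nat.factorial_zero, Nat.cast_one, div_one, one_mul]
  congr! 3 with i j
  have h1 : ∀ i : Fin n, (ofLex (labelPhi (D := D) n i)).1 = i.succ := fun _ => rfl
  have h2 : ∀ i : Fin n, (labelPhi (D := D) n i).idx = 0 := fun _ => rfl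
  simp only [opeMatrix, h1, h2, multiD_zero, Fin.succ_inj, Fin.succ_ne_zero, or_false, if_false,
    Fin.cons_succ]

lemma coeffPhi_pair (H : Euc D → Euc D → ℝ) (γ : MultiIdx₂ D) (x : Fin n → Euc D)
    (z : Euc D) : coeffPhi H [γ.1, γ.2] x z = 1 / 2 * ∑ σ ∈ matchings (Fin n), ∑ p ∈ pairsOf σ,
      (taylorFactor γ.1 (x p) z * taylorFactor γ.2 (x (σ p)) z +
        taylorFactor γ.1 (x (σ p)) z * taylorFactor γ.2 (x p) z) *
        ∏ q ∈ (pairsOf σ).erase p, H (x q) (x (σ q)) := by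
  have h1 : ∀ i : Fin n, (ofLex (labelPair n γ (toLex (inr i)))).1 = i.succ := fun _ => rfl
  have h2 : ∀ i : Fin n, (labelPair n γ (toLex (inr i))).idx = 0 := fun _ => rfl
  have h3 : ∀ i : Fin 2, (ofLex (labelPair n γ (toLex (inl i)))).1 = 0 := fun _ => rfl
  have h4 : (labelPair n γ (toLex (inl 0))).idx = γ.1 := rfl
  have h5 : (labelPair n γ (toLex (inl 1))).idx = γ.2 := rfl
  rw [coeffPhi, opeCoeff, hafnian_orderIso (labelPair n γ), hafnian_two_extra]
  · simp only [List.length_cons, List.length_nil, Nat.factorial]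
    congr 1
    refine sum_congr rfl fun σ hσ => sum_congr rfl fun p _ => ?_
    have hσ' := mem_matchings.1 hσ
    have hne : ∀ q, q ≠ σ q := fun q => (hσ' q).1.symm
    simp only [opeMatrix, h1, h2, h3, h4, h5, multiD_zero, Fin.succ_inj, Fin.succ_ne_zero,
      (Fin.succ_ne_zero _).symm, or_false, if_false, if_true, Fin.cons_succ, hne]
  · simp [opeMatrix, h3]

lemma coeffPhiSqPhi_eq (H : Euc D → Euc D → ℝ) (y : Euc D) (x : Fin n → Euc D)
    (z : Euc D) : coeffPhiSqPhi H y x z = 2 * ∑ σ ∈ matchings (Fin n), ∑ p ∈ pairsOf σ,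
      H y (x p) * H y (x (σ p)) * ∏ q ∈ (pairsOf σ).erase p, H (x q) (x (σ q)) := by
  have h1 : ∀ i : Fin n, (ofLex (labelSq (D := D) n (toLex (inr i)))).1 = i.succ.succ :=
    fun _ => rfl
  have h2 : ∀ i : Fin n, (labelSq (D := D) n (toLex (inr i))).idx = 0 := fun _ => rfl
  have h3 : ∀ i : Fin 2, (ofLex (labelSq (D := D) n (toLex (inl i)))).1 = Fin.succ 0 :=
    fun _ => rfl
  have h4 : ∀ i : Fin 2, (labelSq (D := D) n (toLex (inl i))).idx = 0 := fun i => by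
    fin_cases i <;> rfl
  rw [coeffPhiSqPhi, opeCoeff, hafnian_orderIso (labelSq n), hafnian_two_extra]
  · rw [mul_sum]
    simp only [List.length_nil, Nat.factorial_zero, Nat.cast_one, div_one, one_mul, mul_sum]
    refine sum_congr rfl fun σ hσ => sum_congr rfl fun p _ => ?_
    have hσ' := mem_matchings.1 hσ
    have hne : ∀ q, q ≠ σ q := fun q => (hσ' q).1.symm
    simp only [opeMatrix, h1, h2, h3, h4, multiD_zero, Fin.succ_inj, Fin.succ_ne_zero,
      (Fin.succ_ne_zero _).symm, or_false, if_false, Fin.cons_succ, hne, Fin.cons_zero]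
    ring
  · simp [opeMatrix, h3]

lemma coeffPhiSqC_eq (H : Euc D → Euc D → ℝ) (γ : MultiIdx₂ D) (y z : Euc D) :
    coeffPhiSqC H [γ.1, γ.2] y z
      = 2 * (multiD γ.1 (fun b => H y b) z * multiD γ.2 (fun b => H y b) z) := by
  have h1 : ∀ i : Fin 2, (ofLex (labelSqPair γ (toLex (inr i)))).1 = 2 := fun _ => rfl
  have h3 : ∀ i : Fin 2, (ofLex (labelSqPair γ (toLex (inl i)))).1 = 1 := fun _ => rfl
  have h4 : ∀ i : Fin 2, (labelSqPair γ (toLex (inl i))).idx = 0 := fun i => by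
    fin_cases i <;> rfl
  have h5 : (labelSqPair γ (toLex (inr 0))).idx = γ.1 := rfl
  have h6 : (labelSqPair γ (toLex (inr 1))).idx = γ.2 := rfl
  have hm : matchings (Fin 2) = {swap 0 1} := by decide
  have hp : pairsOf (swap (0 : Fin 2) 1) = {0} := by decide
  have h12 : (1 : Fin 3) ≠ 2 := by decide
  have h20 : (2 : Fin 3) ≠ 0 := by decide
  have h10 : (1 : Fin 3) ≠ 0 := by decide
  have e1 : (Fin.cons z ![y, z] : Fin 3 → Euc D) 1 = y := rfl
  have e2 : (Fin.cons z ![y, z] : Fin 3 → Euc D) 2 = z := rfl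
  rw [coeffPhiSqC, opeCoeff, hafnian_orderIso (labelSqPair γ), hafnian_two_extra]
  · rw [hm, sum_singleton, hp, sum_singleton, Finset.erase_singleton,
      Finset.prod_empty, Equiv.swap_apply_left]
    simp only [opeMatrix, h1, h3, h4, h5, h6, multiD_zero, h12, h20, h10, or_false, if_false,
      e1, e2, List.length_nil, Nat.factorial_zero, Nat.cast_one, div_one, one_mul, mul_one]
    ring
  · simp [opeMatrix, h3]

end Coefficients

/-! ### The flow relation in terms of the kernel -/

section Flow

variable {D n : ℕ} {ζ : ℝ → ℝ} {L : ℝ} {δ N : ℕ}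

lemma chi_eq_sub (y z : Euc D) : chi ζ y z = chi ζ (y - z) 0 := by
  ext L
  rw [chi, chi, dist_eq_norm, dist_eq_norm, sub_zero]

/-- The symmetric part of a family of coefficients. -/
def symPart (c : MultiIdx₂ D → ℝ) (γ : MultiIdx₂ D) : ℝ :=
  1 / 2 * (c γ + c γ.swap)

lemma pairPoly_symPart (δ : ℕ) (c : MultiIdx₂ D → ℝ) (a b : Euc D) :
    pairPoly δ (symPart c) a b = ∑ γ ∈ pairsUpTo D δ, c γ * (1 / 2 *
      (taylorFactor γ.1 a 0 * taylorFactor γ.2 b 0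
        + taylorFactor γ.1 b 0 * taylorFactor γ.2 a 0)) := by
  have h : ∑ γ ∈ pairsUpTo D δ, c γ.swap * (taylorFactor γ.1 a 0 * taylorFactor γ.2 b 0)
      = ∑ γ ∈ pairsUpTo D δ, c γ * (taylorFactor γ.1 b 0 * taylorFactor γ.2 a 0) := by
    refine sum_equiv (Equiv.prodComm _ _) (fun γ => ?_) fun γ _ => ?_
    · rw [mem_pairsUpTo, mem_pairsUpTo, add_comm]
      rfl
    · rw [mul_comm (taylorFactor γ.1 a 0)]
      rfl
  simp only [pairPoly, symPart]
  calc _ = 1 / 2 * ((∑ γ ∈ pairsUpTo D δ, c γ * (taylorFactor γ.1 a 0 * taylorFactor γ.2 b 0))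
        + ∑ γ ∈ pairsUpTo D δ, c γ.swap * (taylorFactor γ.1 a 0 * taylorFactor γ.2 b 0)) := by
        rw [← sum_add_distrib, mul_sum]
        exact sum_congr rfl fun γ _ => by ring
    _ = _ := by
        rw [h, ← sum_add_distrib, mul_sum]
        exact sum_congr rfl fun γ _ => by ring

namespace KernelData

variable {d : KernelData D} {H : ℝ → Euc D → Euc D → ℝ}

lemma multiD_H (hH : d.Represents H) (μ : ℝ) (γ : MultiIdx D) {y z : Euc D} (hyz : y ≠ z) :
    multiD γ (fun b => H μ y b) z = d.dE (idxList γ) μ (y - z) := by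
  have h1 : (fun b => H μ y b) =ᶠ[𝓝 z] fun b => d.E μ (y - b) := by
    filter_upwards [isOpen_ne.mem_nhds hyz.symm] with b hb
    exact hH μ y b (Ne.symm hb)
  rw [multiD_eq_iterD, iterD_congr_nhds h1, dE]
  have h2 := congrFun (iterD_comp_add (fun b => d.E μ (y - b)) z (idxList γ)) 0
  rw [zero_add] at h2
  rw [← h2]
  congr 1
  ext a
  congr 1
  abel

lemma contDiffOn_deriv_wcut (hζ : IsCutoff ζ) (δ N : ℕ) :
    SmoothOn (fun q : Euc D × ℝ => deriv (frakL D δ N (chi ζ q.1 0)) q.2)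
      (univ ×ˢ Ioi 0) := by
  have h1 := (isOp_theta.comp _ _ (isOp_frakL D δ N)).contDiffOn_param (P := Euc D)
    (Ψ := fun y => chi ζ y 0) (contDiffOn_chi hζ)
  have h2 : SmoothOn (fun q : Euc D × ℝ => q.2⁻¹) (univ ×ˢ Ioi 0) :=
    contDiffOn_snd.inv fun q hq => ne_of_gt hq.2
  refine (h2.mul h1).congr fun q hq => ?_
  simp only [comp_apply, theta_apply]
  rw [inv_mul_cancel_left₀ (ne_of_gt hq.2)]

lemma deriv_wcut_eventually_zero (hζ : IsCutoff ζ) (δ N : ℕ) (hL : 0 < L) :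
    ∀ᶠ q : Euc D × ℝ in 𝓝 (0, L), deriv (frakL D δ N (chi ζ q.1 0)) q.2 = 0 := by
  filter_upwards [(wcut_eventually_one (D := D) hζ δ N hL).eventually_nhds] with q hq
  have h : (fun t => wcut ζ δ N t q.1) =ᶠ[𝓝 q.2] fun _ => 1 :=
    (Continuous.tendsto (by fun_prop : Continuous fun t : ℝ => (q.1, t)) q.2).eventually hq
  exact h.deriv_eq.trans (deriv_const _ _)

lemma integrable_scaleD (hζ : IsCutoff ζ) (δ N : ℕ) (γ : MultiIdx₂ D) (μ : ℝ)
    (hL : 0 < L) : Integrable fun y => deriv (frakL D δ N (chi ζ y 0)) L *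
      (d.dE (idxList γ.1) μ y * d.dE (idxList γ.2) μ y) := by
  have h2 := contDiffOn_weight_mul (F := fun y => d.dE (idxList γ.1) μ y * d.dE (idxList γ.2) μ y)
    ((d.contDiffOn_dE_slice _ μ).mul (d.contDiffOn_dE_slice _ μ)) (contDiffOn_deriv_wcut hζ δ N)
    fun L' hL' => deriv_wcut_eventually_zero hζ δ N hL'
  refine (h2.continuousOn.comp_continuous (f := fun y : Euc D => (y, L)) (by fun_prop)
    fun y => ⟨mem_univ _, hL⟩).integrable_of_hasCompactSupport
    (.intro (isCompact_closedBall (0 : Euc D) (2 * L)) fun y hy => ?_)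
  rw [mem_closedBall, dist_zero_right, not_le] at hy
  have h4 := (isOp_frakL D δ N).congr_nhds (chi_eventuallyEq_zero hζ hL hy)
  rw [(isOp_frakL D δ N).map_zero] at h4
  simp only [comp_apply]
  rw [h4.deriv_eq, deriv_const, zero_mul]

lemma counterIntegrand_ae (hH : d.Represents H) (δ N : ℕ)
    (γ : MultiIdx₂ D) (μ : ℝ) (z : Euc D) (L : ℝ) :
    counterIntegrand ζ δ N (H μ) [γ.1, γ.2] z L =ᵐ[volume] fun y => 2 *
      (deriv (frakL D δ N (chi ζ (y - z) 0)) L *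
        (d.dE (idxList γ.1) μ (y - z) * d.dE (idxList γ.2) μ (y - z))) := by
  have hne := d.neZero
  filter_upwards [ae_ne_point z] with y hy
  rw [counterIntegrand, coeffPhiSqC_eq, multiD_H hH μ _ hy, multiD_H hH μ _ hy, chi_eq_sub]
  ring

lemma integrable_counterIntegrand (hH : d.Represents H)
    (hζ : IsCutoff ζ) (δ N : ℕ) (γ : MultiIdx₂ D) (μ : ℝ) (z : Euc D)
    (hL : 0 < L) : Integrable (counterIntegrand ζ δ N (H μ) [γ.1, γ.2] z L) :=
  (((d.integrable_scaleD hζ δ N γ μ hL).comp_sub_right z).const_mul 2).congr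
    (counterIntegrand_ae hH δ N γ μ z L).symm

lemma integral_counterIntegrand (hH : d.Represents H) (δ N : ℕ)
    (γ : MultiIdx₂ D) (μ : ℝ) (z : Euc D) (L : ℝ) :
    ∫ y, counterIntegrand ζ δ N (H μ) [γ.1, γ.2] z L y = 2 * d.scaleD ζ δ N γ μ L := by
  rw [integral_congr_ae (counterIntegrand_ae hH δ N γ μ z L), integral_const_mul, scaleD,
    integral_sub_right_eq_self (fun y => deriv (frakL D δ N (chi ζ y 0)) L *
      (d.dE (idxList γ.1) μ y * d.dE (idxList γ.2) μ y)) z]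

lemma bH_eq (hH : d.Represents H) (hζ : IsCutoff ζ)
    (hN : 2 < N) (b₀ : Counterterm D) {γ : MultiIdx₂ D} (hγ : γ ∈ pairsUpTo D δ)
    (μ : ℝ) (z : Euc D) (hL : 0 < L) : bH ζ δ N H b₀ γ.1 γ.2 μ z L
      = (b₀ γ.1 γ.2 μ - d.b0 ζ δ N γ μ) - d.T (wcut ζ δ N L) γ μ := by
  rw [bH, d.T_wcut hζ hN (mem_pairsUpTo.1 hγ) μ hL]
  simp only [integral_counterIntegrand hH, intervalIntegral.integral_const_mul]
  ring

lemma hasCompactSupport_wcut_sub (hζ : IsCutoff ζ) (δ N : ℕ) (z : Euc D) (hL : 0 < L) :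
    HasCompactSupport fun y : Euc D => wcut ζ δ N L (y - z) :=
  (isCut_wcut hζ δ N hL).hasCompactSupport.comp_homeomorph (Homeomorph.subRight z)

lemma integrable_wcut_E_E (hζ : IsCutoff ζ) (δ N : ℕ) (μ : ℝ) (z : Euc D) (hL : 0 < L)
    {x₁ x₂ : Euc D} (hx : x₁ ≠ x₂) :
    Integrable fun y => wcut ζ δ N L (y - z) * (d.E μ (y - x₁) * d.E μ (y - x₂)) :=
  d.integrable_cut_E_E ((isCut_wcut hζ δ N hL).smooth.continuous.comp
    (by fun_prop : Continuous fun y : Euc D => y - z)) (hasCompactSupport_wcut_sub hζ δ N z hL) μ hx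

lemma flowIntegrand_ae (hH : d.Represents H) (δ N : ℕ) (μ : ℝ)
    (z : Euc D) (L : ℝ) (x : Fin n → Euc D) :
    flowIntegrand ζ δ N (H μ) x z L =ᵐ[volume] fun y => ∑ σ ∈ matchings (Fin n),
      ∑ p ∈ pairsOf σ, (2 * ∏ q ∈ (pairsOf σ).erase p, H μ (x q) (x (σ q))) *
        (wcut ζ δ N L (y - z) * (d.E μ (y - x p) * d.E μ (y - x (σ p)))) := by
  have hne := d.neZero
  have h : ∀ᵐ y : Euc D, ∀ i, y ≠ x i := ae_all_iff.2 fun i => ae_ne_point (x i)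
  filter_upwards [h] with y hy
  rw [flowIntegrand, coeffPhiSqPhi_eq, chi_eq_sub, ← wcut, mul_sum, mul_sum]
  refine sum_congr rfl fun σ _ => ?_
  rw [mul_sum, mul_sum]
  refine sum_congr rfl fun p _ => ?_
  rw [hH μ _ _ (hy p), hH μ _ _ (hy (σ p))]
  ring

lemma integrable_flowIntegrand (hH : d.Represents H)
    (hζ : IsCutoff ζ) (δ N : ℕ) (μ : ℝ) (z : Euc D) (hL : 0 < L) {x : Fin n → Euc D}
    (hx : Injective x) : Integrable (flowIntegrand ζ δ N (H μ) x z L) := by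
  refine (integrable_finsetSum _ fun σ hσ => integrable_finsetSum _ fun p _ =>
    Integrable.const_mul ?_ _).congr (flowIntegrand_ae hH δ N μ z L x).symm
  exact d.integrable_wcut_E_E hζ δ N μ z hL (hx.ne (mem_matchings.1 hσ p).1.symm)

lemma hasDerivAt_coeffPhi (hH : d.Represents H) (μ : ℝ) (z : Euc D)
    {x : Fin n → Euc D} (hx : Injective x) :
    HasDerivAt (fun m => coeffPhi (H m) [] x z) (∑ σ ∈ matchings (Fin n), ∑ p ∈ pairsOf σ,
      d.E' μ (x p - x (σ p)) * ∏ q ∈ (pairsOf σ).erase p, H μ (x q) (x (σ q))) μ := by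
  simp only [coeffPhi_nil]
  refine (hasDerivAt_hafnian (N' := fun p q => d.E' μ (x p - x q)) fun p q hpq => ?_).congr_deriv
    (sum_congr rfl fun σ hσ => sum_congr rfl fun p _ => ?_)
  · simp only [if_neg hpq.ne]
    exact (hasDerivAt_hadKer d.he d.hv μ (x p - x q)).congr_of_eventuallyEq
      (.of_forall fun m => hH m _ _ (hx.ne hpq.ne))
  · congr 1
    exact prod_congr rfl fun q _ => if_neg (mem_matchings.1 hσ q).1.symm

/-- The remainder of the two-point flow relation at scaling degree `δ`. -/
def remainder (d : KernelData D) (ζ : ℝ → ℝ) (δ N : ℕ) (b₀ : Counterterm D)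
    (μ L : ℝ) (a b : Euc D) : ℝ :=
  (d.qreg (wcut ζ δ N L) μ a b - pairPoly δ (fun γ => d.T (wcut ζ δ N L) γ μ) a b)
    + pairPoly δ (symPart fun γ => b₀ γ.1 γ.2 μ - d.b0 ζ δ N γ μ) a b

/-- In all flow relations the error is made of the remainder of the two-point relation. -/
theorem flow_sub (hH : d.Represents H) (hζ : IsCutoff ζ)
    (hN : 2 < N) (b₀ : Counterterm D) (μ : ℝ) (z : Euc D) (hL : 0 < L)
    {x : Fin n → Euc D} (hx : Injective x) (hxz : ∀ i, ‖x i - z‖ < L) :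
    flowLHS H μ z x - flowRHS ζ δ N H b₀ μ z L x = ∑ σ ∈ matchings (Fin n), ∑ p ∈ pairsOf σ,
      d.remainder ζ δ N b₀ μ L (x p - z) (x (σ p) - z) *
        ∏ q ∈ (pairsOf σ).erase p, H μ (x q) (x (σ q)) := by
  have hw : IsCut (wcut ζ δ N L : Euc D → ℝ) L (2 * L) := isCut_wcut hζ δ N hL
  have hT : ∀ a b, pairPoly δ (symPart fun γ => d.T (wcut ζ δ N L) γ μ) a b
      = pairPoly δ (fun γ => d.T (wcut ζ δ N L) γ μ) a b := fun a b => by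
    congr 1
    ext γ
    rw [symPart, d.T_swap hw]
    ring
  have h1 : ∫ y, flowIntegrand ζ δ N (H μ) x z L y = ∑ σ ∈ matchings (Fin n), ∑ p ∈ pairsOf σ,
      (2 * ∏ q ∈ (pairsOf σ).erase p, H μ (x q) (x (σ q))) *
        ∫ y, wcut ζ δ N L (y - z) * (d.E μ (y - x p) * d.E μ (y - x (σ p))) := by
    rw [integral_congr_ae (flowIntegrand_ae hH δ N μ z L x)]
    have hi : ∀ σ ∈ matchings (Fin n), ∀ p, Integrable fun y =>
        (2 * ∏ q ∈ (pairsOf σ).erase p, H μ (x q) (x (σ q))) *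
          (wcut ζ δ N L (y - z) * (d.E μ (y - x p) * d.E μ (y - x (σ p)))) := fun σ hσ p =>
      (d.integrable_wcut_E_E hζ δ N μ z hL (hx.ne (mem_matchings.1 hσ p).1.symm)).const_mul _
    rw [integral_finsetSum _ fun σ hσ => integrable_finsetSum _ fun p _ => hi σ hσ p]
    refine sum_congr rfl fun σ hσ => ?_
    rw [integral_finsetSum _ fun p _ => hi σ hσ p]
    exact sum_congr rfl fun p _ => integral_const_mul _ _
  have h2 : ∑ γ ∈ pairsUpTo D δ, bH ζ δ N H b₀ γ.1 γ.2 μ z L * coeffPhi (H μ) [γ.1, γ.2] x z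
      = ∑ σ ∈ matchings (Fin n), ∑ p ∈ pairsOf σ,
        (pairPoly δ (symPart fun γ => b₀ γ.1 γ.2 μ - d.b0 ζ δ N γ μ) (x p - z) (x (σ p) - z)
          - pairPoly δ (fun γ => d.T (wcut ζ δ N L) γ μ) (x p - z) (x (σ p) - z)) *
        ∏ q ∈ (pairsOf σ).erase p, H μ (x q) (x (σ q)) := by
    simp only [coeffPhi_pair, mul_sum]
    rw [Finset.sum_comm]
    refine sum_congr rfl fun σ _ => ?_
    rw [Finset.sum_comm]
    refine sum_congr rfl fun p _ => ?_
    rw [← hT, pairPoly_symPart, pairPoly_symPart, ← sum_sub_distrib, sum_mul]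
    refine sum_congr rfl fun γ hγ => ?_
    rw [bH_eq hH hζ hN b₀ hγ μ z hL]
    simp only [taylorFactor_sub _ (x _) z]
    ring
  rw [flowLHS, (hasDerivAt_coeffPhi hH μ z hx).deriv, flowRHS, h1, h2, mul_sum,
    ← sum_sub_distrib, ← sum_sub_distrib]
  refine sum_congr rfl fun σ hσ => ?_
  rw [mul_sum, ← sum_sub_distrib, ← sum_sub_distrib]
  refine sum_congr rfl fun p _ => ?_
  have hne : x p - z ≠ x (σ p) - z := fun h => hx.ne (mem_matchings.1 hσ p).1.symm
    (sub_left_injective h)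
  have h3 : ∫ y, wcut ζ δ N L (y - z) * (d.E μ (y - x p) * d.E μ (y - x (σ p)))
      = ∫ y, wcut ζ δ N L y * (d.E μ (y - (x p - z)) * d.E μ (y - (x (σ p) - z))) := by
    rw [← integral_sub_right_eq_self (fun y => wcut ζ δ N L y *
      (d.E μ (y - (x p - z)) * d.E μ (y - (x (σ p) - z)))) z]
    simp only [sub_sub_sub_cancel_right]
  rw [remainder, ← d.qreg_eq hw μ hne (hxz p), h3, sub_sub_sub_cancel_right]
  ring

end KernelData

end Flow

/-! ### Configurations along merger trees -/

namespace MergerTree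

variable {n D : ℕ} (T : MergerTree n)

/-- The nodes separating `i` from `j` have a largest element `A`. Its ancestors are the common
ancestors of `i` and `j`, so that it is a child of their lowest common ancestor. -/
lemma exists_top {i j : Fin n} (hij : i ≠ j) : ∃ A ∈ T.nodes, i ∈ A ∧ j ∉ A ∧
    T.ancestors A = T.nodes.filter (fun S => i ∈ S ∧ j ∈ S) ∧
    ∀ S ∈ T.nodes, i ∈ S → j ∉ S → S ≠ A → T.depth A < T.depth S := by
  obtain ⟨A, hA, hmax⟩ := (T.nodes.filter fun S => i ∈ S ∧ j ∉ S).exists_max_image Finset.card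
    ⟨{i}, by simp [T.leaf_mem, hij.symm]⟩
  simp only [mem_filter] at hA hmax
  have hlam : ∀ S ∈ T.nodes, i ∈ S → S ⊆ A ∨ A ⊆ S := fun S hS hi => by
    rcases T.laminar S hS A hA.1 with h | h | h
    · exact Or.inl h
    · exact Or.inr h
    · exact absurd hA.2.1 (Finset.disjoint_left.1 h hi)
  refine ⟨A, hA.1, hA.2.1, hA.2.2, ?_, fun S hS hi hj hne => ?_⟩
  · ext S
    simp only [ancestors, mem_filter]
    refine and_congr_right fun hS => ⟨fun h => ⟨h.1 hA.2.1, ?_⟩, fun h => ?_⟩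
    · by_contra hj
      exact absurd (hmax S ⟨hS, h.1 hA.2.1, hj⟩) (not_le.2 (Finset.card_lt_card h))
    · rcases hlam S hS h.1 with h' | h'
      · exact absurd (h' h.2) hA.2.2
      · exact Finset.ssubset_iff_subset_ne.2 ⟨h', fun e => hA.2.2 (e ▸ h.2)⟩
  · have hSA : S ⊂ A := by
      rcases hlam S hS hi with h | h
      · exact Finset.ssubset_iff_subset_ne.2 ⟨h, hne⟩
      · exact absurd (Finset.eq_of_subset_of_card_le h (hmax S ⟨hS, hi, hj⟩)).symm hne
    refine Finset.card_lt_card (Finset.ssubset_iff_subset_ne.2 ⟨fun B hB => ?_, fun e => ?_⟩)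
    · simp only [ancestors, mem_filter] at hB ⊢
      exact ⟨hB.1, hSA.trans hB.2⟩
    · have : A ∈ T.ancestors S := by simp [ancestors, hA.1, hSA]
      rw [← e] at this
      simp [ancestors] at this

lemma depth_pos {S : Finset (Fin n)} (hS : S ≠ Finset.univ) : 1 ≤ T.depth S :=
  Finset.card_pos.2 ⟨Finset.univ, by
    simpa [ancestors, T.root_mem, Finset.ssubset_univ_iff] using hS⟩

lemma config_sub (z : Euc D) (v : Finset (Fin n) → Euc D) (ε : ℝ) (i j : Fin n) :
    T.config z v ε i - T.config z v ε j =
      (∑ S ∈ T.nodes.filter (fun S => i ∈ S ∧ j ∉ S), ε ^ T.depth S • v S)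
        - ∑ S ∈ T.nodes.filter (fun S => j ∈ S ∧ i ∉ S), ε ^ T.depth S • v S := by
  simp only [config, add_sub_add_left_eq_sub, Finset.sum_filter, ← sum_sub_distrib]
  refine sum_congr rfl fun S _ => ?_
  by_cases hi : i ∈ S <;> by_cases hj : j ∈ S
  · simp [hi, hj]
  · have : S ≠ Finset.univ := fun h => hj (h ▸ Finset.mem_univ j)
    simp [hi, hj, this]
  · have : S ≠ Finset.univ := fun h => hi (h ▸ Finset.mem_univ i)
    simp [hi, hj, this]
  · simp [hi, hj]

/-- Two points separate at the rate `ε ^ d`, where `d - 1` is the depth of their lowest common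
ancestor. -/
lemma eventually_config_sub (z : Euc D) {v₀ : Finset (Fin n) → Euc D} (hv : v₀ ∈ T.params D)
    {i j : Fin n} (hij : i ≠ j) : ∃ c : ℝ, 0 < c ∧
      ∀ᶠ p : ℝ × (Finset (Fin n) → Euc D) in 𝓝[>] 0 ×ˢ 𝓝[T.params D] v₀,
        c * p.1 ^ T.nodes.card ≤ ‖T.config z p.2 p.1 i - T.config z p.2 p.1 j‖ := by
  obtain ⟨A, hA, hiA, hjA, hAa, hAS⟩ := T.exists_top hij
  obtain ⟨B, hB, hjB, hiB, hBa, hBS⟩ := T.exists_top hij.symm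
  have hAB : T.ancestors A = T.ancestors B := by
    rw [hAa, hBa]; exact Finset.filter_congr fun S _ => and_comm
  have hd : T.depth B = T.depth A := by rw [depth, depth, hAB]
  have hne : v₀ A ≠ v₀ B := hv A hA B hB (fun h => hiB (h ▸ hiA)) hAB
  set d := T.depth A
  let F : Fin n → Fin n → ℝ × (Finset (Fin n) → Euc D) → Euc D := fun i j p =>
    ∑ S ∈ T.nodes.filter (fun S => i ∈ S ∧ j ∉ S), p.1 ^ (T.depth S - d) • p.2 S
  have hF : ∀ {i j : Fin n} {A : Finset (Fin n)}, A ∈ T.nodes → i ∈ A → j ∉ A → T.depth A = d →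
      (∀ S ∈ T.nodes, i ∈ S → j ∉ S → S ≠ A → T.depth A < T.depth S) →
      Tendsto (F i j) (𝓝 (0, v₀)) (𝓝 (v₀ A)) ∧ ∀ p, (∑ S ∈ T.nodes.filter
        (fun S => i ∈ S ∧ j ∉ S), p.1 ^ T.depth S • p.2 S) = p.1 ^ d • F i j p := by
    intro i j A hA hi hj hd h
    refine ⟨?_, fun p => ?_⟩
    · have hc : Continuous (F i j) := continuous_finsetSum _ fun S _ =>
        (continuous_fst.pow _).smul ((continuous_apply S).comp continuous_snd)
      have h0 : F i j (0, v₀) = v₀ A := by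
        refine (Finset.sum_eq_single A (fun S hS hne => ?_) fun h => ?_).trans (by simp [hd])
        · simp only [mem_filter] at hS
          have := h S hS.1 hS.2.1 hS.2.2 hne
          simp [zero_pow (show T.depth S - d ≠ 0 by omega)]
        · exact absurd (mem_filter.2 ⟨hA, hi, hj⟩) h
      rw [← h0]
      exact hc.continuousAt
    · simp only [F, Finset.smul_sum, smul_smul, ← pow_add]
      refine sum_congr rfl fun S hS => ?_
      simp only [mem_filter] at hS
      have : d ≤ T.depth S := by
        by_cases e : S = A
        · rw [e, hd]
        · have := h S hS.1 hS.2.1 hS.2.2 e; omega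
      rw [Nat.add_sub_cancel' this]
  obtain ⟨tA, eA⟩ := hF hA hiA hjA rfl hAS
  obtain ⟨tB, eB⟩ := hF hB hjB hiB hd hBS
  have hpos : 0 < ‖v₀ A - v₀ B‖ := norm_pos_iff.2 (sub_ne_zero.2 hne)
  refine ⟨‖v₀ A - v₀ B‖ / 2, by positivity, ?_⟩
  have hle : 𝓝[>] (0 : ℝ) ×ˢ 𝓝[T.params D] v₀ ≤ 𝓝 (0, v₀) := by
    rw [nhds_prod_eq]; exact prod_mono nhdsWithin_le_nhds nhdsWithin_le_nhds
  have h1 := ((tA.sub tB).norm.eventually (lt_mem_nhds (half_lt_self hpos))).filter_mono hle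
  have h2 : ∀ᶠ p : ℝ × (Finset (Fin n) → Euc D) in 𝓝[>] 0 ×ˢ 𝓝[T.params D] v₀,
      p.1 ∈ Ioo (0 : ℝ) 1 := tendsto_fst.eventually (Ioo_mem_nhdsGT one_pos)
  filter_upwards [h1, h2] with p h1 h2
  rw [config_sub, eA, eB, ← smul_sub, norm_smul, norm_pow, norm_of_nonneg h2.1.le, mul_comm]
  exact mul_le_mul (pow_le_pow_of_le_one h2.1.le h2.2.le (Finset.card_filter_le _ _)) h1.le
    (by positivity) (by have := h2.1; positivity)

lemma eventually_config_ne (z : Euc D) {v₀ : Finset (Fin n) → Euc D} (hv : v₀ ∈ T.params D)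
    {i j : Fin n} (hij : i ≠ j) :
    ∀ᶠ p : ℝ × (Finset (Fin n) → Euc D) in 𝓝[>] 0 ×ˢ 𝓝[T.params D] v₀,
      T.config z p.2 p.1 i ≠ T.config z p.2 p.1 j := by
  obtain ⟨c, hc, h⟩ := T.eventually_config_sub z hv hij
  filter_upwards [h, tendsto_fst.eventually self_mem_nhdsWithin] with p h h1 e
  rw [e, sub_self, norm_zero] at h
  exact absurd h (not_le.2 (mul_pos hc (pow_pos h1 _)))

lemma eventually_config_le (z : Euc D) (v₀ : Finset (Fin n) → Euc D) : ∃ K : ℝ, 0 < K ∧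
    ∀ᶠ p : ℝ × (Finset (Fin n) → Euc D) in 𝓝[>] 0 ×ˢ 𝓝[T.params D] v₀,
      ∀ i, ‖T.config z p.2 p.1 i - z‖ ≤ K * p.1 := by
  refine ⟨(∑ S ∈ T.nodes, ‖v₀ S‖) + 1, by positivity, ?_⟩
  have hc : Continuous fun v : Finset (Fin n) → Euc D => ∑ S ∈ T.nodes, ‖v S‖ := by fun_prop
  have h1 : ∀ᶠ p : ℝ × (Finset (Fin n) → Euc D) in 𝓝[>] 0 ×ˢ 𝓝[T.params D] v₀,
      ∑ S ∈ T.nodes, ‖p.2 S‖ < (∑ S ∈ T.nodes, ‖v₀ S‖) + 1 :=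
    tendsto_snd.eventually (nhdsWithin_le_nhds
      (hc.continuousAt.eventually (gt_mem_nhds (lt_add_one _))))
  have h2 : ∀ᶠ p : ℝ × (Finset (Fin n) → Euc D) in 𝓝[>] 0 ×ˢ 𝓝[T.params D] v₀,
      p.1 ∈ Ioo (0 : ℝ) 1 := tendsto_fst.eventually (Ioo_mem_nhdsGT one_pos)
  filter_upwards [h1, h2] with p h1 h2 i
  rw [config, add_sub_cancel_left]
  refine (norm_sum_le _ _).trans (le_trans ?_ (mul_le_mul_of_nonneg_right h1.le h2.1.le))
  rw [sum_mul]
  refine (sum_le_sum fun S hS => ?_).trans (Finset.sum_le_sum_of_subset_of_nonneg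
    (Finset.filter_subset _ _) fun S _ _ => mul_nonneg (norm_nonneg _) h2.1.le)
  rw [norm_smul, norm_pow, norm_of_nonneg h2.1.le, mul_comm]
  gcongr
  exact pow_le_of_le_one h2.1.le h2.2.le
    (Nat.one_le_iff_ne_zero.1 (T.depth_pos (mem_filter.1 hS).2.2))

lemma params_trivial {v : Finset (Fin 2) → Euc D} (h : v {0} ≠ v {1}) :
    v ∈ (MergerTree.trivial 2).params D := by
  have h1 : ∀ S : Finset (Fin 2), S = ∅ ∨ S = {0} ∨ S = {1} ∨ S = Finset.univ := by decide
  have hn : ∅ ∉ (MergerTree.trivial 2).nodes := by decide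
  have hu : ∀ S : Finset (Fin 2), S ≠ Finset.univ → (MergerTree.trivial 2).ancestors S ≠
    (MergerTree.trivial 2).ancestors Finset.univ := by decide
  intro S hS S' hS' hne ha
  rcases h1 S with rfl | rfl | rfl | rfl <;> rcases h1 S' with rfl | rfl | rfl | rfl <;>
    first
    | exact absurd hS hn | exact absurd hS' hn | exact absurd rfl hne | exact h | exact h.symm
    | exact absurd ha (hu _ (by decide)) | exact absurd ha.symm (hu _ (by decide))

lemma config_trivial (z : Euc D) (v : Finset (Fin 2) → Euc D) (ε : ℝ) (i : Fin 2) :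
    (MergerTree.trivial 2).config z v ε i = z + ε • v {i} := by
  have h : ∀ i : Fin 2, ((MergerTree.trivial 2).nodes.filter fun S => i ∈ S ∧ S ≠ Finset.univ)
    = {{i}} := by decide
  have hd : ∀ i : Fin 2, (MergerTree.trivial 2).depth {i} = 1 := by decide
  rw [config, h i, sum_singleton, hd i, pow_one]

end MergerTree

lemma asympEq_iff {n D : ℕ} {T : MergerTree n} {δ : ℕ} {z : Euc D}
    {F G : (Fin n → Euc D) → ℝ} : AsympEq T δ z F G ↔ ∀ v₀ ∈ T.params D,
      Tendsto (fun p : ℝ × (Finset (Fin n) → Euc D) =>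
        (F (T.config z p.2 p.1) - G (T.config z p.2 p.1)) / p.1 ^ δ)
        (𝓝[>] 0 ×ˢ 𝓝[T.params D] v₀) (𝓝 0) := by
  refine tendstoLocallyUniformlyOn_iff_forall_tendsto.trans (forall₂_congr fun v _ => ?_)
  exact (Uniform.tendsto_nhds_right (a := (0 : ℝ))).symm

/-! ### From two points to `n` points -/

namespace KernelData

variable {D n : ℕ} {ζ : ℝ → ℝ} {δ N δ' : ℕ}

lemma exists_bound_E (d : KernelData D) (μ : ℝ) : ∃ C : ℝ, ∀ u : Euc D, u ≠ 0 → ‖u‖ ≤ 1 →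
    |d.E μ u| ≤ C * (‖u‖ ^ D)⁻¹ := by
  have hb : ∀ f : ℝ → ℝ, Smooth f → ∃ C : ℝ, ∀ u : Euc D, ‖u‖ ≤ 1 →
      |f (μ * ‖u‖ ^ 2)| ≤ C := fun f hf => by
    obtain ⟨C, hC⟩ := (isCompact_closedBall (0 : Euc D) 1).exists_bound_of_continuousOn
      (f := fun u => f (μ * ‖u‖ ^ 2)) (hf.continuous.comp (by fun_prop)).continuousOn
    exact ⟨C, fun u hu => hC u (by simpa using hu)⟩
  obtain ⟨A, hA⟩ := hb d.e d.he
  obtain ⟨B, hB⟩ := hb d.v d.hv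
  refine ⟨A + B * 2, fun u hu hu1 => ?_⟩
  have h0 : 0 < ‖u‖ := norm_pos_iff.2 hu
  have hlog : |log (‖u‖ ^ 2)| ≤ 2 * ‖u‖⁻¹ := by
    rw [log_pow, abs_mul, abs_of_nonpos (Real.log_nonpos h0.le hu1), ← Real.log_inv]
    have := (Real.log_le_sub_one_of_pos (inv_pos.2 h0)).trans (sub_le_self _ zero_le_one)
    push_cast
    rw [abs_of_nonneg zero_le_two]
    linarith
  have h1 : 1 ≤ ‖u‖⁻¹ := (one_le_inv₀ h0).2 hu1
  have hA' := hA u hu1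
  have hB' := hB u hu1
  have hA0 := (abs_nonneg _).trans hA'
  have hB0 := (abs_nonneg _).trans hB'
  have e : d.E μ u = (‖u‖ ^ (D - 2))⁻¹ *
      (d.e (μ * ‖u‖ ^ 2) - d.v (μ * ‖u‖ ^ 2) * log (‖u‖ ^ 2)) := by
    simp only [hadKer, singKer, singA, singB]; ring
  rw [e, abs_mul, abs_of_nonneg (by positivity)]
  have h2 : |d.e (μ * ‖u‖ ^ 2) - d.v (μ * ‖u‖ ^ 2) * log (‖u‖ ^ 2)|
      ≤ (A + B * 2) * ‖u‖⁻¹ := by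
    refine (abs_sub _ _).trans ?_
    rw [abs_mul]
    calc _ ≤ A * ‖u‖⁻¹ + B * (2 * ‖u‖⁻¹) := by
          refine add_le_add (hA'.trans (le_mul_of_one_le_right hA0 h1)) ?_
          exact mul_le_mul hB' hlog (abs_nonneg _) hB0
      _ = _ := by ring
  have h3 : (‖u‖ ^ (D - 2))⁻¹ * ‖u‖⁻¹ ≤ (‖u‖ ^ D)⁻¹ := by
    rw [← mul_inv, ← pow_succ]
    have := d.hD
    exact inv_anti₀ (by positivity) (pow_le_pow_of_le_one h0.le hu1 (by omega))
  calc _ ≤ (‖u‖ ^ (D - 2))⁻¹ * ((A + B * 2) * ‖u‖⁻¹) := by gcongr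
    _ = (A + B * 2) * ((‖u‖ ^ (D - 2))⁻¹ * ‖u‖⁻¹) := by ring
    _ ≤ _ := by gcongr

variable {d : KernelData D} {H : ℝ → Euc D → Euc D → ℝ}

/-- Along a merger tree the remainder of each pair is `O(ε ^ (δ + 1))`, and each of the at most
`r` other propagators diverges at most like `ε ^ (-D * #nodes)`. -/
theorem flowRelation_of_symPart (hH : d.Represents H)
    (hζ : IsCutoff ζ) (hN : 2 < N) {b₀ : Counterterm D} (hb : ∀ μ, ∀ γ ∈ pairsUpTo D δ,
      symPart (fun γ => b₀ γ.1 γ.2 μ - d.b0 ζ δ N γ μ) γ = 0)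
    (T : MergerTree n) {r : ℕ} (hr : ∀ σ ∈ matchings (Fin n), ∀ p ∈ pairsOf σ,
      ((pairsOf σ).erase p).card ≤ r) (hδ : δ' + T.nodes.card * D * r ≤ δ) :
    FlowRelation ζ δ N H b₀ T δ' := by
  intro μ z L hL
  refine asympEq_iff.2 fun v₀ hv => ?_
  set F := 𝓝[>] (0 : ℝ) ×ˢ 𝓝[T.params D] v₀
  set M := T.nodes.card
  have h01 : ∀ᶠ p in F, p.1 ∈ Ioo (0 : ℝ) 1 := tendsto_fst.eventually (Ioo_mem_nhdsGT one_pos)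
  have h0 : Tendsto (fun p : ℝ × (Finset (Fin n) → Euc D) => p.1) F (𝓝 0) :=
    tendsto_fst.mono_right nhdsWithin_le_nhds
  obtain ⟨K, hK0, hK⟩ := T.eventually_config_le z v₀
  have hsep : ∀ i j : Fin n, i ≠ j → ∃ c : ℝ, 0 < c ∧ ∀ᶠ p in F,
      c * p.1 ^ M ≤ ‖T.config z p.2 p.1 i - T.config z p.2 p.1 j‖ :=
    fun i j hij => T.eventually_config_sub z hv hij
  have hinj : ∀ᶠ p in F, Injective (T.config z p.2 p.1) := by
    have : ∀ᶠ p in F, ∀ i j : Fin n, i ≠ j →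
        T.config z p.2 p.1 i ≠ T.config z p.2 p.1 j := eventually_all.2 fun i =>
      eventually_all.2 fun j => eventually_imp_distrib_left.2 (T.eventually_config_ne z hv)
    filter_upwards [this] with p hp i j h
    by_contra hij
    exact hp i j hij h
  have hlt : ∀ c : ℝ, 0 < c → ∀ᶠ p in F, ∀ i, ‖T.config z p.2 p.1 i - z‖ < c := fun c hc => by
    have : Tendsto (fun p : ℝ × (Finset (Fin n) → Euc D) => K * p.1) F (𝓝 0) := by
      simpa using h0.const_mul K
    filter_upwards [hK, this.eventually (gt_mem_nhds hc)] with p h h' i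
    exact (h i).trans_lt h'
  have hrem : ∀ i j : Fin n, (fun p : ℝ × (Finset (Fin n) → Euc D) =>
      d.remainder ζ δ N b₀ μ L (T.config z p.2 p.1 i - z) (T.config z p.2 p.1 j - z))
      =O[F] fun p => p.1 ^ (δ + 1) := by
    intro i j
    obtain ⟨C, hC0, ρ, hρ, hC⟩ := d.exists_bound_T (isCut_wcut hζ δ N hL) μ δ
    refine Asymptotics.IsBigO.of_bound (C * K ^ (δ + 1)) ?_
    filter_upwards [hK, hlt ρ hρ, h01] with p h1 h2 h3
    have hz : pairPoly δ (symPart fun γ => b₀ γ.1 γ.2 μ - d.b0 ζ δ N γ μ)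
        (T.config z p.2 p.1 i - z) (T.config z p.2 p.1 j - z) = 0 :=
      Finset.sum_eq_zero fun γ hγ => by rw [hb μ γ hγ, zero_mul]
    rw [remainder, hz, add_zero, norm_eq_abs, norm_pow, norm_of_nonneg h3.1.le, mul_assoc,
      ← mul_pow]
    refine (hC (T.config z p.2 p.1 i - z, T.config z p.2 p.1 j - z)
      (max_le (h2 i).le (h2 j).le)).trans ?_
    gcongr
    exact max_le (h1 i) (h1 j)
  have hHO : ∀ i j : Fin n, i ≠ j → (fun p : ℝ × (Finset (Fin n) → Euc D) =>
      H μ (T.config z p.2 p.1 i) (T.config z p.2 p.1 j)) =O[F] fun p => (p.1 ^ (M * D))⁻¹ := by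
    intro i j hij
    obtain ⟨C, hC⟩ := d.exists_bound_E μ
    obtain ⟨c, hc, hcs⟩ := hsep i j hij
    refine Asymptotics.IsBigO.of_bound (|C| * (c ^ D)⁻¹) ?_
    filter_upwards [hcs, hinj, h01, hlt (1 / 2) one_half_pos] with p h1 h2 h3 h4
    have hne := h2.ne hij
    have h5 : ‖T.config z p.2 p.1 i - T.config z p.2 p.1 j‖ ≤ 1 := by
      rw [← sub_sub_sub_cancel_right _ _ z]
      exact (norm_sub_le _ _).trans (by linarith [h4 i, h4 j])
    have h6 : 0 < c * p.1 ^ M := mul_pos hc (pow_pos h3.1 _)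
    rw [hH μ _ _ hne, norm_eq_abs, norm_inv, norm_pow, norm_of_nonneg h3.1.le, mul_assoc,
      ← mul_inv, pow_mul, ← mul_pow]
    refine (hC _ (sub_ne_zero.2 hne) h5).trans (mul_le_mul (le_abs_self C) ?_ (by positivity)
      (abs_nonneg _))
    exact inv_anti₀ (by positivity) (pow_le_pow_left₀ h6.le h1 D)
  have hmain : Tendsto (fun p : ℝ × (Finset (Fin n) → Euc D) =>
      ∑ σ ∈ matchings (Fin n), ∑ q ∈ pairsOf σ,
        (d.remainder ζ δ N b₀ μ L (T.config z p.2 p.1 q - z) (T.config z p.2 p.1 (σ q) - z) *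
          ∏ q' ∈ (pairsOf σ).erase q,
            H μ (T.config z p.2 p.1 q') (T.config z p.2 p.1 (σ q'))) / p.1 ^ δ') F (𝓝 0) := by
    have hz : (0 : ℝ) = ∑ σ ∈ matchings (Fin n), ∑ q ∈ pairsOf σ, 0 := by simp
    rw [hz]
    refine tendsto_finsetSum _ fun σ hσ => tendsto_finsetSum _ fun q hq => ?_
    have hO := ((hrem q (σ q)).mul (Asymptotics.IsBigO.finsetProd
      (s := (pairsOf σ).erase q) fun q' hq' => hHO q' (σ q')
        ((mem_matchings.1 hσ q').1.symm))).mul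
      (Asymptotics.isBigO_refl (fun p : ℝ × (Finset (Fin n) → Euc D) => (p.1 ^ δ')⁻¹) F)
    simp only [← div_eq_mul_inv] at hO
    refine (hO.trans (k := fun p => p.1) ?_).trans_tendsto h0
    refine Asymptotics.IsBigO.of_bound 1 ?_
    filter_upwards [h01] with p hp
    have hp0 := hp.1
    rw [Finset.prod_const, inv_pow, ← pow_mul, one_mul, norm_of_nonneg (by positivity),
      norm_of_nonneg hp0.le, ← div_eq_mul_inv, div_div, ← pow_add,
      div_le_iff₀ (by positivity), mul_comm p.1, ← pow_succ]
    refine pow_le_pow_of_le_one hp0.le hp.2.le ?_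
    have := Nat.mul_le_mul_left (M * D) (hr σ hσ q hq)
    omega
  refine hmain.congr' ?_
  filter_upwards [hinj, hlt L hL] with p h1 h2
  rw [flow_sub hH hζ hN b₀ μ z hL h1 h2, Finset.sum_div]
  exact sum_congr rfl fun σ _ => (Finset.sum_div _ _ _).symm

lemma matchings_two : matchings (Fin 2) = {swap 0 1} := by decide

lemma pairsOf_swap : pairsOf (swap (0 : Fin 2) 1) = {0} := by decide

/-- If `F - G` is a polynomial of degree `δ` up to higher order, then `F ∼_δ G` makes the polynomial
vanish. -/
lemma _root_.AsympEq.eq_zero_of_bound [NeZero D] {F G : (Fin 2 → Euc D) → ℝ}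
    {c : MultiIdx₂ D → ℝ} {C ρ : ℝ} (h : AsympEq (.trivial 2) δ 0 F G)
    (hρ : 0 < ρ) (hC : ∀ a b : Euc D, a ≠ b → ‖(a, b)‖ < ρ →
      |F ![a, b] - G ![a, b] - pairPoly δ c a b| ≤ C * ‖(a, b)‖ ^ (δ + 1))
    {γ : MultiIdx₂ D} (hγ : γ ∈ pairsUpTo D δ) : c γ = 0 := by
  refine pairPoly_eq_zero_of_offDiag (fun a b hab => pairPoly_eq_zero_of_tendsto ?_) hγ
  let v : Finset (Fin 2) → Euc D := fun S => if S = {0} then a else b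
  have hv0 : v {0} = a := if_pos rfl
  have hv1 : v {1} = b := if_neg (by decide)
  have hv := MergerTree.params_trivial (v := v) (by rwa [hv0, hv1])
  have ht : Tendsto (fun ε : ℝ => (ε, v)) (𝓝[>] 0)
      (𝓝[>] 0 ×ˢ 𝓝[(MergerTree.trivial 2).params D] v) :=
    tendsto_id.prodMk (tendsto_const_nhdsWithin hv)
  have hc : ∀ ε, (MergerTree.trivial 2).config 0 v ε = ![ε • a, ε • b] := fun ε => by
    ext1 i
    rw [MergerTree.config_trivial, zero_add]
    fin_cases i
    · simp [hv0]
    · simp [hv1]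
  have h1 : Tendsto (fun ε => (F ![ε • a, ε • b] - G ![ε • a, ε • b]) / ε ^ δ) (𝓝[>] 0) (𝓝 0) := by
    simpa only [comp_def, hc] using (asympEq_iff.1 h v hv).comp ht
  have hsm : ∀ᶠ ε : ℝ in 𝓝[>] 0, ‖((ε • a, ε • b) : Euc₂ D)‖ < ρ :=
    nhdsWithin_le_nhds ((Continuous.tendsto' (by fun_prop) 0 0
      (by simp)).eventually (gt_mem_nhds hρ))
  have h2 : Tendsto (fun ε : ℝ => (F ![ε • a, ε • b] - G ![ε • a, ε • b]
      - pairPoly δ c (ε • a) (ε • b)) / ε ^ δ) (𝓝[>] 0) (𝓝 0) := by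
    refine squeeze_zero_norm' (a := fun ε : ℝ => C * ‖(a, b)‖ ^ (δ + 1) * ε) ?_
      (tendsto_nhdsWithin_of_tendsto_nhds (Continuous.tendsto' (by fun_prop) 0 0 (by simp)))
    filter_upwards [hsm, self_mem_nhdsWithin] with ε h4 (hε : 0 < ε)
    rw [norm_div, norm_pow, norm_of_nonneg hε.le, div_le_iff₀ (by positivity)]
    refine (hC _ _ (fun e => hab (smul_right_injective _ hε.ne' e)) h4).trans (le_of_eq ?_)
    rw [← Prod.smul_mk, norm_smul, norm_of_nonneg hε.le]
    ring
  refine ((h1.sub h2).congr fun ε => ?_).trans (by rw [sub_zero])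
  rw [← sub_div, sub_sub_cancel]

/-- The two-point flow relation determines the symmetric part of `b⁰`. -/
theorem twoPointFlow_iff (hH : d.Represents H) (hζ : IsCutoff ζ) (hN : 2 < N) {b₀ : Counterterm D} :
    TwoPointFlow ζ δ N H b₀ ↔ ∀ μ, ∀ γ ∈ pairsUpTo D δ,
      symPart (fun γ => b₀ γ.1 γ.2 μ - d.b0 ζ δ N γ μ) γ = 0 := by
  refine ⟨fun h μ γ hγ => ?_, fun h => flowRelation_of_symPart hH hζ hN h _ (r := 0)
    (fun σ hσ p hp => ?_) (by simp)⟩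
  · have := d.neZero
    obtain ⟨C, hC0, ρ, hρ, hC⟩ := d.exists_bound_T (isCut_wcut hζ δ N one_pos) μ δ
    refine (h μ 0 1 one_pos).eq_zero_of_bound (lt_min hρ one_pos) (C := C)
      (fun a b hab hlt => ?_) hγ
    have hlt' := max_lt_iff.1 (hlt.trans_le (min_le_right _ _))
    rw [flow_sub hH hζ hN b₀ μ 0 one_pos (fun i j hij => by
        fin_cases i <;> fin_cases j <;> simp_all) (fun i => by
        fin_cases i
        · simpa using hlt'.1
        · simpa using hlt'.2), matchings_two, sum_singleton,
      pairsOf_swap, sum_singleton, Finset.erase_singleton, Finset.prod_empty, mul_one,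
      Equiv.swap_apply_left, remainder, sub_zero, sub_zero, add_sub_assoc]
    simp only [Matrix.cons_val_zero, Matrix.cons_val_one, sub_self, add_zero]
    exact hC (a, b) (hlt.le.trans (min_le_left _ _))
  · rw [matchings_two, Finset.mem_singleton] at hσ
    subst hσ
    rw [pairsOf_swap] at hp ⊢
    rw [Finset.mem_singleton.1 hp]
    simp

/-- The two-point flow relation yields the flow relations for `n` factors of `φ` once `δ` exceeds
`δ'` by the degree of divergence of the spectator propagators. -/
theorem flowRelation_of_twoPointFlow (hH : d.Represents H)
    (hζ : IsCutoff ζ) (hN : 2 < N) {b₀ : Counterterm D}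
    (h : TwoPointFlow ζ δ N H b₀) (T : MergerTree n)
    (hδ : δ' + T.nodes.card * D * n ≤ δ) : FlowRelation ζ δ N H b₀ T δ' :=
  flowRelation_of_symPart hH hζ hN ((twoPointFlow_iff hH hζ hN).1 h) T
    (fun σ _ p _ => (Finset.card_le_univ _).trans (by simp)) hδ

theorem twoPointFlow_counterterm (hH : d.Represents H) (hζ : IsCutoff ζ) (hN : 2 < N) :
    TwoPointFlow ζ δ N H (d.counterterm ζ δ N) := by
  refine (twoPointFlow_iff hH hζ hN).2 fun μ γ hγ => ?_
  have h := d.counterterm_of_le (ζ := ζ) (N := N) (mem_pairsUpTo.1 hγ)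
  have h' := d.counterterm_of_le (ζ := ζ) (N := N) (γ := γ.swap)
    (by have := mem_pairsUpTo.1 hγ; simpa [add_comm] using this)
  simp only [symPart]
  rw [h, h']
  simp

theorem eq_counterterm (hH : d.Represents H)
    (hζ : IsCutoff ζ) (hN : 2 < N) {b₀ : Counterterm D} (hb : IsAdmissible δ b₀)
    (h : TwoPointFlow ζ δ N H b₀) : b₀ = d.counterterm ζ δ N := by
  have ha := d.isAdmissible_counterterm (δ := δ) hζ hN
  funext γ₁ γ₂ μ
  by_cases hγ : γ₁.order + γ₂.order ≤ δ
  · have hm : (γ₁, γ₂) ∈ pairsUpTo D δ := mem_pairsUpTo.2 hγ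
    have h1 := (twoPointFlow_iff hH hζ hN).1 h μ _ hm
    have h2 : ∀ γ : MultiIdx₂ D, γ.1.order + γ.2.order ≤ δ →
        d.b0 ζ δ N γ μ = d.counterterm ζ δ N γ.1 γ.2 μ := fun γ hγ => by
      rw [d.counterterm_of_le hγ]
    simp only [symPart, Prod.swap_prod_mk] at h1
    rw [h2 _ hγ, h2 (γ₂, γ₁) (by simpa [add_comm] using hγ), hb.symm γ₂ γ₁] at h1
    have h3 := ha.symm γ₂ γ₁ μ
    simp only at h1 h3
    linarith
  · rw [hb.eq_zero _ _ _ (not_le.1 hγ), ha.eq_zero _ _ _ (not_le.1 hγ)]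

end KernelData

/-! ### Radial solutions of the Klein-Gordon equation -/

/-- The power series `∑ aₙ tⁿ`. -/
def powSum (a : ℕ → ℝ) (t : ℝ) : ℝ := ∑' n, a n * t ^ n

/-- The coefficients of the derivative. -/
def shiftCoeff (a : ℕ → ℝ) (n : ℕ) : ℝ := (n + 1) * a (n + 1)

section PowSum

variable {a : ℕ → ℝ}

lemma shiftCoeff_bound (ha : ∀ n, |a n| ≤ (n.factorial : ℝ)⁻¹) (n : ℕ) :
    |shiftCoeff a n| ≤ (n.factorial : ℝ)⁻¹ := by
  rw [shiftCoeff, abs_mul, abs_of_nonneg (by positivity)]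
  refine (mul_le_mul_of_nonneg_left (ha (n + 1)) (by positivity)).trans (le_of_eq ?_)
  rw [Nat.factorial_succ]
  push_cast
  field_simp

lemma hasSum_powSum (ha : ∀ n, |a n| ≤ (n.factorial : ℝ)⁻¹) (t : ℝ) :
    HasSum (fun n => a n * t ^ n) (powSum a t) := by
  refine (Summable.of_norm_bounded (Real.summable_pow_div_factorial |t|) fun n => ?_).hasSum
  rw [norm_mul, norm_pow, norm_eq_abs, norm_eq_abs, div_eq_inv_mul]
  gcongr
  exact ha n

lemma hasDerivAt_powSum (ha : ∀ n, |a n| ≤ (n.factorial : ℝ)⁻¹) (t : ℝ) :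
    HasDerivAt (powSum a) (powSum (shiftCoeff a) t) t := by
  have hs : Summable fun n : ℕ => |a n| * (n * (|t| + 1) ^ (n - 1)) := by
    refine (summable_nat_add_iff 1).1 (Summable.of_nonneg_of_le (fun n => by positivity)
      (fun n => ?_) (Real.summable_pow_div_factorial (|t| + 1)))
    have := shiftCoeff_bound ha n
    rw [shiftCoeff, abs_mul, abs_of_nonneg (by positivity : (0 : ℝ) ≤ n + 1)] at this
    rw [div_eq_inv_mul, Nat.add_sub_cancel, ← mul_assoc, mul_comm |a (n + 1)|]
    push_cast
    gcongr
  have h := hasDerivAt_tsum_of_isPreconnected (g := fun n y => a n * y ^ n)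
    (g' := fun n y => a n * (n * y ^ (n - 1))) hs (isOpen_ball (x := 0) (ε := |t| + 1))
    (convex_ball 0 _).isPreconnected (fun n y _ => (hasDerivAt_pow n y).const_mul _)
    (fun n y hy => ?_) (Metric.mem_ball_self (by positivity)) (hasSum_powSum ha 0).summable
    (y := t) (by simp)
  · refine h.congr_deriv ?_
    have hb : Summable fun n => a n * (n * t ^ (n - 1)) := Summable.of_norm_bounded hs fun n => by
      rw [norm_mul, norm_mul, norm_pow, Real.norm_natCast, norm_eq_abs, norm_eq_abs]
      gcongr
      linarith
    rw [hb.tsum_eq_zero_add]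
    simp only [CharP.cast_eq_zero, zero_mul, mul_zero, zero_add, powSum, shiftCoeff]
    exact tsum_congr fun n => by push_cast; ring
  · rw [norm_mul, norm_mul, norm_pow, Real.norm_natCast, norm_eq_abs]
    gcongr
    exact (mem_ball_zero_iff.1 hy).le

lemma deriv_powSum (ha : ∀ n, |a n| ≤ (n.factorial : ℝ)⁻¹) :
    deriv (powSum a) = powSum (shiftCoeff a) :=
  funext fun t => (hasDerivAt_powSum ha t).deriv

lemma contDiff_powSum (ha : ∀ n, |a n| ≤ (n.factorial : ℝ)⁻¹) : Smooth (powSum a) := by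
  refine contDiff_infty.2 fun k => ?_
  induction k generalizing a with
  | zero => exact contDiff_zero.2 (continuous_iff_continuousAt.2 fun t =>
      (hasDerivAt_powSum ha t).continuousAt)
  | succ k ih =>
    push_cast
    refine contDiff_succ_iff_deriv.2 ⟨fun t => (hasDerivAt_powSum ha t).differentiableAt,
      fun h => absurd h (by simp), ?_⟩
    rw [deriv_powSum ha]
    exact ih (shiftCoeff_bound ha)

/-- The regular solution of a modified Bessel equation: `F(μ r²)` solves `-∂²F + μF = 0` in `2b`
dimensions. -/
lemma exists_bessel {b : ℝ} (hb : 1 / 2 ≤ b) : ∃ F F' F'' : ℝ → ℝ, Smooth F ∧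
    Smooth F' ∧ (∀ t, HasDerivAt F (F' t) t) ∧ (∀ t, HasDerivAt F' (F'' t) t) ∧ F 0 = 1 ∧
    ∀ t, 4 * t * F'' t + 4 * b * F' t = F t := by
  let a : ℕ → ℝ := fun n => ∏ k ∈ range n, (4 * (k + 1) * (k + b))⁻¹
  have ha1 : ∀ n : ℕ, a (n + 1) = a n * (4 * (n + 1) * (n + b))⁻¹ :=
    fun n => Finset.prod_range_succ _ n
  have hk : ∀ k : ℕ, 0 < (k : ℝ) + b := fun k => by positivity
  have ha : ∀ n, |a n| ≤ (n.factorial : ℝ)⁻¹ := fun n => by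
    induction n with
    | zero => simp [a]
    | succ n ih =>
      have := hk n
      have hn : (0 : ℝ) ≤ n := n.cast_nonneg
      rw [ha1, abs_mul, abs_inv, abs_of_pos (by positivity : 0 < 4 * ((n : ℝ) + 1) * (n + b)),
        Nat.factorial_succ, mul_comm (n + 1), Nat.cast_mul, mul_inv (n.factorial : ℝ),
        Nat.cast_succ]
      refine mul_le_mul ih (inv_anti₀ (by positivity) ?_) (by positivity) (by positivity)
      nlinarith
  have hd := shiftCoeff_bound ha
  refine ⟨powSum a, powSum (shiftCoeff a), powSum (shiftCoeff (shiftCoeff a)), contDiff_powSum ha,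
    contDiff_powSum hd, hasDerivAt_powSum ha, hasDerivAt_powSum hd, ?_, fun t => ?_⟩
  · rw [powSum, tsum_eq_single 0 fun n hn => by simp [hn]]
    simp [a]
  · have h1 := hasSum_powSum hd t
    have h2 : HasSum (fun n : ℕ => n * shiftCoeff a n * t ^ n)
        (powSum (shiftCoeff (shiftCoeff a)) t * t) := by
      have := (hasSum_powSum (shiftCoeff_bound hd) t).mul_right t
      simpa using (hasSum_nat_add_iff (f := fun n : ℕ => n * shiftCoeff a n * t ^ n) 1).1
        (this.congr_fun fun n => by unfold shiftCoeff; push_cast; ring)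
    refine HasSum.unique ?_ (hasSum_powSum ha t)
    have h3 := (h2.mul_left 4).add (h1.mul_left (4 * b))
    rw [show 4 * t * powSum (shiftCoeff (shiftCoeff a)) t
      = 4 * (powSum (shiftCoeff (shiftCoeff a)) t * t) by ring]
    refine h3.congr_fun fun n => ?_
    have := hk n
    rw [shiftCoeff, ha1]
    field_simp

end PowSum

/-- The radial function `s^{-ν} (e(μs) - v(μs) log s)` of `s = r²`. -/
def radG (ν : ℝ) (e v : ℝ → ℝ) (μ s : ℝ) : ℝ :=
  s ^ (-ν) * (e (μ * s) - v (μ * s) * Real.log s)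

/-- The regular part of `∂_s` of a radial function, see `hasDerivAt_radG`. -/
def upE (ν : ℝ) (e v : ℝ → ℝ) (t : ℝ) : ℝ := -ν * e t + t * deriv e t - v t

/-- The logarithmic part of `∂_s` of a radial function, see `hasDerivAt_radG`. -/
def upV (ν : ℝ) (v : ℝ → ℝ) (t : ℝ) : ℝ := -ν * v t + t * deriv v t

lemma contDiff_upV {ν : ℝ} {v : ℝ → ℝ} (hv : Smooth v) : Smooth (upV ν v) :=
  (contDiff_const.mul hv).add (contDiff_id.mul (hv.deriv' : Smooth _))

lemma contDiff_upE {ν : ℝ} {e v : ℝ → ℝ} (he : Smooth e) (hv : Smooth v) :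
    Smooth (upE ν e v) :=
  (contDiff_upV he).sub hv

lemma rpow_neg_add_one {ν s : ℝ} (hs : 0 < s) : s ^ (-(ν + 1)) = s ^ (-ν) / s := by
  rw [neg_add, Real.rpow_add hs, Real.rpow_neg_one, div_eq_mul_inv]

lemma hasDerivAt_radG {ν : ℝ} {e v : ℝ → ℝ} (he : Smooth e) (hv : Smooth v) (μ : ℝ)
    {s : ℝ} (hs : 0 < s) :
    HasDerivAt (radG ν e v μ) (radG (ν + 1) (upE ν e v) (upV ν v) μ s) s := by
  have hc : ∀ f : ℝ → ℝ, Smooth f →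
      HasDerivAt (fun s => f (μ * s)) (deriv f (μ * s) * μ) s := fun f hf =>
    ((hf.differentiable (by simp)).differentiableAt.hasDerivAt (x := μ * s)).comp s
      (by simpa using (hasDerivAt_id s).const_mul μ)
  refine ((Real.hasDerivAt_rpow_const (p := -ν) (Or.inl hs.ne')).mul
    ((hc e he).sub ((hc v hv).mul (Real.hasDerivAt_log hs.ne')))).congr_deriv ?_
  simp only [radG, rpow_neg_add_one hs, Real.rpow_sub_one hs.ne', upE, upV, Pi.sub_apply,
    Pi.mul_apply]
  field_simp
  ring

/-- Radial functions which solve the Klein-Gordon equation in `2ν + 2` dimensions away from the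
origin up to a smooth error, with a smooth logarithmic coefficient, and whose derivative has the
leading singularity of the fundamental solution. -/
structure IsRadialSolution (ν : ℝ) (e v : ℝ → ℝ) : Prop where
  he : Smooth e
  hv : Smooth v
  log : ∃ W : ℝ → ℝ → ℝ, Smooth₂ W ∧
    ∀ μ s, 0 < s → s ^ (-ν) * v (μ * s) = W s μ
  eqn : ∃ ρ : ℝ → ℝ → ℝ, Smooth₂ ρ ∧ ∀ μ s, 0 < s →
    4 * s * radG (ν + 1 + 1) (upE (ν + 1) (upE ν e v) (upV ν v)) (upV (ν + 1) (upV ν v)) μ s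
      + 4 * (ν + 1) * radG (ν + 1) (upE ν e v) (upV ν v) μ s - μ * radG ν e v μ s = ρ s μ
  e_ne : upE ν e v 0 ≠ 0
  v_zero : upV ν v 0 = 0

namespace IsRadialSolution

/-- The derivative `∂_s` raises the dimension by two. -/
lemma succ {ν : ℝ} (hν : 0 ≤ ν) {e v : ℝ → ℝ} (h : IsRadialSolution ν e v) :
    IsRadialSolution (ν + 1) (upE ν e v) (upV ν v) := by
  have he₁ := contDiff_upE (ν := ν) h.he h.hv
  have hv₁ := contDiff_upV (ν := ν) h.hv
  have he₂ := contDiff_upE (ν := ν + 1) he₁ hv₁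
  have hv₂ := contDiff_upV (ν := ν + 1) hv₁
  -- a smooth function of `(s, μ)` which agrees with `f` for `s > 0` also has the derivative of `f`
  have key : ∀ {f f' : ℝ → ℝ → ℝ} {W : ℝ → ℝ → ℝ}, (∀ μ s, 0 < s → HasDerivAt (f μ) (f' μ s) s) →
      (∀ μ s, 0 < s → f μ s = W s μ) → ∀ μ s, 0 < s → f' μ s = deriv (fun s => W s μ) s := by
    intro f f' W hf hW μ s hs
    rw [← (hf μ s hs).deriv]
    exact Filter.EventuallyEq.deriv_eq
      (Filter.eventually_of_mem (Ioi_mem_nhds hs) fun s hs => hW μ s hs)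
  refine ⟨he₁, hv₁, ?_, ?_, ?_, ?_⟩
  · obtain ⟨W, hW, h1⟩ := h.log
    refine ⟨_, contDiff_deriv_fst hW, key (f := fun μ s => s ^ (-ν) * v (μ * s))
      (fun μ s hs => ?_) h1⟩
    have := hasDerivAt_radG (ν := ν) h.hv contDiff_const (v := fun _ => 0) μ hs
    have e : radG ν v (fun _ => 0) μ = fun s => s ^ (-ν) * v (μ * s) := by ext s; simp [radG]
    rw [e] at this
    simpa [radG, upE, upV] using this
  · obtain ⟨ρ, hρ, h1⟩ := h.eqn
    refine ⟨_, contDiff_deriv_fst hρ, key (fun μ s hs => ?_) h1⟩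
    refine ((((hasDerivAt_id s).const_mul 4).mul (hasDerivAt_radG he₂ hv₂ μ hs)).add
      ((hasDerivAt_radG he₁ hv₁ μ hs).const_mul _)).sub
      ((hasDerivAt_radG h.he h.hv μ hs).const_mul μ) |>.congr_deriv ?_
    simp only [id, mul_one]
    ring
  · have : upE (ν + 1) (upE ν e v) (upV ν v) 0 = -(ν + 1) * upE ν e v 0 := by
      rw [upE, h.v_zero]; ring
    rw [this]
    exact mul_ne_zero (by linarith) h.e_ne
  · rw [upV, h.v_zero]; ring

lemma zero : ∃ e v, IsRadialSolution 0 e v := by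
  obtain ⟨F, F', F'', hF, hF', h1, h2, h0, h3⟩ := exists_bessel (b := 1) (by norm_num)
  have e0 : upE 0 (fun _ => 0) (fun t => -F t) = F := by ext t; simp [upE]
  have v0 : upV 0 (fun t => -F t) = fun t => -(t * F' t) := by
    ext t; simp [upV, (h1 t).deriv]
  refine ⟨fun _ => 0, fun t => -F t, contDiff_const, hF.neg,
    ⟨fun s μ => -F (μ * s), (hF.comp (contDiff_snd.mul contDiff_fst)).neg, by simp⟩,
    ⟨fun s μ => 8 * μ * F' (μ * s), (contDiff_const.mul contDiff_snd).mul
      (hF'.comp (contDiff_snd.mul contDiff_fst)), fun μ s hs => ?_⟩, by rw [e0, h0]; simp,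
      by rw [v0]; simp⟩
  have d1 : ∀ t, deriv F t = F' t := fun t => (h1 t).deriv
  have d2 : ∀ t, deriv (fun t => -(t * F' t)) t = -(F' t + t * F'' t) := fun t => by
    simpa [Pi.mul_def] using ((hasDerivAt_id t).mul (h2 t)).neg.deriv
  rw [e0, v0]
  simp only [radG, upE, upV, d1, d2, rpow_neg_add_one hs, neg_zero, Real.rpow_zero]
  have h4 := h3 (μ * s)
  generalize F'' (μ * s) = x, F' (μ * s) = y, F (μ * s) = w at h4 ⊢
  field_simp
  linear_combination s * Real.log s * μ * h4

lemma half : ∃ e v, IsRadialSolution (1 / 2) e v := by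
  obtain ⟨F, F', F'', hF, hF', h1, h2, h0, h3⟩ := exists_bessel (b := 1 / 2) le_rfl
  have v0 : ∀ ν, upV ν (fun _ => 0) = fun _ => 0 := fun ν => by ext t; simp [upV]
  have d1 : ∀ t, deriv F t = F' t := fun t => (h1 t).deriv
  have e0 : upE (1 / 2) F (fun _ => 0) = fun t => -(1 / 2) * F t + t * F' t := by
    ext t; simp [upE, d1]
  have d2 : ∀ t, deriv (fun t => -(1 / 2) * F t + t * F' t) t
      = -(1 / 2) * F' t + (F' t + t * F'' t) := fun t => by
    exact (((h1 t).const_mul (-(1 / 2))).add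
      (((hasDerivAt_id t).mul (h2 t)).congr_deriv (by simp))).deriv
  refine ⟨F, fun _ => 0, hF, contDiff_const, ⟨fun _ _ => 0, contDiff_const, by simp⟩,
    ⟨fun _ _ => 0, contDiff_const, fun μ s hs => ?_⟩, by simp only [e0, h0]; norm_num, by simp [v0]⟩
  rw [e0, v0, v0]
  simp only [radG, upE, d2, rpow_neg_add_one hs]
  have h4 := h3 (μ * s)
  generalize F'' (μ * s) = x, F' (μ * s) = y, F (μ * s) = w at h4 ⊢
  field_simp
  linear_combination 4 * s ^ (-(1 / 2) : ℝ) * s * μ * h4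

lemma exists_of_two_le {D : ℕ} (hD : 2 ≤ D) : ∃ e v, IsRadialSolution (((D : ℝ) - 2) / 2) e v := by
  have hs : ∀ ν : ℝ, 0 ≤ ν → (∃ e v, IsRadialSolution ν e v) → ∀ k : ℕ,
      ∃ e v, IsRadialSolution (ν + k) e v := fun ν hν h k => by
    induction k with
    | zero => simpa using h
    | succ k ih =>
      obtain ⟨e, v, h⟩ := ih
      exact ⟨_, _, by simpa [add_assoc] using h.succ (by positivity)⟩
  obtain ⟨k, hk⟩ := Nat.even_or_odd' (D - 2)
  have hD' : (D : ℝ) - 2 = ((D - 2 : ℕ) : ℝ) := by push_cast [hD]; ring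
  rw [hD']
  rcases hk with hk | hk
  · have := hs 0 le_rfl zero k
    rw [hk]
    convert this using 3
    push_cast; ring_nf
  · have := hs (1 / 2) (by norm_num) half k
    rw [hk]
    convert this using 3
    push_cast; ring_nf

end IsRadialSolution

/-! ### Existence of parametrices -/

section Existence

variable {D : ℕ} {G : ℝ → ℝ} {a : ℝ} {ψ : Euc D → ℝ}

lemma partialD_comp_norm_sq {G' : ℝ} {x : Euc D} (hG : HasDerivAt G G' (‖x‖ ^ 2 + a)) (i : Fin D) :
    HasFDerivAt (fun y : Euc D => G (‖y‖ ^ 2 + a))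
      (G' • ((2 : ℝ) • innerSL ℝ x : Euc D →L[ℝ] ℝ)) x ∧
    partialD i (fun y : Euc D => G (‖y‖ ^ 2 + a)) x = G' * (2 * x i) := by
  have h1 : HasFDerivAt (fun y : Euc D => ‖y‖ ^ 2 + a) ((2 : ℝ) • innerSL ℝ x) x := by
    exact ((hasStrictFDerivAt_norm_sq x).hasFDerivAt.add_const a).congr_fderiv (by simp [two_smul])
  have h := hG.comp_hasFDerivAt x h1
  refine ⟨h, ?_⟩
  rw [partialD, HasFDerivAt.fderiv (f := fun y : Euc D => G (‖y‖ ^ 2 + a)) h]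
  simp [EuclideanSpace.inner_single_right]

/-- The Laplacian of a function of `r²`. -/
lemma kg_comp_norm_sq {G₁ G₂ : ℝ → ℝ} (ha : 0 < a)
    (h1 : ∀ s, 0 < s → HasDerivAt G (G₁ s) s) (h2 : ∀ s, 0 < s → HasDerivAt G₁ (G₂ s) s)
    (hG : Smooth fun y : Euc D => G (‖y‖ ^ 2 + a)) (μ : ℝ) (x : Euc D) :
    kg μ (fun y => G (‖y‖ ^ 2 + a)) x = -(4 * ‖x‖ ^ 2 * G₂ (‖x‖ ^ 2 + a)
      + 2 * D * G₁ (‖x‖ ^ 2 + a)) + μ * G (‖x‖ ^ 2 + a) := by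
  have hp : ∀ y : Euc D, 0 < ‖y‖ ^ 2 + a := fun y => by positivity
  have hi : ∀ i, partialD i (partialD i fun y => G (‖y‖ ^ 2 + a)) x
      = 4 * G₂ (‖x‖ ^ 2 + a) * x i ^ 2 + 2 * G₁ (‖x‖ ^ 2 + a) := fun i => by
    have e : partialD i (fun y : Euc D => G (‖y‖ ^ 2 + a))
        = fun y => G₁ (‖y‖ ^ 2 + a) * (2 * y i) :=
      funext fun y => (partialD_comp_norm_sq (h1 _ (hp y)) i).2
    obtain ⟨hf, hv⟩ := partialD_comp_norm_sq (h2 _ (hp x)) i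
    have hc : HasFDerivAt (fun y : Euc D => 2 * y i)
        ((2 : ℝ) • (EuclideanSpace.proj i : Euc D →L[ℝ] ℝ)) x :=
      (EuclideanSpace.proj i : Euc D →L[ℝ] ℝ).hasFDerivAt.const_mul 2
    rw [e, partialD, HasFDerivAt.fderiv
      (f := fun y : Euc D => G₁ (‖y‖ ^ 2 + a) * (2 * y i)) (hf.mul hc)]
    simp [EuclideanSpace.inner_single_right]
    ring
  rw [kg, laplacian_eq_sum isOpen_univ hG.contDiffOn (mem_univ x), sum_congr rfl
    fun i _ => hi i, sum_add_distrib, ← mul_sum, EuclideanSpace.real_norm_sq_eq x]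
  simp
  ring

lemma hadKer_eq_radG (hD : 2 ≤ D) (e v : ℝ → ℝ) (μ : ℝ) {u : Euc D} (hu : u ≠ 0) :
    singA D u = (‖u‖ ^ 2) ^ (-(((D : ℝ) - 2) / 2)) ∧
    hadKer D e v μ u = radG (((D : ℝ) - 2) / 2) e v μ (‖u‖ ^ 2) := by
  have h0 : 0 < ‖u‖ := norm_pos_iff.2 hu
  have h : singA D u = (‖u‖ ^ 2) ^ (-(((D : ℝ) - 2) / 2)) := by
    rw [singA, ← rpow_natCast, ← rpow_natCast ‖u‖ 2, ← Real.rpow_mul h0.le,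
      ← Real.rpow_neg h0.le]
    push_cast [hD]
    ring_nf
  refine ⟨h, ?_⟩
  rw [radG, ← h, hadKer, singKer, singB, ← singA]
  ring

lemma contDiff_radG {ν : ℝ} {e v : ℝ → ℝ} (he : Smooth e) (hv : Smooth v) (μ : ℝ)
    (ha : 0 < a) : Smooth fun y : Euc D => radG ν e v μ (‖y‖ ^ 2 + a) := by
  have hp : ∀ y : Euc D, ‖y‖ ^ 2 + a ≠ 0 := fun y => by positivity
  have hn : Smooth fun y : Euc D => ‖y‖ ^ 2 + a := (contDiff_norm_sq ℝ).add contDiff_const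
  exact (hn.rpow_const_of_ne hp).mul ((he.comp (contDiff_const.mul hn)).sub
    ((hv.comp (contDiff_const.mul hn)).mul (hn.log hp)))

/-- Dominated convergence against a test function. -/
lemma tendsto_integral_mul {F : ℝ → Euc D → ℝ} {F₀ g : Euc D → ℝ} (hψ : Continuous ψ)
    (hc : HasCompactSupport ψ) (hF : ∀ ε, 0 < ε → Continuous (F ε)) (hg : LocallyIntegrable g)
    (hb : ∀ᶠ ε in 𝓝[>] 0, ∀ x ∈ tsupport ψ, x ≠ 0 → |F ε x| ≤ g x)
    (hl : ∀ x, x ≠ 0 → Tendsto (fun ε => F ε x) (𝓝[>] 0) (𝓝 (F₀ x))) [NeZero D] :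
    Tendsto (fun ε => ∫ x, F ε x * ψ x) (𝓝[>] 0) (𝓝 (∫ x, F₀ x * ψ x)) := by
  refine tendsto_integral_filter_of_dominated_convergence (fun x => g x * |ψ x|) ?_ ?_
    (integrable_mul_of_compact hg hψ.abs (hc.comp_left abs_zero)) ?_
  · filter_upwards [self_mem_nhdsWithin] with ε hε
    exact ((hF ε hε).mul hψ).aestronglyMeasurable
  · filter_upwards [hb] with ε hε
    filter_upwards [ae_ne_point 0] with x hx
    rw [norm_mul, norm_eq_abs, norm_eq_abs]
    by_cases h : x ∈ tsupport ψ
    · exact mul_le_mul_of_nonneg_right (hε x h hx) (abs_nonneg _)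
    · simp [image_eq_zero_of_notMem_tsupport h]
  · filter_upwards [ae_ne_point 0] with x hx
    exact (hl x hx).mul_const _

/-- The radial weight of the delta function at the origin. -/
def deltaWeight (D : ℕ) (y : Euc D) : ℝ := (1 + ‖y‖ ^ 2) ^ (-((D : ℝ) + 2) / 2)

lemma integrable_deltaWeight : Integrable (deltaWeight D) :=
  integrable_rpow_neg_one_add_norm_sq (by simp)

lemma integral_deltaWeight_pos : 0 < ∫ y, deltaWeight D y := by
  have hp : ∀ y, 0 < deltaWeight D y := fun y => Real.rpow_pos_of_pos (by positivity) _
  rw [integral_pos_iff_support_of_nonneg (fun y => (hp y).le) integrable_deltaWeight,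
    Function.support_eq_univ fun y => (hp y).ne']
  exact isOpen_univ.measure_pos _ Set.univ_nonempty

/-- The function `ε² s^{-ν-2} k(s)` at `s = r² + ε²` is an approximate multiple of the delta
function. -/
lemma tendsto_delta {k : ℝ → ℝ} (hk : Continuous k) (hψ : Continuous ψ)
    (hc : HasCompactSupport ψ) : Tendsto (fun ε : ℝ => ∫ x : Euc D,
      ε ^ 2 * (‖x‖ ^ 2 + ε ^ 2) ^ (-((D : ℝ) + 2) / 2) * k (‖x‖ ^ 2 + ε ^ 2) * ψ x) (𝓝[>] 0)
      (𝓝 (k 0 * ψ 0 * ∫ y, deltaWeight D y)) := by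
  have hΦ : Continuous fun q : ℝ × Euc D => k (‖q.2‖ ^ 2 + q.1 ^ 2) * ψ q.2 := by fun_prop
  obtain ⟨C, hC⟩ := (isCompact_Icc (a := (0 : ℝ)) (b := 1)).prod hc.isCompact
    |>.exists_bound_of_continuousOn hΦ.continuousOn
  have hC' : ∀ ε ∈ Ioo (0 : ℝ) 1, ∀ x, |k (‖x‖ ^ 2 + ε ^ 2) * ψ x| ≤ |C| := fun ε hε x => by
    by_cases h : x ∈ tsupport ψ
    · exact (hC (ε, x) ⟨⟨hε.1.le, hε.2.le⟩, h⟩).trans (le_abs_self C)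
    · simp [image_eq_zero_of_notMem_tsupport h]
  have hsub : ∀ ε : ℝ, 0 < ε → ∫ x : Euc D,
      ε ^ 2 * (‖x‖ ^ 2 + ε ^ 2) ^ (-((D : ℝ) + 2) / 2) * k (‖x‖ ^ 2 + ε ^ 2) * ψ x
      = ∫ y : Euc D, deltaWeight D y * (k (‖ε • y‖ ^ 2 + ε ^ 2) * ψ (ε • y)) := fun ε hε => by
    have h := Measure.integral_comp_smul_of_nonneg volume (fun x : Euc D =>
      ε ^ 2 * (‖x‖ ^ 2 + ε ^ 2) ^ (-((D : ℝ) + 2) / 2) * k (‖x‖ ^ 2 + ε ^ 2) * ψ x) ε (hR := hε.le)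
    rw [finrank_euclideanSpace_fin, smul_eq_mul, eq_inv_mul_iff_mul_eq₀ (by positivity),
      ← integral_const_mul] at h
    rw [← h]
    refine integral_congr_fun fun y => ?_
    have e : ‖ε • y‖ ^ 2 + ε ^ 2 = ε ^ 2 * (1 + ‖y‖ ^ 2) := by
      rw [norm_smul, norm_of_nonneg hε.le]; ring
    have e2 : ε ^ D * (ε ^ 2 * (ε ^ 2) ^ (-((D : ℝ) + 2) / 2)) = 1 := by
      rw [← rpow_natCast ε D, ← rpow_natCast ε 2, ← Real.rpow_mul hε.le,
        ← Real.rpow_add hε, ← Real.rpow_add hε]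
      convert Real.rpow_zero ε using 2
      push_cast
      ring
    simp only [e, deltaWeight, Real.mul_rpow (sq_nonneg ε) (by positivity : 0 ≤ 1 + ‖y‖ ^ 2)]
    linear_combination (1 + ‖y‖ ^ 2) ^ (-((D : ℝ) + 2) / 2)
      * (k (ε ^ 2 * (1 + ‖y‖ ^ 2)) * ψ (ε • y)) * e2
  have h01 : ∀ᶠ ε : ℝ in 𝓝[>] 0, ε ∈ Ioo (0 : ℝ) 1 := Ioo_mem_nhdsGT one_pos
  rw [mul_comm, ← integral_mul_const]
  refine Tendsto.congr' (f₁ := fun ε : ℝ => ∫ y : Euc D,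
    deltaWeight D y * (k (‖ε • y‖ ^ 2 + ε ^ 2) * ψ (ε • y))) ?_ ?_
  · filter_upwards [self_mem_nhdsWithin] with ε hε using (hsub ε hε).symm
  · have hm : ∀ ε : ℝ, Continuous fun y : Euc D => k (‖ε • y‖ ^ 2 + ε ^ 2) * ψ (ε • y) :=
      fun ε => by fun_prop
    refine tendsto_integral_filter_of_dominated_convergence (fun y => |deltaWeight D y| * |C|)
      (.of_forall fun ε => integrable_deltaWeight.aestronglyMeasurable.mul
        (hm ε).aestronglyMeasurable) ?_ (integrable_deltaWeight.abs.mul_const _)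
      (.of_forall fun y => ?_)
    · filter_upwards [h01] with ε hε
      refine Eventually.of_forall fun y => ?_
      rw [norm_mul]
      exact mul_le_mul_of_nonneg_left (hC' ε hε _) (norm_nonneg _)
    · refine Tendsto.const_mul _ (tendsto_nhdsWithin_of_tendsto_nhds ?_)
      exact Continuous.tendsto' (by fun_prop) 0 _ (by simp)

namespace IsRadialSolution

variable {e v : ℝ → ℝ}

/-- Integrating by parts with `r²` replaced by `r² + ε²`, and letting `ε → 0`. -/
theorem weak (hD : 2 ≤ D) (h : IsRadialSolution (((D : ℝ) - 2) / 2) e v) {ρ : ℝ → ℝ → ℝ}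
    (hρ : Smooth₂ ρ) (heq : ∀ μ s, 0 < s → 4 * s * radG (((D : ℝ) - 2) / 2 + 1 + 1)
        (upE (((D : ℝ) - 2) / 2 + 1) (upE (((D : ℝ) - 2) / 2) e v) (upV (((D : ℝ) - 2) / 2) v))
        (upV (((D : ℝ) - 2) / 2 + 1) (upV (((D : ℝ) - 2) / 2) v)) μ s
      + 4 * (((D : ℝ) - 2) / 2 + 1) * radG (((D : ℝ) - 2) / 2 + 1)
        (upE (((D : ℝ) - 2) / 2) e v) (upV (((D : ℝ) - 2) / 2) v) μ s
      - μ * radG (((D : ℝ) - 2) / 2) e v μ s = ρ s μ)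
    (μ : ℝ) (hψ : Smooth ψ) (hc : HasCompactSupport ψ) :
    ∫ x, hadKer D e v μ x * kg μ ψ x = -(2 * D * upE (((D : ℝ) - 2) / 2) e v 0
      * ∫ y, deltaWeight D y) * ψ 0 + ∫ x, -ρ (‖x‖ ^ 2) μ * ψ x := by
  have : NeZero D := ⟨by omega⟩
  set ν := ((D : ℝ) - 2) / 2 with hν
  have hν0 : 0 ≤ ν := by have : (2 : ℝ) ≤ D := by exact_mod_cast hD
                         rw [hν]; linarith
  set e₁ := upE ν e v
  set v₁ := upV ν v
  set e₂ := upE (ν + 1) e₁ v₁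
  set v₂ := upV (ν + 1) v₁
  have he₁ : Smooth e₁ := contDiff_upE h.he h.hv
  have hv₁ : Smooth v₁ := contDiff_upV h.hv
  have he₂ : Smooth e₂ := contDiff_upE he₁ hv₁
  have hv₂ : Smooth v₂ := contDiff_upV hv₁
  have hv₁0 : v₁ 0 = 0 := h.v_zero
  have hv₂0 : v₂ 0 = 0 := by simp only [v₂, upV, hv₁0]; ring
  have he₂0 : e₂ 0 = -(D / 2) * e₁ 0 := by simp only [e₂, upE, hv₁0, hν]; ring
  obtain ⟨w, hw, hw'⟩ := exists_contDiff_eq_add_mul hv₂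
  -- the second derivative is `s^{-ν-2} k(s)` with `k` continuous up to `s = 0`
  let k : ℝ → ℝ := fun s => 4 * (e₂ (μ * s) - μ * w (μ * s) * (s * Real.log s))
  have hk : Continuous k := by
    have := he₂.continuous
    have := hw.continuous
    have := Real.continuous_mul_log
    fun_prop
  have hkG : ∀ s, radG (ν + 1 + 1) e₂ v₂ μ s * 4 = s ^ (-((D : ℝ) + 2) / 2) * k s := fun s => by
    have e : -(ν + 1 + 1) = -((D : ℝ) + 2) / 2 := by rw [hν]; ring
    simp only [radG, k, hw' (μ * s), hv₂0, e]
    ring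
  have hint : ∀ ε : ℝ, 0 < ε → (∫ x : Euc D, radG ν e v μ (‖x‖ ^ 2 + ε ^ 2) * kg μ ψ x)
      + ∫ x, ρ (‖x‖ ^ 2 + ε ^ 2) μ * ψ x = ∫ x : Euc D, ε ^ 2 *
        (‖x‖ ^ 2 + ε ^ 2) ^ (-((D : ℝ) + 2) / 2) * k (‖x‖ ^ 2 + ε ^ 2) * ψ x := by
    intro ε hε
    have hG := contDiff_radG (D := D) (ν := ν) h.he h.hv μ (pow_pos hε 2)
    rw [integral_mul_kg hG hψ (Or.inr hc)]
    have hρc : Continuous fun x : Euc D => ρ (‖x‖ ^ 2 + ε ^ 2) μ :=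
      hρ.continuous.comp (f := fun x : Euc D => (‖x‖ ^ 2 + ε ^ 2, μ)) (by fun_prop)
    refine integral_add_eq (integrable_mul_of_compact
      (contDiff_kg hG μ).continuous.locallyIntegrable hψ.continuous hc)
      (integrable_mul_of_compact hρc.locallyIntegrable hψ.continuous hc) fun x => ?_
    have hs : 0 < ‖x‖ ^ 2 + ε ^ 2 := by positivity
    rw [kg_comp_norm_sq (pow_pos hε 2) (fun s => hasDerivAt_radG h.he h.hv μ)
      (fun s => hasDerivAt_radG he₁ hv₁ μ) hG, ← heq μ _ hs, mul_assoc (ε ^ 2), ← hkG,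
      show (D : ℝ) = 2 * (ν + 1) by rw [hν]; ring]
    ring
  have hsm : ∀ x : Euc D, Tendsto (fun ε : ℝ => ‖x‖ ^ 2 + ε ^ 2) (𝓝[>] 0) (𝓝 (‖x‖ ^ 2)) :=
    fun x => tendsto_nhdsWithin_of_tendsto_nhds (Continuous.tendsto' (by fun_prop) _ _ (by simp))
  have h01 : ∀ᶠ ε : ℝ in 𝓝[>] 0, ε ∈ Ioo (0 : ℝ) 1 := Ioo_mem_nhdsGT one_pos
  obtain ⟨R, hR0, hR⟩ := hc.isCompact.isBounded.subset_closedBall_lt 0 0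
  have hx1 : ∀ ε ∈ Ioo (0 : ℝ) 1, ∀ x ∈ tsupport ψ, ‖x‖ ^ 2 + ε ^ 2 ∈ Set.Icc 0 (R ^ 2 + 1) :=
    fun ε hε x hx => by
      have := mem_closedBall_zero_iff.1 (hR hx)
      exact ⟨by positivity, add_le_add (by gcongr) (pow_le_one₀ hε.1.le hε.2.le)⟩
  have hbd : ∀ f : ℝ → ℝ, Continuous f → ∃ C, 0 ≤ C ∧ ∀ ε ∈ Ioo (0 : ℝ) 1, ∀ x ∈ tsupport ψ,
      |f (‖x‖ ^ 2 + ε ^ 2)| ≤ C := fun f hf => by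
    obtain ⟨C, hC⟩ := (isCompact_Icc (a := 0) (b := R ^ 2 + 1)).exists_bound_of_continuousOn
      hf.continuousOn
    exact ⟨|C|, abs_nonneg _, fun ε hε x hx => (hC _ (hx1 ε hε x hx)).trans (le_abs_self C)⟩
  have hρμ : Continuous fun s => ρ s μ :=
    hρ.continuous.comp (f := fun s => (s, μ)) (by fun_prop)
  have t2 : Tendsto (fun ε : ℝ => ∫ x : Euc D, ρ (‖x‖ ^ 2 + ε ^ 2) μ * ψ x) (𝓝[>] 0)
      (𝓝 (∫ x, ρ (‖x‖ ^ 2) μ * ψ x)) := by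
    obtain ⟨C, -, hC⟩ := hbd _ hρμ
    refine tendsto_integral_mul hψ.continuous hc (fun ε _ => hρμ.comp (by fun_prop))
      (continuous_const (y := C)).locallyIntegrable ?_
      fun x _ => (hρμ.tendsto _).comp (hsm x)
    filter_upwards [h01] with ε hε x hx _ using hC ε hε x hx
  have t1 : Tendsto (fun ε : ℝ => ∫ x : Euc D, radG ν e v μ (‖x‖ ^ 2 + ε ^ 2) * kg μ ψ x) (𝓝[>] 0)
      (𝓝 (∫ x, hadKer D e v μ x * kg μ ψ x)) := by
    have hcs : tsupport (kg μ ψ) ⊆ tsupport ψ := closure_minimal (fun x hx => by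
      by_contra hx'
      exact hx (kg_eq_zero_of_notMem_tsupport hx' μ)) (isClosed_tsupport _)
    obtain ⟨A, hA0, hA⟩ := hbd (fun s => e (μ * s)) (h.he.continuous.comp (by fun_prop))
    obtain ⟨B, hB0, hB⟩ := hbd (fun s => v (μ * s)) (h.hv.continuous.comp (by fun_prop))
    refine tendsto_integral_mul (g := fun x => (A + B * Real.log (R ^ 2 + 1)) * singA D x
      + B * |singB D x|) (contDiff_kg hψ μ).continuous (hc.of_isClosed_subset
        (isClosed_tsupport _) hcs) (fun ε hε =>
          (contDiff_radG h.he h.hv μ (pow_pos hε 2)).continuous)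
      (((locallyIntegrable_singA hD).smul (A + B * Real.log (R ^ 2 + 1))).add
        (LocallyIntegrable.smul (f := fun x => |singB D x|) (fun x =>
          have ⟨s, hs, hi⟩ := locallyIntegrable_singB hD x
          ⟨s, hs, hi.norm⟩) B)) ?_ fun x hx => ?_
    · filter_upwards [h01] with ε hε x hx hx0
      have hx := hcs hx
      have hs : 0 < ‖x‖ ^ 2 := pow_pos (norm_pos_iff.2 hx0) 2
      have hsS : ‖x‖ ^ 2 ≤ ‖x‖ ^ 2 + ε ^ 2 := le_add_of_nonneg_right (sq_nonneg ε)
      have hL0 : 0 ≤ Real.log (R ^ 2 + 1) := Real.log_nonneg (by nlinarith)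
      have hlog : |Real.log (‖x‖ ^ 2 + ε ^ 2)| ≤ Real.log (R ^ 2 + 1) + |Real.log (‖x‖ ^ 2)| := by
        have l1 := Real.log_le_log hs hsS
        have l2 := Real.log_le_log (hs.trans_le hsS) (hx1 ε hε x hx).2
        exact abs_le.2 ⟨by linarith [neg_abs_le (Real.log (‖x‖ ^ 2))],
          by linarith [abs_nonneg (Real.log (‖x‖ ^ 2))]⟩
      have hA' := hA ε hε x hx
      have hB' := hB ε hε x hx
      have hsB : |singB D x| = singA D x * |Real.log (‖x‖ ^ 2)| := by
        rw [singB, ← singA, abs_mul, abs_of_nonneg (a := singA D x) (by rw [singA]; positivity)]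
      rw [hsB, radG, abs_mul, (hadKer_eq_radG hD e v μ hx0).1, ← hν, abs_of_nonneg (by positivity)]
      calc _ ≤ (‖x‖ ^ 2) ^ (-ν) *
            (A + B * (Real.log (R ^ 2 + 1) + |Real.log (‖x‖ ^ 2)|)) := by
            refine mul_le_mul (Real.rpow_le_rpow_of_nonpos hs hsS (by linarith)) ?_ (abs_nonneg _)
              (by positivity)
            refine (abs_sub _ _).trans (add_le_add hA' ?_)
            rw [abs_mul]
            exact mul_le_mul hB' hlog (abs_nonneg _) hB0
        _ = _ := by ring
    · rw [(hadKer_eq_radG hD e v μ hx).2]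
      exact ((hasDerivAt_radG h.he h.hv μ
        (pow_pos (norm_pos_iff.2 hx) 2)).continuousAt.tendsto).comp
        (hsm x)
  have t3 := tendsto_delta hk hψ.continuous hc
  have h4 := tendsto_nhds_unique ((t1.add t2).congr' (by
    filter_upwards [self_mem_nhdsWithin] with ε hε using hint ε hε)) t3
  have hk0 : k 0 = -(2 * D * e₁ 0) := by simp only [k, mul_zero, he₂0]; ring
  simp only [neg_mul, integral_neg]
  rw [hk0] at h4
  linear_combination h4

end IsRadialSolution

/-- Radial solutions, divided by the strength of their delta function, are parametrices. -/
theorem exists_kernelData (hD : 2 ≤ D) : ∃ (d : KernelData D) (V : ℝ → Euc D → ℝ),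
    Smooth₂ V ∧
    ∀ μ u, u ≠ 0 → V μ u = singA D u * d.v (μ * ‖u‖ ^ 2) := by
  obtain ⟨e, v, h⟩ := IsRadialSolution.exists_of_two_le hD
  obtain ⟨ρ, hρ, heq⟩ := h.eqn
  obtain ⟨W, hW, hWv⟩ := h.log
  set c : ℝ := -(2 * D * upE (((D : ℝ) - 2) / 2) e v 0 * ∫ y, deltaWeight D y) with hc
  have hc0 : c ≠ 0 := neg_ne_zero.2 (mul_ne_zero (mul_ne_zero (mul_ne_zero two_ne_zero
    (by positivity)) h.e_ne) integral_deltaWeight_pos.ne')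
  have hsq : Smooth fun q : ℝ × Euc D => (‖q.2‖ ^ 2, q.1) :=
    ((contDiff_norm_sq ℝ).comp contDiff_snd).prodMk contDiff_fst
  refine ⟨⟨hD, fun t => c⁻¹ * e t, fun t => c⁻¹ * v t, fun μ x => c⁻¹ * -ρ (‖x‖ ^ 2) μ,
    contDiff_const.mul h.he, contDiff_const.mul h.hv, contDiff_const.mul (hρ.comp hsq).neg,
    fun μ ψ hψ hψc => ?_⟩, fun μ u => c⁻¹ * W (‖u‖ ^ 2) μ, contDiff_const.mul (hW.comp hsq),
    fun μ u hu => ?_⟩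
  · have h1 : ∀ x, hadKer D (fun t => c⁻¹ * e t) (fun t => c⁻¹ * v t) μ x
        = c⁻¹ * hadKer D e v μ x := fun x => by simp only [hadKer, singKer]; ring
    simp only [h1, mul_assoc c⁻¹, integral_const_mul]
    rw [h.weak hD hρ heq μ hψ hψc, ← hc]
    field_simp
  · simp only
    rw [← hWv μ _ (by have := norm_pos_iff.2 hu; positivity), (hadKer_eq_radG hD e v μ hu).1]
    ring

end Existence

/-! ### Parametrices and homogeneous invariant functions -/

section Correspondence

variable {D : ℕ} {ζ : ℝ → ℝ} {g : ℝ → Euc D → ℝ} {δ N : ℕ}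

lemma fderiv_fderiv_comm {E : Type*} [NormedAddCommGroup E] [NormedSpace ℝ E] {F : E → ℝ}
    (hF : Smooth F) (x a b : E) :
    fderiv ℝ (fun y => fderiv ℝ F y a) x b = fderiv ℝ (fun y => fderiv ℝ F y b) x a := by
  have hd : DifferentiableAt ℝ (fderiv ℝ F) x :=
    (hF.fderiv_right (m := ∞) (by simp)).differentiable (by simp) x
  have key : ∀ a b : E, fderiv ℝ (fun y => fderiv ℝ F y a) x b
      = fderiv ℝ (fderiv ℝ F) x b a := fun a b => by
    rw [(hd.hasFDerivAt.clm_apply (hasFDerivAt_const a x)).fderiv]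
    simp
  rw [key, key, (hF.contDiffAt.isSymmSndFDerivAt (by simpa using two_le_infty)) a b]

lemma hasDerivAt_iterD (hg : Smooth₂ g)
    (l : List (Fin D)) (μ : ℝ) (u : Euc D) : HasDerivAt (fun m => iterD l (g m) u)
      (iterD l (fun u => deriv (fun m => g m u) μ) u) μ := by
  induction l generalizing u with
  | nil => exact hasDerivAt_fst hg μ u
  | cons i l ih =>
    set F : ℝ × Euc D → ℝ := fun q => iterD l (g q.1) q.2 with hF
    have hFs : Smooth F := contDiff_iterD_param hg l
    have hF's : ∀ a, Smooth fun q => fderiv ℝ F q a := fun a =>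
      (hFs.fderiv_right (m := ∞) (by simp)).clm_apply contDiff_const
    have h1 : ∀ Φ : ℝ × Euc D → ℝ, Smooth Φ → ∀ u,
        HasDerivAt (fun m => Φ (m, u)) (fderiv ℝ Φ (μ, u) (1, 0)) μ := fun Φ hΦ u =>
      ((hΦ.differentiable (by simp) (μ, u)).hasFDerivAt).comp_hasDerivAt μ
        ((hasDerivAt_id μ).prodMk (hasDerivAt_const μ u))
    have h2 : ∀ Φ : ℝ × Euc D → ℝ, Smooth Φ → ∀ m u, partialD i (fun u => Φ (m, u)) u
        = fderiv ℝ Φ (m, u) (0, 𝐞 i) := fun Φ hΦ m u => by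
      have := ((hΦ.differentiable (by simp) (m, u)).hasFDerivAt).comp u
        (f := fun u => (m, u)) (hasFDerivAt_prodMk_right m u)
      rw [partialD, HasFDerivAt.fderiv (f := fun u => Φ (m, u)) this]
      simp
    have e1 : (fun m => iterD (i :: l) (g m) u)
        = fun m => fderiv ℝ F (m, u) (0, 𝐞 i) :=
      funext fun m => h2 F hFs m u
    have e2 : iterD l (fun u => deriv (fun m => g m u) μ) = fun u => fderiv ℝ F (μ, u) (1, 0) :=
      funext fun u => (ih u).unique (h1 F hFs u)
    rw [e1, iterD_cons, e2, h2 _ (hF's (1, 0)), fderiv_fderiv_comm hFs]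
    exact h1 _ (hF's _) u

/-- Two-point functions whose difference is a smooth function of `x₁ - x₂` are equivalent if and
only if its Taylor coefficients vanish. -/
lemma twoPointEquiv_iff [NeZero D] {w w' : ℝ → Euc D → Euc D → ℝ}
    (hg : ∀ μ, Smooth (g μ)) (h : ∀ μ x y, x ≠ y → w μ x y - w' μ x y = g μ (x - y)) :
    TwoPointEquiv δ w w' ↔ ∀ μ, ∀ l : List (Fin D), l.length ≤ δ → iterD l (g μ) 0 = 0 := by
  refine ⟨fun hw μ l hl => ?_, fun hw μ z => asympEq_iff.2 fun v₀ hv => ?_⟩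
  · have hq : Smooth fun p : Euc₂ D => g μ (p.1 - p.2) :=
      (hg μ).comp (by fun_prop : Smooth fun p : Euc₂ D => p.1 - p.2)
    obtain ⟨C, -, hC⟩ := exists_bound_sub_pairPoly δ (q := fun a b => g μ (a - b)) hq
    have := (hw μ 0).eq_zero_of_bound one_pos (fun a b hab hlt => by
      simpa [h μ a b hab] using hC (a, b) hlt.le) (γ := (listIdx l, listIdx []))
      (by rw [mem_pairsUpTo, order_listIdx, order_listIdx]; simpa using hl)
    rw [← jet_eq_jetM hq l []] at this
    simpa [jet] using this
  · obtain ⟨K, hK0, hK⟩ := (MergerTree.trivial 2).eventually_config_le z v₀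
    obtain ⟨C, hC⟩ := vanishesTo_of_iterD (hg μ) (k := δ + 1) fun l hl => hw μ l (by omega)
    have h0 : Tendsto (fun p : ℝ × (Finset (Fin 2) → Euc D) => p.1)
        (𝓝[>] 0 ×ˢ 𝓝[(MergerTree.trivial 2).params D] v₀) (𝓝 0) :=
      tendsto_fst.mono_right nhdsWithin_le_nhds
    refine squeeze_zero_norm' (a := fun p => |C| * (2 * K) ^ (δ + 1) * p.1) ?_
      (by simpa using h0.const_mul (|C| * (2 * K) ^ (δ + 1)))
    have h1 : ∀ᶠ p : ℝ × (Finset (Fin 2) → Euc D) in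
        𝓝[>] 0 ×ˢ 𝓝[(MergerTree.trivial 2).params D] v₀, 2 * K * p.1 < 1 :=
      (show Tendsto (fun p : ℝ × (Finset (Fin 2) → Euc D) => 2 * K * p.1) _ (𝓝 0) by
        simpa using h0.const_mul (2 * K)).eventually (gt_mem_nhds one_pos)
    filter_upwards [hK, h1, (MergerTree.trivial 2).eventually_config_ne z hv
      (i := 0) (j := 1) (by decide), tendsto_fst.eventually self_mem_nhdsWithin]
      with p hp h1 hne (hε : 0 < p.1)
    rw [h μ _ _ hne, norm_div, norm_pow, norm_of_nonneg hε.le, div_le_iff₀ (by positivity)]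
    have h2 : ‖(MergerTree.trivial 2).config z p.2 p.1 0
        - (MergerTree.trivial 2).config z p.2 p.1 1‖ ≤ 2 * K * p.1 := by
      rw [← sub_sub_sub_cancel_right _ _ z]
      exact (norm_sub_le _ _).trans (by linarith [hp 0, hp 1])
    calc _ ≤ C * ‖_‖ ^ (δ + 1) := hC _ (h2.trans h1.le)
      _ ≤ |C| * (2 * K * p.1) ^ (δ + 1) := by gcongr; exact le_abs_self C
      _ = _ := by ring

namespace IsHomogeneousInvariant

variable {f f' : ℝ → Euc D → Euc D → ℝ}

lemma sub (hf : IsHomogeneousInvariant f) (hf' : IsHomogeneousInvariant f') :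
    IsHomogeneousInvariant fun μ x y => f μ x y - f' μ x y where
  invariant μ g x y := by rw [hf.invariant, hf'.invariant]
  smooth := hf.smooth.sub hf'.smooth
  scaling l hl μ x y := by rw [hf.scaling l hl, hf'.scaling l hl]; ring

lemma contDiff_zero (hf : IsHomogeneousInvariant f) :
    Smooth fun q : ℝ × Euc D => f q.1 q.2 0 :=
  hf.smooth.comp (f := fun q : ℝ × Euc D => (q.1, q.2, (0 : Euc D))) (by fun_prop)

lemma contDiffOn_slice (hf : IsHomogeneousInvariant f) (μ : ℝ) :
    SmoothOn (fun u => f μ u 0) univ :=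
  (contDiff_pslice (g := fun μ u => f μ u 0) hf.contDiff_zero μ).contDiffOn

lemma multiD_eq (hf : IsHomogeneousInvariant f) (γ : MultiIdx D) (μ : ℝ) (z : Euc D) :
    multiD γ (fun x => f μ x z) z = iterD (idxList γ) (fun u => f μ u 0) 0 := by
  have e : (fun x => f μ x z) = fun x => (fun u => f μ u 0) (x + -z) :=
    funext fun x => by rw [eq_sub_of_invariant hf.invariant, sub_eq_add_neg]
  rw [multiD_eq_iterD, e]
  exact (congrFun (iterD_comp_add (fun u => f μ u 0) (-z) (idxList γ)) z).trans (by simp)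

/-- `g = -∫₀^μ f dm` is smooth and scales like a parametrix without logarithmic term. -/
lemma exists_primitive (hD : 2 ≤ D) (hf : IsHomogeneousInvariant f) :
    ∃ g : ℝ → Euc D → ℝ, Smooth₂ g ∧ (∀ u, g 0 u = 0) ∧
      (∀ μ u, deriv (fun m => g m u) μ = -f μ u 0) ∧ ∃ ε : ℝ → ℝ, Smooth ε ∧
        ∀ μ u, u ≠ 0 → g μ u = singA D u * ε (μ * ‖u‖ ^ 2) := by
  have : NeZero D := ⟨by omega⟩
  let g : ℝ → Euc D → ℝ := fun μ u => -(μ * ∫ s in (0 : ℝ)..1, f (s * μ) u 0)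
  have hgs : Smooth₂ g :=
    (contDiff_fst.mul (contDiff_integral_zero_one
      (Φ := fun (q : ℝ × Euc D) s => f (s * q.1) q.2 0) (hf.contDiff_zero.comp
        (f := fun r : (ℝ × Euc D) × ℝ => (r.2 * r.1.1, r.1.2)) (by fun_prop)))).neg
  have hgi : ∀ μ u, g μ u = -∫ m in (0 : ℝ)..μ, f m u 0 := fun μ u => by
    have := intervalIntegral.mul_integral_comp_mul_right (a := 0) (b := 1)
      (f := fun m => f m u 0) μ
    simp only [zero_mul, one_mul] at this
    simp only [g, this]
  refine ⟨g, hgs, fun u => by simp [g], fun μ u => ?_, fun t => g t (𝐞 0),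
    hgs.comp (f := fun t : ℝ => (t, (𝐞 0 : Euc D))) (by fun_prop),
    fun μ u hu => ?_⟩
  · have hc : Continuous fun m => f m u 0 :=
      hf.contDiff_zero.continuous.comp (f := fun m : ℝ => (m, u)) (by fun_prop)
    rw [show (fun m => g m u) = fun m => -∫ m' in (0 : ℝ)..m, f m' u 0 from funext (hgi · u)]
    exact (hc.integral_hasStrictDerivAt 0 μ).hasDerivAt.neg.deriv
  · have h0 : 0 < ‖u‖ := norm_pos_iff.2 hu
    have hs : ∀ m, f (m * ‖u‖ ^ 2) (𝐞 0) 0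
        = ‖u‖ ^ ((D : ℤ) - 4) * f m u 0 := fun m => by
      rw [mul_comm, ← hf.scaling _ h0, smul_zero]
      refine eq_of_norm_eq_of_invariant hf.invariant _ ?_
      rw [norm_smul, norm_inv, norm_norm, inv_mul_cancel₀ h0.ne']
      simp
    have hp : ‖u‖ ^ 2 * ‖u‖ ^ ((D : ℤ) - 4) = ‖u‖ ^ (D - 2) := by
      rw [← zpow_natCast, ← zpow_natCast, ← zpow_add₀ h0.ne']
      congr 1
      push_cast [hD]
      ring
    simp only [g, ← mul_assoc _ μ, hs, intervalIntegral.integral_const_mul, singA]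
    rw [eq_inv_mul_iff_mul_eq₀ (by positivity), ← hp]
    ring

end IsHomogeneousInvariant

namespace KernelData

/-- The generating polynomial of the coefficients `b⁰` of `φ ∂_γ φ`. -/
theorem exists_homogeneousInvariant (d : KernelData D) (hζ : IsCutoff ζ) (hN : 2 < N) :
    ∃ f, IsHomogeneousInvariant f ∧ ∀ γ : MultiIdx D, γ.order ≤ δ → ∀ μ,
      d.b0 ζ δ N (γ, 0) μ = iterD (idxList γ) (fun u => f μ u 0) 0 := by
  have ha := d.isAdmissible_counterterm (δ := δ) hζ hN
  set b := d.counterterm ζ δ N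
  let f : ℝ → Euc D → Euc D → ℝ := fun μ x y => ∑ γ ∈ pairsUpTo D δ,
    b γ.1 γ.2 μ * taylorFactor γ.1 (x - y) 0 * taylorFactor γ.2 (0 : Euc D) 0
  refine ⟨f, ⟨fun μ g x y => ?_, ?_, fun l hl μ x y => ?_⟩, fun γ hγ μ => ?_⟩
  · obtain ⟨A, hA⟩ := exists_isometry_of_norm_eq (u := x - y) (u' := g x - g y) (by
      rw [← dist_eq_norm, ← dist_eq_norm, g.dist_eq])
    simpa [hA] using ha.invariant μ A (x - y) 0
  · refine ContDiff.sum fun γ _ => (((ha.smooth γ.1 γ.2).comp contDiff_fst).mul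
      ((contDiff_taylorFactor γ.1 0).comp ?_)).mul contDiff_const
    exact (contDiff_fst.comp contDiff_snd).sub (contDiff_snd.comp contDiff_snd)
  · simp only [f, mul_sum]
    refine sum_congr rfl fun γ _ => ?_
    have h1 : l ^ γ.1.order * l⁻¹ ^ γ.1.order = 1 := by
      rw [← mul_pow, mul_inv_cancel₀ hl.ne', one_pow]
    have h2 : taylorFactor γ.2 (0 : Euc D) 0 = l ^ γ.2.order * taylorFactor γ.2 (0 : Euc D) 0 := by
      simpa using taylorFactor_smul γ.2 l 0
    rw [ha.scaling _ _ l hl, ← smul_sub, taylorFactor_smul, zpow_add₀ hl.ne',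
      zpow_add₀ hl.ne', zpow_natCast, zpow_natCast]
    linear_combination l ^ ((D : ℤ) - 4) * b γ.1 γ.2 μ * taylorFactor γ.1 (x - y) 0
      * (l ^ γ.2.order * taylorFactor γ.2 (0 : Euc D) 0 * h1 - h2)
  · have hm : (γ, (0 : MultiIdx D)) ∈ pairsUpTo D δ := mem_pairsUpTo.2 (by
      simpa [MultiIdx.order] using hγ)
    have h1 := jetM_pairPoly (fun γ => b γ.1 γ.2 μ) hm
    have h2 : d.b0 ζ δ N (γ, 0) μ = b γ 0 μ := by
      rw [← d.counterterm_of_le (mem_pairsUpTo.1 hm)]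
    rw [h2, ← h1, jetM, jet]
    simp only [idxList_zero, iterD_nil, f, pairPoly, sub_zero, mul_assoc]

/-- Adding a smooth function to a parametrix so that `b⁰` is prescribed, order by order. -/
theorem exists_of_homogeneousInvariant (hD : 2 ≤ D) (hζ : IsCutoff ζ) (hN : 2 < N)
    {f : ℝ → Euc D → Euc D → ℝ} (hf : IsHomogeneousInvariant f) (k : ℕ) :
    ∃ (d : KernelData D) (V : ℝ → Euc D → ℝ), Smooth₂ V ∧
      (∀ μ u, u ≠ 0 → V μ u = singA D u * d.v (μ * ‖u‖ ^ 2)) ∧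
      ∀ γ : MultiIdx D, γ.order ≤ δ → γ.order < k → ∀ μ,
        d.b0 ζ δ N (γ, 0) μ = iterD (idxList γ) (fun u => f μ u 0) 0 := by
  induction k with
  | zero =>
    obtain ⟨d, V, hV, hv⟩ := exists_kernelData hD
    exact ⟨d, V, hV, hv, fun γ _ h => absurd h (Nat.not_lt_zero _)⟩
  | succ k ih =>
    obtain ⟨d, V, hV, hv, hb⟩ := ih
    by_cases hk : δ < k
    · exact ⟨d, V, hV, hv, fun γ h1 _ => hb γ h1 (by omega)⟩
    obtain ⟨f₁, hf₁, hb₁⟩ := d.exists_homogeneousInvariant (δ := δ) hζ hN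
    have hs := hf.sub hf₁
    obtain ⟨g, hg, hg0, hg', ε, hε, hgε⟩ := hs.exists_primitive hD
    have hsub : ∀ l μ, iterD l (fun u => f μ u 0 - f₁ μ u 0) 0
        = iterD l (fun u => f μ u 0) 0 - iterD l (fun u => f₁ μ u 0) 0 := fun l μ =>
      iterD_sub isOpen_univ (hf.contDiffOn_slice μ) (hf₁.contDiffOn_slice μ) l (mem_univ 0)
    have hd' : ∀ l μ, iterD l (fun u => deriv (fun m => g m u) μ) 0
        = -(iterD l (fun u => f μ u 0) 0 - iterD l (fun u => f₁ μ u 0) 0) := fun l μ => by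
      have := iterD_const_mul (-1) isOpen_univ (hs.contDiffOn_slice μ) l
        (mem_univ 0)
      simp only [neg_mul, one_mul] at this
      simp only [hg', this, hsub]
    -- the Taylor coefficients of `g` of order less than `k` are constant in `μ`, hence zero
    have hv' : ∀ μ, VanishesTo k (g μ) := fun μ => by
      refine vanishesTo_of_iterD (contDiff_pslice hg μ) fun l hl => ?_
      have hz : ∀ m, deriv (fun m => iterD l (g m) 0) m = 0 := fun m => by
        have ho := order_listIdx l
        have e := fun φ : ℝ → Euc D → Euc D → ℝ => fun hφ : IsHomogeneousInvariant φ =>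
          iterD_perm isOpen_univ (hφ.contDiffOn_slice m)
            (idxList_listIdx_perm l) (mem_univ (0 : Euc D))
        rw [(hasDerivAt_iterD hg l m 0).deriv, hd', ← e f hf, ← e f₁ hf₁,
          ← hb _ (by omega) (by omega), ← hb₁ _ (by omega), sub_self, neg_zero]
      rw [is_const_of_deriv_eq_zero (fun m => (hasDerivAt_iterD hg l m 0).differentiableAt) hz μ 0,
        show g 0 = fun _ => 0 from funext hg0, iterD_zero]
    refine ⟨d.addSmooth hε hg hgε, V, hV, hv, fun γ h1 h2 μ => ?_⟩
    rw [b0_eq_sub hζ hN hg (fun μ u hu => d.addSmooth_E hε hg hgε μ hu) μ (hv' μ) (by omega) h1,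
      hd', hb₁ γ h1]
    ring

/-- A continuous function which is a multiple of a divergent power vanishes. -/
lemma eq_zero_of_singA (hD : 3 ≤ D) {G : Euc D → ℝ} (hG : Continuous G) {c : ℝ}
    (h : ∀ u, u ≠ 0 → G u = singA D u * c) : c = 0 := by
  have : NeZero D := ⟨by omega⟩
  have h1 : Tendsto (fun u : Euc D => ‖u‖ ^ (D - 2) * G u) (𝓝[≠] 0) (𝓝 0) :=
    tendsto_nhdsWithin_of_tendsto_nhds (Continuous.tendsto' (by fun_prop) _ _
      (by simp [zero_pow (show D - 2 ≠ 0 by omega)]))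
  refine tendsto_nhds_unique (tendsto_const_nhds.congr' ?_) h1
  filter_upwards [self_mem_nhdsWithin] with u hu
  rw [h u hu, singA, mul_inv_cancel_left₀ (pow_ne_zero _ (norm_ne_zero_iff.2 hu))]

/-- In more than two dimensions the parametrices coincide at `μ = 0`. -/
lemma sub_zero_eq_zero (hD : 3 ≤ D) {d d' : KernelData D} {V V' : ℝ → Euc D → ℝ} (hV : Smooth₂ V)
    (hv : ∀ μ u, u ≠ 0 → V μ u = singA D u * d.v (μ * ‖u‖ ^ 2)) (hV' : Smooth₂ V')
    (hv' : ∀ μ u, u ≠ 0 → V' μ u = singA D u * d'.v (μ * ‖u‖ ^ 2)) (hg : Smooth₂ g)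
    (hE : ∀ μ u, u ≠ 0 → d'.E μ u = d.E μ u + g μ u) : g 0 = fun _ => 0 := by
  have h1 := eq_zero_of_singA hD (contDiff_pslice hV 0).continuous (c := d.v 0)
    fun u hu => by simpa using hv 0 u hu
  have h2 := eq_zero_of_singA hD (contDiff_pslice hV' 0).continuous (c := d'.v 0)
    fun u hu => by simpa using hv' 0 u hu
  have hgu : ∀ u, u ≠ 0 → g 0 u = singA D u * (d'.e 0 - d.e 0) := fun u hu => by
    have := hE 0 u hu
    simp only [hadKer, singKer, zero_mul, h1, h2] at this
    linear_combination -this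
  have h3 := eq_zero_of_singA hD (contDiff_pslice hg 0).continuous hgu
  have : NeZero D := ⟨by omega⟩
  have hz : EqOn (g 0) (fun _ => 0) {0}ᶜ := fun u hu => by rw [hgu u hu, h3, mul_zero]
  exact (contDiff_pslice hg 0).continuous.ext_on (dense_compl_singleton 0) continuous_const hz

end KernelData

end Correspondence

section Equivalence

variable {D : ℕ} {ζ : ℝ → ℝ} {δ N : ℕ} {H H' f f' : ℝ → Euc D → Euc D → ℝ}

/-- The correspondence is read off from the canonical counterterm of the kernel. -/
lemma corresponds_iff (hζ : IsCutoff ζ) (hN : 2 < N) {d : KernelData D}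
    (hH : d.Represents H) (hf : IsHomogeneousInvariant f) :
    Corresponds ζ δ N H f ↔ ∀ γ : MultiIdx D, γ.order ≤ δ → ∀ μ,
      d.b0 ζ δ N (γ, 0) μ = iterD (idxList γ) (fun u => f μ u 0) 0 := by
  have hb : ∀ γ : MultiIdx D, γ.order ≤ δ → d.counterterm ζ δ N γ 0 = d.b0 ζ δ N (γ, 0) :=
    fun γ hγ => d.counterterm_of_le (γ := (γ, 0)) (by simpa [MultiIdx.order] using hγ)
  constructor
  · rintro ⟨b₀, h1, h2, h3⟩ γ hγ μ
    rw [← hf.multiD_eq γ μ 0, ← h3 γ hγ, KernelData.eq_counterterm hH hζ hN h1 h2, hb γ hγ]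
  · refine fun h => ⟨_, d.isAdmissible_counterterm hζ hN,
      KernelData.twoPointFlow_counterterm hH hζ hN, fun γ hγ μ z => ?_⟩
    rw [hf.multiD_eq, hb γ hγ, h γ hγ]

/-- Both equivalences say that Taylor coefficients vanish, namely those of `f' - f` and of
`g = H' - H`; the former are the derivatives in `-μ` of the latter, which vanish at `μ = 0` if
`3 ≤ D`. -/
theorem twoPointEquiv_of_corresponds (hD : 2 ≤ D) (hζ : IsCutoff ζ) (hN : 2 < N)
    (hH : IsHadamardParametrix H) (hH' : IsHadamardParametrix H') (hf : IsHomogeneousInvariant f)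
    (hf' : IsHomogeneousInvariant f') (hc : Corresponds ζ δ N H f)
    (hc' : Corresponds ζ δ N H' f') : (TwoPointEquiv δ H H' → TwoPointEquiv δ f f') ∧
      (3 ≤ D → TwoPointEquiv δ f f' → TwoPointEquiv δ H H') := by
  have : NeZero D := ⟨by omega⟩
  obtain ⟨d, hd, V, hV, hv⟩ := hH.exists_kernel hD
  obtain ⟨d', hd', V', hV', hv'⟩ := hH'.exists_kernel hD
  obtain ⟨g, hg, hE⟩ := KernelData.exists_smooth_sub d' d
  have hφ := hf.sub hf'
  have hgμ := contDiff_pslice hg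
  have hcd := (corresponds_iff hζ hN hd hf).1 hc
  have hcd' := (corresponds_iff hζ hN hd' hf').1 hc'
  -- the increment of `b⁰` at the lowest nonvanishing order
  have key : ∀ l : List (Fin D), l.length ≤ δ → ∀ μ, VanishesTo l.length (g μ) →
      iterD l (fun u => f μ u 0 - f' μ u 0) 0
        = -iterD (idxList (listIdx l)) (fun u => deriv (fun m => g m u) μ) 0 := by
    intro l hl μ hv
    have ho := order_listIdx l
    have h1 := KernelData.b0_eq_sub hζ hN hg hE μ hv ho.le (ho.trans_le hl)
    have h2 := iterD_sub isOpen_univ (hf.contDiffOn_slice μ) (hf'.contDiffOn_slice μ)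
      (idxList (listIdx l)) (mem_univ 0)
    rw [← iterD_perm isOpen_univ (hφ.contDiffOn_slice μ) (idxList_listIdx_perm l) (mem_univ 0)]
    rw [hcd _ (ho.trans_le hl), hcd' _ (ho.trans_le hl)] at h1
    simp only at h2
    rw [h2, h1]
    ring
  have e1 := twoPointEquiv_iff (δ := δ) (w := H) (w' := H') hgμ fun μ x y hxy => by
    rw [hd μ x y hxy, hd' μ x y hxy, hE μ _ (sub_ne_zero.2 hxy), add_sub_cancel_left]
  have e2 := twoPointEquiv_iff (δ := δ) (w := f) (w' := f') (g := fun μ u => f μ u 0 - f' μ u 0)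
    (fun μ => contDiffOn_univ.1 (hφ.contDiffOn_slice μ)) fun μ x y _ => by
    rw [eq_sub_of_invariant hf.invariant, eq_sub_of_invariant hf'.invariant]
  rw [e1, e2]
  refine ⟨fun h μ l hl => ?_, fun hD3 h => ?_⟩
  · rw [key l hl μ (vanishesTo_of_iterD (hgμ μ) fun l' hl' => h μ l' (by omega)), neg_eq_zero]
    refine (hasDerivAt_iterD hg _ μ 0).unique ((hasDerivAt_const μ (0 : ℝ)).congr_of_eventuallyEq
      (.of_forall fun m => h m _ ?_))
    rwa [length_idxList, order_listIdx]
  · have hg0 := KernelData.sub_zero_eq_zero hD3 hV' hv' hV hv hg hE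
    suffices ∀ n ≤ δ, ∀ μ (l : List (Fin D)), l.length = n → iterD l (g μ) 0 = 0 from
      fun μ l hl => this _ hl μ l rfl
    intro n
    induction n using Nat.strong_induction_on with
    | _ n ih =>
      rintro hn μ l rfl
      rw [← iterD_perm isOpen_univ (hgμ μ).contDiffOn (idxList_listIdx_perm l) (mem_univ 0)]
      have hz : ∀ m, deriv (fun m => iterD (idxList (listIdx l)) (g m) 0) m = 0 := fun m => by
        rw [(hasDerivAt_iterD hg _ m 0).deriv, ← neg_eq_zero, ← key l hn m
          (vanishesTo_of_iterD (hgμ m) fun l' hl' => ih _ hl' (by omega) m l' rfl), h m l hn]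
      rw [is_const_of_deriv_eq_zero (fun m => (hasDerivAt_iterD hg _ m 0).differentiableAt) hz μ 0,
        hg0, iterD_zero]

end Equivalence

end

theorem mainTheorem3 (D : ℕ) (hD : 2 ≤ D) :
    -- everything in the flow relation is well defined
    (∀ (ζ : ℝ → ℝ), IsCutoff ζ → ∀ (δ N : ℕ), 2 < N →
      ∀ H : ℝ → Euc D → Euc D → ℝ, IsHadamardParametrix H →
      ∀ (μ : ℝ) (z : Euc D) (L : ℝ), 0 < L →
        (∀ γ ∈ pairsUpTo D δ,
          (∀ L' : ℝ, 0 < L' → Integrable (counterIntegrand ζ δ N (H μ) [γ.1, γ.2] z L')) ∧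
          IntervalIntegrable (fun L' => ∫ y, counterIntegrand ζ δ N (H μ) [γ.1, γ.2] z L' y)
            volume 0 L) ∧
        (∀ (n : ℕ) (x : Fin n → Euc D), Function.Injective x →
          Integrable (flowIntegrand ζ δ N (H μ) x z L) ∧
          DifferentiableAt ℝ (fun m => coeffPhi (H m) [] x z) μ)) ∧
    -- the two-point flow relation implies the flow relations for all numbers of factors of `φ`,
    -- for all merger trees and to all scaling degrees
    (∀ (n : ℕ) (T : MergerTree n) (δ' : ℕ), ∃ δ₀ : ℕ, ∀ δ : ℕ, δ₀ ≤ δ → ∀ N : ℕ, 2 < N →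
      ∀ (ζ : ℝ → ℝ), IsCutoff ζ →
      ∀ H : ℝ → Euc D → Euc D → ℝ, IsHadamardParametrix H →
      ∀ b₀ : Counterterm D, TwoPointFlow ζ δ N H b₀ → FlowRelation ζ δ N H b₀ T δ') ∧
    -- the ambiguities
    (∀ (ζ : ℝ → ℝ), IsCutoff ζ → ∀ (δ N : ℕ), 2 < N →
      -- every parametrix satisfies the two-point flow relation for exactly one admissible `b⁰`
      (∀ H : ℝ → Euc D → Euc D → ℝ, IsHadamardParametrix H →
        ∃! b₀ : Counterterm D, IsAdmissible δ b₀ ∧ TwoPointFlow ζ δ N H b₀) ∧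
      -- every parametrix corresponds to an invariant function, and conversely
      (∀ H : ℝ → Euc D → Euc D → ℝ, IsHadamardParametrix H →
        ∃ f, IsHomogeneousInvariant f ∧ Corresponds ζ δ N H f) ∧
      (∀ f : ℝ → Euc D → Euc D → ℝ, IsHomogeneousInvariant f →
        ∃ H, IsHadamardParametrix H ∧ Corresponds ζ δ N H f) ∧
      -- the correspondence is one-to-one up to asymptotic equivalence
      (∀ H H' f f' : ℝ → Euc D → Euc D → ℝ,
        IsHadamardParametrix H → IsHadamardParametrix H' →
        IsHomogeneousInvariant f → IsHomogeneousInvariant f' →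
        Corresponds ζ δ N H f → Corresponds ζ δ N H' f' →
          (TwoPointEquiv δ H H' → TwoPointEquiv δ f f') ∧
          (3 ≤ D → TwoPointEquiv δ f f' → TwoPointEquiv δ H H'))) := by
  refine ⟨fun ζ hζ δ N hN H hH μ z L hL => ?_, fun n T δ' => ?_, fun ζ hζ δ N hN =>
    ⟨fun H hH => ?_, fun H hH => ?_, fun f hf => ?_, fun H H' f f' hH hH' hf hf' =>
      twoPointEquiv_of_corresponds hD hζ hN hH hH' hf hf'⟩⟩
  · obtain ⟨d, hd, -⟩ := hH.exists_kernel hD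
    refine ⟨fun γ hγ => ⟨fun L' hL' => d.integrable_counterIntegrand hd hζ δ N γ μ z hL', ?_⟩,
      fun n x hx => ⟨d.integrable_flowIntegrand hd hζ δ N μ z hL hx,
        (d.hasDerivAt_coeffPhi hd μ z hx).differentiableAt⟩⟩
    simp only [KernelData.integral_counterIntegrand hd]
    exact (d.intervalIntegrable_scaleD hζ hN (mem_pairsUpTo.1 hγ) μ hL).const_mul 2
  · refine ⟨δ' + T.nodes.card * D * n, fun δ hδ N hN ζ hζ H hH b₀ hb => ?_⟩
    obtain ⟨d, hd, -⟩ := hH.exists_kernel hD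
    exact KernelData.flowRelation_of_twoPointFlow hd hζ hN hb T hδ
  · obtain ⟨d, hd, -⟩ := hH.exists_kernel hD
    exact ⟨_, ⟨d.isAdmissible_counterterm hζ hN, KernelData.twoPointFlow_counterterm hd hζ hN⟩,
      fun b₀ hb => KernelData.eq_counterterm hd hζ hN hb.1 hb.2⟩
  · obtain ⟨d, hd, -⟩ := hH.exists_kernel hD
    obtain ⟨f, hf, h⟩ := d.exists_homogeneousInvariant (δ := δ) hζ hN
    exact ⟨f, hf, (corresponds_iff hζ hN hd hf).2 h⟩
  · obtain ⟨d, V, hV, hv, h⟩ :=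
      KernelData.exists_of_homogeneousInvariant (δ := δ) hD hζ hN hf (δ + 1)
    exact ⟨_, d.isHadamardParametrix hV hv, (corresponds_iff hζ hN (fun _ _ _ _ => rfl) hf).2
      fun γ hγ => h γ hγ (Nat.lt_succ_of_le hγ)⟩
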